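/- Let $S=\mathbb{C}[x,y,z]$. For a reduced plane curve $\mathcal{B}\subset\mathbb{P}^2(\mathbb{C})$ with homogeneous equation $f$, let $J_{\mathcal{B}}=\langle \partial_x f,\partial_y f,\partial_z f\rangle$, let $M(\mathcal{B})=S/J_{\mathcal{B}}$ be its Milnor algebra, and let \[ \mathrm{AR}(\mathcal{B})=\{(p,q,r)\in S^3 : p\,\partial_x f+q\,\partial_y f+r\,\partial_z f=0\} \] be the graded $S$-module of Jacobian syzygies. Two reduced plane curves have the same combinatorics if there are a degree-preserving bijection between their irreducible components and a bijection between their singular points such that at corresponding singular points the curves have the same embedded topological type, by a homeomorphism of neighbourhoods in $\mathbb{P}^2$ under which the local branches on a component correspond to the local branches on the corresponding component. They form a strong Ziegler pair if they have the same combinatorics but their modules $\mathrm{AR}$ are not isomorphic as $S$-modules. Consider the following pairs of conic-line arrangements, where $b=\sqrt2$ and $+$ denotes the union of curves. 1. Let $C: -x^2+yz=0$, $L_1: 3x+y+2z=0$, $L_2: -3x+y+2z=0$, $D: (12b-18)x^2+(-36b+51)xz+yz+(24b-34)z^2=0$, $M_1: 2bx+y+2z=0$, $M_2: -2bx+y+2z=0$.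 Put $\mathcal{B}_{1,j}=C+L_1+L_2+D+M_j$ for $j=1,2$. 2. Let $C,L_1,L_2$ be as in 1, and $D: -\frac98x^2+yz=0$, $M_1: -x+y-2z=0$, $M_2: y-z=0$. Put $\mathcal{B}_{2,j}=C+L_1+L_2+D+M_j$ for $j=1,2$. 3. Let $C_1: x^2+xy+y^2-\frac{27}{4}z^2=0$, $C_2: 676x^2+764xy+676y^2-4563z^2=0$, $M_0: y=0$, $M_1: 15x+8y-39z=0$, $M_2: 15x+8y+39z=0$, $M_3: 8x+15y-39z=0$. Put $\mathcal{B}_{3,1}=C_1+C_2+M_0+M_1+M_2$ and $\mathcal{B}_{3,2}=C_1+C_2+M_0+M_1+M_3$. 5. Let $C_1: -x^2+yz+2z^2=0$, $C_2: x^2+y^2-2yz-4z^2=0$, $D: -\frac12x^2+yz+2z^2=0$, $M_1: -x+y=0$, $M_2: -3x+y+4z=0$. Put $\mathcal{B}_{5,j}=C_1+C_2+D+M_j$ for $j=1,2$. Then for each $i\in\{1,2,3,5\}$ the curves $\mathcal{B}_{i,1}$ and $\mathcal{B}_{i,2}$ are reduced and form a strong Ziegler pair. Moreover, the least degree of a nonzero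 homogeneous element of $\mathrm{AR}(\mathcal{B}_{i,1})$ is $3$, while that of $\mathrm{AR}(\mathcal{B}_{i,2})$ is $4$. The Milnor algebras $M(\mathcal{B}_{i,1})$ and $M(\mathcal{B}_{i,2})$ have minimal graded free resolutions over $S$, and these are different: no minimal graded free resolution of $M(\mathcal{B}_{i,1})$ has the same twists in every homological degree as one of $M(\mathcal{B}_{i,2})$. -/

import Mathlib

noncomputable section

namespace ConicLine

/-- The homogeneous coordinate ring `S = ℂ[x, y, z]` of the complex projective plane. -/
abbrev S : Type := MvPolynomial (Fin 3) ℂ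

/-- The complex projective plane. -/
abbrev P2 : Type := Projectivization ℂ (Fin 3 → ℂ)

/-- The classical topology of the projective plane: the quotient topology from the space of
nonzero vectors of `ℂ³`. -/
instance instTopologicalSpaceP2 : TopologicalSpace P2 :=
  TopologicalSpace.coinduced
    (fun v : {v : Fin 3 → ℂ // v ≠ 0} => Projectivization.mk ℂ v.1 v.2) inferInstance

/-! ### Plane curves and their combinatorics -/

/-- The points of the plane at which the form `f` vanishes. For homogeneous `f` the choice of
the representative does not matter. -/
def zeroLocus (f : S) : Set P2 := {P | MvPolynomial.eval P.rep f = 0}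

/-- `f` is the equation of a reduced plane curve: a square-free form of positive degree. -/
def IsReducedCurve (f : S) : Prop :=
  Squarefree f ∧ ∃ d : ℕ, 0 < d ∧ f.IsHomogeneous d

/-- `Z` is an irreducible component of degree `d` of the curve `f = 0`. -/
def IsComponentOfDegree (f : S) (Z : Set P2) (d : ℕ) : Prop :=
  ∃ g : S, Irreducible g ∧ g ∣ f ∧ g.IsHomogeneous d ∧ Z = zeroLocus g

/-- The set of irreducible components of the curve `f = 0`, as subsets of the plane. -/
def components (f : S) : Set (Set P2) := {Z | ∃ d, IsComponentOfDegree f Z d}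

/-- The set of singular points of the reduced curve `f = 0`. -/
def singularPoints (f : S) : Set P2 :=
  {P | P ∈ zeroLocus f ∧ ∀ i, P ∈ zeroLocus (MvPolynomial.pderiv i f)}

/-- Two reduced plane curves have the same combinatorics: there are a degree preserving bijection
`φ` of the irreducible components and a bijection `ψ` of the singular points such that, for every
singular point `P`, the germs of the two curves at `P` and `ψ P` have the same embedded topological
type, by a homeomorphism `h` of neighbourhoods of `P` and `ψ P` in the plane that is compatible
with `φ`. Such an `h` carries the local branches of the first curve at `P` bijectively to those of
the second at `ψ P`, and compatibility with `φ` says that a branch lying on the component `Z` goes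
to a branch lying on the component `φ Z`. -/
def SameCombinatorics (f g : S) : Prop :=
  ∃ (φ : components f ≃ components g) (ψ : singularPoints f ≃ singularPoints g),
    (∀ (Z : components f) (d : ℕ),
      IsComponentOfDegree f (Z : Set P2) d ↔ IsComponentOfDegree g (φ Z : Set P2) d) ∧
    ∀ P : singularPoints f, ∃ h : OpenPartialHomeomorph P2 P2,
      (P : P2) ∈ h.source ∧ h (P : P2) = (ψ P : P2) ∧
      ∀ Z : components f, h '' (h.source ∩ (Z : Set P2)) = h.target ∩ (φ Z : Set P2)

/-! ### Jacobian syzygies and the Milnor algebra -/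

/-- The Jacobian ideal, generated by the three partial derivatives of `f`. The Milnor algebra of
the curve `f = 0` is the quotient `S ⧸ jacobianIdeal f`. -/
def jacobianIdeal (f : S) : Ideal S :=
  Ideal.span (Set.range fun i : Fin 3 => MvPolynomial.pderiv i f)

/-- The module `AR f` of Jacobian syzygies: the triples `r` of polynomials such that
`r 0 * ∂f/∂x + r 1 * ∂f/∂y + r 2 * ∂f/∂z = 0`. -/
def AR (f : S) : Submodule S (Fin 3 → S) where
  carrier := {r | ∑ i, r i * MvPolynomial.pderiv i f = 0}
  zero_mem' := by simp
  add_mem' := by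
    intro a b ha hb
    simp only [Set.mem_ofPred_eq] at ha hb ⊢
    simp only [Pi.add_apply, add_mul, Finset.sum_add_distrib, ha, hb, add_zero]
  smul_mem' := by
    intro c a ha
    simp only [Set.mem_ofPred_eq] at ha ⊢
    simp only [Pi.smul_apply, smul_eq_mul, mul_assoc, ← Finset.mul_sum, ha, mul_zero]

/-- The degrees `d` in which `AR f` has a nonzero homogeneous element. -/
def syzygyDegrees (f : S) : Set ℕ :=
  {d | ∃ r ∈ AR f, r ≠ 0 ∧ ∀ i, (r i).IsHomogeneous d}

/-- Two reduced plane curves form a strong Ziegler pair if they have the same combinatorics but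
their modules of Jacobian syzygies are not isomorphic. -/
def IsStrongZieglerPair (f g : S) : Prop :=
  IsReducedCurve f ∧ IsReducedCurve g ∧ SameCombinatorics f g ∧ IsEmpty (AR f ≃ₗ[S] AR g)

/-- A minimal graded free resolution `⋯ → F₂ → F₁ → F₀ → S ⧸ J → 0` of the graded module `S ⧸ J`,
for a homogeneous ideal `J`. Here `F p` is the direct sum of the `S (-shift p i)` for `i` in
`Fin (rank p)`, so that its `i`-th basis vector has degree `shift p i`; the differentials are
given by matrices, and minimality says that all entries lie in the ideal `(x, y, z)`. -/
structure MinimalGradedFreeResolution (J : Ideal S) where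
  rank : ℕ → ℕ
  shift : ∀ p, Fin (rank p) → ℕ
  d : ∀ p, Matrix (Fin (rank p)) (Fin (rank (p + 1))) S
  aug : (Fin (rank 0) → S) →ₗ[S] S ⧸ J
  aug_homogeneous : ∀ i, ∃ g : S, g.IsHomogeneous (shift 0 i) ∧
    aug (Pi.single i 1) = Ideal.Quotient.mk J g
  d_homogeneous : ∀ p i j, d p i j ≠ 0 →
    ∃ n, shift p i + n = shift (p + 1) j ∧ (d p i j).IsHomogeneous n
  d_minimal : ∀ p i j, MvPolynomial.constantCoeff (d p i j) = 0
  aug_surjective : Function.Surjective aug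
  exact_zero : Function.Exact (d 0).mulVecLin aug
  exact_succ : ∀ p, Function.Exact (d (p + 1)).mulVecLin (d p).mulVecLin

/-- The multiset of twists of the `p`-th module of a resolution: the integer `a` occurs as often
as `S (-a)` is a summand of `F p`. -/
def MinimalGradedFreeResolution.twists {J : Ideal S} (F : MinimalGradedFreeResolution J) (p : ℕ) :
    Multiset ℕ :=
  (Finset.univ : Finset (Fin (F.rank p))).val.map (F.shift p)

/-! ### The arrangements -/

/-- The coordinate `x`. -/
def x : S := MvPolynomial.X 0

/-- The coordinate `y`. -/
def y : S := MvPolynomial.X 1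

/-- The coordinate `z`. -/
def z : S := MvPolynomial.X 2

/-- A complex number as a constant polynomial. -/
def k (a : ℂ) : S := MvPolynomial.C a

/-- The square root of two, as a complex number. -/
def b : ℂ := ((Real.sqrt 2 : ℝ) : ℂ)

namespace Cmb123

/-- The conic `C`. -/
def C : S := -x ^ 2 + y * z

/-- The line `L₁`. -/
def L₁ : S := 3 * x + y + 2 * z

/-- The line `L₂`. -/
def L₂ : S := -3 * x + y + 2 * z

/-- The conic `D`. -/
def D : S := k (12 * b - 18) * x ^ 2 + k (-36 * b + 51) * (x * z) + y * z + k (24 * b - 34) * z ^ 2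

/-- The line `M₁`. -/
def M₁ : S := k (2 * b) * x + y + 2 * z

/-- The line `M₂`. -/
def M₂ : S := k (-2 * b) * x + y + 2 * z

end Cmb123

namespace Cmb124

/-- The conic `D`. -/
def D : S := k (-9 / 8) * x ^ 2 + y * z

/-- The line `M₁`. -/
def M₁ : S := -x + y - 2 * z

/-- The line `M₂`. -/
def M₂ : S := y - z

end Cmb124

namespace Cmb212

/-- The conic `C₁`. -/
def C₁ : S := x ^ 2 + x * y + y ^ 2 - k (27 / 4) * z ^ 2

/-- The conic `C₂`. -/
def C₂ : S := 676 * x ^ 2 + 764 * (x * y) + 676 * y ^ 2 - 4563 * z ^ 2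

/-- The line `M₀`. -/
def M₀ : S := y

/-- The line `M₁`. -/
def M₁ : S := 15 * x + 8 * y - 39 * z

/-- The line `M₂`. -/
def M₂ : S := 15 * x + 8 * y + 39 * z

/-- The line `M₃`. -/
def M₃ : S := 8 * x + 15 * y - 39 * z

end Cmb212

namespace Cmb224

/-- The conic `C₁`. -/
def C₁ : S := -x ^ 2 + y * z + 2 * z ^ 2

/-- The conic `C₂`. -/
def C₂ : S := x ^ 2 + y ^ 2 - 2 * (y * z) - 4 * z ^ 2

/-- The conic `D`. -/
def D : S := k (-1 / 2) * x ^ 2 + y * z + 2 * z ^ 2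

/-- The line `M₁`. -/
def M₁ : S := -x + y

/-- The line `M₂`. -/
def M₂ : S := -3 * x + y + 4 * z

end Cmb224

/-- The four examples, named by their combinatorics. -/
inductive Example where
  | cmb123
  | cmb124
  | cmb212
  | cmb224

/-- The equation of the first arrangement of each pair. -/
def firstCurve : Example → S
  | .cmb123 => Cmb123.C * Cmb123.L₁ * Cmb123.L₂ * Cmb123.D * Cmb123.M₁
  | .cmb124 => Cmb123.C * Cmb123.L₁ * Cmb123.L₂ * Cmb124.D * Cmb124.M₁
  | .cmb212 => Cmb212.C₁ * Cmb212.C₂ * Cmb212.M₀ * Cmb212.M₁ * Cmb212.M₂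
  | .cmb224 => Cmb224.C₁ * Cmb224.C₂ * Cmb224.D * Cmb224.M₁

/-- The equation of the second arrangement of each pair. -/
def secondCurve : Example → S
  | .cmb123 => Cmb123.C * Cmb123.L₁ * Cmb123.L₂ * Cmb123.D * Cmb123.M₂
  | .cmb124 => Cmb123.C * Cmb123.L₁ * Cmb123.L₂ * Cmb124.D * Cmb124.M₂
  | .cmb212 => Cmb212.C₁ * Cmb212.C₂ * Cmb212.M₀ * Cmb212.M₁ * Cmb212.M₃
  | .cmb224 => Cmb224.C₁ * Cmb224.C₂ * Cmb224.D * Cmb224.M₂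

end ConicLine

end

noncomputable section

namespace ConicLine

open MvPolynomial Topology Matrix

/-! ### Local coordinates on the projective plane -/

/-! All eight curves are products of smooth lines and conics, and the proof separates their topology
from their algebra.

Combinatorics. Because the components are smooth, the singular points are exactly the points lying
on two components, and elimination finds them with coordinates that are rational, in `ℚ(√2)`, or
expressed by a root of an explicit quadratic. Only nodes, ordinary triple points and simple
tangencies occur. At each of them there are polynomials `U`, `V` with independent differentials on
an affine chart such that every component agrees, up to factors not vanishing at the point, with one
of `U`, `V`, `U + V`, `V + U ^ 2` or `1`. The inverse function theorem makes `(U, V)` a chart of the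
plane (`exists_localCoordinates`), so two curves with the same table of local types are homeomorphic
near corresponding points, component by component (`HasLocalForm.exists_homeomorph`,
`IsArrangement.sameCombinatorics`).

Modules. An isomorphism of the modules `AR` need not be graded, so comparing least degrees does not
suffice. For squarefree `f` the gradient has no common factor (`exists_not_dvd_pderiv`), hence two
syzygies satisfy `r × s = wedge(r, s) ∇f` with a polynomial `wedge(r, s)`. By Cramer's rule an
isomorphism multiplies all wedges by one common factor, and the Koszul syzygies, whose wedges are
the partial derivatives, force this factor to be a nonzero constant (`exists_wedge_eq`). The first
curve of each pair has syzygies of degrees 3 and 4 whose wedge is a nonzero linear form, since 3 + 4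
= 1 + 6. On the second curve all syzygies start in degree at least 4, so the cross product of the
two images has no component of degree below 8; but it should be a constant times a linear form times
a gradient of degree 6, which is nonzero of degree 7 (`isEmpty_AR_equiv`).

Degrees. Existence is shown by explicit vector fields tangent to every component whose cofactors sum
to zero (`mem_AR_prod`). Absence in a degree is a full rank statement for a matrix over `ℤ[√2]`; a
left inverse modulo a prime above 17, under which `√2` becomes 6, certifies it
(`Certificate.notMem_syzygyDegrees`).

Resolutions. Minimal homogeneous generators of successive kernels give a minimal graded free
resolution (`exists_minimal_generators`). In any such resolution the second free module has its
twists in the set of numbers 6 + `e` with `e` a syzygy degree, and the least syzygy degree does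
occur there. So 9 is a twist for the first curve and not for the second (`twists_ne`). -/

lemma isQuotientMap_mk :
    IsQuotientMap (fun v : {v : Fin 3 → ℂ // v ≠ 0} => Projectivization.mk ℂ v.1 v.2) where
  surjective P := ⟨⟨P.rep, P.rep_nonzero⟩, P.mk_rep⟩
  eq_coinduced := rfl

lemma eval_smul_of_isHomogeneous {f : S} {d : ℕ} (hf : f.IsHomogeneous d) (c : ℂ)
    (v : Fin 3 → ℂ) : eval (c • v) f = c ^ d * eval v f := by
  rw [eval_eq, eval_eq, Finset.mul_sum]
  refine Finset.sum_congr rfl fun m hm => ?_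
  have h : ∑ i ∈ m.support, m i = d := (hf.degree_eq_sum_deg_support hm).symm
  simp only [Pi.smul_apply, smul_eq_mul, mul_pow, Finset.prod_mul_distrib, Finset.prod_pow_eq_pow_sum, h]
  ring

lemma exists_rep_eq_smul (v : Fin 3 → ℂ) (hv : v ≠ 0) :
    ∃ a : ℂ, a ≠ 0 ∧ (Projectivization.mk ℂ v hv).rep = a • v := by
  obtain ⟨a, ha⟩ := Projectivization.exists_smul_eq_mk_rep ℂ v hv
  exact ⟨a, a.ne_zero, ha.symm⟩

lemma mk_mem_zeroLocus {f : S} {d : ℕ} (hf : f.IsHomogeneous d) (v : Fin 3 → ℂ) (hv : v ≠ 0) :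
    Projectivization.mk ℂ v hv ∈ zeroLocus f ↔ eval v f = 0 := by
  obtain ⟨a, ha, h⟩ := exists_rep_eq_smul v hv
  simp [zeroLocus, h, eval_smul_of_isHomogeneous hf, ha]

lemma hasStrictFDerivAt_eval (f : S) (v : Fin 3 → ℂ) :
    HasStrictFDerivAt (fun w : Fin 3 → ℂ => eval w f)
      (∑ i, eval v (pderiv i f) • ContinuousLinearMap.proj (R := ℂ) (φ := fun _ : Fin 3 => ℂ) i)
      v := by
  have hproj : ∀ j, HasStrictFDerivAt (fun w : Fin 3 → ℂ => w j)
      (ContinuousLinearMap.proj (R := ℂ) (φ := fun _ : Fin 3 => ℂ) j) v := fun j =>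
    (ContinuousLinearMap.proj (R := ℂ) (φ := fun _ : Fin 3 => ℂ) j).hasStrictFDerivAt
  induction f using MvPolynomial.induction_on with
  | C a =>
    convert! hasStrictFDerivAt_const (𝕜 := ℂ) a v using 1
    · simp
    · ext w
      simp
  | add p q hp hq =>
    convert! hp.add hq using 1
    · ext w
      simp
    · ext w
      simp [add_mul, Finset.sum_add_distrib]
  | mul_X p j hp =>
    convert! hp.mul (hproj j) using 1
    · ext w
      simp
    · ext w
      fin_cases j <;> simp [Fin.sum_univ_three, pderiv_X, Pi.single_apply] <;> ring

/-- The normalised representative with `k`-th coordinate one. -/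
def affineRep (k : Fin 3) (P : P2) : Fin 3 → ℂ := (P.rep k)⁻¹ • P.rep

lemma affineRep_mk (k : Fin 3) (v : Fin 3 → ℂ) (hv : v ≠ 0) :
    affineRep k (Projectivization.mk ℂ v hv) = (v k)⁻¹ • v := by
  obtain ⟨a, ha, h⟩ := exists_rep_eq_smul v hv
  ext i
  simp only [affineRep, h, Pi.smul_apply, smul_eq_mul, mul_inv]
  field_simp

lemma isOpen_rep_ne_zero (k : Fin 3) : IsOpen {P : P2 | P.rep k ≠ 0} := by
  rw [← isQuotientMap_mk.isOpen_preimage]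
  have : (fun v : {v : Fin 3 → ℂ // v ≠ 0} => Projectivization.mk ℂ v.1 v.2) ⁻¹'
      {P : P2 | P.rep k ≠ 0} = {v | v.1 k ≠ 0} := by
    ext v
    obtain ⟨a, ha, h⟩ := exists_rep_eq_smul v.1 v.2
    simp [h, ha]
  rw [this]
  exact isOpen_ne_fun ((continuous_apply k).comp continuous_subtype_val) continuous_const

lemma continuousOn_affineRep (k : Fin 3) : ContinuousOn (affineRep k) {P : P2 | P.rep k ≠ 0} := by
  rw [isQuotientMap_mk.continuousOn_isOpen_iff (isOpen_rep_ne_zero k)]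
  have : ContinuousOn (fun v : {v : Fin 3 → ℂ // v ≠ 0} => (v.1 k)⁻¹ • v.1) {v | v.1 k ≠ 0} := by
    refine ContinuousOn.smul (ContinuousOn.inv₀
      ((continuous_apply k).comp continuous_subtype_val).continuousOn fun v hv => hv)
      continuous_subtype_val.continuousOn
  refine (this.mono ?_).congr ?_
  · intro v hv
    obtain ⟨a, ha, h⟩ := exists_rep_eq_smul v.1 v.2
    simpa [h, ha] using hv
  · intro v _
    exact affineRep_mk k v.1 v.2

/-- The point with given homogeneous coordinates, with a junk value at zero. -/
def toPoint (w : Fin 3 → ℂ) : P2 :=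
  if h : w ≠ 0 then Projectivization.mk ℂ w h else Projectivization.mk ℂ 1 one_ne_zero

lemma toPoint_of_ne {w : Fin 3 → ℂ} (h : w ≠ 0) : toPoint w = Projectivization.mk ℂ w h :=
  dif_pos h

lemma continuousOn_toPoint : ContinuousOn toPoint {w | w ≠ 0} := by
  rw [continuousOn_iff_continuous_domRestrict]
  convert! isQuotientMap_mk.continuous using 1
  ext w
  exact toPoint_of_ne w.2

lemma toPoint_affineRep {k : Fin 3} {P : P2} (h : P.rep k ≠ 0) : toPoint (affineRep k P) = P := by
  have h2 : affineRep k P ≠ 0 := smul_ne_zero (inv_ne_zero h) P.rep_nonzero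
  rw [toPoint_of_ne h2]
  conv_rhs => rw [← P.mk_rep]
  exact (Projectivization.mk_eq_mk_iff' ℂ _ _ _ _).2 ⟨_, rfl⟩

lemma rep_toPoint {w : Fin 3 → ℂ} {k : Fin 3} (hw : w k = 1) :
    (toPoint w).rep k ≠ 0 ∧ affineRep k (toPoint w) = w := by
  have h : w ≠ 0 := by rintro rfl; simp at hw
  obtain ⟨a, ha, h2⟩ := exists_rep_eq_smul w h
  rw [toPoint_of_ne h, affineRep_mk]
  simp [h2, ha, hw]

lemma affineRep_self {k : Fin 3} {P : P2} (h : P.rep k ≠ 0) : affineRep k P k = 1 := by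
  simp [affineRep, h]

lemma mem_zeroLocus_iff_affineRep {f : S} {d : ℕ} (hf : f.IsHomogeneous d) {k : Fin 3} {P : P2}
    (h : P.rep k ≠ 0) : P ∈ zeroLocus f ↔ eval (affineRep k P) f = 0 := by
  simp [zeroLocus, affineRep, eval_smul_of_isHomogeneous hf, h]

/-- The gradient of `f` at `v`. -/
def grad (f : S) (v : Fin 3 → ℂ) : Fin 3 → ℂ := fun i => eval v (pderiv i f)

/-- Up to sign the `k`-th coordinate of `a × c` is the determinant of the two equations in the two
unknowns other than `w k`, so this is Cramer's rule. -/
lemma eq_zero_of_cross_ne_zero {a c w : Fin 3 → ℂ} {k : Fin 3} (h : (a ⨯₃ c) k ≠ 0)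
    (ha : ∑ i, a i * w i = 0) (hc : ∑ i, c i * w i = 0) (hk : w k = 0) : w = 0 := by
  rw [cross_apply] at h
  simp only [Fin.sum_univ_three] at ha hc
  ext i
  refine (mul_eq_zero.1 (?_ : _ * w i = 0)).resolve_left h
  fin_cases k <;> fin_cases i <;> simp [-mul_eq_zero] at hk ⊢ <;>
    simp only [hk] at ha hc ⊢ <;>
    first
    | (simp; done)
    | linear_combination (c 0) * ha - (a 0) * hc
    | linear_combination (c 1) * ha - (a 1) * hc
    | linear_combination (c 2) * ha - (a 2) * hc
    | linear_combination -(c 0) * ha + (a 0) * hc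
    | linear_combination -(c 1) * ha + (a 1) * hc
    | linear_combination -(c 2) * ha + (a 2) * hc

/-- Two polynomials that vanish at `v` and have independent differentials on the affine chart
define local coordinates of the plane at `v`. -/
lemma exists_localCoordinates (U V : S) (v : Fin 3 → ℂ) (k : Fin 3) (hk : v k = 1)
    (hdet : (grad U v ⨯₃ grad V v) k ≠ 0) :
    ∃ e : OpenPartialHomeomorph P2 (ℂ × ℂ), toPoint v ∈ e.source ∧
      e.source ⊆ {P | P.rep k ≠ 0} ∧
      ∀ P, e P = (eval (affineRep k P) U, eval (affineRep k P) V) := by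
  -- Keeping `w k` as a third coordinate gives a self-map of `ℂ³`, to which the inverse function
  -- theorem applies; the affine chart is the slice `w k = 1`.
  let Ψ : (Fin 3 → ℂ) → (Fin 3 → ℂ) := fun w => ![eval w U, eval w V, w k]
  let L : (Fin 3 → ℂ) →L[ℂ] (Fin 3 → ℂ) := ContinuousLinearMap.pi
    ![∑ i, eval v (pderiv i U) • ContinuousLinearMap.proj (R := ℂ) (φ := fun _ : Fin 3 => ℂ) i,
      ∑ i, eval v (pderiv i V) • ContinuousLinearMap.proj (R := ℂ) (φ := fun _ : Fin 3 => ℂ) i,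
      ContinuousLinearMap.proj (R := ℂ) (φ := fun _ : Fin 3 => ℂ) k]
  -- A vector killed by the differential is orthogonal to both gradients and has vanishing `k`-th
  -- coordinate.
  have hL : Function.Injective (L : (Fin 3 → ℂ) →ₗ[ℂ] (Fin 3 → ℂ)) := by
    rw [injective_iff_map_eq_zero]
    intro w hw
    have h0 := congrFun hw 0
    have h1 := congrFun hw 1
    have h2 := congrFun hw 2
    simp [L] at h0 h1 h2
    exact eq_zero_of_cross_ne_zero hdet h0 h1 h2
  let L' : (Fin 3 → ℂ) ≃L[ℂ] (Fin 3 → ℂ) :=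
    (LinearEquiv.ofInjectiveEndo _ hL).toContinuousLinearEquiv
  have hΨ : HasStrictFDerivAt Ψ (L' : (Fin 3 → ℂ) →L[ℂ] (Fin 3 → ℂ)) v := by
    have hLL : (L' : (Fin 3 → ℂ) →L[ℂ] (Fin 3 → ℂ)) = L := by ext w; rfl
    rw [hLL, hasStrictFDerivAt_pi']
    intro i
    fin_cases i
    · exact hasStrictFDerivAt_eval U v
    · exact hasStrictFDerivAt_eval V v
    · exact (ContinuousLinearMap.proj (R := ℂ) (φ := fun _ : Fin 3 => ℂ) k).hasStrictFDerivAt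
  let Φ := hΨ.toOpenPartialHomeomorph Ψ
  have hΦ : ∀ w, Φ w = Ψ w := fun w => by
    rw [show (Φ : (Fin 3 → ℂ) → (Fin 3 → ℂ)) = Ψ from hΨ.toOpenPartialHomeomorph_coe]
  have hsymm : ∀ p ∈ Φ.target, Ψ (Φ.symm p) = p := fun p hp => by rw [← hΦ, Φ.right_inv hp]
  let E : ℂ × ℂ → (Fin 3 → ℂ) := fun p => ![p.1, p.2, 1]
  have hE : Continuous E := by
    refine continuous_pi fun i => ?_
    fin_cases i <;> simp [E] <;> fun_prop
  have hΨE : ∀ w : Fin 3 → ℂ, w k = 1 → Ψ w = E (eval w U, eval w V) := fun w hw => by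
    simp [Ψ, E, hw]
  -- The local inverse of `Ψ` carries the slice with third coordinate 1 back into the affine chart.
  have key : ∀ p : ℂ × ℂ, E p ∈ Φ.target → Φ.symm (E p) k = 1 ∧
      (eval (Φ.symm (E p)) U, eval (Φ.symm (E p)) V) = p := by
    intro p hp
    have h := hsymm _ hp
    have h0 := congrFun h 0
    have h1 := congrFun h 1
    have h2 := congrFun h 2
    simp [Ψ, E] at h0 h1 h2
    exact ⟨h2, Prod.ext h0 h1⟩
  refine ⟨{ toFun := fun P => (eval (affineRep k P) U, eval (affineRep k P) V)
            invFun := fun p => toPoint (Φ.symm (E p))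
            source := {P | P.rep k ≠ 0} ∩ affineRep k ⁻¹' Φ.source
            target := E ⁻¹' Φ.target
            map_source' := ?_
            map_target' := ?_
            left_inv' := ?_
            right_inv' := ?_
            continuousOn_toFun := ?_
            continuousOn_invFun := ?_
            open_source := ?_
            open_target := ?_ }, ?_, ?_, ?_⟩
  · rintro P ⟨hP, hP2⟩
    have := Φ.map_source hP2
    rw [hΦ, hΨE _ (affineRep_self hP)] at this
    exact this
  · intro p hp
    obtain ⟨h1, h2⟩ := rep_toPoint (key p hp).1
    refine ⟨h1, ?_⟩
    rw [Set.mem_preimage, h2]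
    exact Φ.map_target hp
  · rintro P ⟨hP, hP2⟩
    have : Φ.symm (E (eval (affineRep k P) U, eval (affineRep k P) V)) = affineRep k P := by
      rw [← hΨE _ (affineRep_self hP), ← hΦ, Φ.left_inv hP2]
    simp only [this, toPoint_affineRep hP]
  · intro p hp
    obtain ⟨h1, h2⟩ := rep_toPoint (key p hp).1
    simp only [h2, (key p hp).2]
  · have h := (continuousOn_affineRep k).mono
      (Set.inter_subset_left (t := affineRep k ⁻¹' Φ.source))
    exact ((continuous_eval U).comp_continuousOn h).prodMk ((continuous_eval V).comp_continuousOn h)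
  · refine continuousOn_toPoint.comp
      (Φ.continuousOn_symm.comp hE.continuousOn fun p hp => hp) fun p hp => ?_
    intro h0
    have := (key p hp).1
    rw [h0] at this
    simp at this
  · exact (continuousOn_affineRep k).isOpen_inter_preimage (isOpen_rep_ne_zero k) Φ.open_source
  · exact Φ.open_target.preimage hE
  · obtain ⟨h1, h2⟩ := rep_toPoint hk
    refine ⟨h1, ?_⟩
    rw [Set.mem_preimage, h2]
    exact hΨ.mem_toOpenPartialHomeomorph_source
  · exact fun P hP => hP.1
  · exact fun P => rfl

/-- The position of a component in local coordinates `(u, v)`: it misses the point, or it is one of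
the smooth branches `u = 0`, `v = 0`, `u + v = 0`, `v + u ^ 2 = 0`. -/
inductive Branch
  | away
  | fst
  | snd
  | diag
  | para
  deriving DecidableEq

/-- The equation of a branch in local coordinates. -/
def Branch.poly {R : Type*} [CommRing R] (u v : R) : Branch → R
  | .away => 1
  | .fst => u
  | .snd => v
  | .diag => u + v
  | .para => v + u ^ 2

/-- In suitable local coordinates at `v` the curves `F i` are the branches `τ i`. -/
def HasLocalForm {n : ℕ} (F : Fin n → S) (τ : Fin n → Branch) (v : Fin 3 → ℂ) : Prop :=
  ∃ (k : Fin 3) (U V : S), v k = 1 ∧ eval v U = 0 ∧ eval v V = 0 ∧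
    (grad U v ⨯₃ grad V v) k ≠ 0 ∧
    ∀ i, ∃ c c' : S, eval v c ≠ 0 ∧ eval v c' ≠ 0 ∧ c * F i = c' * (τ i).poly U V

lemma eval_branch_poly (β : Branch) (U V : S) (w : Fin 3 → ℂ) :
    eval w (β.poly U V) = β.poly (eval w U) (eval w V) := by
  cases β <;> simp [Branch.poly]

lemma HasLocalForm.ne_zero {n : ℕ} {F : Fin n → S} {τ : Fin n → Branch} {v : Fin 3 → ℂ}
    (h : HasLocalForm F τ v) : v ≠ 0 := by
  obtain ⟨k, U, V, hk, -⟩ := h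
  rintro rfl
  simp at hk

/-- Where the multipliers `c i` and `c' i` do not vanish, the identity `c i * F i = c' i * (τ
i).poly U V` makes the two zero sets equal. They are nonzero at `v`, hence on a neighbourhood, to
which the coordinate chart is restricted. -/
lemma HasLocalForm.exists_chart {n : ℕ} {F : Fin n → S} {d : Fin n → ℕ}
    (hF : ∀ i, (F i).IsHomogeneous (d i)) {τ : Fin n → Branch} {v : Fin 3 → ℂ}
    (h : HasLocalForm F τ v) :
    ∃ e : OpenPartialHomeomorph P2 (ℂ × ℂ), toPoint v ∈ e.source ∧ e (toPoint v) = 0 ∧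
      ∀ P ∈ e.source, ∀ i, P ∈ zeroLocus (F i) ↔ (τ i).poly (e P).1 (e P).2 = 0 := by
  obtain ⟨k, U, V, hk, hU, hV, hdet, hc⟩ := h
  choose c c' hc0 hc0' hcF using hc
  obtain ⟨e, hv, hs, he⟩ := exists_localCoordinates U V v k hk hdet
  have h1 := (rep_toPoint hk).2
  have hcont := (continuousOn_affineRep k).mono hs
  let T : Set P2 := e.source ∩ affineRep k ⁻¹' {w | ∀ i, eval w (c i) ≠ 0 ∧ eval w (c' i) ≠ 0}
  have hT : IsOpen T := by
    refine hcont.isOpen_inter_preimage e.open_source ?_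
    simp only [Set.ofPred_forall]
    exact isOpen_iInter_of_finite fun i =>
      (isOpen_ne_fun (continuous_eval _) continuous_const).inter
        (isOpen_ne_fun (continuous_eval _) continuous_const)
  refine ⟨e.restrOpen T hT, ?_, ?_, ?_⟩
  · refine ⟨hv, hv, ?_⟩
    rw [Set.mem_preimage, h1]
    exact fun i => ⟨hc0 i, hc0' i⟩
  · change e (toPoint v) = 0
    rw [he, h1, hU, hV]
    rfl
  · rintro P ⟨hP, -, hP2⟩ i
    change _ ↔ (τ i).poly (e P).1 (e P).2 = 0
    rw [mem_zeroLocus_iff_affineRep (hF i) (hs hP), he, ← eval_branch_poly]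
    have := congrArg (eval (affineRep k P)) (hcF i)
    rw [map_mul, map_mul] at this
    rw [← mul_eq_zero_iff_left (hP2 i).1, this, mul_eq_zero_iff_left (hP2 i).2]

/-- Two configurations with the same local form at `v` and `w` are locally homeomorphic there. -/
lemma HasLocalForm.exists_homeomorph {n : ℕ} {F G : Fin n → S} {d : Fin n → ℕ}
    (hF : ∀ i, (F i).IsHomogeneous (d i)) (hG : ∀ i, (G i).IsHomogeneous (d i))
    {τ : Fin n → Branch} {v w : Fin 3 → ℂ} (h : HasLocalForm F τ v) (h' : HasLocalForm G τ w) :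
    ∃ e : OpenPartialHomeomorph P2 P2, toPoint v ∈ e.source ∧ e (toPoint v) = toPoint w ∧
      ∀ i, e '' (e.source ∩ zeroLocus (F i)) = e.target ∩ zeroLocus (G i) := by
  obtain ⟨e, hv, he, h1⟩ := h.exists_chart hF
  obtain ⟨e', hw, he', h2⟩ := h'.exists_chart hG
  -- The homeomorphism is one chart followed by the inverse of the other. Both charts send their
  -- point to the origin and turn the `i`-th component into the same model branch.
  have hmem : ∀ P ∈ (e.trans e'.symm).source, ∀ i,
      P ∈ zeroLocus (F i) ↔ (e.trans e'.symm) P ∈ zeroLocus (G i) := by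
    intro P hP i
    rw [OpenPartialHomeomorph.trans_source] at hP
    rw [h1 P hP.1 i, OpenPartialHomeomorph.coe_trans, Function.comp_apply,
      h2 _ (e'.map_target hP.2) i, e'.right_inv hP.2]
  refine ⟨e.trans e'.symm, ?_, ?_, fun i => ?_⟩
  · rw [OpenPartialHomeomorph.trans_source]
    refine ⟨hv, ?_⟩
    rw [Set.mem_preimage, he, ← he']
    exact e'.map_source hw
  · rw [OpenPartialHomeomorph.coe_trans, Function.comp_apply, he, ← he', e'.left_inv hw]
  · ext Q
    constructor
    · rintro ⟨P, ⟨hP, hP2⟩, rfl⟩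
      exact ⟨OpenPartialHomeomorph.map_source _ hP, (hmem P hP i).1 hP2⟩
    · rintro ⟨hQ, hQ2⟩
      refine ⟨(e.trans e'.symm).symm Q, ⟨OpenPartialHomeomorph.map_target _ hQ, ?_⟩,
        OpenPartialHomeomorph.right_inv _ hQ⟩
      rw [hmem _ (OpenPartialHomeomorph.map_target _ hQ), OpenPartialHomeomorph.right_inv _ hQ]
      exact hQ2

/-! ### Existence of minimal graded free resolutions -/

/-- `v` is homogeneous of degree `e` in the graded free module whose `i`-th basis vector has degree
`a i`. -/
def IsHomVec {n : ℕ} (a : Fin n → ℕ) (e : ℕ) (v : Fin n → S) : Prop :=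
  ∀ i, v i ≠ 0 → ∃ k, a i + k = e ∧ (v i).IsHomogeneous k

/-- The homogeneous component of degree `e` in a graded free module. -/
def homComp {n : ℕ} (a : Fin n → ℕ) (e : ℕ) (v : Fin n → S) : Fin n → S :=
  fun i => if a i ≤ e then homogeneousComponent (e - a i) (v i) else 0

lemma isHomVec_homComp {n : ℕ} (a : Fin n → ℕ) (e : ℕ) (v : Fin n → S) :
    IsHomVec a e (homComp a e v) := by
  intro i hi
  by_cases h : a i ≤ e
  · refine ⟨e - a i, by omega, ?_⟩
    simpa [homComp, h] using homogeneousComponent_isHomogeneous (e - a i) (v i)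
  · simp [homComp, h] at hi

lemma sum_homogeneousComponent_of_lt (p : S) {N : ℕ} (hN : p.totalDegree < N) :
    ∑ j ∈ Finset.range N, homogeneousComponent j p = p := by
  conv_rhs => rw [← sum_homogeneousComponent p]
  symm
  refine Finset.sum_subset (by simpa using hN) fun j _ hj => ?_
  exact homogeneousComponent_eq_zero _ _ (by simpa [Nat.lt_succ_iff] using hj)

lemma exists_eq_sum_homComp {n : ℕ} (a : Fin n → ℕ) (v : Fin n → S) :
    ∃ N, v = ∑ e ∈ Finset.range N, homComp a e v := by
  -- Any bound above all `a i + deg (v i)` works; the sum is a convenient one.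
  refine ⟨∑ i, (a i + (v i).totalDegree + 1), ?_⟩
  ext1 i
  have h : a i + (v i).totalDegree + 1 ≤ ∑ i, (a i + (v i).totalDegree + 1) :=
    Finset.single_le_sum (f := fun i => a i + (v i).totalDegree + 1) (fun _ _ => Nat.zero_le _)
      (Finset.mem_univ i)
  obtain ⟨M, hM⟩ := Nat.exists_eq_add_of_le (show a i ≤ ∑ i, (a i + (v i).totalDegree + 1) by omega)
  rw [Finset.sum_apply, hM, Finset.sum_range_add,
    Finset.sum_eq_zero (fun e he => by
      have := Finset.mem_range.1 he
      simp [homComp, show ¬ a i ≤ e by omega]), zero_add]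
  simp only [homComp, le_add_iff_nonneg_right, zero_le, if_true, Nat.add_sub_cancel_left]
  exact (sum_homogeneousComponent_of_lt _ (by omega)).symm

lemma homogeneousComponent_mul_of_isHomogeneous {q : S} {k : ℕ} (hq : q.IsHomogeneous k) (n : ℕ)
    (p : S) : homogeneousComponent n (p * q) =
      if k ≤ n then homogeneousComponent (n - k) p * q else 0 := by
  have hp := sum_homogeneousComponent_of_lt p (N := p.totalDegree + n + 1) (by omega)
  conv_lhs => rw [← hp, Finset.sum_mul, map_sum]
  have h : ∀ j, homogeneousComponent n (homogeneousComponent j p * q) =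
      if n = j + k then homogeneousComponent j p * q else 0 := fun j =>
    homogeneousComponent_of_mem ((homogeneousComponent_isHomogeneous j p).mul hq)
  simp only [h]
  split_ifs with hk
  · rw [Finset.sum_eq_single (n - k)]
    · rw [if_pos (by omega)]
    · intro j _ hj
      rw [if_neg (by omega)]
    · intro hj
      exact absurd (Finset.mem_range.2 (by omega)) hj
  · exact Finset.sum_eq_zero fun j _ => if_neg (by omega)

/-- The degree `c` refers to the whole vector: each nonzero coordinate `v i` has degree `c - a i`,
so the shifts `a i` cancel and one component of `p` serves all coordinates. -/
lemma homComp_smul {n : ℕ} {a : Fin n → ℕ} {c : ℕ} {v : Fin n → S} (hv : IsHomVec a c v) (e : ℕ)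
    (p : S) : homComp a e (p • v) =
      (if c ≤ e then homogeneousComponent (e - c) p else 0) • v := by
  ext1 i
  by_cases h0 : v i = 0
  · simp [homComp, h0]
  · obtain ⟨k, hk, hvk⟩ := hv i h0
    simp only [homComp, Pi.smul_apply, smul_eq_mul, homogeneousComponent_mul_of_isHomogeneous hvk]
    by_cases h1 : c ≤ e
    · rw [if_pos (by omega), if_pos (by omega), if_pos h1, show e - a i - k = e - c by omega]
    · rw [if_neg h1, zero_mul]
      split_ifs
      · omega
      · rfl
      · rfl

lemma homComp_sum {n : ℕ} (a : Fin n → ℕ) (e : ℕ) {ι : Type*} (s : Finset ι)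
    (v : ι → Fin n → S) : homComp a e (∑ j ∈ s, v j) = ∑ j ∈ s, homComp a e (v j) := by
  ext1 i
  simp only [homComp, Finset.sum_apply, map_sum]
  split_ifs <;> simp

lemma mulVec_eq_sum_smul {n m : ℕ} (d : Matrix (Fin n) (Fin m) S) (p : Fin m → S) :
    d *ᵥ p = ∑ j, p j • fun i => d i j := by
  ext1 i
  simp [mulVec, dotProduct, mul_comm]

/-- A matrix with homogeneous columns is a graded map, hence commutes with taking components. This
makes its kernel a graded submodule. -/
lemma homComp_mulVec {n m : ℕ} {a : Fin n → ℕ} {c : Fin m → ℕ} {d : Matrix (Fin n) (Fin m) S}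
    (hd : ∀ j, IsHomVec a (c j) fun i => d i j) (e : ℕ) (p : Fin m → S) :
    homComp a e (d *ᵥ p) = d *ᵥ homComp c e p := by
  rw [mulVec_eq_sum_smul, mulVec_eq_sum_smul, homComp_sum]
  exact Finset.sum_congr rfl fun j _ => homComp_smul (hd j) e (p j)

/-- A submodule of a graded free module is graded. -/
def IsGradedSubmodule {n : ℕ} (a : Fin n → ℕ) (K : Submodule S (Fin n → S)) : Prop :=
  ∀ v ∈ K, ∀ e, homComp a e v ∈ K

lemma isGradedSubmodule_ker {n m : ℕ} {a : Fin n → ℕ} {c : Fin m → ℕ}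
    {d : Matrix (Fin n) (Fin m) S} (hd : ∀ j, IsHomVec a (c j) fun i => d i j) :
    IsGradedSubmodule c (LinearMap.ker d.mulVecLin) := by
  intro v hv e
  rw [LinearMap.mem_ker, mulVecLin_apply] at hv ⊢
  rw [← homComp_mulVec hd, hv]
  ext1 i
  simp [homComp]

/-- Noetherianity gives finitely many generators, and the finitely many components of each of them
also generate, because the submodule is graded. -/
lemma exists_homogeneous_generators {n : ℕ} {a : Fin n → ℕ} {K : Submodule S (Fin n → S)}
    (hK : IsGradedSubmodule a K) :
    ∃ (m : ℕ) (c : Fin m → ℕ) (g : Fin m → Fin n → S), (∀ j, IsHomVec a (c j) (g j)) ∧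
      Submodule.span S (Set.range g) = K := by
  obtain ⟨s, hs⟩ := IsNoetherian.noetherian K
  choose N hN using exists_eq_sum_homComp a
  let ι := Σ v : s, Fin (N v.1)
  obtain ⟨m, ⟨σ⟩⟩ := Finite.exists_equiv_fin ι
  refine ⟨m, fun j => (σ.symm j).2, fun j => homComp a (σ.symm j).2 (σ.symm j).1.1,
    fun j => isHomVec_homComp _ _ _, le_antisymm ?_ ?_⟩
  · rw [Submodule.span_le]
    rintro _ ⟨j, rfl⟩
    exact hK _ (hs ▸ Submodule.subset_span (σ.symm j).1.2) _
  · conv_lhs => rw [← hs]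
    rw [Submodule.span_le]
    intro v hv
    rw [SetLike.mem_coe, hN v]
    refine Submodule.sum_mem _ fun e he => Submodule.subset_span ?_
    exact ⟨σ ⟨⟨v, hv⟩, ⟨e, Finset.mem_range.1 he⟩⟩, by
      dsimp only
      rw [Equiv.symm_apply_apply]⟩

/-- Take the least possible number of homogeneous generators. A relation with a unit constant term
at one generator would express that generator through the others, contradicting the choice. -/
lemma exists_minimal_generators {n : ℕ} {a : Fin n → ℕ} {K : Submodule S (Fin n → S)}
    (hK : IsGradedSubmodule a K) :
    ∃ (m : ℕ) (c : Fin m → ℕ) (d : Matrix (Fin n) (Fin m) S),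
      (∀ j, IsHomVec a (c j) fun i => d i j) ∧ LinearMap.range d.mulVecLin = K ∧
      ∀ p, d *ᵥ p = 0 → ∀ j, constantCoeff (p j) = 0 := by
  classical
  have hex := exists_homogeneous_generators hK
  obtain ⟨c, g, hg, hspan⟩ := Nat.find_spec hex
  have hmin := fun {m} => Nat.find_min hex (m := m)
  generalize Nat.find hex = m at *
  have hcol : ∀ p : Fin m → S, (Matrix.of fun i j => g j i) *ᵥ p = ∑ j, p j • g j := fun p => by
    rw [mulVec_eq_sum_smul]
    rfl
  refine ⟨m, c, Matrix.of fun i j => g j i, hg, ?_, ?_⟩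
  · rw [range_mulVecLin, ← hspan]
    rfl
  · intro p hp j₀
    by_contra h0
    obtain ⟨m, rfl⟩ : ∃ k, m = k + 1 := ⟨m - 1, by have := j₀.pos; omega⟩
    refine hmin (Nat.lt_succ_self m) ⟨c ∘ j₀.succAbove, g ∘ j₀.succAbove, fun j => hg _, ?_⟩
    -- In degree `c j₀` the coefficient of `g j₀` has degree zero, so this component of the relation
    -- sees exactly the constant term of `p j₀`.
    have h1 := congrArg (homComp a (c j₀)) hp
    rw [homComp_mulVec (d := Matrix.of fun i j => g j i) hg, hcol,
      Fin.sum_univ_succAbove _ j₀] at h1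
    have h2 : homComp c (c j₀) p j₀ = C (constantCoeff (p j₀)) := by
      simp [homComp, homogeneousComponent_zero, constantCoeff_eq]
    have h3 : homComp a (c j₀) (0 : Fin n → S) = 0 := by
      ext1 i
      simp [homComp]
    rw [h2, h3] at h1
    have h4 : g j₀ ∈ Submodule.span S (Set.range (g ∘ j₀.succAbove)) := by
      have h5 : g j₀ = -((C (constantCoeff (p j₀))⁻¹ : S) •
          ∑ i, homComp c (c j₀) p (j₀.succAbove i) • g (j₀.succAbove i)) := by
        rw [← smul_neg, ← eq_neg_iff_add_eq_zero.2 h1, smul_smul, ← C_mul,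
          inv_mul_cancel₀ h0, C_1, one_smul]
      rw [h5]
      refine Submodule.neg_mem _ (Submodule.smul_mem _ _ ?_)
      exact (Submodule.sum_mem _ fun i _ =>
        Submodule.smul_mem _ _ (Submodule.subset_span ⟨i, rfl⟩))
    refine le_antisymm ?_ ?_
    · rw [← hspan]
      exact Submodule.span_mono (Set.range_comp_subset_range _ _)
    · rw [← hspan, Submodule.span_le]
      rintro _ ⟨j, rfl⟩
      rcases Fin.eq_self_or_eq_succAbove j₀ j with rfl | ⟨i, rfl⟩
      · exact h4
      · exact Submodule.subset_span ⟨i, rfl⟩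

/-- One step of a minimal graded free resolution: a graded map of graded free modules whose kernel
lies in the irrelevant ideal times the source. -/
structure MinimalStep where
  tgt : ℕ
  src : ℕ
  a : Fin tgt → ℕ
  c : Fin src → ℕ
  d : Matrix (Fin tgt) (Fin src) S
  hom : ∀ j, IsHomVec a (c j) fun i => d i j
  ker_minimal : ∀ p, d *ᵥ p = 0 → ∀ j, constantCoeff (p j) = 0

lemma MinimalStep.exists_next (s : MinimalStep) :
    ∃ (m : ℕ) (c : Fin m → ℕ) (d : Matrix (Fin s.src) (Fin m) S),
      (∀ j, IsHomVec s.c (c j) fun i => d i j) ∧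
      LinearMap.range d.mulVecLin = LinearMap.ker s.d.mulVecLin ∧
      ∀ p, d *ᵥ p = 0 → ∀ j, constantCoeff (p j) = 0 :=
  exists_minimal_generators (isGradedSubmodule_ker s.hom)

/-- The next step of a minimal graded free resolution. -/
def MinimalStep.next (s : MinimalStep) : MinimalStep where
  tgt := s.src
  src := s.exists_next.choose
  a := s.c
  c := s.exists_next.choose_spec.choose
  d := s.exists_next.choose_spec.choose_spec.choose
  hom := s.exists_next.choose_spec.choose_spec.choose_spec.1
  ker_minimal := s.exists_next.choose_spec.choose_spec.choose_spec.2.2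

lemma MinimalStep.range_next (s : MinimalStep) :
    LinearMap.range s.next.d.mulVecLin = LinearMap.ker (R := S) s.d.mulVecLin :=
  s.exists_next.choose_spec.choose_spec.choose_spec.2.1

/-- Iterated steps of a minimal graded free resolution. -/
def MinimalStep.iter (s : MinimalStep) : ℕ → MinimalStep
  | 0 => s
  | p + 1 => (s.iter p).next

lemma mulVec_single_one {n m : ℕ} (d : Matrix (Fin n) (Fin m) S) (j : Fin m) :
    d *ᵥ Pi.single j 1 = fun i => d i j := by
  ext1 i
  simp

lemma MinimalStep.exact_next (s : MinimalStep) :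
    Function.Exact s.next.d.mulVecLin (s.d.mulVecLin : (Fin s.src → S) →ₗ[S] (Fin s.tgt → S)) :=
  LinearMap.exact_iff.2 s.range_next.symm

/-- Columns of the next differential lie in the kernel of the current one, whose elements have no
constant terms by minimality. -/
lemma MinimalStep.constantCoeff_next (s : MinimalStep) (i : Fin s.next.tgt) (j : Fin s.next.src) :
    constantCoeff (s.next.d i j) = 0 := by
  have h1 := (s.exact_next (s.next.d *ᵥ Pi.single j 1)).2 ⟨Pi.single j 1, rfl⟩
  have := s.ker_minimal _ h1 i
  rwa [mulVec_single_one] at this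

/-- A homogeneous ideal in the irrelevant ideal has a minimal graded free resolution of its
quotient. -/
theorem nonempty_minimalGradedFreeResolution (J : Ideal S)
    (hJ : ∀ f ∈ J, ∀ e, homogeneousComponent e f ∈ J) (hJ0 : ∀ f ∈ J, constantCoeff f = 0) :
    Nonempty (MinimalGradedFreeResolution J) := by
  -- The resolution starts with `S` generated in degree zero and the quotient map.
  let aug : (Fin 1 → S) →ₗ[S] S ⧸ J :=
    (Ideal.Quotient.mkₐ S J).toLinearMap ∘ₗ LinearMap.proj (R := S) (φ := fun _ : Fin 1 => S) 0
  have haug : ∀ v, aug v = Ideal.Quotient.mk J (v 0) := fun v => rfl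
  have hmem : ∀ v, v ∈ LinearMap.ker aug ↔ v 0 ∈ J := fun v => by
    rw [LinearMap.mem_ker, haug, Ideal.Quotient.eq_zero_iff_mem]
  have hgr : IsGradedSubmodule (fun _ => 0) (LinearMap.ker aug) := by
    intro v hv e
    rw [hmem] at hv ⊢
    simpa [homComp] using hJ _ hv e
  obtain ⟨m, c, d, hd, hrange, hker⟩ := exists_minimal_generators hgr
  let s : MinimalStep := ⟨1, m, fun _ => 0, c, d, hd, hker⟩
  have hone : ∀ i : Fin 1, aug (Pi.single i 1) = Ideal.Quotient.mk J 1 := fun i => by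
    rw [haug, Subsingleton.elim i (0 : Fin 1), Pi.single_eq_same]
  -- The first differential is minimal for a different reason than the later ones: its columns
  -- generate `J`, which lies in the irrelevant ideal.
  have hmin : ∀ (i : Fin 1) (j : Fin m), constantCoeff (d i j) = 0 := fun i j => by
    have h1 : d *ᵥ Pi.single j 1 ∈ LinearMap.ker aug := hrange ▸ ⟨Pi.single j 1, rfl⟩
    rw [hmem, mulVec_single_one] at h1
    have := hJ0 _ h1
    rwa [Subsingleton.elim (0 : Fin 1) i] at this
  have hexact : Function.Exact d.mulVecLin aug := by
    rw [LinearMap.exact_iff]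
    exact hrange.symm
  exact ⟨{
    rank := fun p => (s.iter p).tgt
    shift := fun p => (s.iter p).a
    d := fun p => (s.iter p).d
    aug := aug
    aug_homogeneous := fun i => ⟨1, isHomogeneous_one _ _, hone i⟩
    d_homogeneous := fun p i j h => (s.iter p).hom j i h
    d_minimal := fun p => by
      cases p with
      | zero => exact hmin
      | succ p => exact (s.iter p).constantCoeff_next
    aug_surjective := fun q => by
      obtain ⟨f, rfl⟩ := Ideal.Quotient.mk_surjective q
      exact ⟨fun _ => f, rfl⟩
    exact_zero := hexact
    exact_succ := fun p => (s.iter p).exact_next }⟩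

/-! ### Twists of the resolution of the Milnor algebra -/

lemma mem_jacobianIdeal {f h : S} :
    h ∈ jacobianIdeal f ↔ ∃ r : Fin 3 → S, ∑ i, r i * pderiv i f = h := by
  rw [jacobianIdeal, Ideal.span, Submodule.mem_span_range_iff_exists_fun]
  rfl

lemma homogeneousComponent_mem_jacobianIdeal {f : S} {D : ℕ} (hf : f.IsHomogeneous (D + 1))
    {h : S} (hh : h ∈ jacobianIdeal f) (e : ℕ) : homogeneousComponent e h ∈ jacobianIdeal f := by
  obtain ⟨r, rfl⟩ := mem_jacobianIdeal.1 hh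
  rw [map_sum]
  refine Ideal.sum_mem _ fun i _ => ?_
  rw [homogeneousComponent_mul_of_isHomogeneous (k := D) hf.pderiv]
  split_ifs
  · exact Ideal.mul_mem_left _ _ (Ideal.subset_span ⟨i, rfl⟩)
  · exact Ideal.zero_mem _

lemma constantCoeff_eq_zero_of_isHomogeneous {p : S} {d : ℕ} (hp : p.IsHomogeneous d)
    (hd : d ≠ 0) : constantCoeff p = 0 := by
  rw [constantCoeff_eq]
  exact hp.coeff_eq_zero (by simpa using hd.symm)

lemma constantCoeff_of_mem_jacobianIdeal {f : S} {D : ℕ} (hf : f.IsHomogeneous (D + 1))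
    (hD : D ≠ 0) {h : S} (hh : h ∈ jacobianIdeal f) : constantCoeff h = 0 := by
  obtain ⟨r, rfl⟩ := mem_jacobianIdeal.1 hh
  simp only [map_sum, map_mul]
  exact Finset.sum_eq_zero fun i _ => by
    rw [constantCoeff_eq_zero_of_isHomogeneous (d := D) hf.pderiv hD, mul_zero]

theorem nonempty_resolution_jacobianIdeal {f : S} {D : ℕ} (hf : f.IsHomogeneous (D + 1))
    (hD : D ≠ 0) : Nonempty (MinimalGradedFreeResolution (jacobianIdeal f)) :=
  nonempty_minimalGradedFreeResolution _
    (fun _ h e => homogeneousComponent_mem_jacobianIdeal hf h e)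
    (fun _ h => constantCoeff_of_mem_jacobianIdeal hf hD h)

namespace MinimalGradedFreeResolution

lemma constantCoeff_mulVec {J : Ideal S} (F : MinimalGradedFreeResolution J) (p : ℕ)
    (v : Fin (F.rank (p + 1)) → S) (i : Fin (F.rank p)) :
    constantCoeff ((F.d p *ᵥ v) i) = 0 := by
  simp [mulVec, dotProduct, F.d_minimal]

/-- A kernel element is in the image of a matrix without constant terms. This is the form in which
minimality is used below: a relation with a unit coefficient is impossible. -/
lemma constantCoeff_of_aug {J : Ideal S} (F : MinimalGradedFreeResolution J)
    {v : Fin (F.rank 0) → S} (hv : F.aug v = 0) (i : Fin (F.rank 0)) :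
    constantCoeff (v i) = 0 := by
  obtain ⟨w, rfl⟩ := (F.exact_zero v).1 hv
  exact F.constantCoeff_mulVec 0 w i

lemma constantCoeff_of_mulVec {J : Ideal S} (F : MinimalGradedFreeResolution J) (p : ℕ)
    {v : Fin (F.rank (p + 1)) → S} (hv : F.d p *ᵥ v = 0) (i : Fin (F.rank (p + 1))) :
    constantCoeff (v i) = 0 := by
  obtain ⟨w, rfl⟩ := (F.exact_succ p v).1 hv
  exact F.constantCoeff_mulVec (p + 1) w i

lemma aug_apply {J : Ideal S} (F : MinimalGradedFreeResolution J) (v : Fin (F.rank 0) → S) :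
    F.aug v = ∑ i, v i • F.aug (Pi.single i 1) := by
  conv_lhs => rw [← Finset.univ_sum_single v, map_sum]
  refine Finset.sum_congr rfl fun i _ => ?_
  rw [← map_smul, ← Pi.single_smul, smul_eq_mul, mul_one]

/-- The resolution of a proper homogeneous ideal starts with `S`. -/
lemma exists_base {J : Ideal S} (hJ : ∀ h ∈ J, constantCoeff h = 0)
    (F : MinimalGradedFreeResolution J) :
    ∃ i₀ : Fin (F.rank 0), (∀ i, i = i₀) ∧ F.shift 0 i₀ = 0 ∧
      ∀ v, F.aug v = 0 ↔ v i₀ ∈ J := by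
  choose g hg hag using F.aug_homogeneous
  have haug : ∀ v, F.aug v = Ideal.Quotient.mk J (∑ i, v i * g i) := fun v => by
    rw [F.aug_apply, map_sum]
    refine Finset.sum_congr rfl fun i _ => ?_
    rw [hag, map_mul]
    rfl
  obtain ⟨v, hv⟩ := F.aug_surjective 1
  -- The class of 1 is reached, and elements of `J` have no constant term, so some generator has
  -- one. Homogeneity then makes this generator a constant.
  obtain ⟨i₀, hi₀⟩ : ∃ i, constantCoeff (g i) ≠ 0 := by
    by_contra! hcon
    rw [haug, ← map_one (Ideal.Quotient.mk J), Ideal.Quotient.eq] at hv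
    have := hJ _ hv
    simp [hcon] at this
  have hs : F.shift 0 i₀ = 0 := by
    by_contra hne
    exact hi₀ (constantCoeff_eq_zero_of_isHomogeneous (hg i₀) hne)
  have hC : g i₀ = C (constantCoeff (g i₀)) := by
    have h := hg i₀
    rw [hs, ← totalDegree_zero_iff_isHomogeneous, totalDegree_eq_zero_iff_eq_C] at h
    exact h
  -- A second basis vector minus the right multiple of the `i₀`-th one would be a kernel element
  -- with constant coefficient 1.
  have huniq : ∀ i, i = i₀ := by
    intro i
    by_contra hi
    have h := F.constantCoeff_of_aug (v := Pi.single i 1 -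
      Pi.single i₀ (C (constantCoeff (g i₀))⁻¹ * g i)) (by
        rw [haug]
        simp only [Pi.sub_apply, sub_mul, Finset.sum_sub_distrib, Pi.single_apply, ite_mul,
          zero_mul, Finset.sum_ite_eq', Finset.mem_univ, if_true, one_mul]
        rw [mul_right_comm, hC, constantCoeff_C, ← C_mul, inv_mul_cancel₀ hi₀, C_1, one_mul,
          sub_self, map_zero]) i
    simp [hi] at h
  refine ⟨i₀, huniq, hs, fun v => ?_⟩
  rw [haug, Fintype.sum_eq_single i₀ (fun i hi => absurd (huniq i) hi),
    Ideal.Quotient.eq_zero_iff_mem, hC]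
  refine ⟨fun h => ?_, fun h => J.mul_mem_right _ h⟩
  have := J.mul_mem_right (C (constantCoeff (g i₀))⁻¹) h
  rwa [mul_assoc, ← C_mul, mul_inv_cancel₀ hi₀, C_1, mul_one] at this

end MinimalGradedFreeResolution

/-- The first two steps of the resolution of the Milnor algebra in explicit form: minimal
generators `Q i` of the Jacobian ideal, related to the partial derivatives by constant matrices. -/
lemma exists_generators_resolution {f : S} {D : ℕ} (hf : f.IsHomogeneous (D + 1)) (hD : D ≠ 0)
    (F : MinimalGradedFreeResolution (jacobianIdeal f)) :
    ∃ Q : Fin (F.rank 1) → S,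
      (∀ v : Fin (F.rank 1) → S, F.d 0 *ᵥ v = 0 ↔ ∑ i, v i * Q i = 0) ∧
      (∀ i, F.shift 1 i = D) ∧
      (∃ A : Fin (F.rank 1) → Fin 3 → ℂ, ∀ i, Q i = ∑ k, C (A i k) * pderiv k f) ∧
      ∃ B : Fin 3 → Fin (F.rank 1) → ℂ, ∀ k, pderiv k f = ∑ i, C (B k i) * Q i := by
  obtain ⟨i₀, huniq, hs, haug⟩ :=
    F.exists_base fun h hh => constantCoeff_of_mem_jacobianIdeal hf hD hh
  have hpd : ∀ k, (pderiv k f).IsHomogeneous D := fun k => hf.pderiv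
  let Q : Fin (F.rank 1) → S := fun i => F.d 0 i₀ i
  have hmul : ∀ v, (F.d 0 *ᵥ v) i₀ = ∑ i, v i * Q i := fun v => by
    simp [mulVec, dotProduct, Q, mul_comm]
  have hker : ∀ v : Fin (F.rank 1) → S, F.d 0 *ᵥ v = 0 ↔ ∑ i, v i * Q i = 0 := by
    intro v
    rw [← hmul]
    refine ⟨fun h => by rw [h]; rfl, fun h => ?_⟩
    ext1 i
    rw [huniq i, h]
    rfl
  have hQJ : ∀ i, Q i ∈ jacobianIdeal f := by
    intro i
    have h := (haug (F.d 0 *ᵥ Pi.single i 1)).1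
      ((F.exact_zero _).2 ⟨Pi.single i 1, rfl⟩)
    rwa [mulVec_single_one] at h
  have hJQ : ∀ h ∈ jacobianIdeal f, ∃ p : Fin (F.rank 1) → S, ∑ i, p i * Q i = h := by
    intro h hh
    obtain ⟨p, hp⟩ := (F.exact_zero (fun _ => h)).1 ((haug _).2 hh)
    refine ⟨p, ?_⟩
    rw [← hmul]
    exact congrFun hp i₀
  -- If `Q i` vanished, the `i`-th basis vector would be in the kernel, against minimality.
  have hQ0 : ∀ i, Q i ≠ 0 := by
    intro i hi
    have h := F.constantCoeff_of_mulVec 0 (v := Pi.single i 1) (by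
      rw [hker]
      simp [Pi.single_apply, hi]) i
    simp at h
  have hQhom : ∀ i, (Q i).IsHomogeneous (F.shift 1 i) := by
    intro i
    obtain ⟨n, hn, hh⟩ := F.d_homogeneous 0 i₀ i (hQ0 i)
    rw [hs, zero_add] at hn
    rwa [← hn]
  choose B' hB' using fun k => hJQ (pderiv k f) (Ideal.subset_span ⟨k, rfl⟩)
  choose A' hA' using fun i => mem_jacobianIdeal.1 (hQJ i)
  have hA : ∀ i, Q i = ∑ k, (if D ≤ F.shift 1 i then
      homogeneousComponent (F.shift 1 i - D) (A' i k) * pderiv k f else 0) := by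
    intro i
    rw [← homogeneousComponent_eq_self (hQhom i)]
    conv_lhs => rw [← hA' i, map_sum]
    exact Finset.sum_congr rfl fun k _ => homogeneousComponent_mul_of_isHomogeneous (hpd k) _ _
  -- Below degree `D` the Jacobian ideal is zero. Above degree `D` the generator would be a
  -- combination of the partial derivatives with coefficients of positive degree, hence redundant.
  have hshift : ∀ i, F.shift 1 i = D := by
    intro j
    rcases lt_trichotomy (F.shift 1 j) D with h | h | h
    · refine absurd (hA j) ?_
      simp [not_le.2 h, hQ0]
    · exact h
    · exfalso
      have h1 := hA j
      simp only [if_pos h.le] at h1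
      simp only [← hB', Finset.mul_sum] at h1
      rw [Finset.sum_comm] at h1
      -- Rewriting the partial derivatives through the `Q i` gives a relation whose coefficient at
      -- `j` has constant term 1.
      have h2 := F.constantCoeff_of_mulVec 0 (v := Pi.single j 1 - fun i =>
        ∑ k, homogeneousComponent (F.shift 1 j - D) (A' j k) * B' k i) (by
          rw [hker]
          simp only [Pi.sub_apply, sub_mul, Finset.sum_sub_distrib, Pi.single_apply, ite_mul,
            zero_mul, Finset.sum_ite_eq', Finset.mem_univ, if_true, one_mul, Finset.sum_mul]
          rw [sub_eq_zero, h1]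
          simp only [mul_assoc]) j
      have h3 : ∀ k, constantCoeff (homogeneousComponent (F.shift 1 j - D) (A' j k)) = 0 :=
        fun k => constantCoeff_eq_zero_of_isHomogeneous
          (homogeneousComponent_isHomogeneous _ _) (by omega)
      simp [h3] at h2
  -- All `Q i` and all partial derivatives have degree `D`, so only the constant terms of the
  -- coefficients matter.
  refine ⟨Q, hker, hshift, ⟨fun i k => coeff 0 (A' i k), fun i => ?_⟩,
    fun k i => coeff 0 (B' k i), fun k => ?_⟩
  · rw [hA i]
    simp [hshift, homogeneousComponent_zero]
  · rw [← homogeneousComponent_eq_self (hpd k)]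
    conv_lhs => rw [← hB' k, map_sum]
    refine Finset.sum_congr rfl fun i _ => ?_
    have := hQhom i
    rw [hshift] at this
    rw [homogeneousComponent_mul_of_isHomogeneous this]
    simp [homogeneousComponent_zero]

lemma coeff_sum_C_mul {ι : Type*} [Fintype ι] (a : ι → ℂ) (p : ι → S) (m : Fin 3 →₀ ℕ) :
    coeff m (∑ i, C (a i) * p i) = ∑ i, a i * coeff m (p i) := by
  simp [coeff_sum, coeff_C_mul]

lemma isHomogeneous_sum_C_mul {ι : Type*} [Fintype ι] (a : ι → ℂ) {p : ι → S} {e : ℕ}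
    (hp : ∀ i, (p i).IsHomogeneous e) : (∑ i, C (a i) * p i).IsHomogeneous e :=
  IsHomogeneous.sum _ _ _ fun i _ => (hp i).C_mul (a i)

/-- A column of the second differential is a relation among the minimal generators `Q i`. Since the
`Q i` are constant combinations of the partial derivatives, it becomes a Jacobian syzygy. Using
constant matrices here avoids assuming that the partial derivatives are linearly independent. -/
lemma exists_degree_of_shift_two {f : S} {D : ℕ} (hf : f.IsHomogeneous (D + 1)) (hD : D ≠ 0)
    (F : MinimalGradedFreeResolution (jacobianIdeal f)) (j : Fin (F.rank 2)) :
    ∃ e ∈ syzygyDegrees f, F.shift 2 j = D + e := by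
  obtain ⟨Q, hker, hshift, ⟨A, hA⟩, -⟩ := exists_generators_resolution hf hD F
  have hcol : F.d 0 *ᵥ (fun i => F.d 1 i j) = 0 := by
    have := (F.exact_succ 0 (F.d 1 *ᵥ Pi.single j 1)).2 ⟨Pi.single j 1, rfl⟩
    rwa [mulVec_single_one] at this
  have hne : (fun i => F.d 1 i j) ≠ 0 := by
    intro h0
    have h := F.constantCoeff_of_mulVec 1 (v := Pi.single j 1) (by
      rw [mulVec_single_one]
      exact h0) j
    simp at h
  obtain ⟨i₁, hi₁⟩ := Function.ne_iff.1 hne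
  obtain ⟨e, he, -⟩ := F.d_homogeneous 1 i₁ j hi₁
  rw [hshift] at he
  have hhom : ∀ i, (F.d 1 i j).IsHomogeneous e := by
    intro i
    by_cases h0 : F.d 1 i j = 0
    · rw [h0]
      exact isHomogeneous_zero _ _ _
    · obtain ⟨n, hn, hh⟩ := F.d_homogeneous 1 i j h0
      rw [hshift] at hn
      rwa [show e = n by omega]
  rw [hker] at hcol
  refine ⟨e, ⟨fun k => ∑ i, C (A i k) * F.d 1 i j, ?_, ?_, fun k =>
    isHomogeneous_sum_C_mul _ hhom⟩, he.symm⟩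
  · change ∑ k, (∑ i, C (A i k) * F.d 1 i j) * pderiv k f = 0
    rw [← hcol]
    simp only [hA, Finset.mul_sum, Finset.sum_mul]
    rw [Finset.sum_comm]
    exact Finset.sum_congr rfl fun i _ => Finset.sum_congr rfl fun k _ => by ring
  -- If the resulting syzygy vanished, the coefficients of each monomial in the column would form a
  -- constant relation among the `Q i`, which minimality excludes.
  · intro h0
    refine hi₁ ?_
    change F.d 1 i₁ j = 0
    ext m
    have h1 : ∀ k, ∑ i, A i k * coeff m (F.d 1 i j) = 0 := fun k => by
      rw [← coeff_sum_C_mul]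
      exact congrArg (coeff m) (congrFun h0 k)
    have h2 := F.constantCoeff_of_mulVec 0 (v := fun i => C (coeff m (F.d 1 i j))) (by
      rw [hker]
      simp only [hA, Finset.mul_sum, ← mul_assoc, ← C_mul]
      rw [Finset.sum_comm]
      refine Finset.sum_eq_zero fun k _ => ?_
      rw [← Finset.sum_mul, ← map_sum]
      have := h1 k
      simp only [mul_comm (A _ k)] at this
      rw [this, C_0, zero_mul]) i₁
    simpa using h2

/-- A syzygy of least degree yields a relation among the `Q i` of degree `D + e`. Some generator of
the relations therefore has degree at most `D + e`, and none has smaller degree because each comes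
from a Jacobian syzygy. -/
lemma exists_shift_two_eq {f : S} {D e : ℕ} (hf : f.IsHomogeneous (D + 1)) (hD : D ≠ 0)
    (he : IsLeast (syzygyDegrees f) e) (he0 : e ≠ 0)
    (F : MinimalGradedFreeResolution (jacobianIdeal f)) :
    ∃ j, F.shift 2 j = D + e := by
  obtain ⟨Q, hker, hshift, -, B, hB⟩ := exists_generators_resolution hf hD F
  obtain ⟨⟨s, hs, hs0, hshom⟩, hleast⟩ := he
  let v : Fin (F.rank 1) → S := fun i => ∑ k, C (B k i) * s k
  -- If passing to the `Q i` killed the syzygy `s`, a monomial coefficient of `s` would be a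
  -- constant syzygy, so degree zero would be the least degree, against `e ≠ 0`.
  have hv0 : v ≠ 0 := by
    intro h0
    refine hs0 ?_
    ext k m
    have h1 : ∀ i, ∑ k, B k i * coeff m (s k) = 0 := fun i => by
      rw [← coeff_sum_C_mul]
      exact congrArg (coeff m) (congrFun h0 i)
    by_contra hne
    refine he0 (Nat.le_zero.1 (hleast ⟨fun k => C (coeff m (s k)), ?_, ?_, fun k =>
      isHomogeneous_C _ _⟩))
    · change ∑ k, C (coeff m (s k)) * pderiv k f = 0
      simp only [hB, Finset.mul_sum, ← mul_assoc, ← C_mul]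
      rw [Finset.sum_comm]
      refine Finset.sum_eq_zero fun i _ => ?_
      rw [← Finset.sum_mul, ← map_sum]
      have := h1 i
      simp only [mul_comm (B _ i)] at this
      rw [this, C_0, zero_mul]
    · intro h2
      have := congrFun h2 k
      simp at this
      simp [this] at hne
  have hvker : F.d 0 *ᵥ v = 0 := by
    rw [hker, ← show ∑ k, s k * pderiv k f = 0 from hs]
    simp only [v, hB, Finset.mul_sum, Finset.sum_mul]
    rw [Finset.sum_comm]
    exact Finset.sum_congr rfl fun i _ => Finset.sum_congr rfl fun k _ => by ring
  obtain ⟨p, hp⟩ := (F.exact_succ 0 v).1 hvker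
  -- If all columns had larger degree, nothing of degree `D + e` could be in the image.
  obtain ⟨j, hj⟩ : ∃ j, F.shift 2 j ≤ D + e := by
    by_contra! hcon
    refine hv0 ?_
    ext1 i
    have hvi : (v i).IsHomogeneous e := isHomogeneous_sum_C_mul (fun k => B k i) hshom
    rw [← homogeneousComponent_eq_self hvi, ← hp, Pi.zero_apply]
    simp only [mulVecLin_apply, mulVec, dotProduct, map_sum]
    refine Finset.sum_eq_zero fun j _ => ?_
    by_cases h0 : F.d 1 i j = 0
    · rw [h0, zero_mul, map_zero]
    · obtain ⟨n, hn, hh⟩ := F.d_homogeneous 1 i j h0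
      rw [hshift] at hn
      have : D + e < F.shift (1 + 1) j := hcon j
      rw [mul_comm, homogeneousComponent_mul_of_isHomogeneous hh, if_neg (by omega)]
  obtain ⟨n, hn, hn2⟩ := exists_degree_of_shift_two hf hD F j
  have := hleast hn
  exact ⟨j, by omega⟩

/-- Milnor algebras with different least degrees of Jacobian syzygies have different minimal
resolutions. -/
theorem twists_ne {f g : S} {D e : ℕ} (hf : f.IsHomogeneous (D + 1)) (hg : g.IsHomogeneous (D + 1))
    (hD : D ≠ 0) (he : IsLeast (syzygyDegrees f) e) (he0 : e ≠ 0) (hge : e ∉ syzygyDegrees g)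
    (F : MinimalGradedFreeResolution (jacobianIdeal f))
    (G : MinimalGradedFreeResolution (jacobianIdeal g)) : F.twists ≠ G.twists := by
  intro h
  obtain ⟨j, hj⟩ := exists_shift_two_eq hf hD he he0 F
  -- The resolutions are told apart in homological degree two.
  have hmem : D + e ∈ F.twists 2 := Multiset.mem_map.2 ⟨j, Finset.mem_univ_val j, hj⟩
  rw [h] at hmem
  obtain ⟨j', -, hj'⟩ := Multiset.mem_map.1 hmem
  obtain ⟨n, hn, hn2⟩ := exists_degree_of_shift_two hg hD G j'
  exact hge (by rwa [show e = n by omega])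

/-! ### Modules of Jacobian syzygies up to isomorphism -/

/-- The gradient of `f`. -/
def gradient (f : S) : Fin 3 → S := fun i => pderiv i f

/-- A prime dividing all partial derivatives divides `f` by Euler's formula, say `f = p q`, with `p`
not dividing `q` since `f` is squarefree. The product rule then shows that `p` divides its own
derivatives, which have smaller degree, so they vanish and `p` is constant in characteristic zero.
-/
lemma exists_not_dvd_pderiv {f p : S} {d : ℕ} (hd : d ≠ 0) (hf : f.IsHomogeneous d)
    (hsq : Squarefree f) (hp : Prime p) : ∃ i, ¬ p ∣ gradient f i := by
  by_contra! hcon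
  have hpf : p ∣ f := by
    have h : p ∣ d • f := by
      rw [← hf.sum_X_mul_pderiv]
      exact Finset.dvd_sum fun i _ => (hcon i).mul_left _
    rw [nsmul_eq_mul, ← map_natCast (C : ℂ →+* S)] at h
    have h2 := h.mul_left (C ((d : ℂ)⁻¹))
    rwa [← mul_assoc, ← C_mul, inv_mul_cancel₀ (by exact_mod_cast hd), C_1, one_mul] at h2
  obtain ⟨q, rfl⟩ := hpf
  have hpq : ¬ p ∣ q := fun ⟨r, hr⟩ =>
    hp.not_isUnit (hsq p ⟨r, by rw [hr, mul_assoc]⟩)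
  have hpd : ∀ i, pderiv i p = 0 := by
    intro i
    have h := hcon i
    rw [gradient, pderiv_mul] at h
    have h2 : p ∣ pderiv i p * q := (dvd_add_left (dvd_mul_right p _)).1 h
    have h3 := (hp.dvd_or_dvd h2).resolve_right hpq
    by_contra h0
    obtain ⟨r, hr⟩ := h3
    have hr0 : r ≠ 0 := by
      rintro rfl
      exact h0 (by rw [hr, mul_zero])
    have h4 := totalDegree_mul_of_isDomain hp.ne_zero hr0
    rw [← hr] at h4
    have h5 : (pderiv i p).totalDegree + 1 ≤ p.totalDegree := by
      obtain ⟨m, hm, hm2⟩ := Finset.exists_mem_eq_sup _ (support_nonempty.2 h0)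
        fun s : Fin 3 →₀ ℕ => s.sum fun _ e => e
      have h6 : m + Finsupp.single i 1 ∈ p.support := by
        rw [mem_support_iff, coeff_pderiv] at hm
        rw [mem_support_iff]
        exact left_ne_zero_of_mul hm
      have h7 := le_totalDegree h6
      rw [totalDegree, hm2]
      rwa [Finsupp.sum_add_index' (fun _ => rfl) (fun _ _ _ => rfl),
        Finsupp.sum_single_index rfl] at h7
    omega
  -- A monomial of positive degree would survive some derivative, its exponent being nonzero in `ℂ`.
  have hp0 : p.totalDegree = 0 := by
    by_contra hne
    obtain ⟨m, hm, hm2⟩ := Finset.exists_mem_eq_sup _ (support_nonempty.2 hp.ne_zero)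
      fun s : Fin 3 →₀ ℕ => s.sum fun _ e => e
    obtain ⟨i, hi⟩ : ∃ i, m i ≠ 0 := by
      by_contra! h0
      refine hne ?_
      rw [totalDegree, hm2]
      exact Finset.sum_eq_zero fun i _ => h0 i
    have h := coeff_pderiv (i := i) p (m - Finsupp.single i 1)
    rw [hpd i, coeff_zero, tsub_add_cancel_of_le
      (Finsupp.single_le_iff.2 (Nat.one_le_iff_ne_zero.2 hi))] at h
    rcases mul_eq_zero.1 h.symm with h | h
    · exact (mem_support_iff.1 hm) h
    · exact_mod_cast h
  rw [totalDegree_eq_zero_iff_eq_C] at hp0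
  refine hp.not_isUnit ?_
  rw [hp0]
  refine (isUnit_iff_ne_zero.2 fun h0 => hp.ne_zero ?_).map C
  rw [hp0, h0, C_0]

/-- A vector of polynomials without common prime factor. -/
def IsPrimitiveVec (u : Fin 3 → S) : Prop := ∀ p, Prime p → ∃ i, ¬ p ∣ u i

/-- Peel off the prime factors of `a` one at a time: each one fails to divide some `u i`, hence
divides `c`. -/
lemma IsPrimitiveVec.dvd {u : Fin 3 → S} (hu : IsPrimitiveVec u) {a c : S}
    (h : ∀ i, a ∣ u i * c) : a ∣ c := by
  induction a using UniqueFactorizationMonoid.induction_on_prime generalizing c with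
  | h₁ =>
    by_contra hc
    have h1 : ∀ i, u i = 0 := fun i =>
      (mul_eq_zero.1 (zero_dvd_iff.1 (h i))).resolve_right fun h0 => hc (zero_dvd_iff.2 h0)
    obtain ⟨i, hi⟩ := hu (X 0) X_prime
    exact hi (h1 i ▸ dvd_zero _)
  | h₂ a ha => exact ha.dvd
  | h₃ a p ha hp ih =>
    obtain ⟨i, hi⟩ := hu p hp
    obtain ⟨c', rfl⟩ := (hp.dvd_or_dvd ((dvd_mul_right p a).trans (h i))).resolve_left hi
    refine mul_dvd_mul_left p (ih fun j => ?_)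
    have := h j
    rwa [mul_left_comm, mul_dvd_mul_iff_left hp.ne_zero] at this

lemma IsPrimitiveVec.ne_zero {u : Fin 3 → S} (hu : IsPrimitiveVec u) : ∃ i, u i ≠ 0 := by
  obtain ⟨i, hi⟩ := hu (X 0) X_prime
  exact ⟨i, fun h => hi (h ▸ dvd_zero _)⟩

/-- Proportionality over the fraction field says that `u j` divides every `u i * v j`; primitivity
turns this into `u j ∣ v j`, so the ratio is a polynomial. -/
lemma IsPrimitiveVec.exists_smul_eq {u v : Fin 3 → S} (hu : IsPrimitiveVec u)
    (h : ∀ i j, u i * v j = u j * v i) : ∃ a : S, v = a • u := by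
  obtain ⟨j, hj⟩ := hu.ne_zero
  obtain ⟨a, ha⟩ := hu.dvd (a := u j) (c := v j) fun i => ⟨v i, h i j⟩
  refine ⟨a, ?_⟩
  ext1 i
  refine mul_left_cancel₀ hj ?_
  rw [h j i, ha, Pi.smul_apply, smul_eq_mul]
  ring

lemma mem_AR {f : S} {r : Fin 3 → S} : r ∈ AR f ↔
    r 0 * gradient f 0 + r 1 * gradient f 1 + r 2 * gradient f 2 = 0 := by
  change ∑ i, r i * pderiv i f = 0 ↔ _
  rw [Fin.sum_univ_three]
  rfl

/-- Both syzygies are orthogonal to the gradient, so their cross product is parallel to it, and the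
gradient is primitive. -/
lemma exists_cross_eq {f : S} (hf : IsPrimitiveVec (gradient f)) {r s : Fin 3 → S}
    (hr : r ∈ AR f) (hs : s ∈ AR f) : ∃ a : S, r ⨯₃ s = a • gradient f := by
  rw [mem_AR] at hr hs
  refine hf.exists_smul_eq fun i j => ?_
  rw [cross_apply]
  fin_cases i <;> fin_cases j <;> simp <;> first
    | ring1
    | linear_combination (s 0) * hr - (r 0) * hs
    | linear_combination (s 1) * hr - (r 1) * hs
    | linear_combination (s 2) * hr - (r 2) * hs
    | linear_combination -(s 0) * hr + (r 0) * hs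
    | linear_combination -(s 1) * hr + (r 1) * hs
    | linear_combination -(s 2) * hr + (r 2) * hs

open Classical in
/-- The coefficient `a` in `r × s = a ∇f`, for Jacobian syzygies `r`, `s` of `f`. -/
def wedge (f : S) (r s : Fin 3 → S) : S :=
  if h : ∃ a : S, r ⨯₃ s = a • gradient f then h.choose else 0

lemma cross_eq_wedge {f : S} (hf : IsPrimitiveVec (gradient f)) {r s : Fin 3 → S}
    (hr : r ∈ AR f) (hs : s ∈ AR f) : r ⨯₃ s = wedge f r s • gradient f := by
  have h := exists_cross_eq hf hr hs
  rw [wedge, dif_pos h]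
  exact h.choose_spec

lemma smul_gradient_injective {f : S} (hf : IsPrimitiveVec (gradient f)) {a c : S}
    (h : a • gradient f = c • gradient f) : a = c := by
  obtain ⟨i, hi⟩ := hf.ne_zero
  exact mul_right_cancel₀ hi (congrFun h i)

/-- Cramer's rule for three syzygies. -/
lemma wedge_smul {f : S} (hf : IsPrimitiveVec (gradient f)) {r s t : Fin 3 → S}
    (hr : r ∈ AR f) (hs : s ∈ AR f) (ht : t ∈ AR f) :
    wedge f r s • t = wedge f t s • r + wedge f r t • s := by
  obtain ⟨k, hk⟩ := hf.ne_zero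
  have h1 := cross_eq_wedge hf hr hs
  have h2 := cross_eq_wedge hf ht hs
  have h3 := cross_eq_wedge hf hr ht
  have e1 := fun i => congrFun h1 i
  have e2 := fun i => congrFun h2 i
  have e3 := fun i => congrFun h3 i
  rw [mem_AR] at hr hs ht
  -- Three syzygies lie in the plane orthogonal to the nonzero gradient, so their determinant
  -- vanishes.
  have hdet : r 0 * (s 1 * t 2 - s 2 * t 1) - r 1 * (s 0 * t 2 - s 2 * t 0) +
      r 2 * (s 0 * t 1 - s 1 * t 0) = 0 := by
    refine (mul_eq_zero.1 (?_ : gradient f k * _ = 0)).resolve_left hk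
    fin_cases k <;> simp only [Fin.zero_eta, Fin.mk_one, Fin.reduceFinMk, Fin.isValue]
    · linear_combination (s 1 * t 2 - s 2 * t 1) * hr - (r 1 * t 2 - r 2 * t 1) * hs +
        (r 1 * s 2 - r 2 * s 1) * ht
    · linear_combination -(s 0 * t 2 - s 2 * t 0) * hr + (r 0 * t 2 - r 2 * t 0) * hs -
        (r 0 * s 2 - r 2 * s 0) * ht
    · linear_combination (s 0 * t 1 - s 1 * t 0) * hr - (r 0 * t 1 - r 1 * t 0) * hs +
        (r 0 * s 1 - r 1 * s 0) * ht
  ext1 j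
  refine mul_left_cancel₀ hk ?_
  have e1k := e1 k
  have e2k := e2 k
  have e3k := e3 k
  simp only [Pi.add_apply, Pi.smul_apply, smul_eq_mul] at *
  rw [cross_apply] at e1k e2k e3k
  -- The difference of the two sides is zero for `j ≠ k` and the determinant `hdet` for `j = k`.
  have : ((r ⨯₃ s) k) * t j = ((t ⨯₃ s) k) * r j + ((r ⨯₃ t) k) * s j := by
    simp only [cross_apply]
    fin_cases k <;> fin_cases j <;> simp <;> first
      | ring1
      | linear_combination hdet
  simp only [cross_apply] at this
  rw [e1k, e2k, e3k] at this
  linear_combination this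

/-- The cross product is bilinear and alternating, so a change of syzygies multiplies the wedge by
the determinant of the change. -/
lemma wedge_of_smul {f : S} (hf : IsPrimitiveVec (gradient f)) {r s r' s' : Fin 3 → S}
    (hr : r ∈ AR f) (hs : s ∈ AR f) (hr' : r' ∈ AR f) (hs' : s' ∈ AR f) {a a₁ a₂ a₃ a₄ : S}
    (h : a • r' = a₁ • r + a₂ • s) (h' : a • s' = a₃ • r + a₄ • s) :
    a * a * wedge f r' s' = (a₁ * a₄ - a₂ * a₃) * wedge f r s := by
  refine smul_gradient_injective hf ?_
  rw [mul_smul, mul_smul, ← cross_eq_wedge hf hr' hs', mul_smul, ← cross_eq_wedge hf hr hs,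
    ← map_smul, ← LinearMap.map_smul₂, h, h', cross_apply, cross_apply]
  ext1 i
  fin_cases i <;> simp <;> ring

/-- The ratio of the wedges before and after `φ` does not depend on the pair. By Cramer's rule
`wedge f r s` times any other syzygy is a combination of `r` and `s`; linearity of `φ` preserves
these relations, so one and the same determinant governs the change of both wedges. -/
lemma wedge_mul_wedge {f g : S} (hf : IsPrimitiveVec (gradient f))
    (hg : IsPrimitiveVec (gradient g)) (φ : AR f ≃ₗ[S] AR g) (r s r' s' : AR f)
    (h0 : wedge f r s ≠ 0) :
    wedge f r s * wedge g (φ r') (φ s') = wedge f r' s' * wedge g (φ r) (φ s) := by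
  have h1 := wedge_smul hf r.2 s.2 r'.2
  have h2 := wedge_smul hf r.2 s.2 s'.2
  have h3 := wedge_of_smul hf r.2 s.2 r'.2 s'.2 h1 h2
  have e : ∀ {a₁ a₂ a₃ : S} {t : AR f}, a₁ • (t : Fin 3 → S) = a₂ • (r : Fin 3 → S) +
      a₃ • (s : Fin 3 → S) → a₁ • (φ t : Fin 3 → S) = a₂ • (φ r : Fin 3 → S) +
      a₃ • (φ s : Fin 3 → S) := by
    intro a₁ a₂ a₃ t h
    have : a₁ • t = a₂ • r + a₃ • s := Subtype.ext h
    have h' := congrArg φ this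
    simp only [map_add, map_smul] at h'
    exact congrArg Subtype.val h'
  have h4 := wedge_of_smul hg (φ r).2 (φ s).2 (φ r').2 (φ s').2 (e h1) (e h2)
  refine mul_left_cancel₀ (mul_ne_zero h0 h0) ?_
  linear_combination wedge f r s * h4 - wedge g (φ r) (φ s) * h3

/-- The Koszul syzygies. -/
def koszul (f : S) : Fin 3 → Fin 3 → S :=
  ![![0, gradient f 2, -gradient f 1], ![-gradient f 2, 0, gradient f 0],
    ![gradient f 1, -gradient f 0, 0]]

lemma koszul_mem (f : S) (i : Fin 3) : koszul f i ∈ AR f := by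
  rw [mem_AR]
  fin_cases i <;> simp [koszul] <;> ring

/-- Wedges of Koszul syzygies are the partial derivatives. Hence the wedges of all pairs have no
common prime factor, which pins down the ratio in `wedge_mul_wedge`. -/
lemma exists_koszul_wedge {f : S} (hf : IsPrimitiveVec (gradient f)) (k : Fin 3) :
    ∃ r ∈ AR f, ∃ s ∈ AR f, wedge f r s = gradient f k := by
  have key : ∀ i j, koszul f i ⨯₃ koszul f j = gradient f k • gradient f →
      ∃ r ∈ AR f, ∃ s ∈ AR f, wedge f r s = gradient f k := fun i j h =>
    ⟨_, koszul_mem f i, _, koszul_mem f j, smul_gradient_injective hf (by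
      rw [← h, ← cross_eq_wedge hf (koszul_mem f i) (koszul_mem f j)])⟩
  fin_cases k
  · refine key 1 2 ?_
    rw [cross_apply]
    ext1 i
    fin_cases i <;> simp [koszul]
    ring
  · refine key 2 0 ?_
    rw [cross_apply]
    ext1 i
    fin_cases i <;> simp [koszul]
    ring
  · refine key 0 1 ?_
    rw [cross_apply]
    ext1 i
    fin_cases i <;> simp [koszul]
    ring

/-- An isomorphism of modules of Jacobian syzygies preserves the wedge up to a constant. -/
lemma exists_wedge_eq {f g : S} (hf : IsPrimitiveVec (gradient f))
    (hg : IsPrimitiveVec (gradient g)) (φ : AR f ≃ₗ[S] AR g) (r s : AR f)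
    (h0 : wedge f r s ≠ 0) :
    ∃ c, IsUnit c ∧ wedge g (φ r) (φ s) = wedge f r s * c := by
  -- Comparison with Koszul pairs of `f` shows that `wedge f r s` divides the new wedge times every
  -- partial derivative of `f`.
  obtain ⟨c, hc⟩ := hf.dvd (a := wedge f r s) (c := wedge g (φ r) (φ s)) fun k => by
    obtain ⟨r', hr', s', hs', h⟩ := exists_koszul_wedge hf k
    exact ⟨_, by rw [wedge_mul_wedge hf hg φ r s ⟨r', hr'⟩ ⟨s', hs'⟩ h0, h]⟩
  refine ⟨c, isUnit_iff_dvd_one.2 (hg.dvd fun k => ?_), hc⟩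
  -- Pulling Koszul pairs of `g` back along `φ` shows that `c` divides every partial derivative of
  -- `g`, hence is a unit.
  obtain ⟨r', hr', s', hs', h⟩ := exists_koszul_wedge hg k
  have h2 := wedge_mul_wedge hf hg φ r s (φ.symm ⟨r', hr'⟩) (φ.symm ⟨s', hs'⟩) h0
  rw [LinearEquiv.apply_symm_apply, LinearEquiv.apply_symm_apply, h, hc, mul_left_comm] at h2
  rw [mul_one]
  exact ⟨_, (mul_left_cancel₀ h0 h2).trans (mul_comm _ _)⟩

lemma isHomogeneous_of_mul {p q : S} {m n : ℕ} (hq : q.IsHomogeneous n) (hq0 : q ≠ 0)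
    (h : (p * q).IsHomogeneous (m + n)) : p.IsHomogeneous m := by
  have h1 : ∀ j, j ≠ m → homogeneousComponent j p = 0 := by
    intro j hj
    have h2 := homogeneousComponent_of_mem (m := j + n) h
    rw [if_neg (by omega), homogeneousComponent_mul_of_isHomogeneous hq, if_pos (by omega),
      Nat.add_sub_cancel] at h2
    exact (mul_eq_zero.1 h2).resolve_right hq0
  have h3 := sum_homogeneousComponent_of_lt p (N := p.totalDegree + m + 1) (by omega)
  rw [Finset.sum_eq_single m (fun j _ hj => h1 j hj)
    (fun hm => absurd (Finset.mem_range.2 (by omega)) hm)] at h3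
  rw [← h3]
  exact homogeneousComponent_isHomogeneous m p

lemma homogeneousComponent_mul_eq_zero {p q : S} {d n : ℕ}
    (hp : ∀ j < d, homogeneousComponent j p = 0) (hq : ∀ j < d, homogeneousComponent j q = 0)
    (hn : n < 2 * d) : homogeneousComponent n (p * q) = 0 := by
  conv_lhs => rw [← sum_homogeneousComponent p, Finset.sum_mul, map_sum]
  refine Finset.sum_eq_zero fun j _ => ?_
  rw [mul_comm, homogeneousComponent_mul_of_isHomogeneous (homogeneousComponent_isHomogeneous j p)]
  split_ifs with h
  · by_cases hj : j < d
    · rw [hp j hj, mul_zero]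
    · rw [hq _ (by omega), zero_mul]
  · rfl

/-- The partial derivatives of a form all have the same degree, so the homogeneous components of a
syzygy are again syzygies. This is needed because the images under an isomorphism are not assumed
homogeneous. -/
lemma homogeneousComponent_eq_zero_of_mem_AR {g : S} {D e : ℕ} (hg : g.IsHomogeneous (D + 1))
    (he : ∀ d ∈ syzygyDegrees g, e ≤ d) {r : Fin 3 → S} (hr : r ∈ AR g) (i : Fin 3) (j : ℕ)
    (hj : j < e) : homogeneousComponent j (r i) = 0 := by
  by_contra h0
  refine absurd (he j ⟨fun i => homogeneousComponent j (r i), ?_, ?_, fun i =>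
    homogeneousComponent_isHomogeneous _ _⟩) (not_le.2 hj)
  · have h1 := congrArg (homogeneousComponent (j + D)) (show ∑ i, r i * pderiv i g = 0 from hr)
    rw [map_sum, map_zero] at h1
    change ∑ i, homogeneousComponent j (r i) * pderiv i g = 0
    rw [← h1]
    refine Finset.sum_congr rfl fun i _ => ?_
    rw [homogeneousComponent_mul_of_isHomogeneous (k := D) hg.pderiv, if_pos (by omega),
      Nat.add_sub_cancel]
  · exact fun h => h0 (congrFun h i)

/-- If `f` has independent Jacobian syzygies of degrees `d₁`, `d₂` and `g` has none of degree below
`e`, where `d₁ + d₂ < 2 * e`, then the modules of Jacobian syzygies are not isomorphic. -/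
theorem isEmpty_AR_equiv {f g : S} {D d₁ d₂ m e : ℕ} (hf : f.IsHomogeneous (D + 1))
    (hg : g.IsHomogeneous (D + 1)) (hfs : Squarefree f) (hgs : Squarefree g)
    {r s : Fin 3 → S} (hr : r ∈ AR f) (hs : s ∈ AR f) (hrd : ∀ i, (r i).IsHomogeneous d₁)
    (hsd : ∀ i, (s i).IsHomogeneous d₂) (hrs : r ⨯₃ s ≠ 0) (hm : d₁ + d₂ = m + D)
    (he : ∀ d ∈ syzygyDegrees g, e ≤ d) (hlt : d₁ + d₂ < 2 * e) :
    IsEmpty (AR f ≃ₗ[S] AR g) := by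
  refine ⟨fun φ => ?_⟩
  have pf : IsPrimitiveVec (gradient f) := fun p hp =>
    exists_not_dvd_pderiv (Nat.succ_ne_zero D) hf hfs hp
  have pg : IsPrimitiveVec (gradient g) := fun p hp =>
    exists_not_dvd_pderiv (Nat.succ_ne_zero D) hg hgs hp
  have hcross := cross_eq_wedge pf hr hs
  have h0 : wedge f r s ≠ 0 := by
    intro h
    rw [h, zero_smul] at hcross
    exact hrs hcross
  -- The wedge is the quotient of a form of degree `d₁ + d₂` by a form of degree `D`.
  have hhom : (wedge f r s).IsHomogeneous m := by
    obtain ⟨i, hi⟩ := pf.ne_zero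
    refine isHomogeneous_of_mul (n := D) (q := gradient f i) hf.pderiv hi ?_
    rw [← smul_eq_mul, ← Pi.smul_apply, ← hcross, ← hm]
    rw [cross_apply]
    fin_cases i
    · exact ((hrd 1).mul (hsd 2)).sub ((hrd 2).mul (hsd 1))
    · exact ((hrd 2).mul (hsd 0)).sub ((hrd 0).mul (hsd 2))
    · exact ((hrd 0).mul (hsd 1)).sub ((hrd 1).mul (hsd 0))
  obtain ⟨c, hcu, hc⟩ := exists_wedge_eq pf pg φ ⟨r, hr⟩ ⟨s, hs⟩ h0
  obtain ⟨j, hj⟩ := pg.ne_zero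
  have h1 := congrFun (cross_eq_wedge pg (φ ⟨r, hr⟩).2 (φ ⟨s, hs⟩).2) j
  rw [hc, Pi.smul_apply, smul_eq_mul] at h1
  have hv := fun t : AR g => homogeneousComponent_eq_zero_of_mem_AR hg he t.2
  -- The coordinates of both images start in degree `e`, so their products have no component in
  -- degree `m + D = d₁ + d₂ < 2 * e`.
  have h2 : homogeneousComponent (m + D)
      (((φ ⟨r, hr⟩ : Fin 3 → S) ⨯₃ (φ ⟨s, hs⟩ : Fin 3 → S)) j) = 0 := by
    have h3 : ∀ i k, homogeneousComponent (m + D)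
        ((φ ⟨r, hr⟩ : Fin 3 → S) i * (φ ⟨s, hs⟩ : Fin 3 → S) k) = 0 := fun i k =>
      homogeneousComponent_mul_eq_zero (hv _ i) (hv _ k) (by omega)
    rw [cross_apply]
    fin_cases j <;> simp [h3]
  -- The unit is a constant, so the same coordinate equals a nonzero form of degree exactly `m + D`.
  obtain ⟨u, hu, rfl⟩ := (MvPolynomial.isUnit_iff_eq_C_of_isReduced).1 hcu
  have h4 : (wedge f r s * C u * gradient g j).IsHomogeneous (m + D) := by
    have := hhom.mul (isHomogeneous_C (Fin 3) u)
    rw [add_zero] at this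
    exact this.mul hg.pderiv
  rw [h1, homogeneousComponent_eq_self h4] at h2
  exact mul_ne_zero (mul_ne_zero h0 hcu.ne_zero) hj h2

/-! ### Smooth lines and conics -/

/-- `F` is an irreducible form of degree `d` that defines a smooth curve. -/
structure IsSmoothForm (F : S) (d : ℕ) : Prop where
  irreducible : Irreducible F
  isHomogeneous : F.IsHomogeneous d
  smooth : ∀ w ≠ 0, grad F w ≠ 0

lemma isUnit_of_totalDegree_eq_zero {p : S} (h : p.totalDegree = 0) (hp : p ≠ 0) : IsUnit p := by
  rw [totalDegree_eq_zero_iff_eq_C] at h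
  rw [h] at hp ⊢
  exact (isUnit_iff_ne_zero.2 fun h0 => hp (by rw [h0, C_0])).map C

lemma totalDegree_of_isUnit {p : S} (h : IsUnit p) : p.totalDegree = 0 := by
  obtain ⟨u, -, rfl⟩ := (MvPolynomial.isUnit_iff_eq_C_of_isReduced).1 h
  exact totalDegree_C u

/-- Irreducibility is a degree count. The gradient is constant, and by Euler's formula a form of
degree one with zero gradient vanishes. -/
lemma isSmoothForm_of_linear {F : S} (hF : F.IsHomogeneous 1) (h0 : F ≠ 0) : IsSmoothForm F 1 := by
  refine ⟨⟨fun h => ?_, fun p q hpq => ?_⟩, hF, fun w _ hw => ?_⟩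
  · have := totalDegree_of_isUnit h
    rw [hF.totalDegree h0] at this
    omega
  · have hp : p ≠ 0 := by rintro rfl; simp [hpq] at h0
    have hq : q ≠ 0 := by rintro rfl; simp [hpq] at h0
    have h := totalDegree_mul_of_isDomain hp hq
    rw [← hpq, hF.totalDegree h0] at h
    rcases Nat.eq_zero_or_pos p.totalDegree with h1 | h1
    · exact Or.inl (isUnit_of_totalDegree_eq_zero h1 hp)
    · exact Or.inr (isUnit_of_totalDegree_eq_zero (by omega) hq)
  · have h1 := hF.sum_X_mul_pderiv
    refine h0 ?_
    rw [one_smul] at h1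
    rw [← h1]
    refine Finset.sum_eq_zero fun i _ => ?_
    have h2 : (pderiv i F).IsHomogeneous 0 := hF.pderiv
    rw [← totalDegree_zero_iff_isHomogeneous, totalDegree_eq_zero_iff_eq_C] at h2
    have h3 : eval w (pderiv i F) = 0 := congrFun hw i
    rw [h2, eval_C] at h3
    rw [h2, h3, C_0, mul_zero]

/-- The matrix of second derivatives at the origin. -/
def hessian (F : S) : Matrix (Fin 3) (Fin 3) ℂ :=
  Matrix.of fun i j => constantCoeff (pderiv j (pderiv i F))

lemma eq_zero_of_totalDegree_le_one {q : S} (hq : q.totalDegree ≤ 1) (h0 : constantCoeff q = 0)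
    (h1 : ∀ i, constantCoeff (pderiv i q) = 0) : q = 0 := by
  ext m
  rw [coeff_zero]
  by_cases hm : m = 0
  · rw [hm]
    exact h0
  · obtain ⟨i, hi⟩ : ∃ i, m i ≠ 0 := by
      by_contra! h
      exact hm (Finsupp.ext h)
    by_contra hne
    have h2 := (le_totalDegree (mem_support_iff.2 hne)).trans hq
    have h3 : m = Finsupp.single i 1 := by
      have h4 : Finsupp.single i 1 ≤ m := Finsupp.single_le_iff.2 (Nat.one_le_iff_ne_zero.2 hi)
      obtain ⟨m', rfl⟩ := exists_add_of_le h4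
      rw [Finsupp.sum_add_index' (fun _ => rfl) (fun _ _ _ => rfl),
        Finsupp.sum_single_index rfl] at h2
      have h5 : m'.sum (fun _ e => e) = 0 := by omega
      have h6 : m' = 0 := by
        ext j
        by_contra hj
        exact hj ((Finset.sum_eq_zero_iff.1 h5) j (Finsupp.mem_support_iff.2 hj))
      rw [h6, add_zero]
    have h4 := h1 i
    rw [constantCoeff_eq, coeff_pderiv, zero_add] at h4
    rw [h3] at hne
    simp at h4
    exact hne h4

/-- If the form were a product of two linear forms, its Hessian would be a sum of two matrices of
rank one, hence singular. Smoothness holds because the gradient at `w` is the Hessian applied to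
`w`. -/
lemma isSmoothForm_of_quadratic {F : S} (hF : F.IsHomogeneous 2) (hdet : (hessian F).det ≠ 0) :
    IsSmoothForm F 2 := by
  have h0 : F ≠ 0 := by
    rintro rfl
    refine hdet ?_
    have : hessian 0 = 0 := by
      ext i j
      simp [hessian]
    rw [this]
    exact det_zero
  refine ⟨⟨fun h => ?_, fun p q hpq => ?_⟩, hF, fun w hw0 hw => ?_⟩
  · have := totalDegree_of_isUnit h
    rw [hF.totalDegree h0] at this
    omega
  · by_contra! hcon
    have hp : p ≠ 0 := by rintro rfl; simp [hpq] at h0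
    have hq : q ≠ 0 := by rintro rfl; simp [hpq] at h0
    have hp1 : p.totalDegree ≠ 0 := fun h => hcon.1 (isUnit_of_totalDegree_eq_zero h hp)
    have hq1 : q.totalDegree ≠ 0 := fun h => hcon.2 (isUnit_of_totalDegree_eq_zero h hq)
    have h := totalDegree_mul_of_isDomain hp hq
    rw [← hpq, hF.totalDegree h0] at h
    have hc := constantCoeff_eq_zero_of_isHomogeneous hF two_ne_zero
    have hg : ∀ i, constantCoeff (pderiv i F) = 0 := fun i =>
      constantCoeff_eq_zero_of_isHomogeneous (d := 1) hF.pderiv one_ne_zero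
    simp only [hpq, map_mul, pderiv_mul, map_add] at hc hg
    -- The factors are not known to be homogeneous. A nonzero constant term of `p` would force the
    -- constant and linear terms of `q` to vanish, since `F` has no terms of degree zero or one.
    have hp0 : constantCoeff p = 0 := by
      by_contra hne
      have hq0 := (mul_eq_zero.1 hc).resolve_left hne
      refine hq (eq_zero_of_totalDegree_le_one (by omega) hq0 fun i => ?_)
      have := hg i
      rw [hq0, mul_zero, zero_add] at this
      exact (mul_eq_zero.1 this).resolve_left hne
    have hq0 : constantCoeff q = 0 := by
      by_contra hne
      refine hp (eq_zero_of_totalDegree_le_one (by omega) hp0 fun i => ?_)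
      have := hg i
      rw [hp0, zero_mul, add_zero] at this
      exact (mul_eq_zero.1 this).resolve_right hne
    refine hdet ?_
    rw [det_fin_three]
    simp only [hessian, hpq, pderiv_mul, map_add, map_mul, hp0, hq0, Matrix.of_apply]
    ring
  · refine hw0 (eq_zero_of_mulVec_eq_zero hdet ?_)
    ext1 i
    have h1 : (pderiv i F).IsHomogeneous 1 := hF.pderiv
    have h2 := congrArg (eval w) h1.sum_X_mul_pderiv
    have h3 : eval w (pderiv i F) = 0 := congrFun hw i
    rw [one_smul, h3, map_sum] at h2
    rw [Pi.zero_apply, ← h2, mulVec, dotProduct]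
    refine Finset.sum_congr rfl fun j _ => ?_
    have h4 : (pderiv j (pderiv i F)).IsHomogeneous 0 := h1.pderiv
    rw [← totalDegree_zero_iff_isHomogeneous, totalDegree_eq_zero_iff_eq_C] at h4
    rw [map_mul, eval_X, hessian, Matrix.of_apply, h4, eval_C, constantCoeff_C, mul_comm]

/-- The linear form with given coefficients. -/
def linearForm (a₀ a₁ a₂ : ℂ) : S := C a₀ * X 0 + C a₁ * X 1 + C a₂ * X 2

/-- The ternary quadratic form with given coefficients. -/
def quadraticForm (a₀ a₁ a₂ a₃ a₄ a₅ : ℂ) : S :=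
  C a₀ * X 0 ^ 2 + C a₁ * X 1 ^ 2 + C a₂ * X 2 ^ 2 + C a₃ * (X 1 * X 2) + C a₄ * (X 0 * X 2) +
    C a₅ * (X 0 * X 1)

lemma isSmoothForm_linearForm {a₀ a₁ a₂ : ℂ} (i : Fin 3) (h : ![a₀, a₁, a₂] i ≠ 0) :
    IsSmoothForm (linearForm a₀ a₁ a₂) 1 := by
  refine isSmoothForm_of_linear ?_ fun h0 => h ?_
  · exact ((isHomogeneous_C_mul_X _ _).add (isHomogeneous_C_mul_X _ _)).add
      (isHomogeneous_C_mul_X _ _)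
  · have := congrArg (eval (Pi.single i 1)) h0
    fin_cases i <;> simpa [linearForm] using this

/-- The expression in `h` is half the determinant of the Hessian. -/
lemma isSmoothForm_quadraticForm {a₀ a₁ a₂ a₃ a₄ a₅ : ℂ}
    (h : 4 * a₀ * a₁ * a₂ + a₃ * a₄ * a₅ - a₀ * a₃ ^ 2 - a₁ * a₄ ^ 2 - a₂ * a₅ ^ 2 ≠ 0) :
    IsSmoothForm (quadraticForm a₀ a₁ a₂ a₃ a₄ a₅) 2 := by
  refine isSmoothForm_of_quadratic ?_ fun h0 => h ?_
  · have h2 : ∀ i j : Fin 3, (X i * X j : S).IsHomogeneous 2 := fun i j =>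
      (isHomogeneous_X _ i).mul (isHomogeneous_X _ j)
    exact ((((((isHomogeneous_X_pow _ _).C_mul _).add ((isHomogeneous_X_pow _ _).C_mul _)).add
      ((isHomogeneous_X_pow _ _).C_mul _)).add ((h2 _ _).C_mul _)).add ((h2 _ _).C_mul _)).add
      ((h2 _ _).C_mul _)
  · rw [det_fin_three] at h0
    have h2 : constantCoeff (2 : S) = 2 := map_ofNat _ 2
    simp [hessian, quadraticForm, pderiv_X, Pi.single_apply, h2] at h0
    linear_combination h0 / 2

/-! ### Combinatorics of arrangements -/

/-- The curve `∏ F i = 0` has smooth components `F i` of degrees `d i`, which meet exactly in the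
points `p m`, where they have the local forms `τ m`. -/
structure IsArrangement {n m : ℕ} (F : Fin n → S) (d : Fin n → ℕ) (τ : Fin m → Fin n → Branch)
    (p : Fin m → Fin 3 → ℂ) : Prop where
  smooth : ∀ i, IsSmoothForm (F i) (d i)
  localForm : ∀ a, HasLocalForm F (τ a) (p a)
  cover : ∀ i j, i < j → ∀ w ≠ 0, eval w (F i) = 0 → eval w (F j) = 0 → ∃ a, ∃ c : ℂ, w = c • p a
  injective : ∀ a a', a < a' → (∀ i, τ a i = .away ↔ τ a' i = .away) → ∀ c : ℂ, p a ≠ c • p a'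

/-- At every point of the configuration two components meet, and any two components are separated
by a point of the configuration. -/
def IsSeparating {n m : ℕ} (τ : Fin m → Fin n → Branch) : Prop :=
  (∀ a, ∃ i j, i ≠ j ∧ τ a i ≠ .away ∧ τ a j ≠ .away) ∧
    ∀ i j, i ≠ j → ∃ a, τ a i ≠ .away ∧ τ a j = .away

lemma HasLocalForm.eval_eq_zero_iff {n : ℕ} {F : Fin n → S} {τ : Fin n → Branch}
    {v : Fin 3 → ℂ} (h : HasLocalForm F τ v) (i : Fin n) : eval v (F i) = 0 ↔ τ i ≠ .away := by
  obtain ⟨k, U, V, -, hU, hV, -, hc⟩ := h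
  obtain ⟨c, c', hc0, hc0', hF⟩ := hc i
  have := congrArg (eval v) hF
  rw [map_mul, map_mul, eval_branch_poly, hU, hV] at this
  rw [← mul_eq_zero_iff_left hc0, this, mul_eq_zero_iff_left hc0']
  cases τ i <;> simp [Branch.poly]

namespace IsArrangement

variable {n m : ℕ} {F : Fin n → S} {d : Fin n → ℕ} {τ : Fin m → Fin n → Branch}
  {p : Fin m → Fin 3 → ℂ}

lemma not_dvd (h : IsArrangement F d τ p) (hτ : IsSeparating τ) {i j : Fin n}
    (hij : i ≠ j) : ¬ F i ∣ F j := by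
  rintro ⟨q, hq⟩
  obtain ⟨a, h1, h2⟩ := hτ.2 i j hij
  have h3 := ((h.localForm a).eval_eq_zero_iff i).2 h1
  have h4 := (h.localForm a).eval_eq_zero_iff j
  rw [hq, map_mul, h3, zero_mul] at h4
  exact h4.1 rfl h2

lemma zeroLocus_injective (h : IsArrangement F d τ p) (hτ : IsSeparating τ) :
    Function.Injective fun i => zeroLocus (F i) := by
  intro i j hij
  by_contra hne
  obtain ⟨a, h1, h2⟩ := hτ.2 i j hne
  have h0 := (h.localForm a).ne_zero
  have h3 := (mk_mem_zeroLocus (h.smooth i).isHomogeneous (p a) h0).2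
    (((h.localForm a).eval_eq_zero_iff i).2 h1)
  have hij' : zeroLocus (F i) = zeroLocus (F j) := hij
  rw [hij', mk_mem_zeroLocus (h.smooth j).isHomogeneous,
    (h.localForm a).eval_eq_zero_iff j] at h3
  exact h3 h2

lemma squarefree (h : IsArrangement F d τ p) (hτ : IsSeparating τ) : Squarefree (∏ i, F i) := by
  have key : ∀ s : Finset (Fin n), Squarefree (∏ i ∈ s, F i) := by
    intro s
    induction s using Finset.induction_on with
    | empty => simp
    | insert i s hi ih =>
      rw [Finset.prod_insert hi]
      refine squarefree_mul_iff.2 ⟨?_, (h.smooth i).irreducible.squarefree, ih⟩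
      refine (h.smooth i).irreducible.isRelPrime_iff_not_dvd.2 fun hdvd => ?_
      obtain ⟨j, hj, hij⟩ := (h.smooth i).irreducible.prime.exists_mem_finset_dvd hdvd
      exact h.not_dvd hτ (by rintro rfl; exact hi hj) hij
  exact key _

lemma isHomogeneous (h : IsArrangement F d τ p) : (∏ i, F i).IsHomogeneous (∑ i, d i) :=
  IsHomogeneous.prod _ _ _ fun i _ => (h.smooth i).isHomogeneous

lemma isReducedCurve (h : IsArrangement F d τ p) (hτ : IsSeparating τ) (hd : 0 < ∑ i, d i) :
    IsReducedCurve (∏ i, F i) :=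
  ⟨h.squarefree hτ, _, hd, h.isHomogeneous⟩

/-- An irreducible divisor of the product is associated to one of the irreducible factors, so it has
the same zero set and the same degree. -/
lemma isComponentOfDegree_iff (h : IsArrangement F d τ p) (Z : Set P2) (e : ℕ) :
    IsComponentOfDegree (∏ i, F i) Z e ↔ ∃ i, Z = zeroLocus (F i) ∧ e = d i := by
  constructor
  · rintro ⟨g, hg, hdvd, hhom, rfl⟩
    obtain ⟨i, -, hi⟩ := hg.prime.exists_mem_finset_dvd hdvd
    obtain ⟨u, hu⟩ := (hg.associated_of_dvd (h.smooth i).irreducible hi)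
    obtain ⟨c, hc, hcu⟩ := (MvPolynomial.isUnit_iff_eq_C_of_isReduced).1 u.isUnit
    rw [hcu] at hu
    refine ⟨i, ?_, ?_⟩
    · ext P
      simp [zeroLocus, ← hu, hc.ne_zero]
    · have h1 := hhom.mul (isHomogeneous_C (Fin 3) c)
      rw [hu, add_zero] at h1
      exact h1.inj_right (h.smooth i).isHomogeneous (h.smooth i).irreducible.ne_zero
  · rintro ⟨i, rfl, rfl⟩
    exact ⟨F i, (h.smooth i).irreducible, Finset.dvd_prod_of_mem _ (Finset.mem_univ i),
      (h.smooth i).isHomogeneous, rfl⟩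

/-- The components of an arrangement. -/
def componentsEquiv (h : IsArrangement F d τ p) (hτ : IsSeparating τ) :
    Fin n ≃ components (∏ i, F i) :=
  Equiv.ofBijective (fun i => ⟨zeroLocus (F i), d i, (h.isComponentOfDegree_iff _ _).2 ⟨i, rfl, rfl⟩⟩)
    ⟨fun _ _ hij => h.zeroLocus_injective hτ (congrArg Subtype.val hij), by
      rintro ⟨Z, e, hZ⟩
      obtain ⟨i, rfl, -⟩ := (h.isComponentOfDegree_iff _ _).1 hZ
      exact ⟨i, rfl⟩⟩

lemma toPoint_mem_zeroLocus (h : IsArrangement F d τ p) (a : Fin m) (i : Fin n) :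
    toPoint (p a) ∈ zeroLocus (F i) ↔ τ a i ≠ .away := by
  rw [toPoint_of_ne (h.localForm a).ne_zero, mk_mem_zeroLocus (h.smooth i).isHomogeneous,
    (h.localForm a).eval_eq_zero_iff]

/-- At a point of `F i` only the term of the product rule that differentiates `F i` survives. -/
lemma eval_pderiv_prod (i : Fin n) (k : Fin 3) (w : Fin 3 → ℂ) (hi : eval w (F i) = 0) :
    eval w (pderiv k (∏ i, F i)) =
      eval w (pderiv k (F i)) * ∏ j ∈ Finset.univ.erase i, eval w (F j) := by
  rw [← Finset.mul_prod_erase _ _ (Finset.mem_univ i), pderiv_mul, map_add, map_mul, map_mul, hi,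
    zero_mul, add_zero, map_prod]

/-- At a point on a single component the gradient of the product is a nonzero multiple of the
gradient of that smooth component. Hence a singular point lies on two components, and `cover` lists
all such points. -/
lemma mem_singularPoints_iff (h : IsArrangement F d τ p) (hτ : IsSeparating τ) (P : P2) :
    P ∈ singularPoints (∏ i, F i) ↔ ∃ a, P = toPoint (p a) := by
  constructor
  · rintro ⟨hP, hP2⟩
    have h0 : eval P.rep (∏ i, F i) = 0 := hP
    rw [map_prod, Finset.prod_eq_zero_iff] at h0
    obtain ⟨i, -, hi⟩ := h0
    have key : ∃ j ∈ Finset.univ.erase i, eval P.rep (F j) = 0 := by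
      rw [← Finset.prod_eq_zero_iff]
      by_contra hne
      refine (h.smooth i).smooth P.rep P.rep_nonzero (funext fun k => ?_)
      have h1 : eval P.rep (pderiv k (∏ i, F i)) = 0 := hP2 k
      rw [eval_pderiv_prod i k _ hi] at h1
      exact (mul_eq_zero.1 h1).resolve_right hne
    obtain ⟨j, hj, hj0⟩ := key
    have hji := Finset.ne_of_mem_erase hj
    obtain ⟨a, c, hc⟩ : ∃ a, ∃ c : ℂ, P.rep = c • p a := by
      rcases lt_or_gt_of_ne hji with hlt | hlt
      · exact h.cover _ _ hlt _ P.rep_nonzero hj0 hi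
      · exact h.cover _ _ hlt _ P.rep_nonzero hi hj0
    refine ⟨a, ?_⟩
    rw [toPoint_of_ne (h.localForm a).ne_zero, ← P.mk_rep]
    exact (Projectivization.mk_eq_mk_iff' ℂ _ _ _ _).2 ⟨c, hc.symm⟩
  · rintro ⟨a, rfl⟩
    obtain ⟨i, j, hij, hi, hj⟩ := hτ.1 a
    have hi' : eval (toPoint (p a)).rep (F i) = 0 := (h.toPoint_mem_zeroLocus a i).2 hi
    have hj' : eval (toPoint (p a)).rep (F j) = 0 := (h.toPoint_mem_zeroLocus a j).2 hj
    refine ⟨?_, fun k => ?_⟩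
    · change eval _ _ = 0
      rw [map_prod]
      exact Finset.prod_eq_zero (Finset.mem_univ i) hi'
    · change eval _ _ = 0
      rw [eval_pderiv_prod i k _ hi', Finset.prod_eq_zero
        (Finset.mem_erase.2 ⟨hij.symm, Finset.mem_univ j⟩) hj', mul_zero]

/-- Points lying on different sets of components differ automatically, so `IsArrangement.injective`
demands a computation only for points with the same incident components. -/
lemma toPoint_injective (h : IsArrangement F d τ p) :
    Function.Injective fun a => toPoint (p a) := by
  have key : ∀ a a', a < a' → toPoint (p a) ≠ toPoint (p a') := by
    intro a a' hlt heq
    have hinc : ∀ i, τ a i = .away ↔ τ a' i = .away := fun i => by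
      rw [← not_iff_not]
      change τ a i ≠ .away ↔ τ a' i ≠ .away
      rw [← h.toPoint_mem_zeroLocus, ← h.toPoint_mem_zeroLocus, heq]
    rw [toPoint_of_ne (h.localForm a).ne_zero, toPoint_of_ne (h.localForm a').ne_zero,
      Projectivization.mk_eq_mk_iff'] at heq
    obtain ⟨c, hc⟩ := heq
    exact h.injective a a' hlt hinc c hc.symm
  intro a a' heq
  rcases lt_trichotomy a a' with hlt | rfl | hlt
  · exact absurd heq (key _ _ hlt)
  · rfl
  · exact absurd heq.symm (key _ _ hlt)

/-- The singular points of an arrangement. -/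
def singularPointsEquiv (h : IsArrangement F d τ p) (hτ : IsSeparating τ) :
    Fin m ≃ singularPoints (∏ i, F i) :=
  Equiv.ofBijective (fun a => ⟨toPoint (p a), (h.mem_singularPoints_iff hτ _).2 ⟨a, rfl⟩⟩)
    ⟨fun _ _ hab => h.toPoint_injective (congrArg Subtype.val hab), by
      rintro ⟨P, hP⟩
      obtain ⟨a, rfl⟩ := (h.mem_singularPoints_iff hτ _).1 hP
      exact ⟨a, rfl⟩⟩

/-- Arrangements with components of the same degrees and points of the same local forms have the
same combinatorics. -/
theorem sameCombinatorics {G : Fin n → S} {q : Fin m → Fin 3 → ℂ} (hτ : IsSeparating τ)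
    (h : IsArrangement F d τ p) (h' : IsArrangement G d τ q) :
    SameCombinatorics (∏ i, F i) (∏ i, G i) := by
  refine ⟨(h.componentsEquiv hτ).symm.trans (h'.componentsEquiv hτ),
    (h.singularPointsEquiv hτ).symm.trans (h'.singularPointsEquiv hτ), ?_, ?_⟩
  · intro Z e
    obtain ⟨i, rfl⟩ := (h.componentsEquiv hτ).surjective Z
    rw [Equiv.trans_apply, Equiv.symm_apply_apply, h.isComponentOfDegree_iff,
      h'.isComponentOfDegree_iff]
    change (∃ j, zeroLocus (F i) = zeroLocus (F j) ∧ e = d j) ↔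
      ∃ j, zeroLocus (G i) = zeroLocus (G j) ∧ e = d j
    simp only [(h.zeroLocus_injective hτ).eq_iff (a := i), (h'.zeroLocus_injective hτ).eq_iff
      (a := i)]
  · intro P
    obtain ⟨a, rfl⟩ := (h.singularPointsEquiv hτ).surjective P
    obtain ⟨e, h1, h2, h3⟩ := (h.localForm a).exists_homeomorph
      (fun i => (h.smooth i).isHomogeneous) (fun i => (h'.smooth i).isHomogeneous) (h'.localForm a)
    refine ⟨e, h1, ?_, fun Z => ?_⟩
    · rw [Equiv.trans_apply, Equiv.symm_apply_apply]
      exact h2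
    · obtain ⟨i, rfl⟩ := (h.componentsEquiv hτ).surjective Z
      rw [Equiv.trans_apply, Equiv.symm_apply_apply]
      exact h3 i

end IsArrangement

/-! ### Vanishing of syzygies in a given degree -/

section Forms

variable {R R' : Type*} [CommSemiring R] [CommSemiring R']

/-- The value of a quadratic plus a linear form with given coefficients. -/
def formVal (c : Fin 9 → R) (v : Fin 3 → R) : R :=
  c 0 * (v 0 * v 0) + c 1 * (v 1 * v 1) + c 2 * (v 2 * v 2) + c 3 * (v 1 * v 2) +
    c 4 * (v 0 * v 2) + c 5 * (v 0 * v 1) + c 6 * v 0 + c 7 * v 1 + c 8 * v 2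

/-- The gradient of a quadratic plus a linear form with given coefficients. -/
def formGrad (c : Fin 9 → R) (v : Fin 3 → R) : Fin 3 → R :=
  ![c 0 * (v 0 + v 0) + c 4 * v 2 + c 5 * v 1 + c 6,
    c 1 * (v 1 + v 1) + c 3 * v 2 + c 5 * v 0 + c 7,
    c 2 * (v 2 + v 2) + c 3 * v 1 + c 4 * v 0 + c 8]

/-- The value of a product of forms. -/
def prodVal (v : Fin 3 → R) : List (Fin 9 → R) → R
  | [] => 1
  | c :: cs => formVal c v * prodVal v cs

/-- The gradient of a product of forms. -/
def prodGrad (v : Fin 3 → R) (i : Fin 3) : List (Fin 9 → R) → R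
  | [] => 0
  | c :: cs => formGrad c v i * prodVal v cs + formVal c v * prodGrad v i cs

/-- Nine coefficients treat conics and lines uniformly. The formulas need no subtraction, so they
make sense over semirings: the certificate is evaluated in `ℕ` and compared along ring maps with
values in `ZMod 17` and `ℂ`. -/
lemma map_formVal (h : R →+* R') (c : Fin 9 → R) (v : Fin 3 → R) :
    h (formVal c v) = formVal (h ∘ c) (h ∘ v) := by
  simp [formVal]

lemma map_formGrad (h : R →+* R') (c : Fin 9 → R) (v : Fin 3 → R) (i : Fin 3) :
    h (formGrad c v i) = formGrad (h ∘ c) (h ∘ v) i := by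
  fin_cases i <;> simp [formGrad]

lemma map_prodVal (h : R →+* R') (v : Fin 3 → R) (cs : List (Fin 9 → R)) :
    h (prodVal v cs) = prodVal (h ∘ v) (cs.map (h ∘ ·)) := by
  induction cs with
  | nil => simp [prodVal]
  | cons c cs ih => simp [prodVal, map_formVal, ih]

lemma map_prodGrad (h : R →+* R') (v : Fin 3 → R) (i : Fin 3) (cs : List (Fin 9 → R)) :
    h (prodGrad v i cs) = prodGrad (h ∘ v) i (cs.map (h ∘ ·)) := by
  induction cs with
  | nil => simp [prodGrad]
  | cons c cs ih => simp [prodGrad, map_formVal, map_formGrad, map_prodVal, ih]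

/-- The product of forms as a polynomial. -/
def prodForm (cs : List (Fin 9 → R)) : MvPolynomial (Fin 3) R :=
  (cs.map fun c => formVal (C ∘ c) X).prod

lemma eval_formVal (c : Fin 9 → R) (v : Fin 3 → R) :
    eval v (formVal (C ∘ c) X) = formVal c v := by
  simp [formVal]

lemma eval_prodForm (v : Fin 3 → R) (cs : List (Fin 9 → R)) :
    eval v (prodForm cs) = prodVal v cs := by
  induction cs with
  | nil => simp [prodForm, prodVal]
  | cons c cs ih =>
    rw [prodForm, List.map_cons, List.prod_cons, map_mul, eval_formVal]
    rw [prodForm] at ih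
    rw [ih, prodVal]

lemma eval_pderiv_formVal (c : Fin 9 → R) (v : Fin 3 → R) (i : Fin 3) :
    eval v (pderiv i (formVal (C ∘ c) X)) = formGrad c v i := by
  fin_cases i <;> simp [formVal, formGrad, pderiv_X]

lemma eval_pderiv_prodForm (v : Fin 3 → R) (i : Fin 3) (cs : List (Fin 9 → R)) :
    eval v (pderiv i (prodForm cs)) = prodGrad v i cs := by
  induction cs with
  | nil => simp [prodForm, prodGrad]
  | cons c cs ih =>
    have h := eval_prodForm v cs
    rw [prodForm] at h ih
    rw [prodForm, List.map_cons, List.prod_cons, pderiv_mul, map_add, map_mul, map_mul,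
      eval_formVal, eval_pderiv_formVal, ih, h, prodGrad]

lemma map_prodForm (h : R →+* R') (cs : List (Fin 9 → R)) :
    map h (prodForm cs) = prodForm (cs.map (h ∘ ·)) := by
  simp only [prodForm, map_list_prod, List.map_map]
  congr 1
  refine List.map_congr_left fun c _ => ?_
  simp [formVal]

end Forms

/-- The embedding of `ℤ[√2]` into the complex numbers. -/
def zsqrtdToComplex : ℤ√2 →+* ℂ :=
  Zsqrtd.lift ⟨b, by
    rw [b, ← Complex.ofReal_mul, Real.mul_self_sqrt (by norm_num)]
    norm_num⟩

/-- This comes down to 2 not being the square of an integer. -/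
lemma zsqrtdToComplex_injective : Function.Injective zsqrtdToComplex := by
  refine Zsqrtd.lift_injective _ fun n hn => ?_
  have h1 : n ≤ 1 := by nlinarith
  have h2 : -1 ≤ n := by nlinarith
  interval_cases n <;> omega

lemma zsqrtdToComplex_apply (a : ℤ√2) : zsqrtdToComplex a = a.re + a.im * b := rfl

/-- The reduction of `ℤ[√2]` modulo a prime above `17`. -/
def zsqrtdToZMod : ℤ√2 →+* ZMod 17 := Zsqrtd.lift ⟨6, by decide⟩

lemma zsqrtdToZMod_apply (a : ℤ√2) : zsqrtdToZMod a = a.re + a.im * 6 := rfl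

/-- The weighted sum of the values of a monomial at given points. -/
def dotMonomial (e : ℕ × ℕ × ℕ) : List ℕ → List ℕ → List (ℕ × ℕ × ℕ) → ℕ
  | a :: as, g :: gs, v :: vs =>
    a * g * (v.1 ^ e.1 * v.2.1 ^ e.2.1 * v.2.2 ^ e.2.2) + dotMonomial e as gs vs
  | _, _, _ => 0

/-- The coordinates of a point, or the exponents of a monomial, as a function. -/
def tripleFun (v : ℕ × ℕ × ℕ) : Fin 3 → ℕ := ![v.1, v.2.1, v.2.2]

lemma dotMonomial_eq_sum (e : ℕ × ℕ × ℕ) (as gs : List ℕ) (vs : List (ℕ × ℕ × ℕ)) :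
    ∀ N, vs.length = N → dotMonomial e as gs vs = ∑ a ∈ Finset.range N,
      as.getD a 0 * gs.getD a 0 * ∏ i, tripleFun (vs.getD a 0) i ^ tripleFun e i := by
  induction vs generalizing as gs with
  | nil =>
    rintro N rfl
    cases as <;> cases gs <;> rfl
  | cons v vs ih =>
    rintro N rfl
    rw [List.length_cons, Finset.sum_range_succ']
    rcases as with _ | ⟨a, as⟩
    · simp [dotMonomial]
    rcases gs with _ | ⟨g, gs⟩
    · simp [dotMonomial]
    · simp only [dotMonomial, ih as gs _ rfl, List.getD_cons_succ, List.getD_cons_zero,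
        Fin.prod_univ_three]
      rw [add_comm]
      rfl

/-- The exponents of the monomials of degree `d` in three variables. -/
def exponents (d : ℕ) : List (ℕ × ℕ × ℕ) :=
  (List.range (d + 1)).flatMap fun i =>
    (List.range (d + 1 - i)).map fun j => (d - i - j, j, i)

/-- A certificate that the product of the forms `cs` has no Jacobian syzygies of degree `d`: points
`vs`, values `gs` of the gradient modulo `17` and a left inverse `L` modulo `17` of the matrix of
values of the unknown syzygy. -/
structure Certificate where
  cs : List (Fin 9 → ℤ√2)
  d : ℕ
  vs : List (ℕ × ℕ × ℕ)
  gs : Fin 3 → List ℕ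
  L : List (List ℕ)

/-- The coefficients of a form modulo `17`. -/
def residue (a : ℤ√2) : ℕ := ((a.re + a.im * 6) % 17).toNat

/-- The values of the gradient in the certificate are correct. -/
def Certificate.GradientValid (K : Certificate) : Prop :=
  ∀ a < K.vs.length, ∀ i : Fin 3, (K.gs i).getD a 0 =
    prodGrad (tripleFun (K.vs.getD a 0)) i (K.cs.map (residue ∘ ·)) % 17

/-- The left inverse in the certificate is correct. -/
def Certificate.InverseValid (K : Certificate) : Prop :=
  ∀ (i : Fin 3) (k : Fin (exponents K.d).length) (j : Fin 3) (l : Fin (exponents K.d).length),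
    dotMonomial ((exponents K.d).get l) (K.L.getD (i * (exponents K.d).length + k) []) (K.gs j)
      K.vs % 17 = if i = j ∧ k = l then 1 else 0

instance (K : Certificate) : Decidable K.GradientValid := by
  unfold Certificate.GradientValid
  infer_instance

instance (K : Certificate) : Decidable K.InverseValid := by
  unfold Certificate.InverseValid
  infer_instance

lemma mem_exponents {d : ℕ} {e : ℕ × ℕ × ℕ} (h : e.1 + e.2.1 + e.2.2 = d) : e ∈ exponents d := by
  obtain ⟨e₀, e₁, e₂⟩ := e
  simp only [exponents, List.mem_flatMap, List.mem_map, List.mem_range, Prod.mk.injEq] at h ⊢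
  exact ⟨e₂, by omega, e₁, by omega, by omega, rfl, rfl⟩

/-- The exponent vector of the `l`-th monomial of degree `d`. -/
def exponentVec (d : ℕ) (l : Fin (exponents d).length) : Fin 3 →₀ ℕ :=
  Finsupp.equivFunOnFinite.symm (tripleFun ((exponents d).get l))

lemma exponentVec_injective {d : ℕ} (h : (exponents d).Nodup) :
    Function.Injective (exponentVec d) := by
  intro l l' hl
  have h1 := Finsupp.equivFunOnFinite.symm.injective hl
  refine h.injective_get ?_
  exact Prod.ext (congrFun h1 0) (Prod.ext (congrFun h1 1) (congrFun h1 2))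

lemma exists_exponentVec_eq {d : ℕ} (m : Fin 3 →₀ ℕ) (hm : m.degree = d) :
    ∃ l, exponentVec d l = m := by
  rw [Finsupp.degree_eq_sum, Fin.sum_univ_three] at hm
  obtain ⟨l, hl⟩ := List.get_of_mem (mem_exponents (e := (m 0, m 1, m 2)) hm)
  refine ⟨l, ?_⟩
  ext i
  rw [exponentVec, hl]
  fin_cases i <;> rfl

lemma eval_eq_sum_exponentVec {d : ℕ} (h : (exponents d).Nodup) {p : S} (hp : p.IsHomogeneous d)
    (w : Fin 3 → ℂ) : eval w p = ∑ l, coeff (exponentVec d l) p *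
      ∏ i, w i ^ tripleFun ((exponents d).get l) i := by
  change _ = ∑ l, coeff (exponentVec d l) p * ∏ i, w i ^ exponentVec d l i
  rw [eval_eq', ← Finset.sum_image (s := Finset.univ) (g := exponentVec d)
    (f := fun m => coeff m p * ∏ i, w i ^ m i) fun _ _ _ _ hl => exponentVec_injective h hl]
  refine Finset.sum_subset (fun m hm => ?_) fun m _ hm => ?_
  · obtain ⟨l, rfl⟩ := exists_exponentVec_eq m (by
      by_contra hne
      exact mem_support_iff.1 hm (hp.coeff_eq_zero hne))
    exact Finset.mem_image_of_mem _ (Finset.mem_univ l)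
  · rw [notMem_support_iff.1 hm, zero_mul]

lemma natCast_residue (a : ℤ√2) : (residue a : ZMod 17) = zsqrtdToZMod a := by
  have h : ((residue a : ℤ) : ZMod 17) = zsqrtdToZMod a := by
    rw [residue, Int.toNat_of_nonneg (Int.emod_nonneg _ (by norm_num)), zsqrtdToZMod_apply]
    have := ZMod.intCast_mod (a.re + a.im * 6) 17
    push_cast at this ⊢
    exact this
  rw [← h, Int.cast_natCast]

/-- A valid certificate excludes Jacobian syzygies. -/
theorem Certificate.notMem_syzygyDegrees (K : Certificate) (hE : (exponents K.d).Nodup)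
    (hK : K.GradientValid ∧ K.InverseValid) {f : S} {c : ℂ}
    (hf : map zsqrtdToComplex (prodForm K.cs) = C c * f) : K.d ∉ syzygyDegrees f := by
  rintro ⟨r, hr, hr0, hrd⟩
  let pt : Fin K.vs.length → Fin 3 → ℤ√2 := fun a i => (tripleFun (K.vs.getD a 0) i : ℕ)
  -- The unknowns are the coefficients of the three forms of a syzygy of degree `K.d`. The row of
  -- `A` at a point evaluates the syzygy relation there.
  let A : Matrix (Fin K.vs.length) (Fin 3 × Fin (exponents K.d).length) (ℤ√2) := Matrix.of fun a q =>
    (∏ i, pt a i ^ tripleFun ((exponents K.d).get q.2) i) * eval (pt a) (pderiv q.1 (prodForm K.cs))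
  let L : Matrix (Fin 3 × Fin (exponents K.d).length) (Fin K.vs.length) (ℤ√2) := Matrix.of fun q a =>
    ((K.L.getD (q.1 * (exponents K.d).length + q.2) []).getD a 0 : ℕ)
  have hgrad : ∀ a i, zsqrtdToZMod (eval (pt a) (pderiv i (prodForm K.cs))) =
      ((K.gs i).getD a 0 : ℕ) := by
    intro a i
    rw [hK.1 a a.2 i, ZMod.natCast_mod, eval_pderiv_prodForm, map_prodGrad]
    change _ = Nat.castRingHom (ZMod 17) _
    rw [map_prodGrad, List.map_map]
    congr 1
    · ext j
      simp [pt]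
    · refine List.map_congr_left fun c _ => ?_
      ext j
      simp [natCast_residue]
  -- The numerical check says precisely that `L` is a left inverse of `A` after reduction modulo the
  -- prime above 17.
  have hone : (L * A).map zsqrtdToZMod = 1 := by
    ext ⟨i, k⟩ ⟨j, l⟩
    have h := congrArg (Nat.cast (R := ZMod 17)) (hK.2 i k j l)
    rw [ZMod.natCast_mod, dotMonomial_eq_sum _ _ _ _ _ rfl, Finset.sum_range] at h
    rw [map_apply, mul_apply, map_sum, one_apply]
    push_cast at h
    simp only [Prod.mk.injEq]
    rw [← h]
    refine Finset.sum_congr rfl fun a _ => ?_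
    simp only [L, A, Matrix.of_apply, map_mul, hgrad, map_prod, map_pow, pt, map_natCast]
    ring
  -- The determinant of `L * A` lies in `ℤ[√2]` and reduces to 1, so it is nonzero there, and it
  -- stays nonzero under the embedding into `ℂ`.
  have hdet : ((L * A).map zsqrtdToComplex).det ≠ 0 := by
    rw [← RingHom.mapMatrix_apply, ← RingHom.map_det, Ne,
      map_eq_zero_iff _ zsqrtdToComplex_injective]
    intro h0
    have h1 := congrArg det hone
    rw [← RingHom.mapMatrix_apply, ← RingHom.map_det, h0, map_zero, det_one] at h1
    exact absurd h1 (by decide)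
  -- The scalar `c` only rescales every equation; it clears denominators in the equation of the
  -- curve.
  have hA : A.map zsqrtdToComplex *ᵥ (fun q => coeff (exponentVec K.d q.2) (r q.1)) = 0 := by
    ext1 a
    have h1 := congrArg (eval (zsqrtdToComplex ∘ pt a))
      (show ∑ i, r i * pderiv i f = 0 from hr)
    have h2 : ∀ i, zsqrtdToComplex (eval (pt a) (pderiv i (prodForm K.cs))) =
        c * eval (zsqrtdToComplex ∘ pt a) (pderiv i f) := fun i => by
      have h3 := congrArg (fun p => eval (zsqrtdToComplex ∘ pt a) (pderiv i p)) hf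
      simp only [pderiv_map, pderiv_C_mul, map_mul, eval_C, eval_map] at h3
      rw [← h3]
      rw [eval, coe_eval₂Hom, eval₂_comp_left, RingHom.comp_id]
    rw [map_sum, map_zero] at h1
    rw [Pi.zero_apply, mulVec, dotProduct, Fintype.sum_prod_type, ← mul_zero c, ← h1,
      Finset.mul_sum]
    refine Finset.sum_congr rfl fun i _ => ?_
    rw [map_mul, eval_eq_sum_exponentVec hE (hrd i), Finset.sum_mul, Finset.mul_sum]
    refine Finset.sum_congr rfl fun l _ => ?_
    simp only [map_apply, A, Matrix.of_apply, map_mul, h2, map_prod, map_pow, Function.comp_apply]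
    ring
  have h0 := eq_zero_of_mulVec_eq_zero hdet
    (v := fun q => coeff (exponentVec K.d q.2) (r q.1)) (by
      rw [Matrix.map_mul, ← mulVec_mulVec, hA, mulVec_zero])
  refine hr0 ?_
  ext i m
  by_cases hm : m.degree = K.d
  · obtain ⟨l, rfl⟩ := exists_exponentVec_eq m hm
    exact congrFun h0 (i, l)
  · exact (hrd i).coeff_eq_zero hm

/-! ### Local forms from equations -/

/-- The local form of a node on the components `i` and `j`. -/
def node {n : ℕ} (i j : Fin n) : Fin n → Branch :=
  fun l => if l = i then .fst else if l = j then .snd else .away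

/-- The local form of an ordinary triple point on the components `i`, `j` and `l`. -/
def triplePoint {n : ℕ} (i j l : Fin n) : Fin n → Branch :=
  fun m => if m = i then .fst else if m = j then .snd else if m = l then .diag else .away

/-- The local form of a simple tangency of the components `i` and `j`. -/
def tacnode {n : ℕ} (i j : Fin n) : Fin n → Branch :=
  fun l => if l = i then .snd else if l = j then .para else .away

lemma grad_mul_of_eval_eq_zero {c f : S} {v : Fin 3 → ℂ} (hf : eval v f = 0) :
    grad (c * f) v = eval v c • grad f v := by
  ext1 i
  simp [grad, hf]

lemma hasLocalForm_node {n : ℕ} {F : Fin n → S} {v : Fin 3 → ℂ} (i j : Fin n) (k : Fin 3)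
    (hk : v k = 1) (hi : eval v (F i) = 0) (hj : eval v (F j) = 0)
    (hg : (grad (F i) v ⨯₃ grad (F j) v) k ≠ 0)
    (hl : ∀ l, l ≠ i → l ≠ j → eval v (F l) ≠ 0) : HasLocalForm F (node i j) v := by
  refine ⟨k, F i, F j, hk, hi, hj, hg, fun l => ?_⟩
  by_cases h1 : l = i
  · exact ⟨1, 1, by simp, by simp, by simp [node, h1, Branch.poly]⟩
  by_cases h2 : l = j
  · subst h2
    exact ⟨1, 1, by simp, by simp, by simp [node, h1, Branch.poly]⟩
  · exact ⟨1, F l, by simp, hl l h1 h2, by simp [node, h1, h2, Branch.poly]⟩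

/-- With `c₁ * F i` and `c₂ * F j` as coordinates the third component becomes their sum. That the
three multipliers are units at the point makes the three branches pairwise transverse. -/
lemma hasLocalForm_triplePoint {n : ℕ} {F : Fin n → S} {v : Fin 3 → ℂ} (i j l : Fin n)
    (k : Fin 3) (c₁ c₂ c₃ : S) (hk : v k = 1) (hi : eval v (F i) = 0) (hj : eval v (F j) = 0)
    (hg : (grad (F i) v ⨯₃ grad (F j) v) k ≠ 0) (h₁ : eval v c₁ ≠ 0) (h₂ : eval v c₂ ≠ 0)
    (h₃ : eval v c₃ ≠ 0) (hc : c₃ * F l = c₁ * F i + c₂ * F j)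
    (hm : ∀ m, m ≠ i → m ≠ j → m ≠ l → eval v (F m) ≠ 0) :
    HasLocalForm F (triplePoint i j l) v := by
  refine ⟨k, c₁ * F i, c₂ * F j, hk, by simp [hi], by simp [hj], ?_, fun m => ?_⟩
  · rw [grad_mul_of_eval_eq_zero hi, grad_mul_of_eval_eq_zero hj, map_smul, LinearMap.map_smul₂,
      smul_smul, Pi.smul_apply, smul_eq_mul]
    exact mul_ne_zero (mul_ne_zero h₂ h₁) hg
  by_cases e1 : m = i
  · exact ⟨c₁, 1, h₁, by simp, by simp [triplePoint, e1, Branch.poly]⟩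
  by_cases e2 : m = j
  · subst e2
    exact ⟨c₂, 1, h₂, by simp, by simp [triplePoint, e1, Branch.poly]⟩
  by_cases e3 : m = l
  · subst e3
    exact ⟨c₃, 1, h₃, by simp, by simp [triplePoint, e1, e2, Branch.poly, hc]⟩
  · exact ⟨1, F m, by simp, hm m e1 e2 e3, by simp [triplePoint, e1, e2, e3, Branch.poly]⟩

/-- The coordinate `t` is a parameter along the branch of `F i`, transverse to it, and `t ^ 2` in
the identity records contact of order exactly two. -/
lemma hasLocalForm_tacnode {n : ℕ} {F : Fin n → S} {v : Fin 3 → ℂ} (i j : Fin n) (k : Fin 3)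
    (c₁ c₂ t : S) (hk : v k = 1) (hi : eval v (F i) = 0) (ht : eval v t = 0)
    (hg : (grad t v ⨯₃ grad (F i) v) k ≠ 0) (h₁ : eval v c₁ ≠ 0) (h₂ : eval v c₂ ≠ 0)
    (hc : c₂ * F j = c₁ * F i + t ^ 2) (hij : i ≠ j)
    (hl : ∀ l, l ≠ i → l ≠ j → eval v (F l) ≠ 0) : HasLocalForm F (tacnode i j) v := by
  refine ⟨k, t, c₁ * F i, hk, ht, by simp [hi], ?_, fun l => ?_⟩
  · rw [grad_mul_of_eval_eq_zero hi, map_smul, Pi.smul_apply, smul_eq_mul]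
    exact mul_ne_zero h₁ hg
  by_cases e1 : l = i
  · subst e1
    exact ⟨c₁, 1, h₁, by simp, by simp [tacnode, Branch.poly]⟩
  by_cases e2 : l = j
  · subst e2
    exact ⟨c₂, 1, h₂, by simp, by simp [tacnode, hij.symm, Branch.poly, hc]⟩
  · exact ⟨1, F l, by simp, hl l e1 e2, by simp [tacnode, e1, e2, Branch.poly]⟩

section Coordinates

variable (a₀ a₁ a₂ a₃ a₄ a₅ : ℂ) (v : Fin 3 → ℂ)

lemma eval_linearForm : eval v (linearForm a₀ a₁ a₂) = a₀ * v 0 + a₁ * v 1 + a₂ * v 2 := by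
  simp [linearForm]

lemma eval_quadraticForm : eval v (quadraticForm a₀ a₁ a₂ a₃ a₄ a₅) =
    a₀ * v 0 ^ 2 + a₁ * v 1 ^ 2 + a₂ * v 2 ^ 2 + a₃ * (v 1 * v 2) + a₄ * (v 0 * v 2) +
      a₅ * (v 0 * v 1) := by
  simp [quadraticForm]

lemma gradient_linearForm : gradient (linearForm a₀ a₁ a₂) = ![C a₀, C a₁, C a₂] := by
  ext1 i
  fin_cases i <;> simp [gradient, linearForm, pderiv_X]

lemma gradient_quadraticForm : gradient (quadraticForm a₀ a₁ a₂ a₃ a₄ a₅) =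
    ![2 * C a₀ * X 0 + C a₄ * X 2 + C a₅ * X 1, 2 * C a₁ * X 1 + C a₃ * X 2 + C a₅ * X 0,
      2 * C a₂ * X 2 + C a₃ * X 1 + C a₄ * X 0] := by
  ext1 i
  fin_cases i <;>
    simp [gradient, quadraticForm, pderiv_X] <;> ring

lemma grad_eq_eval_gradient (f : S) (i : Fin 3) : grad f v i = eval v (gradient f i) := rfl

lemma grad_linearForm : grad (linearForm a₀ a₁ a₂) v = ![a₀, a₁, a₂] := by
  ext1 i
  rw [grad_eq_eval_gradient, gradient_linearForm]
  fin_cases i <;> simp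

lemma grad_quadraticForm : grad (quadraticForm a₀ a₁ a₂ a₃ a₄ a₅) v =
    ![2 * a₀ * v 0 + a₄ * v 2 + a₅ * v 1, 2 * a₁ * v 1 + a₃ * v 2 + a₅ * v 0,
      2 * a₂ * v 2 + a₃ * v 1 + a₄ * v 0] := by
  ext1 i
  rw [grad_eq_eval_gradient, gradient_quadraticForm]
  fin_cases i <;> simp [map_ofNat]

end Coordinates

lemma eq_smul_of_coordinates {w v : Fin 3 → ℂ} (c : ℂ) (h₀ : w 0 = c * v 0) (h₁ : w 1 = c * v 1)
    (h₂ : w 2 = c * v 2) : w = c • v := by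
  ext1 i
  fin_cases i
  · exact h₀
  · exact h₁
  · exact h₂

lemma b_mul_b : b * b = 2 := by
  rw [b, ← Complex.ofReal_mul, Real.mul_self_sqrt (by norm_num)]
  norm_num

/-! ### Explicit syzygies -/

/-- The triple `r` is a vector field tangent to every component, with cofactor `c i` on `F i`. By
the product rule it multiplies the product of the `F i` by the sum of the cofactors. -/
lemma mem_AR_prod {n : ℕ} {F : Fin n → S} {r : Fin 3 → S} (c : Fin n → S)
    (h : ∀ i, r 0 * gradient (F i) 0 + r 1 * gradient (F i) 1 + r 2 * gradient (F i) 2 = c i * F i)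
    (hc : ∑ i, c i = 0) : r ∈ AR (∏ i, F i) := by
  have key : ∀ s : Finset (Fin n), r 0 * gradient (∏ i ∈ s, F i) 0 +
      r 1 * gradient (∏ i ∈ s, F i) 1 + r 2 * gradient (∏ i ∈ s, F i) 2 =
        (∑ i ∈ s, c i) * ∏ i ∈ s, F i := by
    intro s
    induction s using Finset.induction_on with
    | empty => simp [gradient]
    | insert i s hi ih =>
      have := h i
      simp only [gradient] at ih this ⊢
      rw [Finset.prod_insert hi, Finset.sum_insert hi, pderiv_mul, pderiv_mul, pderiv_mul]
      linear_combination (∏ i ∈ s, F i) * this + F i * ih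
  rw [mem_AR, key, hc, zero_mul]

/-- The form of degree `d` with given list of coefficients. -/
def formOfCoeffs (d : ℕ) (cs : List ℂ) : S :=
  (List.zipWith (fun c (e : ℕ × ℕ × ℕ) => C c * (X 0 ^ e.1 * X 1 ^ e.2.1 * X 2 ^ e.2.2))
    cs (exponents d)).sum

lemma isHomogeneous_formOfCoeffs (d : ℕ) (cs : List ℂ) : (formOfCoeffs d cs).IsHomogeneous d := by
  have key : ∀ (es : List (ℕ × ℕ × ℕ)) (cs : List ℂ), (∀ e ∈ es, e.1 + e.2.1 + e.2.2 = d) →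
      (List.zipWith (fun c (e : ℕ × ℕ × ℕ) => (C c : S) * (X 0 ^ e.1 * X 1 ^ e.2.1 * X 2 ^ e.2.2))
        cs es).sum.IsHomogeneous d := by
    intro es
    induction es with
    | nil =>
      intro cs _
      cases cs <;> exact isHomogeneous_zero _ _ _
    | cons e es ih =>
      intro cs h
      rcases cs with _ | ⟨c, cs⟩
      · exact isHomogeneous_zero _ _ _
      · rw [List.zipWith_cons_cons, List.sum_cons]
        refine IsHomogeneous.add (IsHomogeneous.C_mul ?_ c)
          (ih cs fun e' he' => h e' (List.mem_cons_of_mem _ he'))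
        rw [← h e (List.mem_cons_self ..)]
        exact ((isHomogeneous_X_pow _ _).mul (isHomogeneous_X_pow _ _)).mul (isHomogeneous_X_pow _ _)
  refine key _ _ fun e he => ?_
  simp only [exponents, List.mem_flatMap, List.mem_map, List.mem_range] at he
  obtain ⟨i, hi, j, hj, rfl⟩ := he
  dsimp only
  omega

/-- Multiply by a power of a variable. Thus absence in one degree excludes all lower degrees at
once. -/
lemma syzygyDegrees_mono {f : S} {d e : ℕ} (hd : d ∈ syzygyDegrees f) (hde : d ≤ e) :
    e ∈ syzygyDegrees f := by
  obtain ⟨r, hr, hr0, hrd⟩ := hd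
  refine ⟨X 0 ^ (e - d) • r, (AR f).smul_mem _ hr, smul_ne_zero (pow_ne_zero _ (X_ne_zero 0)) hr0,
    fun i => ?_⟩
  have := (isHomogeneous_X_pow (R := ℂ) (0 : Fin 3) (e - d)).mul (hrd i)
  rwa [Nat.sub_add_cancel hde] at this

lemma isLeast_syzygyDegrees {f : S} {d : ℕ} (h : d ∉ syzygyDegrees f)
    (h' : d + 1 ∈ syzygyDegrees f) : IsLeast (syzygyDegrees f) (d + 1) :=
  ⟨h', fun _ he => by
    by_contra hlt
    exact h (syzygyDegrees_mono he (by omega))⟩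

/-- The conclusion for a pair of arrangements of degree seven with the same combinatorics, from
explicit syzygies of degrees `3` and `4` of the first, a syzygy of degree `4` of the second, and the
absence of syzygies of lower degree. -/
theorem conclusion_of_arrangements {n m : ℕ} {F G : Fin n → S} {d : Fin n → ℕ}
    {τ : Fin m → Fin n → Branch} {p q : Fin m → Fin 3 → ℂ} (hτ : IsSeparating τ)
    (hF : IsArrangement F d τ p) (hG : IsArrangement G d τ q) (hd : ∑ i, d i = 7)
    {f g : S} (hf : f = ∏ i, F i) (hg : g = ∏ i, G i)
    {r s u : Fin 3 → S} (hr : r ∈ AR (∏ i, F i)) (hs : s ∈ AR (∏ i, F i)) (hu : u ∈ AR (∏ i, G i))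
    (hrd : ∀ i, (r i).IsHomogeneous 3) (hsd : ∀ i, (s i).IsHomogeneous 4)
    (hud : ∀ i, (u i).IsHomogeneous 4) (hrs : r ⨯₃ s ≠ 0) (hu0 : u ≠ 0)
    (hf2 : 2 ∉ syzygyDegrees f) (hg3 : 3 ∉ syzygyDegrees g) :
    IsStrongZieglerPair f g ∧ IsLeast (syzygyDegrees f) 3 ∧ IsLeast (syzygyDegrees g) 4 ∧
    Nonempty (MinimalGradedFreeResolution (jacobianIdeal f)) ∧
    Nonempty (MinimalGradedFreeResolution (jacobianIdeal g)) ∧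
    ∀ (R : MinimalGradedFreeResolution (jacobianIdeal f))
      (R' : MinimalGradedFreeResolution (jacobianIdeal g)), R.twists ≠ R'.twists := by
  subst hf hg
  have hfh := hF.isHomogeneous
  have hgh := hG.isHomogeneous
  rw [hd] at hfh hgh
  have hr0 : r ≠ 0 := by
    rintro rfl
    simp at hrs
  have hfl : IsLeast (syzygyDegrees (∏ i, F i)) 3 :=
    isLeast_syzygyDegrees hf2 ⟨r, hr, hr0, hrd⟩
  have hgl : IsLeast (syzygyDegrees (∏ i, G i)) 4 :=
    isLeast_syzygyDegrees hg3 ⟨u, hu, hu0, hud⟩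
  exact ⟨⟨hF.isReducedCurve hτ (by omega), hG.isReducedCurve hτ (by omega),
      -- Degree seven curves have partial derivatives of degree six; `m = 1` comes from 3 + 4 = 1 +
      -- 6, and the decisive inequality is 3 + 4 < 2 · 4.
      hF.sameCombinatorics hτ hG, isEmpty_AR_equiv (D := 6) (m := 1) hfh hgh (hF.squarefree hτ)
      (hG.squarefree hτ) hr hs hrd hsd hrs rfl (fun _ he => hgl.2 he) (by norm_num)⟩,
    hfl, hgl, nonempty_resolution_jacobianIdeal (D := 6) hfh (by norm_num),
    nonempty_resolution_jacobianIdeal (D := 6) hgh (by norm_num),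
    twists_ne (D := 6) hfh hgh (by norm_num) hfl (by norm_num) hg3⟩

/-! ### Computations in coordinates -/

/-- The vector `w` is a multiple of `v`. -/
def Proportional (w v : Fin 3 → ℂ) : Prop := ∃ c : ℂ, w = c • v

lemma proportional_of_coordinates {w₀ w₁ w₂ v₀ v₁ v₂ : ℂ} (c : ℂ) (h₀ : w₀ = c * v₀)
    (h₁ : w₁ = c * v₁) (h₂ : w₂ = c * v₂) : Proportional ![w₀, w₁, w₂] ![v₀, v₁, v₂] :=
  ⟨c, eq_smul_of_coordinates c h₀ h₁ h₂⟩

lemma ne_smul_of_coordinates {w₀ w₁ w₂ v₀ v₁ v₂ : ℂ}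
    (h : ∀ c : ℂ, w₀ = c * v₀ → w₁ = c * v₁ → w₂ = c * v₂ → False) (c : ℂ) :
    ![w₀, w₁, w₂] ≠ c • ![v₀, v₁, v₂] :=
  fun e => h c (congrFun e 0) (congrFun e 1) (congrFun e 2)

lemma vec_eta (w : Fin 3 → ℂ) : ![w 0, w 1, w 2] = w := by
  ext1 i
  fin_cases i <;> rfl

lemma covered_of {n m : ℕ} {F : Fin n → S} {p : Fin m → Fin 3 → ℂ} {i j : Fin n}
    (h : ∀ X Y Z, eval ![X, Y, Z] (F i) = 0 → eval ![X, Y, Z] (F j) = 0 →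
      ∃ a, Proportional ![X, Y, Z] (p a)) :
    ∀ w ≠ 0, eval w (F i) = 0 → eval w (F j) = 0 → ∃ a, ∃ c : ℂ, w = c • p a := by
  intro w _ hi hj
  rw [← vec_eta w] at hi hj ⊢
  exact h _ _ _ hi hj

/-- Polynomial identities are checked on values, where `ring` and `linear_combination` can use
`b_mul_b`. -/
lemma eq_of_eval {p q : S} (h : ∀ X Y Z : ℂ, eval ![X, Y, Z] p = eval ![X, Y, Z] q) : p = q :=
  MvPolynomial.funext fun w => by
    rw [← vec_eta w]
    exact h _ _ _

/-- Nonvanishing is always certified by an explicit inverse `s`; the product is reduced to 1 using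
only `b ^ 2 = 2` and, where present, the quadratic equation of `r`. -/
lemma ne_zero_of_mul {a : ℂ} (s : ℂ) (h : s * a = 1) : a ≠ 0 :=
  right_ne_zero_of_mul_eq_one h

/-- Some intersection points have coordinates that are conjugate roots of a quadratic. Only the
equation of one root is used; the other is given by the sum of the roots. -/
lemma exists_quadratic_root (p q : ℂ) : ∃ r : ℂ, r ^ 2 + p * r + q = 0 := by
  obtain ⟨s, hs⟩ := IsAlgClosed.exists_pow_nat_eq (p ^ 2 / 4 - q) (n := 2) (by norm_num)
  exact ⟨s - p / 2, by linear_combination hs⟩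

lemma eval_linearForm_vec (a₀ a₁ a₂ X Y Z : ℂ) :
    eval ![X, Y, Z] (linearForm a₀ a₁ a₂) = a₀ * X + a₁ * Y + a₂ * Z :=
  eval_linearForm a₀ a₁ a₂ _

lemma eval_quadraticForm_vec (a₀ a₁ a₂ a₃ a₄ a₅ X Y Z : ℂ) :
    eval ![X, Y, Z] (quadraticForm a₀ a₁ a₂ a₃ a₄ a₅) =
      a₀ * X ^ 2 + a₁ * Y ^ 2 + a₂ * Z ^ 2 + a₃ * (Y * Z) + a₄ * (X * Z) + a₅ * (X * Y) :=
  eval_quadraticForm a₀ a₁ a₂ a₃ a₄ a₅ _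

lemma grad_linearForm_vec (a₀ a₁ a₂ X Y Z : ℂ) :
    grad (linearForm a₀ a₁ a₂) ![X, Y, Z] = ![a₀, a₁, a₂] :=
  grad_linearForm a₀ a₁ a₂ _

lemma grad_quadraticForm_vec (a₀ a₁ a₂ a₃ a₄ a₅ X Y Z : ℂ) :
    grad (quadraticForm a₀ a₁ a₂ a₃ a₄ a₅) ![X, Y, Z] =
      ![2 * a₀ * X + a₄ * Z + a₅ * Y, 2 * a₁ * Y + a₃ * Z + a₅ * X,
        2 * a₂ * Z + a₃ * Y + a₄ * X] :=
  grad_quadraticForm a₀ a₁ a₂ a₃ a₄ a₅ _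

section Cross

variable {u v : Fin 3 → ℂ} {u₀ u₁ u₂ v₀ v₁ v₂ : ℂ}

lemma cross_one_ne_zero (hu : u = ![u₀, u₁, u₂]) (hv : v = ![v₀, v₁, v₂])
    (h : u₂ * v₀ - u₀ * v₂ ≠ 0) : (u ⨯₃ v) 1 ≠ 0 := by
  subst hu hv
  rw [cross_apply]
  exact h

lemma cross_two_ne_zero (hu : u = ![u₀, u₁, u₂]) (hv : v = ![v₀, v₁, v₂])
    (h : u₀ * v₁ - u₁ * v₀ ≠ 0) : (u ⨯₃ v) 2 ≠ 0 := by
  subst hu hv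
  rw [cross_apply]
  exact h

end Cross

lemma forall_fin_four {P : Fin 4 → Prop} (h₀ : P 0) (h₁ : P 1) (h₂ : P 2) (h₃ : P 3) (i : Fin 4) :
    P i := by
  fin_cases i <;> assumption

lemma forall_fin_five {P : Fin 5 → Prop} (h₀ : P 0) (h₁ : P 1) (h₂ : P 2) (h₃ : P 3) (h₄ : P 4)
    (i : Fin 5) : P i := by
  fin_cases i <;> assumption

lemma forall_lt_four {P : Fin 4 → Fin 4 → Prop} (h₀₁ : P 0 1) (h₀₂ : P 0 2) (h₀₃ : P 0 3)
    (h₁₂ : P 1 2) (h₁₃ : P 1 3) (h₂₃ : P 2 3) (i j : Fin 4) (h : i < j) : P i j := by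
  fin_cases i <;> fin_cases j <;> first | assumption | exact absurd h (by decide)

lemma forall_lt_five {P : Fin 5 → Fin 5 → Prop} (h₀₁ : P 0 1) (h₀₂ : P 0 2) (h₀₃ : P 0 3)
    (h₀₄ : P 0 4) (h₁₂ : P 1 2) (h₁₃ : P 1 3) (h₁₄ : P 1 4) (h₂₃ : P 2 3) (h₂₄ : P 2 4)
    (h₃₄ : P 3 4) (i j : Fin 5) (h : i < j) : P i j := by
  fin_cases i <;> fin_cases j <;> first | assumption | exact absurd h (by decide)

lemma eval_formOfCoeffs_two (a₀ a₁ a₂ a₃ a₄ a₅ X Y Z : ℂ) :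
    eval ![X, Y, Z] (formOfCoeffs 2 [a₀, a₁, a₂, a₃, a₄, a₅]) =
      a₀ * X ^ 2 + a₁ * X * Y + a₂ * Y ^ 2 + a₃ * X * Z + a₄ * Y * Z + a₅ * Z ^ 2 := by
  simp [formOfCoeffs, exponents, List.range_succ]
  ring

lemma eval_formOfCoeffs_three (a₀ a₁ a₂ a₃ a₄ a₅ a₆ a₇ a₈ a₉ X Y Z : ℂ) :
    eval ![X, Y, Z] (formOfCoeffs 3 [a₀, a₁, a₂, a₃, a₄, a₅, a₆, a₇, a₈, a₉]) =
      a₀ * X ^ 3 + a₁ * X ^ 2 * Y + a₂ * X * Y ^ 2 + a₃ * Y ^ 3 + a₄ * X ^ 2 * Z + a₅ * X * Y * Z +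
        a₆ * Y ^ 2 * Z + a₇ * X * Z ^ 2 + a₈ * Y * Z ^ 2 + a₉ * Z ^ 3 := by
  simp [formOfCoeffs, exponents, List.range_succ]
  ring

lemma eval_formOfCoeffs_four (a₀ a₁ a₂ a₃ a₄ a₅ a₆ a₇ a₈ a₉ c₀ c₁ c₂ c₃ c₄ X Y Z : ℂ) :
    eval ![X, Y, Z] (formOfCoeffs 4
      [a₀, a₁, a₂, a₃, a₄, a₅, a₆, a₇, a₈, a₉, c₀, c₁, c₂, c₃, c₄]) =
      a₀ * X ^ 4 + a₁ * X ^ 3 * Y + a₂ * X ^ 2 * Y ^ 2 + a₃ * X * Y ^ 3 + a₄ * Y ^ 4 +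
        a₅ * X ^ 3 * Z + a₆ * X ^ 2 * Y * Z + a₇ * X * Y ^ 2 * Z + a₈ * Y ^ 3 * Z +
        a₉ * X ^ 2 * Z ^ 2 + c₀ * X * Y * Z ^ 2 + c₁ * Y ^ 2 * Z ^ 2 + c₂ * X * Z ^ 3 +
        c₃ * Y * Z ^ 3 + c₄ * Z ^ 4 := by
  simp [formOfCoeffs, exponents, List.range_succ]
  ring

lemma crossProduct_ne_zero_of_eval {r s : Fin 3 → S} (X Y Z : ℂ)
    (h : eval ![X, Y, Z] (r 0) * eval ![X, Y, Z] (s 1) -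
      eval ![X, Y, Z] (r 1) * eval ![X, Y, Z] (s 0) ≠ 0) : r ⨯₃ s ≠ 0 := by
  intro h0
  have := congrArg (eval ![X, Y, Z]) (congrFun h0 2)
  simp only [cross_apply, cons_val, map_sub, map_mul, Pi.zero_apply, map_zero] at this
  exact h this

lemma ne_zero_of_eval {r : Fin 3 → S} (X Y Z : ℂ) (h : eval ![X, Y, Z] (r 0) ≠ 0) : r ≠ 0 := by
  rintro rfl
  simp at h

/-! ### Equations, gradients and smoothness of the individual lines and conics. -/

lemma eval_cmb123_C (X Y Z : ℂ) : eval ![X, Y, Z] Cmb123.C =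
    -X ^ 2 + Y * Z := by
  simp [Cmb123.C, x, y, z]

lemma cmb123_C_eq : Cmb123.C =
    quadraticForm (-1) 0 0 1 0 0 :=
  eq_of_eval fun X Y Z => by
    rw [eval_cmb123_C, eval_quadraticForm_vec]
    ring

lemma grad_cmb123_C (X Y Z : ℂ) : grad Cmb123.C ![X, Y, Z] =
    ![-2 * X, Z, Y] := by
  rw [cmb123_C_eq, grad_quadraticForm_vec]
  congrm ![?_, ?_, ?_] <;> ring

lemma isSmoothForm_cmb123_C : IsSmoothForm Cmb123.C 2 := by
  rw [cmb123_C_eq]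
  exact isSmoothForm_quadraticForm (ne_zero_of_mul 1 (by ring))

/-- The coefficients of `Cmb123.C`, up to a factor. -/
def cmb123_CCoeffs : Fin 9 → ℤ√2 :=
  ![-1, 0, 0, 1, 0, 0, 0, 0, 0]

lemma formVal_cmb123_CCoeffs (X Y Z : ℂ) : formVal (zsqrtdToComplex ∘ cmb123_CCoeffs) ![X, Y, Z] =
    1 * eval ![X, Y, Z] Cmb123.C := by
  rw [eval_cmb123_C]
  simp [formVal, cmb123_CCoeffs, zsqrtdToComplex_apply]
  ring

lemma eval_cmb123_L₁ (X Y Z : ℂ) : eval ![X, Y, Z] Cmb123.L₁ =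
    3 * X + Y + 2 * Z := by
  simp [Cmb123.L₁, x, y, z]

lemma cmb123_L₁_eq : Cmb123.L₁ =
    linearForm 3 1 2 :=
  eq_of_eval fun X Y Z => by
    rw [eval_cmb123_L₁, eval_linearForm_vec]
    ring

lemma grad_cmb123_L₁ (X Y Z : ℂ) : grad Cmb123.L₁ ![X, Y, Z] =
    ![3, 1, 2] := by
  rw [cmb123_L₁_eq, grad_linearForm_vec]

lemma isSmoothForm_cmb123_L₁ : IsSmoothForm Cmb123.L₁ 1 := by
  rw [cmb123_L₁_eq]
  exact isSmoothForm_linearForm 1 (by norm_num)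

/-- The coefficients of `Cmb123.L₁`, up to a factor. -/
def cmb123_L₁Coeffs : Fin 9 → ℤ√2 :=
  ![0, 0, 0, 0, 0, 0, 3, 1, 2]

lemma formVal_cmb123_L₁Coeffs (X Y Z : ℂ) : formVal (zsqrtdToComplex ∘ cmb123_L₁Coeffs) ![X, Y, Z] =
    1 * eval ![X, Y, Z] Cmb123.L₁ := by
  rw [eval_cmb123_L₁]
  simp [formVal, cmb123_L₁Coeffs, zsqrtdToComplex_apply]

lemma eval_cmb123_L₂ (X Y Z : ℂ) : eval ![X, Y, Z] Cmb123.L₂ =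
    -3 * X + Y + 2 * Z := by
  simp [Cmb123.L₂, x, y, z]

lemma cmb123_L₂_eq : Cmb123.L₂ =
    linearForm (-3) 1 2 :=
  eq_of_eval fun X Y Z => by
    rw [eval_cmb123_L₂, eval_linearForm_vec]
    ring

lemma grad_cmb123_L₂ (X Y Z : ℂ) : grad Cmb123.L₂ ![X, Y, Z] =
    ![-3, 1, 2] := by
  rw [cmb123_L₂_eq, grad_linearForm_vec]

lemma isSmoothForm_cmb123_L₂ : IsSmoothForm Cmb123.L₂ 1 := by
  rw [cmb123_L₂_eq]
  exact isSmoothForm_linearForm 1 (by norm_num)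

/-- The coefficients of `Cmb123.L₂`, up to a factor. -/
def cmb123_L₂Coeffs : Fin 9 → ℤ√2 :=
  ![0, 0, 0, 0, 0, 0, -3, 1, 2]

lemma formVal_cmb123_L₂Coeffs (X Y Z : ℂ) : formVal (zsqrtdToComplex ∘ cmb123_L₂Coeffs) ![X, Y, Z] =
    1 * eval ![X, Y, Z] Cmb123.L₂ := by
  rw [eval_cmb123_L₂]
  simp [formVal, cmb123_L₂Coeffs, zsqrtdToComplex_apply]

lemma eval_cmb123_D (X Y Z : ℂ) : eval ![X, Y, Z] Cmb123.D =
    (12 * b - 18) * X ^ 2 + (-36 * b + 51) * X * Z + Y * Z + (24 * b - 34) * Z ^ 2 := by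
  simp [Cmb123.D, x, y, z, k]
  ring

lemma cmb123_D_eq : Cmb123.D =
    quadraticForm (12 * b - 18) 0 (24 * b - 34) 1 (-36 * b + 51) 0 :=
  eq_of_eval fun X Y Z => by
    rw [eval_cmb123_D, eval_quadraticForm_vec]
    ring

lemma grad_cmb123_D (X Y Z : ℂ) : grad Cmb123.D ![X, Y, Z] =
    ![(24 * b - 36) * X + (-36 * b + 51) * Z, Z, (-36 * b + 51) * X + Y + (48 * b - 68) * Z] := by
  rw [cmb123_D_eq, grad_quadraticForm_vec]
  congrm ![?_, ?_, ?_] <;> ring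

lemma isSmoothForm_cmb123_D : IsSmoothForm Cmb123.D 2 := by
  rw [cmb123_D_eq]
  -- The discriminant here is `18 - 12 * b`, and `b / 3 + 1 / 2` is its inverse.
  exact isSmoothForm_quadraticForm (ne_zero_of_mul (1 / 3 * b + 1 / 2) (by linear_combination -4 *
    b_mul_b))

/-- The coefficients of `Cmb123.D`, up to a factor. -/
def cmb123_DCoeffs : Fin 9 → ℤ√2 :=
  ![⟨-18, 12⟩, 0, ⟨-34, 24⟩, 1, ⟨51, -36⟩, 0, 0, 0, 0]

lemma formVal_cmb123_DCoeffs (X Y Z : ℂ) : formVal (zsqrtdToComplex ∘ cmb123_DCoeffs) ![X, Y, Z] =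
    1 * eval ![X, Y, Z] Cmb123.D := by
  rw [eval_cmb123_D]
  simp [formVal, cmb123_DCoeffs, zsqrtdToComplex_apply]
  ring

lemma eval_cmb123_M₁ (X Y Z : ℂ) : eval ![X, Y, Z] Cmb123.M₁ =
    2 * b * X + Y + 2 * Z := by
  simp [Cmb123.M₁, x, y, z, k]

lemma cmb123_M₁_eq : Cmb123.M₁ =
    linearForm (2 * b) 1 2 :=
  eq_of_eval fun X Y Z => by
    rw [eval_cmb123_M₁, eval_linearForm_vec]
    ring

lemma grad_cmb123_M₁ (X Y Z : ℂ) : grad Cmb123.M₁ ![X, Y, Z] =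
    ![2 * b, 1, 2] := by
  rw [cmb123_M₁_eq, grad_linearForm_vec]

lemma isSmoothForm_cmb123_M₁ : IsSmoothForm Cmb123.M₁ 1 := by
  rw [cmb123_M₁_eq]
  exact isSmoothForm_linearForm 1 (by norm_num)

/-- The coefficients of `Cmb123.M₁`, up to a factor. -/
def cmb123_M₁Coeffs : Fin 9 → ℤ√2 :=
  ![0, 0, 0, 0, 0, 0, ⟨0, 2⟩, 1, 2]

lemma formVal_cmb123_M₁Coeffs (X Y Z : ℂ) : formVal (zsqrtdToComplex ∘ cmb123_M₁Coeffs) ![X, Y, Z] =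
    1 * eval ![X, Y, Z] Cmb123.M₁ := by
  rw [eval_cmb123_M₁]
  simp [formVal, cmb123_M₁Coeffs, zsqrtdToComplex_apply]

lemma eval_cmb123_M₂ (X Y Z : ℂ) : eval ![X, Y, Z] Cmb123.M₂ =
    -2 * b * X + Y + 2 * Z := by
  simp [Cmb123.M₂, x, y, z, k]

lemma cmb123_M₂_eq : Cmb123.M₂ =
    linearForm (-2 * b) 1 2 :=
  eq_of_eval fun X Y Z => by
    rw [eval_cmb123_M₂, eval_linearForm_vec]
    ring

lemma grad_cmb123_M₂ (X Y Z : ℂ) : grad Cmb123.M₂ ![X, Y, Z] =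
    ![-2 * b, 1, 2] := by
  rw [cmb123_M₂_eq, grad_linearForm_vec]

lemma isSmoothForm_cmb123_M₂ : IsSmoothForm Cmb123.M₂ 1 := by
  rw [cmb123_M₂_eq]
  exact isSmoothForm_linearForm 1 (by norm_num)

/-- The coefficients of `Cmb123.M₂`, up to a factor. -/
def cmb123_M₂Coeffs : Fin 9 → ℤ√2 :=
  ![0, 0, 0, 0, 0, 0, ⟨0, -2⟩, 1, 2]

lemma formVal_cmb123_M₂Coeffs (X Y Z : ℂ) : formVal (zsqrtdToComplex ∘ cmb123_M₂Coeffs) ![X, Y, Z] =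
    1 * eval ![X, Y, Z] Cmb123.M₂ := by
  rw [eval_cmb123_M₂]
  simp [formVal, cmb123_M₂Coeffs, zsqrtdToComplex_apply]

lemma eval_cmb124_D (X Y Z : ℂ) : eval ![X, Y, Z] Cmb124.D =
    -9 / 8 * X ^ 2 + Y * Z := by
  simp [Cmb124.D, x, y, z, k]

lemma cmb124_D_eq : Cmb124.D =
    quadraticForm (-9 / 8) 0 0 1 0 0 :=
  eq_of_eval fun X Y Z => by
    rw [eval_cmb124_D, eval_quadraticForm_vec]
    ring

lemma grad_cmb124_D (X Y Z : ℂ) : grad Cmb124.D ![X, Y, Z] =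
    ![-9 / 4 * X, Z, Y] := by
  rw [cmb124_D_eq, grad_quadraticForm_vec]
  congrm ![?_, ?_, ?_] <;> ring

lemma isSmoothForm_cmb124_D : IsSmoothForm Cmb124.D 2 := by
  rw [cmb124_D_eq]
  exact isSmoothForm_quadraticForm (ne_zero_of_mul (8 / 9) (by ring))

/-- The coefficients of `Cmb124.D`, up to a factor. -/
def cmb124_DCoeffs : Fin 9 → ℤ√2 :=
  ![-9, 0, 0, 8, 0, 0, 0, 0, 0]

/-- The factor 8 clears the denominator, since certificates need coefficients in `ℤ[√2]`. -/
lemma formVal_cmb124_DCoeffs (X Y Z : ℂ) : formVal (zsqrtdToComplex ∘ cmb124_DCoeffs) ![X, Y, Z] =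
    8 * eval ![X, Y, Z] Cmb124.D := by
  rw [eval_cmb124_D]
  simp [formVal, cmb124_DCoeffs, zsqrtdToComplex_apply]
  ring

lemma eval_cmb124_M₁ (X Y Z : ℂ) : eval ![X, Y, Z] Cmb124.M₁ =
    -X + Y - 2 * Z := by
  simp [Cmb124.M₁, x, y, z]

lemma cmb124_M₁_eq : Cmb124.M₁ =
    linearForm (-1) 1 (-2) :=
  eq_of_eval fun X Y Z => by
    rw [eval_cmb124_M₁, eval_linearForm_vec]
    ring

lemma grad_cmb124_M₁ (X Y Z : ℂ) : grad Cmb124.M₁ ![X, Y, Z] =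
    ![-1, 1, -2] := by
  rw [cmb124_M₁_eq, grad_linearForm_vec]

lemma isSmoothForm_cmb124_M₁ : IsSmoothForm Cmb124.M₁ 1 := by
  rw [cmb124_M₁_eq]
  exact isSmoothForm_linearForm 1 (by norm_num)

/-- The coefficients of `Cmb124.M₁`, up to a factor. -/
def cmb124_M₁Coeffs : Fin 9 → ℤ√2 :=
  ![0, 0, 0, 0, 0, 0, -1, 1, -2]

lemma formVal_cmb124_M₁Coeffs (X Y Z : ℂ) : formVal (zsqrtdToComplex ∘ cmb124_M₁Coeffs) ![X, Y, Z] =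
    1 * eval ![X, Y, Z] Cmb124.M₁ := by
  rw [eval_cmb124_M₁]
  simp [formVal, cmb124_M₁Coeffs, zsqrtdToComplex_apply]
  ring

lemma eval_cmb124_M₂ (X Y Z : ℂ) : eval ![X, Y, Z] Cmb124.M₂ =
    Y - Z := by
  simp [Cmb124.M₂, y, z]

lemma cmb124_M₂_eq : Cmb124.M₂ =
    linearForm 0 1 (-1) :=
  eq_of_eval fun X Y Z => by
    rw [eval_cmb124_M₂, eval_linearForm_vec]
    ring

lemma grad_cmb124_M₂ (X Y Z : ℂ) : grad Cmb124.M₂ ![X, Y, Z] =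
    ![0, 1, -1] := by
  rw [cmb124_M₂_eq, grad_linearForm_vec]

lemma isSmoothForm_cmb124_M₂ : IsSmoothForm Cmb124.M₂ 1 := by
  rw [cmb124_M₂_eq]
  exact isSmoothForm_linearForm 1 (by norm_num)

/-- The coefficients of `Cmb124.M₂`, up to a factor. -/
def cmb124_M₂Coeffs : Fin 9 → ℤ√2 :=
  ![0, 0, 0, 0, 0, 0, 0, 1, -1]

lemma formVal_cmb124_M₂Coeffs (X Y Z : ℂ) : formVal (zsqrtdToComplex ∘ cmb124_M₂Coeffs) ![X, Y, Z] =
    1 * eval ![X, Y, Z] Cmb124.M₂ := by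
  rw [eval_cmb124_M₂]
  simp [formVal, cmb124_M₂Coeffs, zsqrtdToComplex_apply]
  ring

lemma eval_cmb212_C₁ (X Y Z : ℂ) : eval ![X, Y, Z] Cmb212.C₁ =
    X ^ 2 + X * Y + Y ^ 2 - 27 / 4 * Z ^ 2 := by
  simp [Cmb212.C₁, x, y, z, k]

lemma cmb212_C₁_eq : Cmb212.C₁ =
    quadraticForm 1 1 (-27 / 4) 0 0 1 :=
  eq_of_eval fun X Y Z => by
    rw [eval_cmb212_C₁, eval_quadraticForm_vec]
    ring

lemma grad_cmb212_C₁ (X Y Z : ℂ) : grad Cmb212.C₁ ![X, Y, Z] =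
    ![2 * X + Y, X + 2 * Y, -27 / 2 * Z] := by
  rw [cmb212_C₁_eq, grad_quadraticForm_vec]
  congrm ![?_, ?_, ?_] <;> ring

lemma isSmoothForm_cmb212_C₁ : IsSmoothForm Cmb212.C₁ 2 := by
  rw [cmb212_C₁_eq]
  exact isSmoothForm_quadraticForm (ne_zero_of_mul (-4 / 81) (by ring))

/-- The coefficients of `Cmb212.C₁`, up to a factor. -/
def cmb212_C₁Coeffs : Fin 9 → ℤ√2 :=
  ![4, 4, -27, 0, 0, 4, 0, 0, 0]

lemma formVal_cmb212_C₁Coeffs (X Y Z : ℂ) : formVal (zsqrtdToComplex ∘ cmb212_C₁Coeffs) ![X, Y, Z] =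
    4 * eval ![X, Y, Z] Cmb212.C₁ := by
  rw [eval_cmb212_C₁]
  simp [formVal, cmb212_C₁Coeffs, zsqrtdToComplex_apply]
  ring

lemma eval_cmb212_C₂ (X Y Z : ℂ) : eval ![X, Y, Z] Cmb212.C₂ =
    676 * X ^ 2 + 764 * X * Y + 676 * Y ^ 2 - 4563 * Z ^ 2 := by
  simp [Cmb212.C₂, x, y, z]
  ring

lemma cmb212_C₂_eq : Cmb212.C₂ =
    quadraticForm 676 676 (-4563) 0 0 764 :=
  eq_of_eval fun X Y Z => by
    rw [eval_cmb212_C₂, eval_quadraticForm_vec]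
    ring

lemma grad_cmb212_C₂ (X Y Z : ℂ) : grad Cmb212.C₂ ![X, Y, Z] =
    ![1352 * X + 764 * Y, 764 * X + 1352 * Y, -9126 * Z] := by
  rw [cmb212_C₂_eq, grad_quadraticForm_vec]
  congrm ![?_, ?_, ?_] <;> ring

lemma isSmoothForm_cmb212_C₂ : IsSmoothForm Cmb212.C₂ 2 := by
  rw [cmb212_C₂_eq]
  exact isSmoothForm_quadraticForm (ne_zero_of_mul (-1 / 5677321104) (by ring))

/-- The coefficients of `Cmb212.C₂`, up to a factor. -/
def cmb212_C₂Coeffs : Fin 9 → ℤ√2 :=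
  ![676, 676, -4563, 0, 0, 764, 0, 0, 0]

lemma formVal_cmb212_C₂Coeffs (X Y Z : ℂ) : formVal (zsqrtdToComplex ∘ cmb212_C₂Coeffs) ![X, Y, Z] =
    1 * eval ![X, Y, Z] Cmb212.C₂ := by
  rw [eval_cmb212_C₂]
  simp [formVal, cmb212_C₂Coeffs, zsqrtdToComplex_apply]
  ring

lemma eval_cmb212_M₀ (X Y Z : ℂ) : eval ![X, Y, Z] Cmb212.M₀ =
    Y := by
  simp [Cmb212.M₀, y]

lemma cmb212_M₀_eq : Cmb212.M₀ =
    linearForm 0 1 0 :=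
  eq_of_eval fun X Y Z => by
    rw [eval_cmb212_M₀, eval_linearForm_vec]
    ring

lemma grad_cmb212_M₀ (X Y Z : ℂ) : grad Cmb212.M₀ ![X, Y, Z] =
    ![0, 1, 0] := by
  rw [cmb212_M₀_eq, grad_linearForm_vec]

lemma isSmoothForm_cmb212_M₀ : IsSmoothForm Cmb212.M₀ 1 := by
  rw [cmb212_M₀_eq]
  exact isSmoothForm_linearForm 1 (by norm_num)

/-- The coefficients of `Cmb212.M₀`, up to a factor. -/
def cmb212_M₀Coeffs : Fin 9 → ℤ√2 :=
  ![0, 0, 0, 0, 0, 0, 0, 1, 0]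

lemma formVal_cmb212_M₀Coeffs (X Y Z : ℂ) : formVal (zsqrtdToComplex ∘ cmb212_M₀Coeffs) ![X, Y, Z] =
    1 * eval ![X, Y, Z] Cmb212.M₀ := by
  rw [eval_cmb212_M₀]
  simp [formVal, cmb212_M₀Coeffs, zsqrtdToComplex_apply]

lemma eval_cmb212_M₁ (X Y Z : ℂ) : eval ![X, Y, Z] Cmb212.M₁ =
    15 * X + 8 * Y - 39 * Z := by
  simp [Cmb212.M₁, x, y, z]

lemma cmb212_M₁_eq : Cmb212.M₁ =
    linearForm 15 8 (-39) :=
  eq_of_eval fun X Y Z => by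
    rw [eval_cmb212_M₁, eval_linearForm_vec]
    ring

lemma grad_cmb212_M₁ (X Y Z : ℂ) : grad Cmb212.M₁ ![X, Y, Z] =
    ![15, 8, -39] := by
  rw [cmb212_M₁_eq, grad_linearForm_vec]

lemma isSmoothForm_cmb212_M₁ : IsSmoothForm Cmb212.M₁ 1 := by
  rw [cmb212_M₁_eq]
  exact isSmoothForm_linearForm 1 (by norm_num)

/-- The coefficients of `Cmb212.M₁`, up to a factor. -/
def cmb212_M₁Coeffs : Fin 9 → ℤ√2 :=
  ![0, 0, 0, 0, 0, 0, 15, 8, -39]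

lemma formVal_cmb212_M₁Coeffs (X Y Z : ℂ) : formVal (zsqrtdToComplex ∘ cmb212_M₁Coeffs) ![X, Y, Z] =
    1 * eval ![X, Y, Z] Cmb212.M₁ := by
  rw [eval_cmb212_M₁]
  simp [formVal, cmb212_M₁Coeffs, zsqrtdToComplex_apply]
  ring

lemma eval_cmb212_M₂ (X Y Z : ℂ) : eval ![X, Y, Z] Cmb212.M₂ =
    15 * X + 8 * Y + 39 * Z := by
  simp [Cmb212.M₂, x, y, z]

lemma cmb212_M₂_eq : Cmb212.M₂ =
    linearForm 15 8 39 :=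
  eq_of_eval fun X Y Z => by
    rw [eval_cmb212_M₂, eval_linearForm_vec]

lemma grad_cmb212_M₂ (X Y Z : ℂ) : grad Cmb212.M₂ ![X, Y, Z] =
    ![15, 8, 39] := by
  rw [cmb212_M₂_eq, grad_linearForm_vec]

lemma isSmoothForm_cmb212_M₂ : IsSmoothForm Cmb212.M₂ 1 := by
  rw [cmb212_M₂_eq]
  exact isSmoothForm_linearForm 1 (by norm_num)

/-- The coefficients of `Cmb212.M₂`, up to a factor. -/
def cmb212_M₂Coeffs : Fin 9 → ℤ√2 :=
  ![0, 0, 0, 0, 0, 0, 15, 8, 39]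

lemma formVal_cmb212_M₂Coeffs (X Y Z : ℂ) : formVal (zsqrtdToComplex ∘ cmb212_M₂Coeffs) ![X, Y, Z] =
    1 * eval ![X, Y, Z] Cmb212.M₂ := by
  rw [eval_cmb212_M₂]
  simp [formVal, cmb212_M₂Coeffs, zsqrtdToComplex_apply]

lemma eval_cmb212_M₃ (X Y Z : ℂ) : eval ![X, Y, Z] Cmb212.M₃ =
    8 * X + 15 * Y - 39 * Z := by
  simp [Cmb212.M₃, x, y, z]

lemma cmb212_M₃_eq : Cmb212.M₃ =
    linearForm 8 15 (-39) :=
  eq_of_eval fun X Y Z => by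
    rw [eval_cmb212_M₃, eval_linearForm_vec]
    ring

lemma grad_cmb212_M₃ (X Y Z : ℂ) : grad Cmb212.M₃ ![X, Y, Z] =
    ![8, 15, -39] := by
  rw [cmb212_M₃_eq, grad_linearForm_vec]

lemma isSmoothForm_cmb212_M₃ : IsSmoothForm Cmb212.M₃ 1 := by
  rw [cmb212_M₃_eq]
  exact isSmoothForm_linearForm 1 (by norm_num)

/-- The coefficients of `Cmb212.M₃`, up to a factor. -/
def cmb212_M₃Coeffs : Fin 9 → ℤ√2 :=
  ![0, 0, 0, 0, 0, 0, 8, 15, -39]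

lemma formVal_cmb212_M₃Coeffs (X Y Z : ℂ) : formVal (zsqrtdToComplex ∘ cmb212_M₃Coeffs) ![X, Y, Z] =
    1 * eval ![X, Y, Z] Cmb212.M₃ := by
  rw [eval_cmb212_M₃]
  simp [formVal, cmb212_M₃Coeffs, zsqrtdToComplex_apply]
  ring

lemma eval_cmb224_C₁ (X Y Z : ℂ) : eval ![X, Y, Z] Cmb224.C₁ =
    -X ^ 2 + Y * Z + 2 * Z ^ 2 := by
  simp [Cmb224.C₁, x, y, z]

lemma cmb224_C₁_eq : Cmb224.C₁ =
    quadraticForm (-1) 0 2 1 0 0 :=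
  eq_of_eval fun X Y Z => by
    rw [eval_cmb224_C₁, eval_quadraticForm_vec]
    ring

lemma grad_cmb224_C₁ (X Y Z : ℂ) : grad Cmb224.C₁ ![X, Y, Z] =
    ![-2 * X, Z, Y + 4 * Z] := by
  rw [cmb224_C₁_eq, grad_quadraticForm_vec]
  congrm ![?_, ?_, ?_] <;> ring

lemma isSmoothForm_cmb224_C₁ : IsSmoothForm Cmb224.C₁ 2 := by
  rw [cmb224_C₁_eq]
  exact isSmoothForm_quadraticForm (ne_zero_of_mul 1 (by ring))

/-- The coefficients of `Cmb224.C₁`, up to a factor. -/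
def cmb224_C₁Coeffs : Fin 9 → ℤ√2 :=
  ![-1, 0, 2, 1, 0, 0, 0, 0, 0]

lemma formVal_cmb224_C₁Coeffs (X Y Z : ℂ) : formVal (zsqrtdToComplex ∘ cmb224_C₁Coeffs) ![X, Y, Z] =
    1 * eval ![X, Y, Z] Cmb224.C₁ := by
  rw [eval_cmb224_C₁]
  simp [formVal, cmb224_C₁Coeffs, zsqrtdToComplex_apply]
  ring

lemma eval_cmb224_C₂ (X Y Z : ℂ) : eval ![X, Y, Z] Cmb224.C₂ =
    X ^ 2 + Y ^ 2 - 2 * Y * Z - 4 * Z ^ 2 := by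
  simp [Cmb224.C₂, x, y, z]
  ring

lemma cmb224_C₂_eq : Cmb224.C₂ =
    quadraticForm 1 1 (-4) (-2) 0 0 :=
  eq_of_eval fun X Y Z => by
    rw [eval_cmb224_C₂, eval_quadraticForm_vec]
    ring

lemma grad_cmb224_C₂ (X Y Z : ℂ) : grad Cmb224.C₂ ![X, Y, Z] =
    ![2 * X, 2 * Y - 2 * Z, -2 * Y - 8 * Z] := by
  rw [cmb224_C₂_eq, grad_quadraticForm_vec]
  congrm ![?_, ?_, ?_] <;> ring

lemma isSmoothForm_cmb224_C₂ : IsSmoothForm Cmb224.C₂ 2 := by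
  rw [cmb224_C₂_eq]
  exact isSmoothForm_quadraticForm (ne_zero_of_mul (-1 / 20) (by ring))

/-- The coefficients of `Cmb224.C₂`, up to a factor. -/
def cmb224_C₂Coeffs : Fin 9 → ℤ√2 :=
  ![1, 1, -4, -2, 0, 0, 0, 0, 0]

lemma formVal_cmb224_C₂Coeffs (X Y Z : ℂ) : formVal (zsqrtdToComplex ∘ cmb224_C₂Coeffs) ![X, Y, Z] =
    1 * eval ![X, Y, Z] Cmb224.C₂ := by
  rw [eval_cmb224_C₂]
  simp [formVal, cmb224_C₂Coeffs, zsqrtdToComplex_apply]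
  ring

lemma eval_cmb224_D (X Y Z : ℂ) : eval ![X, Y, Z] Cmb224.D =
    -1 / 2 * X ^ 2 + Y * Z + 2 * Z ^ 2 := by
  simp [Cmb224.D, x, y, z, k]

lemma cmb224_D_eq : Cmb224.D =
    quadraticForm (-1 / 2) 0 2 1 0 0 :=
  eq_of_eval fun X Y Z => by
    rw [eval_cmb224_D, eval_quadraticForm_vec]
    ring

lemma grad_cmb224_D (X Y Z : ℂ) : grad Cmb224.D ![X, Y, Z] =
    ![-X, Z, Y + 4 * Z] := by
  rw [cmb224_D_eq, grad_quadraticForm_vec]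
  congrm ![?_, ?_, ?_] <;> ring

lemma isSmoothForm_cmb224_D : IsSmoothForm Cmb224.D 2 := by
  rw [cmb224_D_eq]
  exact isSmoothForm_quadraticForm (ne_zero_of_mul 2 (by ring))

/-- The coefficients of `Cmb224.D`, up to a factor. -/
def cmb224_DCoeffs : Fin 9 → ℤ√2 :=
  ![-1, 0, 4, 2, 0, 0, 0, 0, 0]

lemma formVal_cmb224_DCoeffs (X Y Z : ℂ) : formVal (zsqrtdToComplex ∘ cmb224_DCoeffs) ![X, Y, Z] =
    2 * eval ![X, Y, Z] Cmb224.D := by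
  rw [eval_cmb224_D]
  simp [formVal, cmb224_DCoeffs, zsqrtdToComplex_apply]
  ring

lemma eval_cmb224_M₁ (X Y Z : ℂ) : eval ![X, Y, Z] Cmb224.M₁ =
    -X + Y := by
  simp [Cmb224.M₁, x, y]

lemma cmb224_M₁_eq : Cmb224.M₁ =
    linearForm (-1) 1 0 :=
  eq_of_eval fun X Y Z => by
    rw [eval_cmb224_M₁, eval_linearForm_vec]
    ring

lemma grad_cmb224_M₁ (X Y Z : ℂ) : grad Cmb224.M₁ ![X, Y, Z] =
    ![-1, 1, 0] := by
  rw [cmb224_M₁_eq, grad_linearForm_vec]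

lemma isSmoothForm_cmb224_M₁ : IsSmoothForm Cmb224.M₁ 1 := by
  rw [cmb224_M₁_eq]
  exact isSmoothForm_linearForm 1 (by norm_num)

/-- The coefficients of `Cmb224.M₁`, up to a factor. -/
def cmb224_M₁Coeffs : Fin 9 → ℤ√2 :=
  ![0, 0, 0, 0, 0, 0, -1, 1, 0]

lemma formVal_cmb224_M₁Coeffs (X Y Z : ℂ) : formVal (zsqrtdToComplex ∘ cmb224_M₁Coeffs) ![X, Y, Z] =
    1 * eval ![X, Y, Z] Cmb224.M₁ := by
  rw [eval_cmb224_M₁]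
  simp [formVal, cmb224_M₁Coeffs, zsqrtdToComplex_apply]

lemma eval_cmb224_M₂ (X Y Z : ℂ) : eval ![X, Y, Z] Cmb224.M₂ =
    -3 * X + Y + 4 * Z := by
  simp [Cmb224.M₂, x, y, z]

lemma cmb224_M₂_eq : Cmb224.M₂ =
    linearForm (-3) 1 4 :=
  eq_of_eval fun X Y Z => by
    rw [eval_cmb224_M₂, eval_linearForm_vec]
    ring

lemma grad_cmb224_M₂ (X Y Z : ℂ) : grad Cmb224.M₂ ![X, Y, Z] =
    ![-3, 1, 4] := by
  rw [cmb224_M₂_eq, grad_linearForm_vec]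

lemma isSmoothForm_cmb224_M₂ : IsSmoothForm Cmb224.M₂ 1 := by
  rw [cmb224_M₂_eq]
  exact isSmoothForm_linearForm 1 (by norm_num)

/-- The coefficients of `Cmb224.M₂`, up to a factor. -/
def cmb224_M₂Coeffs : Fin 9 → ℤ√2 :=
  ![0, 0, 0, 0, 0, 0, -3, 1, 4]

lemma formVal_cmb224_M₂Coeffs (X Y Z : ℂ) : formVal (zsqrtdToComplex ∘ cmb224_M₂Coeffs) ![X, Y, Z] =
    1 * eval ![X, Y, Z] Cmb224.M₂ := by
  rw [eval_cmb224_M₂]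
  simp [formVal, cmb224_M₂Coeffs, zsqrtdToComplex_apply]

/-! ### The `cmb123` pair: singular points and combinatorics. -/

/-- The degrees of the components. -/
def cmb123Degrees : Fin 5 → ℕ := ![2, 1, 1, 2, 1]

/-- The local types at the singular points. -/
def cmb123Types : Fin 10 → Fin 5 → Branch :=
  ![node 0 1, node 0 1, triplePoint 0 2 3, triplePoint 0 2 3, triplePoint 1 2 4, tacnode 0 3,
    tacnode 1 3, tacnode 4 0, node 3 4, node 3 4]

lemma isSeparating_cmb123Types : IsSeparating cmb123Types := by
  unfold IsSeparating
  decide +kernel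

/-- These are the only pairs of singular points not already separated by the components through
them. -/
lemma cmb123Types_eq : ∀ u v, u < v →
    (∀ i, cmb123Types u i = .away ↔ cmb123Types v i = .away) →
    (u = 0 ∧ v = 1) ∨ (u = 2 ∧ v = 3) ∨ (u = 8 ∧ v = 9) := by
  decide +kernel

/-- As in the lemmas of this kind below, eliminating `Y` by means of the line leaves a binary
quadratic in `X` and `Z`. Each linear factor determines one point up to scaling; a double factor
means tangency. -/
lemma inter_cmb123_C_cmb123_L₁ {X Y Z : ℂ}
    (h : eval ![X, Y, Z] Cmb123.C = 0) (h' : eval ![X, Y, Z] Cmb123.L₁ = 0) :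
    Proportional ![X, Y, Z] ![-2, 4, 1] ∨ Proportional ![X, Y, Z] ![-1, 1, 1] := by
  rw [eval_cmb123_C] at h
  rw [eval_cmb123_L₁] at h'
  have key : (X + 2 * Z) * (X + Z) = 0 := by linear_combination -h + Z * h'
  rcases mul_eq_zero.1 key with e | e
  · exact .inl (proportional_of_coordinates Z (by linear_combination e) (by linear_combination -3 *
    e + h') (by ring))
  · exact .inr (proportional_of_coordinates Z (by linear_combination e) (by linear_combination -3 *
    e + h') (by ring))

lemma inter_cmb123_C_cmb123_L₂ {X Y Z : ℂ}
    (h : eval ![X, Y, Z] Cmb123.C = 0) (h' : eval ![X, Y, Z] Cmb123.L₂ = 0) :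
    Proportional ![X, Y, Z] ![2, 4, 1] ∨ Proportional ![X, Y, Z] ![1, 1, 1] := by
  rw [eval_cmb123_C] at h
  rw [eval_cmb123_L₂] at h'
  have key : (X - 2 * Z) * (X - Z) = 0 := by linear_combination -h + Z * h'
  rcases mul_eq_zero.1 key with e | e
  · exact .inl (proportional_of_coordinates Z (by linear_combination e) (by linear_combination 3 * e
    + h') (by ring))
  · exact .inr (proportional_of_coordinates Z (by linear_combination e) (by linear_combination 3 * e
    + h') (by ring))

lemma inter_cmb123_C_cmb123_D {X Y Z : ℂ}
    (h : eval ![X, Y, Z] Cmb123.C = 0) (h' : eval ![X, Y, Z] Cmb123.D = 0) :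
    Proportional ![X, Y, Z] ![2, 4, 1] ∨ Proportional ![X, Y, Z] ![1, 1, 1] ∨ Proportional ![X, Y,
      Z] ![0, 1, 0] := by
  rw [eval_cmb123_C] at h
  rw [eval_cmb123_D] at h'
  -- The pencil of the two conics contains the degenerate member `z L₂`: one has `D = (18 - 12 * b)
  -- C + (12 * b - 17) z L₂`. The line `z = 0` touches `C`, which gives the tangency at `(0, 1, 0)`,
  -- and `L₂` cuts out the other two points.
  have hh : (Z) * (-3 * X + Y + 2 * Z) = 0 := by linear_combination (12 * b + 18) * h + (-12 * b -
    17) * h' + (144 * X ^ 2 - 432 * X * Z + 288 * Z ^ 2) * b_mul_b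
  rcases mul_eq_zero.1 hh with h₁ | h₁
  · have e : X = 0 := pow_eq_zero_iff two_ne_zero |>.1 (by linear_combination -h + Y * h₁)
    exact .inr (.inr (proportional_of_coordinates Y (by linear_combination e) (by ring) (by
      linear_combination h₁)))
  · have key : (X - 2 * Z) * (X - Z) = 0 := by linear_combination -h + Z * h₁
    rcases mul_eq_zero.1 key with e | e
    · exact .inl (proportional_of_coordinates Z (by linear_combination e) (by linear_combination 3 *
      e + h₁) (by ring))
    · exact .inr (.inl (proportional_of_coordinates Z (by linear_combination e) (by
      linear_combination 3 * e + h₁) (by ring)))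

/-- The line is tangent to the conic: elimination leaves the square of `X + b Z`. -/
lemma inter_cmb123_C_cmb123_M₁ {X Y Z : ℂ}
    (h : eval ![X, Y, Z] Cmb123.C = 0) (h' : eval ![X, Y, Z] Cmb123.M₁ = 0) :
    Proportional ![X, Y, Z] ![-b, 2, 1] := by
  rw [eval_cmb123_C] at h
  rw [eval_cmb123_M₁] at h'
  have e : b * Z + X = 0 := pow_eq_zero_iff two_ne_zero |>.1 (by linear_combination -h + Z * h' + Z
    ^ 2 * b_mul_b)
  exact proportional_of_coordinates Z (by linear_combination e) (by linear_combination -2 * b * e +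
    h' + 2 * Z * b_mul_b) (by ring)

lemma inter_cmb123_L₁_cmb123_L₂ {X Y Z : ℂ}
    (h : eval ![X, Y, Z] Cmb123.L₁ = 0) (h' : eval ![X, Y, Z] Cmb123.L₂ = 0) :
    Proportional ![X, Y, Z] ![0, -2, 1] := by
  rw [eval_cmb123_L₁] at h
  rw [eval_cmb123_L₂] at h'
  exact proportional_of_coordinates Z (by linear_combination 1 / 6 * h - 1 / 6 * h') (by
    linear_combination 1 / 2 * h + 1 / 2 * h') (by ring)

lemma inter_cmb123_L₁_cmb123_D {X Y Z : ℂ}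
    (h : eval ![X, Y, Z] Cmb123.L₁ = 0) (h' : eval ![X, Y, Z] Cmb123.D = 0) :
    Proportional ![X, Y, Z] ![-b, 3 * b - 2, 1] := by
  rw [eval_cmb123_L₁] at h
  rw [eval_cmb123_D] at h'
  have e : b * Z + X = 0 := pow_eq_zero_iff two_ne_zero |>.1 (by linear_combination (-1 / 3 * b - 1
    / 2) * h' + (1 / 3 * b * Z + 1 / 2 * Z) * h + (4 * X ^ 2 - 12 * X * Z + 9 * Z ^ 2) * b_mul_b)
  exact proportional_of_coordinates Z (by linear_combination e) (by linear_combination -3 * e + h)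
    (by ring)

lemma inter_cmb123_L₁_cmb123_M₁ {X Y Z : ℂ}
    (h : eval ![X, Y, Z] Cmb123.L₁ = 0) (h' : eval ![X, Y, Z] Cmb123.M₁ = 0) :
    Proportional ![X, Y, Z] ![0, -2, 1] := by
  rw [eval_cmb123_L₁] at h
  rw [eval_cmb123_M₁] at h'
  exact proportional_of_coordinates Z (by linear_combination (2 * b + 3) * h + (-2 * b - 3) * h' + 4
    * X * b_mul_b) (by linear_combination (-6 * b - 8) * h + (6 * b + 9) * h' - 12 * X * b_mul_b)
    (by ring)

lemma inter_cmb123_L₂_cmb123_D {X Y Z : ℂ}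
    (h : eval ![X, Y, Z] Cmb123.L₂ = 0) (h' : eval ![X, Y, Z] Cmb123.D = 0) :
    Proportional ![X, Y, Z] ![2, 4, 1] ∨ Proportional ![X, Y, Z] ![1, 1, 1] := by
  rw [eval_cmb123_L₂] at h
  rw [eval_cmb123_D] at h'
  have key : (X - 2 * Z) * (X - Z) = 0 := by linear_combination (-1 / 3 * b - 1 / 2) * h' + (1 / 3 *
    b * Z + 1 / 2 * Z) * h + (4 * X ^ 2 - 12 * X * Z + 8 * Z ^ 2) * b_mul_b
  rcases mul_eq_zero.1 key with e | e
  · exact .inl (proportional_of_coordinates Z (by linear_combination e) (by linear_combination 3 * e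
    + h) (by ring))
  · exact .inr (proportional_of_coordinates Z (by linear_combination e) (by linear_combination 3 * e
    + h) (by ring))

lemma inter_cmb123_L₂_cmb123_M₁ {X Y Z : ℂ}
    (h : eval ![X, Y, Z] Cmb123.L₂ = 0) (h' : eval ![X, Y, Z] Cmb123.M₁ = 0) :
    Proportional ![X, Y, Z] ![0, -2, 1] := by
  rw [eval_cmb123_L₂] at h
  rw [eval_cmb123_M₁] at h'
  exact proportional_of_coordinates Z (by linear_combination (2 * b - 3) * h + (-2 * b + 3) * h' + 4
    * X * b_mul_b) (by linear_combination (6 * b - 8) * h + (-6 * b + 9) * h' + 12 * X * b_mul_b)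
    (by ring)

/-- The two `X`-coordinates (with `Z = 1`) are the roots of the quadratic in `hr`, whose
discriminant `(1 - 24 * b) / 36` is negative, so they do not lie in `ℚ(√2)`. -/
lemma inter_cmb123_D_cmb123_M₁ {X Y Z : ℂ} {r : ℂ} (hr : 2 * b * r + r ^ 2 - 1 / 6 * r + 2 = 0)
    (h : eval ![X, Y, Z] Cmb123.D = 0) (h' : eval ![X, Y, Z] Cmb123.M₁ = 0) :
    Proportional ![X, Y, Z] ![r, -2 * b * r - 2, 1] ∨ Proportional ![X, Y, Z] ![-2 * b - r + 1 / 6,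
      4 * b ^ 2 + 2 * b * r - 1 / 3 * b - 2, 1] := by
  rw [eval_cmb123_D] at h
  rw [eval_cmb123_M₁] at h'
  have key : (-r * Z + X) * (2 * b * Z + r * Z + X - 1 / 6 * Z) = 0 := by linear_combination (-1 / 3
    * b - 1 / 2) * h + (1 / 3 * b * Z + 1 / 2 * Z) * h' - Z ^ 2 * hr + (4 * X ^ 2 - 38 / 3 * X * Z +
    8 * Z ^ 2) * b_mul_b
  rcases mul_eq_zero.1 key with e | e
  · exact .inl (proportional_of_coordinates Z (by linear_combination e) (by linear_combination -2 *
    b * e + h') (by ring))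
  · exact .inr (proportional_of_coordinates Z (by linear_combination e) (by linear_combination -2 *
    b * e + h') (by ring))

/-- The components of the first curve. -/
def cmb123First : Fin 5 → S :=
  ![Cmb123.C, Cmb123.L₁, Cmb123.L₂, Cmb123.D, Cmb123.M₁]

/-- The singular points of the first curve. -/
def cmb123FirstPoints (r : ℂ) : Fin 10 → Fin 3 → ℂ :=
  ![![-2, 4, 1], ![-1, 1, 1], ![2, 4, 1], ![1, 1, 1], ![0, -2, 1], ![0, 1, 0], ![-b, 3 * b - 2, 1],
    ![-b, 2, 1], ![r, -2 * b * r - 2, 1], ![-2 * b - r + 1 / 6, 4 * b ^ 2 + 2 * b * r - 1 / 3 * b -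
    2, 1]]

/-- For every point the data are an affine chart, the local coordinates with their multipliers, and
inverses of all values that must not vanish. The multipliers come from the same identities that
locate the point. -/
lemma hasLocalForm_cmb123First {r : ℂ} (hr : 2 * b * r + r ^ 2 - 1 / 6 * r + 2 = 0) (a : Fin 10) :
    HasLocalForm cmb123First (cmb123Types a) (cmb123FirstPoints r a) := by
  have h0 : HasLocalForm cmb123First (node 0 1) ![-2, 4, 1] :=
    hasLocalForm_node 0 1 2 rfl ((eval_cmb123_C ..).trans (by ring)) ((eval_cmb123_L₁ ..).trans (by
      ring)) (cross_two_ne_zero (grad_cmb123_C ..) (grad_cmb123_L₁ ..) (ne_zero_of_mul 1 (by ring)))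
      (forall_fin_five (fun h => absurd rfl h) (fun _ h => absurd rfl h) (fun _ _ => (eval_cmb123_L₂
      ..).trans_ne (ne_zero_of_mul (1 / 12) (by ring))) (fun _ _ => (eval_cmb123_D ..).trans_ne
      (ne_zero_of_mul (-b - 17 / 12) (by linear_combination -144 * b_mul_b))) (fun _ _ =>
      (eval_cmb123_M₁ ..).trans_ne (ne_zero_of_mul (b + 3 / 2) (by linear_combination -4 *
      b_mul_b))))
  have h1 : HasLocalForm cmb123First (node 0 1) ![-1, 1, 1] :=
    hasLocalForm_node 0 1 2 rfl ((eval_cmb123_C ..).trans (by ring)) ((eval_cmb123_L₁ ..).trans (by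
      ring)) (cross_two_ne_zero (grad_cmb123_C ..) (grad_cmb123_L₁ ..) (ne_zero_of_mul (-1) (by
      ring))) (forall_fin_five (fun h => absurd rfl h) (fun _ h => absurd rfl h) (fun _ _ =>
      (eval_cmb123_L₂ ..).trans_ne (ne_zero_of_mul (1 / 6) (by ring))) (fun _ _ => (eval_cmb123_D
      ..).trans_ne (ne_zero_of_mul (-2 * b - 17 / 6) (by linear_combination -144 * b_mul_b))) (fun _
      _ => (eval_cmb123_M₁ ..).trans_ne (ne_zero_of_mul (2 * b + 3) (by linear_combination -4 *
      b_mul_b))))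
  -- The identity is `D = (18 - 12 * b) C + (12 * b - 17) z L₂`; the second coefficient is nonzero
  -- at the point because `z = 1` there.
  have h2 : HasLocalForm cmb123First (triplePoint 0 2 3) ![2, 4, 1] :=
    hasLocalForm_triplePoint 0 2 3 2 (C (-12 * b + 18) : S) (linearForm 0 0 (12 * b - 17)) (C 1) rfl
      ((eval_cmb123_C ..).trans (by ring)) ((eval_cmb123_L₂ ..).trans (by ring)) (cross_two_ne_zero
      (grad_cmb123_C ..) (grad_cmb123_L₂ ..) (ne_zero_of_mul (-1) (by ring))) ((eval_C _).trans_ne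
      (ne_zero_of_mul (1 / 3 * b + 1 / 2) (by linear_combination -4 * b_mul_b)))
      ((eval_linearForm_vec ..).trans_ne (ne_zero_of_mul (-12 * b - 17) (by linear_combination -144
      * b_mul_b))) ((eval_C _).trans_ne (ne_zero_of_mul 1 (by ring))) (eq_of_eval fun X Y Z => by
        simp only [cmb123First, cons_val, map_add, map_mul, eval_C, eval_linearForm_vec,
          eval_cmb123_D, eval_cmb123_C, eval_cmb123_L₂]
        ring) (forall_fin_five (fun h => absurd rfl h) (fun _ _ _ => (eval_cmb123_L₁ ..).trans_ne
          (ne_zero_of_mul (1 / 12) (by ring))) (fun _ h => absurd rfl h) (fun _ _ h => absurd rfl h)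
          (fun _ _ _ => (eval_cmb123_M₁ ..).trans_ne (ne_zero_of_mul (-b + 3 / 2) (by
          linear_combination -4 * b_mul_b))))
  have h3 : HasLocalForm cmb123First (triplePoint 0 2 3) ![1, 1, 1] :=
    hasLocalForm_triplePoint 0 2 3 2 (C (-12 * b + 18) : S) (linearForm 0 0 (12 * b - 17)) (C 1) rfl
      ((eval_cmb123_C ..).trans (by ring)) ((eval_cmb123_L₂ ..).trans (by ring)) (cross_two_ne_zero
      (grad_cmb123_C ..) (grad_cmb123_L₂ ..) (ne_zero_of_mul 1 (by ring))) ((eval_C _).trans_ne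
      (ne_zero_of_mul (1 / 3 * b + 1 / 2) (by linear_combination -4 * b_mul_b)))
      ((eval_linearForm_vec ..).trans_ne (ne_zero_of_mul (-12 * b - 17) (by linear_combination -144
      * b_mul_b))) ((eval_C _).trans_ne (ne_zero_of_mul 1 (by ring))) (eq_of_eval fun X Y Z => by
        simp only [cmb123First, cons_val, map_add, map_mul, eval_C, eval_linearForm_vec,
          eval_cmb123_D, eval_cmb123_C, eval_cmb123_L₂]
        ring) (forall_fin_five (fun h => absurd rfl h) (fun _ _ _ => (eval_cmb123_L₁ ..).trans_ne
          (ne_zero_of_mul (1 / 6) (by ring))) (fun _ h => absurd rfl h) (fun _ _ h => absurd rfl h)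
          (fun _ _ _ => (eval_cmb123_M₁ ..).trans_ne (ne_zero_of_mul (-2 * b + 3) (by
          linear_combination -4 * b_mul_b))))
  -- The three concurrent lines are linearly dependent.
  have h4 : HasLocalForm cmb123First (triplePoint 1 2 4) ![0, -2, 1] :=
    hasLocalForm_triplePoint 1 2 4 2 (C (1 / 3 * b + 1 / 2) : S) (C (-1 / 3 * b + 1 / 2) : S) (C 1)
      rfl ((eval_cmb123_L₁ ..).trans (by ring)) ((eval_cmb123_L₂ ..).trans (by ring))
      (cross_two_ne_zero (grad_cmb123_L₁ ..) (grad_cmb123_L₂ ..) (ne_zero_of_mul (1 / 6) (by ring)))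
      ((eval_C _).trans_ne (ne_zero_of_mul (-12 * b + 18) (by linear_combination -4 * b_mul_b)))
      ((eval_C _).trans_ne (ne_zero_of_mul (12 * b + 18) (by linear_combination -4 * b_mul_b)))
      ((eval_C _).trans_ne (ne_zero_of_mul 1 (by ring))) (eq_of_eval fun X Y Z => by
        simp only [cmb123First, cons_val, map_add, map_mul, eval_C, eval_cmb123_M₁, eval_cmb123_L₁, eval_cmb123_L₂]
        ring) (forall_fin_five (fun _ _ _ => (eval_cmb123_C ..).trans_ne (ne_zero_of_mul (-1 / 2)
          (by ring))) (fun h => absurd rfl h) (fun _ h => absurd rfl h) (fun _ _ _ => (eval_cmb123_D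
          ..).trans_ne (ne_zero_of_mul (-1 / 6 * b - 1 / 4) (by linear_combination -4 * b_mul_b)))
          (fun _ _ h => absurd rfl h))
  -- Put `l = 12 * b - 17`, so that `D = (1 - l) C + l z L₂`. Multiplying by `l y L₂` and replacing
  -- `y z` by `C + x ^ 2` gives `l y L₂ D = (l (1 - l) y L₂ + l ^ 2 L₂ ^ 2) C + (l x L₂) ^ 2`. These
  -- are the three quadratic forms below.
  have h5 : HasLocalForm cmb123First (tacnode 0 3) ![0, 1, 0] :=
    hasLocalForm_tacnode 0 3 1 (quadraticForm (-3672 * b + 5193) (12 * b - 17) (-1632 * b + 2308)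
      (-792 * b + 1120) (4896 * b - 6924) (1188 * b - 1680)) (quadraticForm 0 (12 * b - 17) 0 (24 *
      b - 34) 0 (-36 * b + 51)) (quadraticForm (-36 * b + 51) 0 0 0 (24 * b - 34) (12 * b - 17)) rfl
      ((eval_cmb123_C ..).trans (by ring)) ((eval_quadraticForm_vec ..).trans (by ring))
      (cross_one_ne_zero (grad_quadraticForm_vec ..) (grad_cmb123_C ..) (ne_zero_of_mul (12 * b +
      17) (by linear_combination -144 * b_mul_b))) ((eval_quadraticForm_vec ..).trans_ne
      (ne_zero_of_mul (-12 * b - 17) (by linear_combination -144 * b_mul_b)))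
      ((eval_quadraticForm_vec ..).trans_ne (ne_zero_of_mul (-12 * b - 17) (by
      linear_combination -144 * b_mul_b))) (eq_of_eval fun X Y Z => by
        simp only [cmb123First, cons_val, map_add, map_mul, map_pow, eval_quadraticForm_vec, eval_cmb123_D, eval_cmb123_C]
        linear_combination (-1296 * X ^ 4 + 432 * X ^ 3 * Y + 1728 * X ^ 3 * Z + 1008 * X ^ 2 * Y *
          Z - 576 * X ^ 2 * Z ^ 2 - 432 * X * Y ^ 2 * Z - 1728 * X * Y * Z ^ 2 + 288 * Y ^ 2 * Z ^ 2
          + 576 * Y * Z ^ 3) * b_mul_b) (by decide) (forall_fin_five (fun h => absurd rfl h) (fun _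
          _ => (eval_cmb123_L₁ ..).trans_ne (ne_zero_of_mul 1 (by ring))) (fun _ _ =>
          (eval_cmb123_L₂ ..).trans_ne (ne_zero_of_mul 1 (by ring))) (fun _ h => absurd rfl h) (fun
          _ _ => (eval_cmb123_M₁ ..).trans_ne (ne_zero_of_mul 1 (by ring))))
  -- The constant multiplier of `D` makes its `x ^ 2` coefficient 1, so that modulo `L₁` the conic
  -- becomes the square of `x + b z`.
  have h6 : HasLocalForm cmb123First (tacnode 1 3) ![-b, 3 * b - 2, 1] :=
    hasLocalForm_tacnode 1 3 2 (linearForm 0 0 (-1 / 3 * b - 1 / 2)) (C (-1 / 3 * b - 1 / 2) : S)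
      (linearForm 1 0 b) rfl ((eval_cmb123_L₁ ..).trans (by ring)) ((eval_linearForm_vec ..).trans
      (by ring)) (cross_two_ne_zero (grad_linearForm_vec ..) (grad_cmb123_L₁ ..) (ne_zero_of_mul 1
      (by ring))) ((eval_linearForm_vec ..).trans_ne (ne_zero_of_mul (12 * b - 18) (by
      linear_combination -4 * b_mul_b))) ((eval_C _).trans_ne (ne_zero_of_mul (12 * b - 18) (by
      linear_combination -4 * b_mul_b))) (eq_of_eval fun X Y Z => by
        simp only [cmb123First, cons_val, map_add, map_mul, map_pow, eval_C, eval_linearForm_vec,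
          eval_cmb123_D, eval_cmb123_L₁]
        linear_combination (-4 * X ^ 2 + 12 * X * Z - 9 * Z ^ 2) * b_mul_b) (by decide)
          (forall_fin_five (fun _ _ => (eval_cmb123_C ..).trans_ne (ne_zero_of_mul (3 / 2 * b + 2)
          (by linear_combination (-3 / 2 * b + 5 / 2) * b_mul_b))) (fun h => absurd rfl h) (fun _ _
          => (eval_cmb123_L₂ ..).trans_ne (ne_zero_of_mul (1 / 12 * b) (by linear_combination 1 / 2
          * b_mul_b))) (fun _ h => absurd rfl h) (fun _ _ => (eval_cmb123_M₁ ..).trans_ne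
          (ne_zero_of_mul (3 / 2 * b + 2) (by linear_combination (-3 * b + 1 / 2) * b_mul_b))))
  have h7 : HasLocalForm cmb123First (tacnode 4 0) ![-b, 2, 1] :=
    hasLocalForm_tacnode 4 0 2 (linearForm 0 0 (-1)) (C (-1) : S) (linearForm 1 0 b) rfl
      ((eval_cmb123_M₁ ..).trans (by linear_combination -2 * b_mul_b)) ((eval_linearForm_vec
      ..).trans (by ring)) (cross_two_ne_zero (grad_linearForm_vec ..) (grad_cmb123_M₁ ..)
      (ne_zero_of_mul 1 (by ring))) ((eval_linearForm_vec ..).trans_ne (ne_zero_of_mul (-1) (by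
      ring))) ((eval_C _).trans_ne (ne_zero_of_mul (-1) (by ring))) (eq_of_eval fun X Y Z => by
        simp only [cmb123First, cons_val, map_add, map_mul, map_pow, eval_C, eval_linearForm_vec,
          eval_cmb123_C, eval_cmb123_M₁]
        linear_combination -Z ^ 2 * b_mul_b) (by decide) (forall_fin_five (fun _ h => absurd rfl h)
          (fun _ _ => (eval_cmb123_L₁ ..).trans_ne (ne_zero_of_mul (-3 / 2 * b - 2) (by
          linear_combination 9 / 2 * b_mul_b))) (fun _ _ => (eval_cmb123_L₂ ..).trans_ne
          (ne_zero_of_mul (3 / 2 * b - 2) (by linear_combination 9 / 2 * b_mul_b))) (fun _ _ =>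
          (eval_cmb123_D ..).trans_ne (ne_zero_of_mul (-3 / 2 * b - 2) (by linear_combination (-18 *
          b ^ 2 - 51 * b - 63 / 2) * b_mul_b))) (fun h => absurd rfl h))
  -- Transversality amounts to a nonzero discriminant of the quadratic of `r`. The denominator 1151
  -- is, up to sign, the norm of `1 - 24 * b`.
  have h8 : HasLocalForm cmb123First (node 3 4) ![r, -2 * b * r - 2, 1] :=
    hasLocalForm_node 3 4 2 rfl ((eval_cmb123_D ..).trans (by linear_combination (12 * b - 18) * hr
      - 24 * r * b_mul_b)) ((eval_cmb123_M₁ ..).trans (by ring)) (cross_two_ne_zero (grad_cmb123_D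
      ..) (grad_cmb123_M₁ ..) (ne_zero_of_mul (888 / 1151 * b * r + 1114 / 1151 * b + 1188 / 1151 *
      r + 1677 / 1151) (by linear_combination (21312 / 1151 * b ^ 2 - 3456 / 1151 * b - 42768 /
      1151) * hr + (-42624 / 1151 * b * r + 3456 / 1151 * r - 84956 / 1151) * b_mul_b)))
      (forall_fin_five (fun _ _ => (eval_cmb123_C ..).trans_ne (ne_zero_of_mul (6 * b + 3 * r - 1 /
      2) (by linear_combination (-6 * b - 3 * r) * hr))) (fun _ _ => (eval_cmb123_L₁ ..).trans_ne
      (ne_zero_of_mul (-b * r - 17 / 6 * b - 3 / 2 * r - 15 / 4) (by linear_combination (2 * b ^ 2 -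
      9 / 2) * hr + (-4 * b * r + 6 * r - 4) * b_mul_b))) (fun _ _ => (eval_cmb123_L₂ ..).trans_ne
      (ne_zero_of_mul (-b * r + 19 / 6 * b + 3 / 2 * r - 17 / 4) (by linear_combination (2 * b ^ 2 -
      9 / 2) * hr + (-4 * b * r - 6 * r - 4) * b_mul_b))) (fun h => absurd rfl h) (fun _ h => absurd
      rfl h))
  have h9 : HasLocalForm cmb123First (node 3 4) ![-2 * b - r + 1 / 6, 4 * b ^ 2 + 2 * b * r - 1 / 3
    * b - 2, 1] :=
    hasLocalForm_node 3 4 2 rfl ((eval_cmb123_D ..).trans (by linear_combination (12 * b - 18) * hr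
      + (48 * b + 24 * r - 4) * b_mul_b)) ((eval_cmb123_M₁ ..).trans (by ring)) (cross_two_ne_zero
      (grad_cmb123_D ..) (grad_cmb123_M₁ ..) (ne_zero_of_mul (-888 / 1151 * b * r - 1114 / 1151 * b
      - 1188 / 1151 * r - 1677 / 1151) (by linear_combination (21312 / 1151 * b ^ 2 - 3456 / 1151 *
      b - 42768 / 1151) * hr + (53472 / 1151 * b + 60480 / 1151 * r - 4460 / 1151) * b_mul_b)))
      (forall_fin_five (fun _ _ => (eval_cmb123_C ..).trans_ne (ne_zero_of_mul (-3 * r) (by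
      linear_combination (3 * r - 1 / 2) * hr))) (fun _ _ => (eval_cmb123_L₁ ..).trans_ne
      (ne_zero_of_mul (b * r + 3 / 2 * r) (by linear_combination (2 * b ^ 2 - 9 / 2) * hr - 4 *
      b_mul_b))) (fun _ _ => (eval_cmb123_L₂ ..).trans_ne (ne_zero_of_mul (b * r - 3 / 2 * r) (by
      linear_combination (2 * b ^ 2 - 9 / 2) * hr - 4 * b_mul_b))) (fun h => absurd rfl h) (fun _ h
      => absurd rfl h))
  fin_cases a
  exacts [h0, h1, h2, h3, h4, h5, h6, h7, h8, h9]

lemma isArrangement_cmb123First {r : ℂ} (hr : 2 * b * r + r ^ 2 - 1 / 6 * r + 2 = 0) :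
    IsArrangement cmb123First cmb123Degrees cmb123Types (cmb123FirstPoints r) where
  smooth := forall_fin_five isSmoothForm_cmb123_C isSmoothForm_cmb123_L₁ isSmoothForm_cmb123_L₂
    isSmoothForm_cmb123_D isSmoothForm_cmb123_M₁
  localForm := hasLocalForm_cmb123First hr
  cover := forall_lt_five (covered_of fun _ _ _ h h' => by
      rcases inter_cmb123_C_cmb123_L₁ h h' with e | e
      exacts [⟨0, e⟩, ⟨1, e⟩])
    (covered_of fun _ _ _ h h' => by
      rcases inter_cmb123_C_cmb123_L₂ h h' with e | e
      exacts [⟨2, e⟩, ⟨3, e⟩])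
    (covered_of fun _ _ _ h h' => by
      rcases inter_cmb123_C_cmb123_D h h' with e | e | e
      exacts [⟨2, e⟩, ⟨3, e⟩, ⟨5, e⟩])
    (covered_of fun _ _ _ h h' => ⟨7, inter_cmb123_C_cmb123_M₁ h h'⟩)
    (covered_of fun _ _ _ h h' => ⟨4, inter_cmb123_L₁_cmb123_L₂ h h'⟩)
    (covered_of fun _ _ _ h h' => ⟨6, inter_cmb123_L₁_cmb123_D h h'⟩)
    (covered_of fun _ _ _ h h' => ⟨4, inter_cmb123_L₁_cmb123_M₁ h h'⟩)
    (covered_of fun _ _ _ h h' => by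
      rcases inter_cmb123_L₂_cmb123_D h h' with e | e
      exacts [⟨2, e⟩, ⟨3, e⟩])
    (covered_of fun _ _ _ h h' => ⟨4, inter_cmb123_L₂_cmb123_M₁ h h'⟩)
    (covered_of fun _ _ _ h h' => by
      rcases inter_cmb123_D_cmb123_M₁ hr h h' with e | e
      exacts [⟨8, e⟩, ⟨9, e⟩])
  injective := by
    intro u v huv h
    rcases cmb123Types_eq u v huv h with ⟨rfl, rfl⟩ | ⟨rfl, rfl⟩ | ⟨rfl, rfl⟩
    · exact ne_smul_of_coordinates fun c h0 h1 h2 => one_ne_zero (α := ℂ) (by linear_combination -h0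
      - h2)
    · exact ne_smul_of_coordinates fun c h0 h1 h2 => one_ne_zero (α := ℂ) (by linear_combination h0
      - h2)
    -- Equal points would make `r` a double root of its quadratic, whose discriminant is invertible.
    · exact ne_smul_of_coordinates fun c h0 h1 h2 => one_ne_zero (α := ℂ) (by
      linear_combination (-1728 / 1151 * b * r + 72 / 1151 * b - 72 / 1151 * r - 3450 / 1151) * h0 +
      (72 / 1151 * b * r - 3456 / 1151 * b - 3450 / 1151 * r + 1007 / 1151) * h2 + (1728 / 1151 * b
      * c + 1728 / 1151 * b + 72 / 1151 * c + 72 / 1151) * hr + (-3456 / 1151 * r - 144 / 1151 * c)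
      * b_mul_b)

/-- The reflection `x ↦ -x` preserves `C` and exchanges `L₁` with `L₂` and `M₁` with `M₂`, so this
is the mirror image of the previous tangency. The conic `D` is not symmetric, which is what
distinguishes the two curves. -/
lemma inter_cmb123_C_cmb123_M₂ {X Y Z : ℂ}
    (h : eval ![X, Y, Z] Cmb123.C = 0) (h' : eval ![X, Y, Z] Cmb123.M₂ = 0) :
    Proportional ![X, Y, Z] ![b, 2, 1] := by
  rw [eval_cmb123_C] at h
  rw [eval_cmb123_M₂] at h'
  have e : -b * Z + X = 0 := pow_eq_zero_iff two_ne_zero |>.1 (by linear_combination -h + Z * h' + Z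
    ^ 2 * b_mul_b)
  exact proportional_of_coordinates Z (by linear_combination e) (by linear_combination 2 * b * e +
    h' + 2 * Z * b_mul_b) (by ring)

lemma inter_cmb123_L₁_cmb123_M₂ {X Y Z : ℂ}
    (h : eval ![X, Y, Z] Cmb123.L₁ = 0) (h' : eval ![X, Y, Z] Cmb123.M₂ = 0) :
    Proportional ![X, Y, Z] ![0, -2, 1] := by
  rw [eval_cmb123_L₁] at h
  rw [eval_cmb123_M₂] at h'
  exact proportional_of_coordinates Z (by linear_combination (-2 * b + 3) * h + (2 * b - 3) * h' + 4
    * X * b_mul_b) (by linear_combination (6 * b - 8) * h + (-6 * b + 9) * h' - 12 * X * b_mul_b)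
    (by ring)

lemma inter_cmb123_L₂_cmb123_M₂ {X Y Z : ℂ}
    (h : eval ![X, Y, Z] Cmb123.L₂ = 0) (h' : eval ![X, Y, Z] Cmb123.M₂ = 0) :
    Proportional ![X, Y, Z] ![0, -2, 1] := by
  rw [eval_cmb123_L₂] at h
  rw [eval_cmb123_M₂] at h'
  exact proportional_of_coordinates Z (by linear_combination (-2 * b - 3) * h + (2 * b + 3) * h' + 4
    * X * b_mul_b) (by linear_combination (-6 * b - 8) * h + (6 * b + 9) * h' + 12 * X * b_mul_b)
    (by ring)

/-- In contrast with the first curve, the quadratic splits over `ℚ`. -/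
lemma inter_cmb123_D_cmb123_M₂ {X Y Z : ℂ}
    (h : eval ![X, Y, Z] Cmb123.D = 0) (h' : eval ![X, Y, Z] Cmb123.M₂ = 0) :
    Proportional ![X, Y, Z] ![3 / 2, 3 * b - 2, 1] ∨ Proportional ![X, Y, Z] ![4 / 3, 8 / 3 * b - 2,
      1] := by
  rw [eval_cmb123_D] at h
  rw [eval_cmb123_M₂] at h'
  have key : (X - 3 / 2 * Z) * (X - 4 / 3 * Z) = 0 := by linear_combination (-1 / 3 * b - 1 / 2) * h
    + (1 / 3 * b * Z + 1 / 2 * Z) * h' + (4 * X ^ 2 - 34 / 3 * X * Z + 8 * Z ^ 2) * b_mul_b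
  rcases mul_eq_zero.1 key with e | e
  · exact .inl (proportional_of_coordinates Z (by linear_combination e) (by linear_combination 2 * b
    * e + h') (by ring))
  · exact .inr (proportional_of_coordinates Z (by linear_combination e) (by linear_combination 2 * b
    * e + h') (by ring))

/-- The components of the second curve. -/
def cmb123Second : Fin 5 → S :=
  ![Cmb123.C, Cmb123.L₁, Cmb123.L₂, Cmb123.D, Cmb123.M₂]

/-- The singular points of the second curve. -/
def cmb123SecondPoints : Fin 10 → Fin 3 → ℂ :=
  ![![-2, 4, 1], ![-1, 1, 1], ![2, 4, 1], ![1, 1, 1], ![0, -2, 1], ![0, 1, 0], ![-b, 3 * b - 2, 1],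
    ![b, 2, 1], ![3 / 2, 3 * b - 2, 1], ![4 / 3, 8 / 3 * b - 2, 1]]

lemma hasLocalForm_cmb123Second (a : Fin 10) :
    HasLocalForm cmb123Second (cmb123Types a) (cmb123SecondPoints a) := by
  have h0 : HasLocalForm cmb123Second (node 0 1) ![-2, 4, 1] :=
    hasLocalForm_node 0 1 2 rfl ((eval_cmb123_C ..).trans (by ring)) ((eval_cmb123_L₁ ..).trans (by
      ring)) (cross_two_ne_zero (grad_cmb123_C ..) (grad_cmb123_L₁ ..) (ne_zero_of_mul 1 (by ring)))
      (forall_fin_five (fun h => absurd rfl h) (fun _ h => absurd rfl h) (fun _ _ => (eval_cmb123_L₂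
      ..).trans_ne (ne_zero_of_mul (1 / 12) (by ring))) (fun _ _ => (eval_cmb123_D ..).trans_ne
      (ne_zero_of_mul (-b - 17 / 12) (by linear_combination -144 * b_mul_b))) (fun _ _ =>
      (eval_cmb123_M₂ ..).trans_ne (ne_zero_of_mul (-b + 3 / 2) (by linear_combination -4 *
      b_mul_b))))
  have h1 : HasLocalForm cmb123Second (node 0 1) ![-1, 1, 1] :=
    hasLocalForm_node 0 1 2 rfl ((eval_cmb123_C ..).trans (by ring)) ((eval_cmb123_L₁ ..).trans (by
      ring)) (cross_two_ne_zero (grad_cmb123_C ..) (grad_cmb123_L₁ ..) (ne_zero_of_mul (-1) (by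
      ring))) (forall_fin_five (fun h => absurd rfl h) (fun _ h => absurd rfl h) (fun _ _ =>
      (eval_cmb123_L₂ ..).trans_ne (ne_zero_of_mul (1 / 6) (by ring))) (fun _ _ => (eval_cmb123_D
      ..).trans_ne (ne_zero_of_mul (-2 * b - 17 / 6) (by linear_combination -144 * b_mul_b))) (fun _
      _ => (eval_cmb123_M₂ ..).trans_ne (ne_zero_of_mul (-2 * b + 3) (by linear_combination -4 *
      b_mul_b))))
  have h2 : HasLocalForm cmb123Second (triplePoint 0 2 3) ![2, 4, 1] :=
    hasLocalForm_triplePoint 0 2 3 2 (C (-12 * b + 18) : S) (linearForm 0 0 (12 * b - 17)) (C 1) rfl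
      ((eval_cmb123_C ..).trans (by ring)) ((eval_cmb123_L₂ ..).trans (by ring)) (cross_two_ne_zero
      (grad_cmb123_C ..) (grad_cmb123_L₂ ..) (ne_zero_of_mul (-1) (by ring))) ((eval_C _).trans_ne
      (ne_zero_of_mul (1 / 3 * b + 1 / 2) (by linear_combination -4 * b_mul_b)))
      ((eval_linearForm_vec ..).trans_ne (ne_zero_of_mul (-12 * b - 17) (by linear_combination -144
      * b_mul_b))) ((eval_C _).trans_ne (ne_zero_of_mul 1 (by ring))) (eq_of_eval fun X Y Z => by
        simp only [cmb123Second, cons_val, map_add, map_mul, eval_C, eval_linearForm_vec,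
          eval_cmb123_D, eval_cmb123_C, eval_cmb123_L₂]
        ring) (forall_fin_five (fun h => absurd rfl h) (fun _ _ _ => (eval_cmb123_L₁ ..).trans_ne
          (ne_zero_of_mul (1 / 12) (by ring))) (fun _ h => absurd rfl h) (fun _ _ h => absurd rfl h)
          (fun _ _ _ => (eval_cmb123_M₂ ..).trans_ne (ne_zero_of_mul (b + 3 / 2) (by
          linear_combination -4 * b_mul_b))))
  have h3 : HasLocalForm cmb123Second (triplePoint 0 2 3) ![1, 1, 1] :=
    hasLocalForm_triplePoint 0 2 3 2 (C (-12 * b + 18) : S) (linearForm 0 0 (12 * b - 17)) (C 1) rfl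
      ((eval_cmb123_C ..).trans (by ring)) ((eval_cmb123_L₂ ..).trans (by ring)) (cross_two_ne_zero
      (grad_cmb123_C ..) (grad_cmb123_L₂ ..) (ne_zero_of_mul 1 (by ring))) ((eval_C _).trans_ne
      (ne_zero_of_mul (1 / 3 * b + 1 / 2) (by linear_combination -4 * b_mul_b)))
      ((eval_linearForm_vec ..).trans_ne (ne_zero_of_mul (-12 * b - 17) (by linear_combination -144
      * b_mul_b))) ((eval_C _).trans_ne (ne_zero_of_mul 1 (by ring))) (eq_of_eval fun X Y Z => by
        simp only [cmb123Second, cons_val, map_add, map_mul, eval_C, eval_linearForm_vec,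
          eval_cmb123_D, eval_cmb123_C, eval_cmb123_L₂]
        ring) (forall_fin_five (fun h => absurd rfl h) (fun _ _ _ => (eval_cmb123_L₁ ..).trans_ne
          (ne_zero_of_mul (1 / 6) (by ring))) (fun _ h => absurd rfl h) (fun _ _ h => absurd rfl h)
          (fun _ _ _ => (eval_cmb123_M₂ ..).trans_ne (ne_zero_of_mul (2 * b + 3) (by
          linear_combination -4 * b_mul_b))))
  have h4 : HasLocalForm cmb123Second (triplePoint 1 2 4) ![0, -2, 1] :=
    hasLocalForm_triplePoint 1 2 4 2 (C (-1 / 3 * b + 1 / 2) : S) (C (1 / 3 * b + 1 / 2) : S) (C 1)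
      rfl ((eval_cmb123_L₁ ..).trans (by ring)) ((eval_cmb123_L₂ ..).trans (by ring))
      (cross_two_ne_zero (grad_cmb123_L₁ ..) (grad_cmb123_L₂ ..) (ne_zero_of_mul (1 / 6) (by ring)))
      ((eval_C _).trans_ne (ne_zero_of_mul (12 * b + 18) (by linear_combination -4 * b_mul_b)))
      ((eval_C _).trans_ne (ne_zero_of_mul (-12 * b + 18) (by linear_combination -4 * b_mul_b)))
      ((eval_C _).trans_ne (ne_zero_of_mul 1 (by ring))) (eq_of_eval fun X Y Z => by
        simp only [cmb123Second, cons_val, map_add, map_mul, eval_C, eval_cmb123_M₂, eval_cmb123_L₁, eval_cmb123_L₂]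
        ring) (forall_fin_five (fun _ _ _ => (eval_cmb123_C ..).trans_ne (ne_zero_of_mul (-1 / 2)
          (by ring))) (fun h => absurd rfl h) (fun _ h => absurd rfl h) (fun _ _ _ => (eval_cmb123_D
          ..).trans_ne (ne_zero_of_mul (-1 / 6 * b - 1 / 4) (by linear_combination -4 * b_mul_b)))
          (fun _ _ h => absurd rfl h))
  have h5 : HasLocalForm cmb123Second (tacnode 0 3) ![0, 1, 0] :=
    hasLocalForm_tacnode 0 3 1 (quadraticForm (-3672 * b + 5193) (12 * b - 17) (-1632 * b + 2308)
      (-792 * b + 1120) (4896 * b - 6924) (1188 * b - 1680)) (quadraticForm 0 (12 * b - 17) 0 (24 *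
      b - 34) 0 (-36 * b + 51)) (quadraticForm (-36 * b + 51) 0 0 0 (24 * b - 34) (12 * b - 17)) rfl
      ((eval_cmb123_C ..).trans (by ring)) ((eval_quadraticForm_vec ..).trans (by ring))
      (cross_one_ne_zero (grad_quadraticForm_vec ..) (grad_cmb123_C ..) (ne_zero_of_mul (12 * b +
      17) (by linear_combination -144 * b_mul_b))) ((eval_quadraticForm_vec ..).trans_ne
      (ne_zero_of_mul (-12 * b - 17) (by linear_combination -144 * b_mul_b)))
      ((eval_quadraticForm_vec ..).trans_ne (ne_zero_of_mul (-12 * b - 17) (by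
      linear_combination -144 * b_mul_b))) (eq_of_eval fun X Y Z => by
        simp only [cmb123Second, cons_val, map_add, map_mul, map_pow, eval_quadraticForm_vec, eval_cmb123_D, eval_cmb123_C]
        linear_combination (-1296 * X ^ 4 + 432 * X ^ 3 * Y + 1728 * X ^ 3 * Z + 1008 * X ^ 2 * Y *
          Z - 576 * X ^ 2 * Z ^ 2 - 432 * X * Y ^ 2 * Z - 1728 * X * Y * Z ^ 2 + 288 * Y ^ 2 * Z ^ 2
          + 576 * Y * Z ^ 3) * b_mul_b) (by decide) (forall_fin_five (fun h => absurd rfl h) (fun _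
          _ => (eval_cmb123_L₁ ..).trans_ne (ne_zero_of_mul 1 (by ring))) (fun _ _ =>
          (eval_cmb123_L₂ ..).trans_ne (ne_zero_of_mul 1 (by ring))) (fun _ h => absurd rfl h) (fun
          _ _ => (eval_cmb123_M₂ ..).trans_ne (ne_zero_of_mul 1 (by ring))))
  have h6 : HasLocalForm cmb123Second (tacnode 1 3) ![-b, 3 * b - 2, 1] :=
    hasLocalForm_tacnode 1 3 2 (linearForm 0 0 (-1 / 3 * b - 1 / 2)) (C (-1 / 3 * b - 1 / 2) : S)
      (linearForm 1 0 b) rfl ((eval_cmb123_L₁ ..).trans (by ring)) ((eval_linearForm_vec ..).trans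
      (by ring)) (cross_two_ne_zero (grad_linearForm_vec ..) (grad_cmb123_L₁ ..) (ne_zero_of_mul 1
      (by ring))) ((eval_linearForm_vec ..).trans_ne (ne_zero_of_mul (12 * b - 18) (by
      linear_combination -4 * b_mul_b))) ((eval_C _).trans_ne (ne_zero_of_mul (12 * b - 18) (by
      linear_combination -4 * b_mul_b))) (eq_of_eval fun X Y Z => by
        simp only [cmb123Second, cons_val, map_add, map_mul, map_pow, eval_C, eval_linearForm_vec,
          eval_cmb123_D, eval_cmb123_L₁]
        linear_combination (-4 * X ^ 2 + 12 * X * Z - 9 * Z ^ 2) * b_mul_b) (by decide)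
          (forall_fin_five (fun _ _ => (eval_cmb123_C ..).trans_ne (ne_zero_of_mul (3 / 2 * b + 2)
          (by linear_combination (-3 / 2 * b + 5 / 2) * b_mul_b))) (fun h => absurd rfl h) (fun _ _
          => (eval_cmb123_L₂ ..).trans_ne (ne_zero_of_mul (1 / 12 * b) (by linear_combination 1 / 2
          * b_mul_b))) (fun _ h => absurd rfl h) (fun _ _ => (eval_cmb123_M₂ ..).trans_ne
          (ne_zero_of_mul (3 / 2 * b - 2) (by linear_combination (3 * b + 1 / 2) * b_mul_b))))
  have h7 : HasLocalForm cmb123Second (tacnode 4 0) ![b, 2, 1] :=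
    hasLocalForm_tacnode 4 0 2 (linearForm 0 0 (-1)) (C (-1) : S) (linearForm 1 0 (-b)) rfl
      ((eval_cmb123_M₂ ..).trans (by linear_combination -2 * b_mul_b)) ((eval_linearForm_vec
      ..).trans (by ring)) (cross_two_ne_zero (grad_linearForm_vec ..) (grad_cmb123_M₂ ..)
      (ne_zero_of_mul 1 (by ring))) ((eval_linearForm_vec ..).trans_ne (ne_zero_of_mul (-1) (by
      ring))) ((eval_C _).trans_ne (ne_zero_of_mul (-1) (by ring))) (eq_of_eval fun X Y Z => by
        simp only [cmb123Second, cons_val, map_add, map_mul, map_pow, eval_C, eval_linearForm_vec,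
          eval_cmb123_C, eval_cmb123_M₂]
        linear_combination -Z ^ 2 * b_mul_b) (by decide) (forall_fin_five (fun _ h => absurd rfl h)
          (fun _ _ => (eval_cmb123_L₁ ..).trans_ne (ne_zero_of_mul (3 / 2 * b - 2) (by
          linear_combination 9 / 2 * b_mul_b))) (fun _ _ => (eval_cmb123_L₂ ..).trans_ne
          (ne_zero_of_mul (-3 / 2 * b - 2) (by linear_combination 9 / 2 * b_mul_b))) (fun _ _ =>
          (eval_cmb123_D ..).trans_ne (ne_zero_of_mul (99 / 2 * b + 70) (by linear_combination (594
          * b ^ 2 - 1833 * b + 2241 / 2) * b_mul_b))) (fun h => absurd rfl h))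
  have h8 : HasLocalForm cmb123Second (node 3 4) ![3 / 2, 3 * b - 2, 1] :=
    hasLocalForm_node 3 4 2 rfl ((eval_cmb123_D ..).trans (by ring)) ((eval_cmb123_M₂ ..).trans (by
      ring)) (cross_two_ne_zero (grad_cmb123_D ..) (grad_cmb123_M₂ ..) (ne_zero_of_mul (-2 * b - 3)
      (by linear_combination -4 * b_mul_b))) (forall_fin_five (fun _ _ => (eval_cmb123_C
      ..).trans_ne (ne_zero_of_mul (-48 * b - 68) (by linear_combination -144 * b_mul_b))) (fun _ _
      => (eval_cmb123_L₁ ..).trans_ne (ne_zero_of_mul (-4 / 3 * b + 2) (by linear_combination -4 *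
      b_mul_b))) (fun _ _ => (eval_cmb123_L₂ ..).trans_ne (ne_zero_of_mul (-4 / 3 * b - 2) (by
      linear_combination -4 * b_mul_b))) (fun h => absurd rfl h) (fun _ h => absurd rfl h))
  have h9 : HasLocalForm cmb123Second (node 3 4) ![4 / 3, 8 / 3 * b - 2, 1] :=
    hasLocalForm_node 3 4 2 rfl ((eval_cmb123_D ..).trans (by ring)) ((eval_cmb123_M₂ ..).trans (by
      ring)) (cross_two_ne_zero (grad_cmb123_D ..) (grad_cmb123_M₂ ..) (ne_zero_of_mul (2 * b + 3)
      (by linear_combination -4 * b_mul_b))) (forall_fin_five (fun _ _ => (eval_cmb123_C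
      ..).trans_ne (ne_zero_of_mul (-54 * b - 153 / 2) (by linear_combination -144 * b_mul_b))) (fun
      _ _ => (eval_cmb123_L₁ ..).trans_ne (ne_zero_of_mul (-3 / 2 * b + 9 / 4) (by
      linear_combination -4 * b_mul_b))) (fun _ _ => (eval_cmb123_L₂ ..).trans_ne (ne_zero_of_mul
      (-3 / 2 * b - 9 / 4) (by linear_combination -4 * b_mul_b))) (fun h => absurd rfl h) (fun _ h
      => absurd rfl h))
  fin_cases a
  exacts [h0, h1, h2, h3, h4, h5, h6, h7, h8, h9]

lemma isArrangement_cmb123Second :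
    IsArrangement cmb123Second cmb123Degrees cmb123Types cmb123SecondPoints where
  smooth := forall_fin_five isSmoothForm_cmb123_C isSmoothForm_cmb123_L₁ isSmoothForm_cmb123_L₂
    isSmoothForm_cmb123_D isSmoothForm_cmb123_M₂
  localForm := hasLocalForm_cmb123Second
  cover := forall_lt_five (covered_of fun _ _ _ h h' => by
      rcases inter_cmb123_C_cmb123_L₁ h h' with e | e
      exacts [⟨0, e⟩, ⟨1, e⟩])
    (covered_of fun _ _ _ h h' => by
      rcases inter_cmb123_C_cmb123_L₂ h h' with e | e
      exacts [⟨2, e⟩, ⟨3, e⟩])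
    (covered_of fun _ _ _ h h' => by
      rcases inter_cmb123_C_cmb123_D h h' with e | e | e
      exacts [⟨2, e⟩, ⟨3, e⟩, ⟨5, e⟩])
    (covered_of fun _ _ _ h h' => ⟨7, inter_cmb123_C_cmb123_M₂ h h'⟩)
    (covered_of fun _ _ _ h h' => ⟨4, inter_cmb123_L₁_cmb123_L₂ h h'⟩)
    (covered_of fun _ _ _ h h' => ⟨6, inter_cmb123_L₁_cmb123_D h h'⟩)
    (covered_of fun _ _ _ h h' => ⟨4, inter_cmb123_L₁_cmb123_M₂ h h'⟩)
    (covered_of fun _ _ _ h h' => by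
      rcases inter_cmb123_L₂_cmb123_D h h' with e | e
      exacts [⟨2, e⟩, ⟨3, e⟩])
    (covered_of fun _ _ _ h h' => ⟨4, inter_cmb123_L₂_cmb123_M₂ h h'⟩)
    (covered_of fun _ _ _ h h' => by
      rcases inter_cmb123_D_cmb123_M₂ h h' with e | e
      exacts [⟨8, e⟩, ⟨9, e⟩])
  injective := by
    intro u v huv h
    rcases cmb123Types_eq u v huv h with ⟨rfl, rfl⟩ | ⟨rfl, rfl⟩ | ⟨rfl, rfl⟩
    · exact ne_smul_of_coordinates fun c h0 h1 h2 => one_ne_zero (α := ℂ) (by linear_combination -h0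
      - h2)
    · exact ne_smul_of_coordinates fun c h0 h1 h2 => one_ne_zero (α := ℂ) (by linear_combination h0
      - h2)
    · exact ne_smul_of_coordinates fun c h0 h1 h2 => one_ne_zero (α := ℂ) (by linear_combination 6 *
      h0 - 8 * h2)

/-! ### The `cmb124` pair: singular points and combinatorics. -/

/-- The degrees of the components. -/
def cmb124Degrees : Fin 5 → ℕ := ![2, 1, 1, 2, 1]

/-- The local types at the singular points. -/
def cmb124Types : Fin 11 → Fin 5 → Branch :=
  ![triplePoint 1 4 0, triplePoint 2 4 0, node 0 1, node 0 2, node 1 2, tacnode 0 3, tacnode 0 3,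
    tacnode 1 3, tacnode 2 3, node 3 4, node 3 4]

lemma isSeparating_cmb124Types : IsSeparating cmb124Types := by
  unfold IsSeparating
  decide +kernel

lemma cmb124Types_eq : ∀ u v, u < v →
    (∀ i, cmb124Types u i = .away ↔ cmb124Types v i = .away) →
    (u = 5 ∧ v = 6) ∨ (u = 9 ∧ v = 10) := by
  decide +kernel

/-- The pencil of the two conics contains the double line `x ^ 2 = 8 (C - D)`, so they are tangent
at the two points of `C` on `x = 0`. -/
lemma inter_cmb123_C_cmb124_D {X Y Z : ℂ}
    (h : eval ![X, Y, Z] Cmb123.C = 0) (h' : eval ![X, Y, Z] Cmb124.D = 0) :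
    Proportional ![X, Y, Z] ![0, 1, 0] ∨ Proportional ![X, Y, Z] ![0, 0, 1] := by
  rw [eval_cmb123_C] at h
  rw [eval_cmb124_D] at h'
  have h₁ : X = 0 := pow_eq_zero_iff two_ne_zero |>.1 (by linear_combination 8 * h - 8 * h')
  have key : (-Z) * (Y) = 0 := by linear_combination -h - X * h₁
  rcases mul_eq_zero.1 key with e | e
  · exact .inl (proportional_of_coordinates Y (by linear_combination h₁) (by ring) (by
    linear_combination -e))
  · exact .inr (proportional_of_coordinates Z (by linear_combination h₁) (by linear_combination e)
    (by ring))

lemma inter_cmb123_C_cmb124_M₁ {X Y Z : ℂ}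
    (h : eval ![X, Y, Z] Cmb123.C = 0) (h' : eval ![X, Y, Z] Cmb124.M₁ = 0) :
    Proportional ![X, Y, Z] ![-1, 1, 1] ∨ Proportional ![X, Y, Z] ![2, 4, 1] := by
  rw [eval_cmb123_C] at h
  rw [eval_cmb124_M₁] at h'
  have key : (X + Z) * (X - 2 * Z) = 0 := by linear_combination -h + Z * h'
  rcases mul_eq_zero.1 key with e | e
  · exact .inl (proportional_of_coordinates Z (by linear_combination e) (by linear_combination e +
    h') (by ring))
  · exact .inr (proportional_of_coordinates Z (by linear_combination e) (by linear_combination e +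
    h') (by ring))

lemma inter_cmb123_L₁_cmb124_D {X Y Z : ℂ}
    (h : eval ![X, Y, Z] Cmb123.L₁ = 0) (h' : eval ![X, Y, Z] Cmb124.D = 0) :
    Proportional ![X, Y, Z] ![-4 / 3, 2, 1] := by
  rw [eval_cmb123_L₁] at h
  rw [eval_cmb124_D] at h'
  have e : X + 4 / 3 * Z = 0 := pow_eq_zero_iff two_ne_zero |>.1 (by linear_combination -8 / 9 * h'
    + 8 / 9 * Z * h)
  exact proportional_of_coordinates Z (by linear_combination e) (by linear_combination -3 * e + h)
    (by ring)

lemma inter_cmb123_L₁_cmb124_M₁ {X Y Z : ℂ}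
    (h : eval ![X, Y, Z] Cmb123.L₁ = 0) (h' : eval ![X, Y, Z] Cmb124.M₁ = 0) :
    Proportional ![X, Y, Z] ![-1, 1, 1] := by
  rw [eval_cmb123_L₁] at h
  rw [eval_cmb124_M₁] at h'
  exact proportional_of_coordinates Z (by linear_combination 1 / 4 * h - 1 / 4 * h') (by
    linear_combination 1 / 4 * h + 3 / 4 * h') (by ring)

lemma inter_cmb123_L₂_cmb124_D {X Y Z : ℂ}
    (h : eval ![X, Y, Z] Cmb123.L₂ = 0) (h' : eval ![X, Y, Z] Cmb124.D = 0) :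
    Proportional ![X, Y, Z] ![4 / 3, 2, 1] := by
  rw [eval_cmb123_L₂] at h
  rw [eval_cmb124_D] at h'
  have e : X - 4 / 3 * Z = 0 := pow_eq_zero_iff two_ne_zero |>.1 (by linear_combination -8 / 9 * h'
    + 8 / 9 * Z * h)
  exact proportional_of_coordinates Z (by linear_combination e) (by linear_combination 3 * e + h)
    (by ring)

lemma inter_cmb123_L₂_cmb124_M₁ {X Y Z : ℂ}
    (h : eval ![X, Y, Z] Cmb123.L₂ = 0) (h' : eval ![X, Y, Z] Cmb124.M₁ = 0) :
    Proportional ![X, Y, Z] ![2, 4, 1] := by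
  rw [eval_cmb123_L₂] at h
  rw [eval_cmb124_M₁] at h'
  exact proportional_of_coordinates Z (by linear_combination -1 / 2 * h + 1 / 2 * h') (by
    linear_combination -1 / 2 * h + 3 / 2 * h') (by ring)

/-- The roots lie in `ℚ(√10)`; the second one is `8 / 9 - r`. -/
lemma inter_cmb124_D_cmb124_M₁ {X Y Z : ℂ} {r : ℂ} (hr : r ^ 2 - 8 / 9 * r - 16 / 9 = 0)
    (h : eval ![X, Y, Z] Cmb124.D = 0) (h' : eval ![X, Y, Z] Cmb124.M₁ = 0) :
    Proportional ![X, Y, Z] ![r, r + 2, 1] ∨ Proportional ![X, Y, Z] ![-r + 8 / 9, -r + 26 / 9, 1]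
      := by
  rw [eval_cmb124_D] at h
  rw [eval_cmb124_M₁] at h'
  have key : (-r * Z + X) * (r * Z + X - 8 / 9 * Z) = 0 := by linear_combination -8 / 9 * h + 8 / 9
    * Z * h' - Z ^ 2 * hr
  rcases mul_eq_zero.1 key with e | e
  · exact .inl (proportional_of_coordinates Z (by linear_combination e) (by linear_combination e +
    h') (by ring))
  · exact .inr (proportional_of_coordinates Z (by linear_combination e) (by linear_combination e +
    h') (by ring))

/-- The components of the first curve. -/
def cmb124First : Fin 5 → S :=
  ![Cmb123.C, Cmb123.L₁, Cmb123.L₂, Cmb124.D, Cmb124.M₁]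

/-- The singular points of the first curve. -/
def cmb124FirstPoints (r : ℂ) : Fin 11 → Fin 3 → ℂ :=
  ![![-1, 1, 1], ![2, 4, 1], ![-2, 4, 1], ![1, 1, 1], ![0, -2, 1], ![0, 1, 0], ![0, 0, 1], ![-4 / 3,
    2, 1], ![4 / 3, 2, 1], ![r, r + 2, 1], ![-r + 8 / 9, -r + 26 / 9, 1]]

lemma hasLocalForm_cmb124First {r : ℂ} (hr : r ^ 2 - 8 / 9 * r - 16 / 9 = 0) (a : Fin 11) :
    HasLocalForm cmb124First (cmb124Types a) (cmb124FirstPoints r a) := by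
  -- The conic passes through the intersection of the two lines, so it is a combination of them with
  -- linear coefficients. The coefficients are nonzero at the point because the conic is transverse
  -- to both lines.
  have h0 : HasLocalForm cmb124First (triplePoint 1 4 0) ![-1, 1, 1] :=
    hasLocalForm_triplePoint 1 4 0 2 (linearForm (-1 / 2) (1 / 4) 0) (linearForm (-1 / 2) (-1 / 4)
      0) (C 1) rfl ((eval_cmb123_L₁ ..).trans (by ring)) ((eval_cmb124_M₁ ..).trans (by ring))
      (cross_two_ne_zero (grad_cmb123_L₁ ..) (grad_cmb124_M₁ ..) (ne_zero_of_mul (1 / 4) (by ring)))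
      ((eval_linearForm_vec ..).trans_ne (ne_zero_of_mul (4 / 3) (by ring))) ((eval_linearForm_vec
      ..).trans_ne (ne_zero_of_mul 4 (by ring))) ((eval_C _).trans_ne (ne_zero_of_mul 1 (by ring)))
      (eq_of_eval fun X Y Z => by
        simp only [cmb124First, cons_val, map_add, map_mul, eval_C, eval_linearForm_vec,
          eval_cmb123_C, eval_cmb123_L₁, eval_cmb124_M₁]
        ring) (forall_fin_five (fun _ _ h => absurd rfl h) (fun h => absurd rfl h) (fun _ _ _ =>
          (eval_cmb123_L₂ ..).trans_ne (ne_zero_of_mul (1 / 6) (by ring))) (fun _ _ _ =>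
          (eval_cmb124_D ..).trans_ne (ne_zero_of_mul (-8) (by ring))) (fun _ h => absurd rfl h))
  have h1 : HasLocalForm cmb124First (triplePoint 2 4 0) ![2, 4, 1] :=
    hasLocalForm_triplePoint 2 4 0 2 (linearForm (1 / 4) (1 / 4) 0) (linearForm (1 / 4) (-1 / 4) 0)
      (C 1) rfl ((eval_cmb123_L₂ ..).trans (by ring)) ((eval_cmb124_M₁ ..).trans (by ring))
      (cross_two_ne_zero (grad_cmb123_L₂ ..) (grad_cmb124_M₁ ..) (ne_zero_of_mul (-1 / 2) (by
      ring))) ((eval_linearForm_vec ..).trans_ne (ne_zero_of_mul (2 / 3) (by ring)))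
      ((eval_linearForm_vec ..).trans_ne (ne_zero_of_mul (-2) (by ring))) ((eval_C _).trans_ne
      (ne_zero_of_mul 1 (by ring))) (eq_of_eval fun X Y Z => by
        simp only [cmb124First, cons_val, map_add, map_mul, eval_C, eval_linearForm_vec,
          eval_cmb123_C, eval_cmb123_L₂, eval_cmb124_M₁]
        ring) (forall_fin_five (fun _ _ h => absurd rfl h) (fun _ _ _ => (eval_cmb123_L₁
          ..).trans_ne (ne_zero_of_mul (1 / 12) (by ring))) (fun h => absurd rfl h) (fun _ _ _ =>
          (eval_cmb124_D ..).trans_ne (ne_zero_of_mul (-2) (by ring))) (fun _ h => absurd rfl h))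
  have h2 : HasLocalForm cmb124First (node 0 1) ![-2, 4, 1] :=
    hasLocalForm_node 0 1 2 rfl ((eval_cmb123_C ..).trans (by ring)) ((eval_cmb123_L₁ ..).trans (by
      ring)) (cross_two_ne_zero (grad_cmb123_C ..) (grad_cmb123_L₁ ..) (ne_zero_of_mul 1 (by ring)))
      (forall_fin_five (fun h => absurd rfl h) (fun _ h => absurd rfl h) (fun _ _ => (eval_cmb123_L₂
      ..).trans_ne (ne_zero_of_mul (1 / 12) (by ring))) (fun _ _ => (eval_cmb124_D ..).trans_ne
      (ne_zero_of_mul (-2) (by ring))) (fun _ _ => (eval_cmb124_M₁ ..).trans_ne (ne_zero_of_mul (1 /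
      4) (by ring))))
  have h3 : HasLocalForm cmb124First (node 0 2) ![1, 1, 1] :=
    hasLocalForm_node 0 2 2 rfl ((eval_cmb123_C ..).trans (by ring)) ((eval_cmb123_L₂ ..).trans (by
      ring)) (cross_two_ne_zero (grad_cmb123_C ..) (grad_cmb123_L₂ ..) (ne_zero_of_mul 1 (by ring)))
      (forall_fin_five (fun h => absurd rfl h) (fun _ _ => (eval_cmb123_L₁ ..).trans_ne
      (ne_zero_of_mul (1 / 6) (by ring))) (fun _ h => absurd rfl h) (fun _ _ => (eval_cmb124_D
      ..).trans_ne (ne_zero_of_mul (-8) (by ring))) (fun _ _ => (eval_cmb124_M₁ ..).trans_ne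
      (ne_zero_of_mul (-1 / 2) (by ring))))
  have h4 : HasLocalForm cmb124First (node 1 2) ![0, -2, 1] :=
    hasLocalForm_node 1 2 2 rfl ((eval_cmb123_L₁ ..).trans (by ring)) ((eval_cmb123_L₂ ..).trans (by
      ring)) (cross_two_ne_zero (grad_cmb123_L₁ ..) (grad_cmb123_L₂ ..) (ne_zero_of_mul (1 / 6) (by
      ring))) (forall_fin_five (fun _ _ => (eval_cmb123_C ..).trans_ne (ne_zero_of_mul (-1 / 2) (by
      ring))) (fun h => absurd rfl h) (fun _ h => absurd rfl h) (fun _ _ => (eval_cmb124_D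
      ..).trans_ne (ne_zero_of_mul (-1 / 2) (by ring))) (fun _ _ => (eval_cmb124_M₁ ..).trans_ne
      (ne_zero_of_mul (-1 / 4) (by ring))))
  -- The identity is `-8 D = -8 C + x ^ 2`; it serves both points of contact.
  have h5 : HasLocalForm cmb124First (tacnode 0 3) ![0, 1, 0] :=
    hasLocalForm_tacnode 0 3 1 (C (-8) : S) (C (-8) : S) (linearForm 1 0 0) rfl ((eval_cmb123_C
      ..).trans (by ring)) ((eval_linearForm_vec ..).trans (by ring)) (cross_one_ne_zero
      (grad_linearForm_vec ..) (grad_cmb123_C ..) (ne_zero_of_mul (-1) (by ring))) ((eval_C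
      _).trans_ne (ne_zero_of_mul (-1 / 8) (by ring))) ((eval_C _).trans_ne (ne_zero_of_mul (-1 / 8)
      (by ring))) (eq_of_eval fun X Y Z => by
        simp only [cmb124First, cons_val, map_add, map_mul, map_pow, eval_C, eval_linearForm_vec,
          eval_cmb124_D, eval_cmb123_C]
        ring) (by decide) (forall_fin_five (fun h => absurd rfl h) (fun _ _ => (eval_cmb123_L₁
          ..).trans_ne (ne_zero_of_mul 1 (by ring))) (fun _ _ => (eval_cmb123_L₂ ..).trans_ne
          (ne_zero_of_mul 1 (by ring))) (fun _ h => absurd rfl h) (fun _ _ => (eval_cmb124_M₁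
          ..).trans_ne (ne_zero_of_mul 1 (by ring))))
  have h6 : HasLocalForm cmb124First (tacnode 0 3) ![0, 0, 1] :=
    hasLocalForm_tacnode 0 3 2 (C (-8) : S) (C (-8) : S) (linearForm 1 0 0) rfl ((eval_cmb123_C
      ..).trans (by ring)) ((eval_linearForm_vec ..).trans (by ring)) (cross_two_ne_zero
      (grad_linearForm_vec ..) (grad_cmb123_C ..) (ne_zero_of_mul 1 (by ring))) ((eval_C _).trans_ne
      (ne_zero_of_mul (-1 / 8) (by ring))) ((eval_C _).trans_ne (ne_zero_of_mul (-1 / 8) (by ring)))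
      (eq_of_eval fun X Y Z => by
        simp only [cmb124First, cons_val, map_add, map_mul, map_pow, eval_C, eval_linearForm_vec,
          eval_cmb124_D, eval_cmb123_C]
        ring) (by decide) (forall_fin_five (fun h => absurd rfl h) (fun _ _ => (eval_cmb123_L₁
          ..).trans_ne (ne_zero_of_mul (1 / 2) (by ring))) (fun _ _ => (eval_cmb123_L₂ ..).trans_ne
          (ne_zero_of_mul (1 / 2) (by ring))) (fun _ h => absurd rfl h) (fun _ _ => (eval_cmb124_M₁
          ..).trans_ne (ne_zero_of_mul (-1 / 2) (by ring))))
  have h7 : HasLocalForm cmb124First (tacnode 1 3) ![-4 / 3, 2, 1] :=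
    hasLocalForm_tacnode 1 3 2 (linearForm 0 0 (-8 / 9)) (C (-8 / 9) : S) (linearForm 1 0 (4 / 3))
      rfl ((eval_cmb123_L₁ ..).trans (by ring)) ((eval_linearForm_vec ..).trans (by ring))
      (cross_two_ne_zero (grad_linearForm_vec ..) (grad_cmb123_L₁ ..) (ne_zero_of_mul 1 (by ring)))
      ((eval_linearForm_vec ..).trans_ne (ne_zero_of_mul (-9 / 8) (by ring))) ((eval_C _).trans_ne
      (ne_zero_of_mul (-9 / 8) (by ring))) (eq_of_eval fun X Y Z => by
        simp only [cmb124First, cons_val, map_add, map_mul, map_pow, eval_C, eval_linearForm_vec,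
          eval_cmb124_D, eval_cmb123_L₁]
        ring) (by decide) (forall_fin_five (fun _ _ => (eval_cmb123_C ..).trans_ne (ne_zero_of_mul
          (9 / 2) (by ring))) (fun h => absurd rfl h) (fun _ _ => (eval_cmb123_L₂ ..).trans_ne
          (ne_zero_of_mul (1 / 8) (by ring))) (fun _ h => absurd rfl h) (fun _ _ => (eval_cmb124_M₁
          ..).trans_ne (ne_zero_of_mul (3 / 4) (by ring))))
  have h8 : HasLocalForm cmb124First (tacnode 2 3) ![4 / 3, 2, 1] :=
    hasLocalForm_tacnode 2 3 2 (linearForm 0 0 (-8 / 9)) (C (-8 / 9) : S) (linearForm 1 0 (-4 / 3))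
      rfl ((eval_cmb123_L₂ ..).trans (by ring)) ((eval_linearForm_vec ..).trans (by ring))
      (cross_two_ne_zero (grad_linearForm_vec ..) (grad_cmb123_L₂ ..) (ne_zero_of_mul 1 (by ring)))
      ((eval_linearForm_vec ..).trans_ne (ne_zero_of_mul (-9 / 8) (by ring))) ((eval_C _).trans_ne
      (ne_zero_of_mul (-9 / 8) (by ring))) (eq_of_eval fun X Y Z => by
        simp only [cmb124First, cons_val, map_add, map_mul, map_pow, eval_C, eval_linearForm_vec,
          eval_cmb124_D, eval_cmb123_L₂]
        ring) (by decide) (forall_fin_five (fun _ _ => (eval_cmb123_C ..).trans_ne (ne_zero_of_mul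
          (9 / 2) (by ring))) (fun _ _ => (eval_cmb123_L₁ ..).trans_ne (ne_zero_of_mul (1 / 8) (by
          ring))) (fun h => absurd rfl h) (fun _ h => absurd rfl h) (fun _ _ => (eval_cmb124_M₁
          ..).trans_ne (ne_zero_of_mul (-3 / 4) (by ring))))
  have h9 : HasLocalForm cmb124First (node 3 4) ![r, r + 2, 1] :=
    hasLocalForm_node 3 4 2 rfl ((eval_cmb124_D ..).trans (by linear_combination -9 / 8 * hr))
      ((eval_cmb124_M₁ ..).trans (by ring)) (cross_two_ne_zero (grad_cmb124_D ..) (grad_cmb124_M₁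
      ..) (ne_zero_of_mul (-9 / 40 * r + 1 / 10) (by linear_combination 81 / 160 * hr)))
      (forall_fin_five (fun _ _ => (eval_cmb123_C ..).trans_ne (ne_zero_of_mul (-9 / 4 * r + 13 / 2)
      (by linear_combination (9 / 4 * r - 27 / 4) * hr))) (fun _ _ => (eval_cmb123_L₁ ..).trans_ne
      (ne_zero_of_mul (-9 / 4 * r + 17 / 4) (by linear_combination -9 * hr))) (fun _ _ =>
      (eval_cmb123_L₂ ..).trans_ne (ne_zero_of_mul (9 / 8 * r + 5 / 4) (by linear_combination -9 / 4
      * hr))) (fun h => absurd rfl h) (fun _ h => absurd rfl h))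
  have h10 : HasLocalForm cmb124First (node 3 4) ![-r + 8 / 9, -r + 26 / 9, 1] :=
    hasLocalForm_node 3 4 2 rfl ((eval_cmb124_D ..).trans (by linear_combination -9 / 8 * hr))
      ((eval_cmb124_M₁ ..).trans (by ring)) (cross_two_ne_zero (grad_cmb124_D ..) (grad_cmb124_M₁
      ..) (ne_zero_of_mul (9 / 40 * r - 1 / 10) (by linear_combination 81 / 160 * hr)))
      (forall_fin_five (fun _ _ => (eval_cmb123_C ..).trans_ne (ne_zero_of_mul (9 / 4 * r + 9 / 2)
      (by linear_combination (-9 / 4 * r - 19 / 4) * hr))) (fun _ _ => (eval_cmb123_L₁ ..).trans_ne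
      (ne_zero_of_mul (9 / 4 * r + 9 / 4) (by linear_combination -9 * hr))) (fun _ _ =>
      (eval_cmb123_L₂ ..).trans_ne (ne_zero_of_mul (-9 / 8 * r + 9 / 4) (by linear_combination -9 /
      4 * hr))) (fun h => absurd rfl h) (fun _ h => absurd rfl h))
  fin_cases a
  exacts [h0, h1, h2, h3, h4, h5, h6, h7, h8, h9, h10]

lemma isArrangement_cmb124First {r : ℂ} (hr : r ^ 2 - 8 / 9 * r - 16 / 9 = 0) :
    IsArrangement cmb124First cmb124Degrees cmb124Types (cmb124FirstPoints r) where
  smooth := forall_fin_five isSmoothForm_cmb123_C isSmoothForm_cmb123_L₁ isSmoothForm_cmb123_L₂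
    isSmoothForm_cmb124_D isSmoothForm_cmb124_M₁
  localForm := hasLocalForm_cmb124First hr
  cover := forall_lt_five (covered_of fun _ _ _ h h' => by
      rcases inter_cmb123_C_cmb123_L₁ h h' with e | e
      exacts [⟨2, e⟩, ⟨0, e⟩])
    (covered_of fun _ _ _ h h' => by
      rcases inter_cmb123_C_cmb123_L₂ h h' with e | e
      exacts [⟨1, e⟩, ⟨3, e⟩])
    (covered_of fun _ _ _ h h' => by
      rcases inter_cmb123_C_cmb124_D h h' with e | e
      exacts [⟨5, e⟩, ⟨6, e⟩])
    (covered_of fun _ _ _ h h' => by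
      rcases inter_cmb123_C_cmb124_M₁ h h' with e | e
      exacts [⟨0, e⟩, ⟨1, e⟩])
    (covered_of fun _ _ _ h h' => ⟨4, inter_cmb123_L₁_cmb123_L₂ h h'⟩)
    (covered_of fun _ _ _ h h' => ⟨7, inter_cmb123_L₁_cmb124_D h h'⟩)
    (covered_of fun _ _ _ h h' => ⟨0, inter_cmb123_L₁_cmb124_M₁ h h'⟩)
    (covered_of fun _ _ _ h h' => ⟨8, inter_cmb123_L₂_cmb124_D h h'⟩)
    (covered_of fun _ _ _ h h' => ⟨1, inter_cmb123_L₂_cmb124_M₁ h h'⟩)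
    (covered_of fun _ _ _ h h' => by
      rcases inter_cmb124_D_cmb124_M₁ hr h h' with e | e
      exacts [⟨9, e⟩, ⟨10, e⟩])
  injective := by
    intro u v huv h
    rcases cmb124Types_eq u v huv h with ⟨rfl, rfl⟩ | ⟨rfl, rfl⟩
    · exact ne_smul_of_coordinates fun c h0 h1 h2 => one_ne_zero (α := ℂ) (by linear_combination h1)
    · exact ne_smul_of_coordinates fun c h0 h1 h2 => one_ne_zero (α := ℂ) (by linear_combination (81
      / 320 * r - 9 / 80) * h0 + (-9 / 80 * r + 11 / 20) * h2 + (-81 / 320 * c - 81 / 320) * hr)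

/-- Both lines `M₁` and `M₂` join a point of `C ∩ L₁` to a point of `C ∩ L₂`. Only `M₂` is preserved
by the symmetry `x ↦ -x` of the remaining components. -/
lemma inter_cmb123_C_cmb124_M₂ {X Y Z : ℂ}
    (h : eval ![X, Y, Z] Cmb123.C = 0) (h' : eval ![X, Y, Z] Cmb124.M₂ = 0) :
    Proportional ![X, Y, Z] ![-1, 1, 1] ∨ Proportional ![X, Y, Z] ![1, 1, 1] := by
  rw [eval_cmb123_C] at h
  rw [eval_cmb124_M₂] at h'
  have key : (X + Z) * (X - Z) = 0 := by linear_combination -h + Z * h'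
  rcases mul_eq_zero.1 key with e | e
  · exact .inl (proportional_of_coordinates Z (by linear_combination e) (by linear_combination h')
    (by ring))
  · exact .inr (proportional_of_coordinates Z (by linear_combination e) (by linear_combination h')
    (by ring))

lemma inter_cmb123_L₁_cmb124_M₂ {X Y Z : ℂ}
    (h : eval ![X, Y, Z] Cmb123.L₁ = 0) (h' : eval ![X, Y, Z] Cmb124.M₂ = 0) :
    Proportional ![X, Y, Z] ![-1, 1, 1] := by
  rw [eval_cmb123_L₁] at h
  rw [eval_cmb124_M₂] at h'
  exact proportional_of_coordinates Z (by linear_combination 1 / 3 * h - 1 / 3 * h') (by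
    linear_combination h') (by ring)

lemma inter_cmb123_L₂_cmb124_M₂ {X Y Z : ℂ}
    (h : eval ![X, Y, Z] Cmb123.L₂ = 0) (h' : eval ![X, Y, Z] Cmb124.M₂ = 0) :
    Proportional ![X, Y, Z] ![1, 1, 1] := by
  rw [eval_cmb123_L₂] at h
  rw [eval_cmb124_M₂] at h'
  exact proportional_of_coordinates Z (by linear_combination -1 / 3 * h + 1 / 3 * h') (by
    linear_combination h') (by ring)

lemma inter_cmb124_D_cmb124_M₂ {X Y Z : ℂ}
    (h : eval ![X, Y, Z] Cmb124.D = 0) (h' : eval ![X, Y, Z] Cmb124.M₂ = 0) :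
    Proportional ![X, Y, Z] ![2 / 3 * b, 1, 1] ∨ Proportional ![X, Y, Z] ![-2 / 3 * b, 1, 1] := by
  rw [eval_cmb124_D] at h
  rw [eval_cmb124_M₂] at h'
  have key : (-2 / 3 * b * Z + X) * (2 / 3 * b * Z + X) = 0 := by linear_combination -8 / 9 * h + 8
    / 9 * Z * h' - 4 / 9 * Z ^ 2 * b_mul_b
  rcases mul_eq_zero.1 key with e | e
  · exact .inl (proportional_of_coordinates Z (by linear_combination e) (by linear_combination h')
    (by ring))
  · exact .inr (proportional_of_coordinates Z (by linear_combination e) (by linear_combination h')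
    (by ring))

/-- The components of the second curve. -/
def cmb124Second : Fin 5 → S :=
  ![Cmb123.C, Cmb123.L₁, Cmb123.L₂, Cmb124.D, Cmb124.M₂]

/-- The singular points of the second curve. -/
def cmb124SecondPoints : Fin 11 → Fin 3 → ℂ :=
  ![![-1, 1, 1], ![1, 1, 1], ![-2, 4, 1], ![2, 4, 1], ![0, -2, 1], ![0, 1, 0], ![0, 0, 1], ![-4 / 3,
    2, 1], ![4 / 3, 2, 1], ![2 / 3 * b, 1, 1], ![-2 / 3 * b, 1, 1]]

lemma hasLocalForm_cmb124Second (a : Fin 11) :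
    HasLocalForm cmb124Second (cmb124Types a) (cmb124SecondPoints a) := by
  have h0 : HasLocalForm cmb124Second (triplePoint 1 4 0) ![-1, 1, 1] :=
    hasLocalForm_triplePoint 1 4 0 2 (linearForm (-1 / 3) (1 / 3) 0) (linearForm (-2 / 3) (-1 / 3)
      0) (C 1) rfl ((eval_cmb123_L₁ ..).trans (by ring)) ((eval_cmb124_M₂ ..).trans (by ring))
      (cross_two_ne_zero (grad_cmb123_L₁ ..) (grad_cmb124_M₂ ..) (ne_zero_of_mul (1 / 3) (by ring)))
      ((eval_linearForm_vec ..).trans_ne (ne_zero_of_mul (3 / 2) (by ring))) ((eval_linearForm_vec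
      ..).trans_ne (ne_zero_of_mul 3 (by ring))) ((eval_C _).trans_ne (ne_zero_of_mul 1 (by ring)))
      (eq_of_eval fun X Y Z => by
        simp only [cmb124Second, cons_val, map_add, map_mul, eval_C, eval_linearForm_vec,
          eval_cmb123_C, eval_cmb123_L₁, eval_cmb124_M₂]
        ring) (forall_fin_five (fun _ _ h => absurd rfl h) (fun h => absurd rfl h) (fun _ _ _ =>
          (eval_cmb123_L₂ ..).trans_ne (ne_zero_of_mul (1 / 6) (by ring))) (fun _ _ _ =>
          (eval_cmb124_D ..).trans_ne (ne_zero_of_mul (-8) (by ring))) (fun _ h => absurd rfl h))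
  have h1 : HasLocalForm cmb124Second (triplePoint 2 4 0) ![1, 1, 1] :=
    hasLocalForm_triplePoint 2 4 0 2 (linearForm (1 / 3) (1 / 3) 0) (linearForm (2 / 3) (-1 / 3) 0)
      (C 1) rfl ((eval_cmb123_L₂ ..).trans (by ring)) ((eval_cmb124_M₂ ..).trans (by ring))
      (cross_two_ne_zero (grad_cmb123_L₂ ..) (grad_cmb124_M₂ ..) (ne_zero_of_mul (-1 / 3) (by
      ring))) ((eval_linearForm_vec ..).trans_ne (ne_zero_of_mul (3 / 2) (by ring)))
      ((eval_linearForm_vec ..).trans_ne (ne_zero_of_mul 3 (by ring))) ((eval_C _).trans_ne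
      (ne_zero_of_mul 1 (by ring))) (eq_of_eval fun X Y Z => by
        simp only [cmb124Second, cons_val, map_add, map_mul, eval_C, eval_linearForm_vec,
          eval_cmb123_C, eval_cmb123_L₂, eval_cmb124_M₂]
        ring) (forall_fin_five (fun _ _ h => absurd rfl h) (fun _ _ _ => (eval_cmb123_L₁
          ..).trans_ne (ne_zero_of_mul (1 / 6) (by ring))) (fun h => absurd rfl h) (fun _ _ _ =>
          (eval_cmb124_D ..).trans_ne (ne_zero_of_mul (-8) (by ring))) (fun _ h => absurd rfl h))
  have h2 : HasLocalForm cmb124Second (node 0 1) ![-2, 4, 1] :=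
    hasLocalForm_node 0 1 2 rfl ((eval_cmb123_C ..).trans (by ring)) ((eval_cmb123_L₁ ..).trans (by
      ring)) (cross_two_ne_zero (grad_cmb123_C ..) (grad_cmb123_L₁ ..) (ne_zero_of_mul 1 (by ring)))
      (forall_fin_five (fun h => absurd rfl h) (fun _ h => absurd rfl h) (fun _ _ => (eval_cmb123_L₂
      ..).trans_ne (ne_zero_of_mul (1 / 12) (by ring))) (fun _ _ => (eval_cmb124_D ..).trans_ne
      (ne_zero_of_mul (-2) (by ring))) (fun _ _ => (eval_cmb124_M₂ ..).trans_ne (ne_zero_of_mul (1 /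
      3) (by ring))))
  have h3 : HasLocalForm cmb124Second (node 0 2) ![2, 4, 1] :=
    hasLocalForm_node 0 2 2 rfl ((eval_cmb123_C ..).trans (by ring)) ((eval_cmb123_L₂ ..).trans (by
      ring)) (cross_two_ne_zero (grad_cmb123_C ..) (grad_cmb123_L₂ ..) (ne_zero_of_mul (-1) (by
      ring))) (forall_fin_five (fun h => absurd rfl h) (fun _ _ => (eval_cmb123_L₁ ..).trans_ne
      (ne_zero_of_mul (1 / 12) (by ring))) (fun _ h => absurd rfl h) (fun _ _ => (eval_cmb124_D
      ..).trans_ne (ne_zero_of_mul (-2) (by ring))) (fun _ _ => (eval_cmb124_M₂ ..).trans_ne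
      (ne_zero_of_mul (1 / 3) (by ring))))
  have h4 : HasLocalForm cmb124Second (node 1 2) ![0, -2, 1] :=
    hasLocalForm_node 1 2 2 rfl ((eval_cmb123_L₁ ..).trans (by ring)) ((eval_cmb123_L₂ ..).trans (by
      ring)) (cross_two_ne_zero (grad_cmb123_L₁ ..) (grad_cmb123_L₂ ..) (ne_zero_of_mul (1 / 6) (by
      ring))) (forall_fin_five (fun _ _ => (eval_cmb123_C ..).trans_ne (ne_zero_of_mul (-1 / 2) (by
      ring))) (fun h => absurd rfl h) (fun _ h => absurd rfl h) (fun _ _ => (eval_cmb124_D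
      ..).trans_ne (ne_zero_of_mul (-1 / 2) (by ring))) (fun _ _ => (eval_cmb124_M₂ ..).trans_ne
      (ne_zero_of_mul (-1 / 3) (by ring))))
  have h5 : HasLocalForm cmb124Second (tacnode 0 3) ![0, 1, 0] :=
    hasLocalForm_tacnode 0 3 1 (C (-8) : S) (C (-8) : S) (linearForm 1 0 0) rfl ((eval_cmb123_C
      ..).trans (by ring)) ((eval_linearForm_vec ..).trans (by ring)) (cross_one_ne_zero
      (grad_linearForm_vec ..) (grad_cmb123_C ..) (ne_zero_of_mul (-1) (by ring))) ((eval_C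
      _).trans_ne (ne_zero_of_mul (-1 / 8) (by ring))) ((eval_C _).trans_ne (ne_zero_of_mul (-1 / 8)
      (by ring))) (eq_of_eval fun X Y Z => by
        simp only [cmb124Second, cons_val, map_add, map_mul, map_pow, eval_C, eval_linearForm_vec,
          eval_cmb124_D, eval_cmb123_C]
        ring) (by decide) (forall_fin_five (fun h => absurd rfl h) (fun _ _ => (eval_cmb123_L₁
          ..).trans_ne (ne_zero_of_mul 1 (by ring))) (fun _ _ => (eval_cmb123_L₂ ..).trans_ne
          (ne_zero_of_mul 1 (by ring))) (fun _ h => absurd rfl h) (fun _ _ => (eval_cmb124_M₂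
          ..).trans_ne (ne_zero_of_mul 1 (by ring))))
  have h6 : HasLocalForm cmb124Second (tacnode 0 3) ![0, 0, 1] :=
    hasLocalForm_tacnode 0 3 2 (C (-8) : S) (C (-8) : S) (linearForm 1 0 0) rfl ((eval_cmb123_C
      ..).trans (by ring)) ((eval_linearForm_vec ..).trans (by ring)) (cross_two_ne_zero
      (grad_linearForm_vec ..) (grad_cmb123_C ..) (ne_zero_of_mul 1 (by ring))) ((eval_C _).trans_ne
      (ne_zero_of_mul (-1 / 8) (by ring))) ((eval_C _).trans_ne (ne_zero_of_mul (-1 / 8) (by ring)))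
      (eq_of_eval fun X Y Z => by
        simp only [cmb124Second, cons_val, map_add, map_mul, map_pow, eval_C, eval_linearForm_vec,
          eval_cmb124_D, eval_cmb123_C]
        ring) (by decide) (forall_fin_five (fun h => absurd rfl h) (fun _ _ => (eval_cmb123_L₁
          ..).trans_ne (ne_zero_of_mul (1 / 2) (by ring))) (fun _ _ => (eval_cmb123_L₂ ..).trans_ne
          (ne_zero_of_mul (1 / 2) (by ring))) (fun _ h => absurd rfl h) (fun _ _ => (eval_cmb124_M₂
          ..).trans_ne (ne_zero_of_mul (-1) (by ring))))
  have h7 : HasLocalForm cmb124Second (tacnode 1 3) ![-4 / 3, 2, 1] :=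
    hasLocalForm_tacnode 1 3 2 (linearForm 0 0 (-8 / 9)) (C (-8 / 9) : S) (linearForm 1 0 (4 / 3))
      rfl ((eval_cmb123_L₁ ..).trans (by ring)) ((eval_linearForm_vec ..).trans (by ring))
      (cross_two_ne_zero (grad_linearForm_vec ..) (grad_cmb123_L₁ ..) (ne_zero_of_mul 1 (by ring)))
      ((eval_linearForm_vec ..).trans_ne (ne_zero_of_mul (-9 / 8) (by ring))) ((eval_C _).trans_ne
      (ne_zero_of_mul (-9 / 8) (by ring))) (eq_of_eval fun X Y Z => by
        simp only [cmb124Second, cons_val, map_add, map_mul, map_pow, eval_C, eval_linearForm_vec,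
          eval_cmb124_D, eval_cmb123_L₁]
        ring) (by decide) (forall_fin_five (fun _ _ => (eval_cmb123_C ..).trans_ne (ne_zero_of_mul
          (9 / 2) (by ring))) (fun h => absurd rfl h) (fun _ _ => (eval_cmb123_L₂ ..).trans_ne
          (ne_zero_of_mul (1 / 8) (by ring))) (fun _ h => absurd rfl h) (fun _ _ => (eval_cmb124_M₂
          ..).trans_ne (ne_zero_of_mul 1 (by ring))))
  have h8 : HasLocalForm cmb124Second (tacnode 2 3) ![4 / 3, 2, 1] :=
    hasLocalForm_tacnode 2 3 2 (linearForm 0 0 (-8 / 9)) (C (-8 / 9) : S) (linearForm 1 0 (-4 / 3))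
      rfl ((eval_cmb123_L₂ ..).trans (by ring)) ((eval_linearForm_vec ..).trans (by ring))
      (cross_two_ne_zero (grad_linearForm_vec ..) (grad_cmb123_L₂ ..) (ne_zero_of_mul 1 (by ring)))
      ((eval_linearForm_vec ..).trans_ne (ne_zero_of_mul (-9 / 8) (by ring))) ((eval_C _).trans_ne
      (ne_zero_of_mul (-9 / 8) (by ring))) (eq_of_eval fun X Y Z => by
        simp only [cmb124Second, cons_val, map_add, map_mul, map_pow, eval_C, eval_linearForm_vec,
          eval_cmb124_D, eval_cmb123_L₂]
        ring) (by decide) (forall_fin_five (fun _ _ => (eval_cmb123_C ..).trans_ne (ne_zero_of_mul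
          (9 / 2) (by ring))) (fun _ _ => (eval_cmb123_L₁ ..).trans_ne (ne_zero_of_mul (1 / 8) (by
          ring))) (fun h => absurd rfl h) (fun _ h => absurd rfl h) (fun _ _ => (eval_cmb124_M₂
          ..).trans_ne (ne_zero_of_mul 1 (by ring))))
  have h9 : HasLocalForm cmb124Second (node 3 4) ![2 / 3 * b, 1, 1] :=
    hasLocalForm_node 3 4 2 rfl ((eval_cmb124_D ..).trans (by linear_combination -1 / 2 * b_mul_b))
      ((eval_cmb124_M₂ ..).trans (by ring)) (cross_two_ne_zero (grad_cmb124_D ..) (grad_cmb124_M₂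
      ..) (ne_zero_of_mul (-1 / 3 * b) (by linear_combination 1 / 2 * b_mul_b))) (forall_fin_five
      (fun _ _ => (eval_cmb123_C ..).trans_ne (ne_zero_of_mul 9 (by linear_combination -4 *
      b_mul_b))) (fun _ _ => (eval_cmb123_L₁ ..).trans_ne (ne_zero_of_mul (-2 * b + 3) (by
      linear_combination -4 * b_mul_b))) (fun _ _ => (eval_cmb123_L₂ ..).trans_ne (ne_zero_of_mul (2
      * b + 3) (by linear_combination -4 * b_mul_b))) (fun h => absurd rfl h) (fun _ h => absurd rfl
      h))
  have h10 : HasLocalForm cmb124Second (node 3 4) ![-2 / 3 * b, 1, 1] :=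
    hasLocalForm_node 3 4 2 rfl ((eval_cmb124_D ..).trans (by linear_combination -1 / 2 * b_mul_b))
      ((eval_cmb124_M₂ ..).trans (by ring)) (cross_two_ne_zero (grad_cmb124_D ..) (grad_cmb124_M₂
      ..) (ne_zero_of_mul (1 / 3 * b) (by linear_combination 1 / 2 * b_mul_b))) (forall_fin_five
      (fun _ _ => (eval_cmb123_C ..).trans_ne (ne_zero_of_mul 9 (by linear_combination -4 *
      b_mul_b))) (fun _ _ => (eval_cmb123_L₁ ..).trans_ne (ne_zero_of_mul (2 * b + 3) (by
      linear_combination -4 * b_mul_b))) (fun _ _ => (eval_cmb123_L₂ ..).trans_ne (ne_zero_of_mul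
      (-2 * b + 3) (by linear_combination -4 * b_mul_b))) (fun h => absurd rfl h) (fun _ h => absurd
      rfl h))
  fin_cases a
  exacts [h0, h1, h2, h3, h4, h5, h6, h7, h8, h9, h10]

lemma isArrangement_cmb124Second :
    IsArrangement cmb124Second cmb124Degrees cmb124Types cmb124SecondPoints where
  smooth := forall_fin_five isSmoothForm_cmb123_C isSmoothForm_cmb123_L₁ isSmoothForm_cmb123_L₂
    isSmoothForm_cmb124_D isSmoothForm_cmb124_M₂
  localForm := hasLocalForm_cmb124Second
  cover := forall_lt_five (covered_of fun _ _ _ h h' => by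
      rcases inter_cmb123_C_cmb123_L₁ h h' with e | e
      exacts [⟨2, e⟩, ⟨0, e⟩])
    (covered_of fun _ _ _ h h' => by
      rcases inter_cmb123_C_cmb123_L₂ h h' with e | e
      -- The points `(2, 4, 1)` and `(1, 1, 1)` of `C ∩ L₂` have exchanged roles: the line now
      -- passes through the latter.
      exacts [⟨3, e⟩, ⟨1, e⟩])
    (covered_of fun _ _ _ h h' => by
      rcases inter_cmb123_C_cmb124_D h h' with e | e
      exacts [⟨5, e⟩, ⟨6, e⟩])
    (covered_of fun _ _ _ h h' => by
      rcases inter_cmb123_C_cmb124_M₂ h h' with e | e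
      exacts [⟨0, e⟩, ⟨1, e⟩])
    (covered_of fun _ _ _ h h' => ⟨4, inter_cmb123_L₁_cmb123_L₂ h h'⟩)
    (covered_of fun _ _ _ h h' => ⟨7, inter_cmb123_L₁_cmb124_D h h'⟩)
    (covered_of fun _ _ _ h h' => ⟨0, inter_cmb123_L₁_cmb124_M₂ h h'⟩)
    (covered_of fun _ _ _ h h' => ⟨8, inter_cmb123_L₂_cmb124_D h h'⟩)
    (covered_of fun _ _ _ h h' => ⟨1, inter_cmb123_L₂_cmb124_M₂ h h'⟩)
    (covered_of fun _ _ _ h h' => by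
      rcases inter_cmb124_D_cmb124_M₂ h h' with e | e
      exacts [⟨9, e⟩, ⟨10, e⟩])
  injective := by
    intro u v huv h
    rcases cmb124Types_eq u v huv h with ⟨rfl, rfl⟩ | ⟨rfl, rfl⟩
    · exact ne_smul_of_coordinates fun c h0 h1 h2 => one_ne_zero (α := ℂ) (by linear_combination h1)
    · exact ne_smul_of_coordinates fun c h0 h1 h2 => one_ne_zero (α := ℂ) (by linear_combination 3 /
      8 * b * h0 + 1 / 2 * h2 + (-1 / 4 * c - 1 / 4) * b_mul_b)

/-! ### The `cmb212` pair: singular points and combinatorics. -/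

/-- The degrees of the components. -/
def cmb212Degrees : Fin 5 → ℕ := ![2, 2, 1, 1, 1]

/-- The local types at the singular points. -/
def cmb212Types : Fin 11 → Fin 5 → Branch :=
  ![node 0 1, node 0 1, triplePoint 0 2 1, triplePoint 0 2 1, tacnode 3 0, tacnode 3 1, tacnode 4 0,
    tacnode 4 1, node 2 3, node 2 4, node 3 4]

lemma isSeparating_cmb212Types : IsSeparating cmb212Types := by
  unfold IsSeparating
  decide +kernel

lemma cmb212Types_eq : ∀ u v, u < v →
    (∀ i, cmb212Types u i = .away ↔ cmb212Types v i = .away) →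
    (u = 0 ∧ v = 1) ∨ (u = 2 ∧ v = 3) := by
  decide +kernel

/-- The pencil contains the pair of axes, `C₂ = 676 C₁ + 88 x y`. Of the four base points, the two
on `y = 0` lie on `M₀` and become triple points, while the two on `x = 0` are nodes. -/
lemma inter_cmb212_C₁_cmb212_C₂ {X Y Z : ℂ} {r : ℂ} (hr : r ^ 2 - 27 / 4 = 0)
    (h : eval ![X, Y, Z] Cmb212.C₁ = 0) (h' : eval ![X, Y, Z] Cmb212.C₂ = 0) :
    Proportional ![X, Y, Z] ![0, r, 1] ∨ Proportional ![X, Y, Z] ![0, -r, 1] ∨ Proportional ![X, Y,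
      Z] ![r, 0, 1] ∨ Proportional ![X, Y, Z] ![-r, 0, 1] := by
  rw [eval_cmb212_C₁] at h
  rw [eval_cmb212_C₂] at h'
  have hh : (X) * (Y) = 0 := by linear_combination -169 / 22 * h + 1 / 88 * h'
  rcases mul_eq_zero.1 hh with h₁ | h₁
  · have key : (-r * Z + Y) * (r * Z + Y) = 0 := by linear_combination h + (-X - Y) * h₁ - Z ^ 2 *
    hr
    rcases mul_eq_zero.1 key with e | e
    · exact .inl (proportional_of_coordinates Z (by linear_combination h₁) (by linear_combination e)
      (by ring))
    · exact .inr (.inl (proportional_of_coordinates Z (by linear_combination h₁) (by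
      linear_combination e) (by ring)))
  · have key : (-r * Z + X) * (r * Z + X) = 0 := by linear_combination h + (-X - Y) * h₁ - Z ^ 2 *
    hr
    rcases mul_eq_zero.1 key with e | e
    · exact .inr (.inr (.inl (proportional_of_coordinates Z (by linear_combination e) (by
      linear_combination h₁) (by ring))))
    · exact .inr (.inr (.inr (proportional_of_coordinates Z (by linear_combination e) (by
      linear_combination h₁) (by ring))))

lemma inter_cmb212_C₁_cmb212_M₀ {X Y Z : ℂ} {r : ℂ} (hr : r ^ 2 - 27 / 4 = 0)
    (h : eval ![X, Y, Z] Cmb212.C₁ = 0) (h' : eval ![X, Y, Z] Cmb212.M₀ = 0) :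
    Proportional ![X, Y, Z] ![r, 0, 1] ∨ Proportional ![X, Y, Z] ![-r, 0, 1] := by
  rw [eval_cmb212_C₁] at h
  rw [eval_cmb212_M₀] at h'
  have key : (-r * Z + X) * (r * Z + X) = 0 := by linear_combination h + (-X - Y) * h' - Z ^ 2 * hr
  rcases mul_eq_zero.1 key with e | e
  · exact .inl (proportional_of_coordinates Z (by linear_combination e) (by linear_combination h')
    (by ring))
  · exact .inr (proportional_of_coordinates Z (by linear_combination e) (by linear_combination h')
    (by ring))

/-- The lines `M₁`, `M₂` and `M₃` are common tangents of the two conics, so elimination always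
leaves a square. -/
lemma inter_cmb212_C₁_cmb212_M₁ {X Y Z : ℂ}
    (h : eval ![X, Y, Z] Cmb212.C₁ = 0) (h' : eval ![X, Y, Z] Cmb212.M₁ = 0) :
    Proportional ![X, Y, Z] ![33 / 13, 3 / 26, 1] := by
  rw [eval_cmb212_C₁] at h
  rw [eval_cmb212_M₁] at h'
  have e : X - 33 / 13 * Z = 0 := pow_eq_zero_iff two_ne_zero |>.1 (by linear_combination 64 / 169 *
    h + (7 / 169 * X - 8 / 169 * Y - 3 / 13 * Z) * h')
  exact proportional_of_coordinates Z (by linear_combination e) (by linear_combination -15 / 8 * e +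
    1 / 8 * h') (by ring)

lemma inter_cmb212_C₁_cmb212_M₂ {X Y Z : ℂ}
    (h : eval ![X, Y, Z] Cmb212.C₁ = 0) (h' : eval ![X, Y, Z] Cmb212.M₂ = 0) :
    Proportional ![X, Y, Z] ![-33 / 13, -3 / 26, 1] := by
  rw [eval_cmb212_C₁] at h
  rw [eval_cmb212_M₂] at h'
  have e : X + 33 / 13 * Z = 0 := pow_eq_zero_iff two_ne_zero |>.1 (by linear_combination 64 / 169 *
    h + (7 / 169 * X - 8 / 169 * Y + 3 / 13 * Z) * h')
  exact proportional_of_coordinates Z (by linear_combination e) (by linear_combination -15 / 8 * e +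
    1 / 8 * h') (by ring)

lemma inter_cmb212_C₂_cmb212_M₀ {X Y Z : ℂ} {r : ℂ} (hr : r ^ 2 - 27 / 4 = 0)
    (h : eval ![X, Y, Z] Cmb212.C₂ = 0) (h' : eval ![X, Y, Z] Cmb212.M₀ = 0) :
    Proportional ![X, Y, Z] ![r, 0, 1] ∨ Proportional ![X, Y, Z] ![-r, 0, 1] := by
  rw [eval_cmb212_C₂] at h
  rw [eval_cmb212_M₀] at h'
  have key : (-r * Z + X) * (r * Z + X) = 0 := by linear_combination 1 / 676 * h + (-191 / 169 * X -
    Y) * h' - Z ^ 2 * hr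
  rcases mul_eq_zero.1 key with e | e
  · exact .inl (proportional_of_coordinates Z (by linear_combination e) (by linear_combination h')
    (by ring))
  · exact .inr (proportional_of_coordinates Z (by linear_combination e) (by linear_combination h')
    (by ring))

lemma inter_cmb212_C₂_cmb212_M₁ {X Y Z : ℂ}
    (h : eval ![X, Y, Z] Cmb212.C₂ = 0) (h' : eval ![X, Y, Z] Cmb212.M₁ = 0) :
    Proportional ![X, Y, Z] ![429 / 161, -39 / 322, 1] := by
  rw [eval_cmb212_C₂] at h
  rw [eval_cmb212_M₁] at h'
  have e : X - 429 / 161 * Z = 0 := pow_eq_zero_iff two_ne_zero |>.1 (by linear_combination 16 /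
    25921 * h + (1007 / 25921 * X - 1352 / 25921 * Y - 6591 / 25921 * Z) * h')
  exact proportional_of_coordinates Z (by linear_combination e) (by linear_combination -15 / 8 * e +
    1 / 8 * h') (by ring)

lemma inter_cmb212_C₂_cmb212_M₂ {X Y Z : ℂ}
    (h : eval ![X, Y, Z] Cmb212.C₂ = 0) (h' : eval ![X, Y, Z] Cmb212.M₂ = 0) :
    Proportional ![X, Y, Z] ![-429 / 161, 39 / 322, 1] := by
  rw [eval_cmb212_C₂] at h
  rw [eval_cmb212_M₂] at h'
  have e : X + 429 / 161 * Z = 0 := pow_eq_zero_iff two_ne_zero |>.1 (by linear_combination 16 /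
    25921 * h + (1007 / 25921 * X - 1352 / 25921 * Y + 6591 / 25921 * Z) * h')
  exact proportional_of_coordinates Z (by linear_combination e) (by linear_combination -15 / 8 * e +
    1 / 8 * h') (by ring)

lemma inter_cmb212_M₀_cmb212_M₁ {X Y Z : ℂ}
    (h : eval ![X, Y, Z] Cmb212.M₀ = 0) (h' : eval ![X, Y, Z] Cmb212.M₁ = 0) :
    Proportional ![X, Y, Z] ![13 / 5, 0, 1] := by
  rw [eval_cmb212_M₀] at h
  rw [eval_cmb212_M₁] at h'
  exact proportional_of_coordinates Z (by linear_combination -8 / 15 * h + 1 / 15 * h') (by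
    linear_combination h) (by ring)

lemma inter_cmb212_M₀_cmb212_M₂ {X Y Z : ℂ}
    (h : eval ![X, Y, Z] Cmb212.M₀ = 0) (h' : eval ![X, Y, Z] Cmb212.M₂ = 0) :
    Proportional ![X, Y, Z] ![-13 / 5, 0, 1] := by
  rw [eval_cmb212_M₀] at h
  rw [eval_cmb212_M₂] at h'
  exact proportional_of_coordinates Z (by linear_combination -8 / 15 * h + 1 / 15 * h') (by
    linear_combination h) (by ring)

lemma inter_cmb212_M₁_cmb212_M₂ {X Y Z : ℂ}
    (h : eval ![X, Y, Z] Cmb212.M₁ = 0) (h' : eval ![X, Y, Z] Cmb212.M₂ = 0) :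
    Proportional ![X, Y, Z] ![-8 / 15, 1, 0] := by
  rw [eval_cmb212_M₁] at h
  rw [eval_cmb212_M₂] at h'
  exact proportional_of_coordinates Y (by linear_combination 1 / 30 * h + 1 / 30 * h') (by ring) (by
    linear_combination -1 / 78 * h + 1 / 78 * h')

/-- The components of the first curve. -/
def cmb212First : Fin 5 → S :=
  ![Cmb212.C₁, Cmb212.C₂, Cmb212.M₀, Cmb212.M₁, Cmb212.M₂]

/-- The singular points of the first curve. -/
def cmb212FirstPoints (r : ℂ) : Fin 11 → Fin 3 → ℂ :=
  ![![0, r, 1], ![0, -r, 1], ![r, 0, 1], ![-r, 0, 1], ![33 / 13, 3 / 26, 1], ![429 / 161, -39 / 322,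
    1], ![-33 / 13, -3 / 26, 1], ![-429 / 161, 39 / 322, 1], ![13 / 5, 0, 1], ![-13 / 5, 0, 1], ![-8
    / 15, 1, 0]]

lemma hasLocalForm_cmb212First {r : ℂ} (hr : r ^ 2 - 27 / 4 = 0) (a : Fin 11) :
    HasLocalForm cmb212First (cmb212Types a) (cmb212FirstPoints r a) := by
  have h0 : HasLocalForm cmb212First (node 0 1) ![0, r, 1] :=
    hasLocalForm_node 0 1 2 rfl ((eval_cmb212_C₁ ..).trans (by linear_combination hr))
      ((eval_cmb212_C₂ ..).trans (by linear_combination 676 * hr)) (cross_two_ne_zero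
      (grad_cmb212_C₁ ..) (grad_cmb212_C₂ ..) (ne_zero_of_mul (-1 / 1188) (by linear_combination 4 /
      27 * hr))) (forall_fin_five (fun h => absurd rfl h) (fun _ h => absurd rfl h) (fun _ _ =>
      (eval_cmb212_M₀ ..).trans_ne (ne_zero_of_mul (4 / 27 * r) (by linear_combination 4 / 27 *
      hr))) (fun _ _ => (eval_cmb212_M₁ ..).trans_ne (ne_zero_of_mul (-8 / 1089 * r - 13 / 363) (by
      linear_combination -64 / 1089 * hr))) (fun _ _ => (eval_cmb212_M₂ ..).trans_ne (ne_zero_of_mul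
      (-8 / 1089 * r + 13 / 363) (by linear_combination -64 / 1089 * hr))))
  have h1 : HasLocalForm cmb212First (node 0 1) ![0, -r, 1] :=
    hasLocalForm_node 0 1 2 rfl ((eval_cmb212_C₁ ..).trans (by linear_combination hr))
      ((eval_cmb212_C₂ ..).trans (by linear_combination 676 * hr)) (cross_two_ne_zero
      (grad_cmb212_C₁ ..) (grad_cmb212_C₂ ..) (ne_zero_of_mul (-1 / 1188) (by linear_combination 4 /
      27 * hr))) (forall_fin_five (fun h => absurd rfl h) (fun _ h => absurd rfl h) (fun _ _ =>
      (eval_cmb212_M₀ ..).trans_ne (ne_zero_of_mul (-4 / 27 * r) (by linear_combination 4 / 27 *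
      hr))) (fun _ _ => (eval_cmb212_M₁ ..).trans_ne (ne_zero_of_mul (8 / 1089 * r - 13 / 363) (by
      linear_combination -64 / 1089 * hr))) (fun _ _ => (eval_cmb212_M₂ ..).trans_ne (ne_zero_of_mul
      (8 / 1089 * r + 13 / 363) (by linear_combination -64 / 1089 * hr))))
  -- The identity is `C₂ = 676 C₁ + 88 x M₀`, and `x` is the nonzero root `r` at the point.
  have h2 : HasLocalForm cmb212First (triplePoint 0 2 1) ![r, 0, 1] :=
    hasLocalForm_triplePoint 0 2 1 2 (C 676 : S) (linearForm 88 0 0) (C 1) rfl ((eval_cmb212_C₁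
      ..).trans (by linear_combination hr)) ((eval_cmb212_M₀ ..).trans (by ring)) (cross_two_ne_zero
      (grad_cmb212_C₁ ..) (grad_cmb212_M₀ ..) (ne_zero_of_mul (2 / 27 * r) (by linear_combination 4
      / 27 * hr))) ((eval_C _).trans_ne (ne_zero_of_mul (1 / 676) (by ring))) ((eval_linearForm_vec
      ..).trans_ne (ne_zero_of_mul (1 / 594 * r) (by linear_combination 4 / 27 * hr))) ((eval_C
      _).trans_ne (ne_zero_of_mul 1 (by ring))) (eq_of_eval fun X Y Z => by
        simp only [cmb212First, cons_val, map_add, map_mul, eval_C, eval_linearForm_vec,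
          eval_cmb212_C₂, eval_cmb212_C₁, eval_cmb212_M₀]
        ring) (forall_fin_five (fun h => absurd rfl h) (fun _ _ h => absurd rfl h) (fun _ h =>
          absurd rfl h) (fun _ _ _ => (eval_cmb212_M₁ ..).trans_ne (ne_zero_of_mul (-20 / 3 * r - 52
          / 3) (by linear_combination -100 * hr))) (fun _ _ _ => (eval_cmb212_M₂ ..).trans_ne
          (ne_zero_of_mul (-20 / 3 * r + 52 / 3) (by linear_combination -100 * hr))))
  have h3 : HasLocalForm cmb212First (triplePoint 0 2 1) ![-r, 0, 1] :=
    hasLocalForm_triplePoint 0 2 1 2 (C 676 : S) (linearForm 88 0 0) (C 1) rfl ((eval_cmb212_C₁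
      ..).trans (by linear_combination hr)) ((eval_cmb212_M₀ ..).trans (by ring)) (cross_two_ne_zero
      (grad_cmb212_C₁ ..) (grad_cmb212_M₀ ..) (ne_zero_of_mul (-2 / 27 * r) (by linear_combination 4
      / 27 * hr))) ((eval_C _).trans_ne (ne_zero_of_mul (1 / 676) (by ring))) ((eval_linearForm_vec
      ..).trans_ne (ne_zero_of_mul (-1 / 594 * r) (by linear_combination 4 / 27 * hr))) ((eval_C
      _).trans_ne (ne_zero_of_mul 1 (by ring))) (eq_of_eval fun X Y Z => by
        simp only [cmb212First, cons_val, map_add, map_mul, eval_C, eval_linearForm_vec,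
          eval_cmb212_C₂, eval_cmb212_C₁, eval_cmb212_M₀]
        ring) (forall_fin_five (fun h => absurd rfl h) (fun _ _ h => absurd rfl h) (fun _ h =>
          absurd rfl h) (fun _ _ _ => (eval_cmb212_M₁ ..).trans_ne (ne_zero_of_mul (20 / 3 * r - 52
          / 3) (by linear_combination -100 * hr))) (fun _ _ _ => (eval_cmb212_M₂ ..).trans_ne
          (ne_zero_of_mul (20 / 3 * r + 52 / 3) (by linear_combination -100 * hr))))
  -- Substituting for `y` from the line gives the conic leading coefficient `169 / 64` in `x`; its
  -- inverse normalises the square.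
  have h4 : HasLocalForm cmb212First (tacnode 3 0) ![33 / 13, 3 / 26, 1] :=
    hasLocalForm_tacnode 3 0 2 (linearForm (-7 / 169) (8 / 169) (3 / 13)) (C (64 / 169) : S)
      (linearForm 1 0 (-33 / 13)) rfl ((eval_cmb212_M₁ ..).trans (by ring)) ((eval_linearForm_vec
      ..).trans (by ring)) (cross_two_ne_zero (grad_linearForm_vec ..) (grad_cmb212_M₁ ..)
      (ne_zero_of_mul (1 / 8) (by ring))) ((eval_linearForm_vec ..).trans_ne (ne_zero_of_mul (2197 /
      288) (by ring))) ((eval_C _).trans_ne (ne_zero_of_mul (169 / 64) (by ring))) (eq_of_eval fun X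
      Y Z => by
        simp only [cmb212First, cons_val, map_add, map_mul, map_pow, eval_C, eval_linearForm_vec,
          eval_cmb212_C₁, eval_cmb212_M₁]
        ring) (by decide) (forall_fin_five (fun _ h => absurd rfl h) (fun _ _ => (eval_cmb212_C₂
          ..).trans_ne (ne_zero_of_mul (169 / 4356) (by ring))) (fun _ _ => (eval_cmb212_M₀
          ..).trans_ne (ne_zero_of_mul (26 / 3) (by ring))) (fun h => absurd rfl h) (fun _ _ =>
          (eval_cmb212_M₂ ..).trans_ne (ne_zero_of_mul (1 / 78) (by ring))))
  have h5 : HasLocalForm cmb212First (tacnode 3 1) ![429 / 161, -39 / 322, 1] :=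
    hasLocalForm_tacnode 3 1 2 (linearForm (-1007 / 25921) (1352 / 25921) (6591 / 25921)) (C (16 /
      25921) : S) (linearForm 1 0 (-429 / 161)) rfl ((eval_cmb212_M₁ ..).trans (by ring))
      ((eval_linearForm_vec ..).trans (by ring)) (cross_two_ne_zero (grad_linearForm_vec ..)
      (grad_cmb212_M₁ ..) (ne_zero_of_mul (1 / 8) (by ring))) ((eval_linearForm_vec ..).trans_ne
      (ne_zero_of_mul (25921 / 3744) (by ring))) ((eval_C _).trans_ne (ne_zero_of_mul (25921 / 16)
      (by ring))) (eq_of_eval fun X Y Z => by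
        simp only [cmb212First, cons_val, map_add, map_mul, map_pow, eval_C, eval_linearForm_vec,
          eval_cmb212_C₂, eval_cmb212_M₁]
        ring) (by decide) (forall_fin_five (fun _ _ => (eval_cmb212_C₁ ..).trans_ne (ne_zero_of_mul
          (25921 / 1089) (by ring))) (fun _ h => absurd rfl h) (fun _ _ => (eval_cmb212_M₀
          ..).trans_ne (ne_zero_of_mul (-322 / 39) (by ring))) (fun h => absurd rfl h) (fun _ _ =>
          (eval_cmb212_M₂ ..).trans_ne (ne_zero_of_mul (1 / 78) (by ring))))
  have h6 : HasLocalForm cmb212First (tacnode 4 0) ![-33 / 13, -3 / 26, 1] :=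
    hasLocalForm_tacnode 4 0 2 (linearForm (-7 / 169) (8 / 169) (-3 / 13)) (C (64 / 169) : S)
      (linearForm 1 0 (33 / 13)) rfl ((eval_cmb212_M₂ ..).trans (by ring)) ((eval_linearForm_vec
      ..).trans (by ring)) (cross_two_ne_zero (grad_linearForm_vec ..) (grad_cmb212_M₂ ..)
      (ne_zero_of_mul (1 / 8) (by ring))) ((eval_linearForm_vec ..).trans_ne (ne_zero_of_mul (-2197
      / 288) (by ring))) ((eval_C _).trans_ne (ne_zero_of_mul (169 / 64) (by ring))) (eq_of_eval fun
      X Y Z => by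
        simp only [cmb212First, cons_val, map_add, map_mul, map_pow, eval_C, eval_linearForm_vec,
          eval_cmb212_C₁, eval_cmb212_M₂]
        ring) (by decide) (forall_fin_five (fun _ h => absurd rfl h) (fun _ _ => (eval_cmb212_C₂
          ..).trans_ne (ne_zero_of_mul (169 / 4356) (by ring))) (fun _ _ => (eval_cmb212_M₀
          ..).trans_ne (ne_zero_of_mul (-26 / 3) (by ring))) (fun _ _ => (eval_cmb212_M₁
          ..).trans_ne (ne_zero_of_mul (-1 / 78) (by ring))) (fun h => absurd rfl h))
  have h7 : HasLocalForm cmb212First (tacnode 4 1) ![-429 / 161, 39 / 322, 1] :=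
    hasLocalForm_tacnode 4 1 2 (linearForm (-1007 / 25921) (1352 / 25921) (-6591 / 25921)) (C (16 /
      25921) : S) (linearForm 1 0 (429 / 161)) rfl ((eval_cmb212_M₂ ..).trans (by ring))
      ((eval_linearForm_vec ..).trans (by ring)) (cross_two_ne_zero (grad_linearForm_vec ..)
      (grad_cmb212_M₂ ..) (ne_zero_of_mul (1 / 8) (by ring))) ((eval_linearForm_vec ..).trans_ne
      (ne_zero_of_mul (-25921 / 3744) (by ring))) ((eval_C _).trans_ne (ne_zero_of_mul (25921 / 16)
      (by ring))) (eq_of_eval fun X Y Z => by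
        simp only [cmb212First, cons_val, map_add, map_mul, map_pow, eval_C, eval_linearForm_vec,
          eval_cmb212_C₂, eval_cmb212_M₂]
        ring) (by decide) (forall_fin_five (fun _ _ => (eval_cmb212_C₁ ..).trans_ne (ne_zero_of_mul
          (25921 / 1089) (by ring))) (fun _ h => absurd rfl h) (fun _ _ => (eval_cmb212_M₀
          ..).trans_ne (ne_zero_of_mul (322 / 39) (by ring))) (fun _ _ => (eval_cmb212_M₁
          ..).trans_ne (ne_zero_of_mul (-1 / 78) (by ring))) (fun h => absurd rfl h))
  have h8 : HasLocalForm cmb212First (node 2 3) ![13 / 5, 0, 1] :=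
    hasLocalForm_node 2 3 2 rfl ((eval_cmb212_M₀ ..).trans (by ring)) ((eval_cmb212_M₁ ..).trans (by
      ring)) (cross_two_ne_zero (grad_cmb212_M₀ ..) (grad_cmb212_M₁ ..) (ne_zero_of_mul (-1 / 15)
      (by ring))) (forall_fin_five (fun _ _ => (eval_cmb212_C₁ ..).trans_ne (ne_zero_of_mul 100 (by
      ring))) (fun _ _ => (eval_cmb212_C₂ ..).trans_ne (ne_zero_of_mul (25 / 169) (by ring))) (fun h
      => absurd rfl h) (fun _ h => absurd rfl h) (fun _ _ => (eval_cmb212_M₂ ..).trans_ne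
      (ne_zero_of_mul (1 / 78) (by ring))))
  have h9 : HasLocalForm cmb212First (node 2 4) ![-13 / 5, 0, 1] :=
    hasLocalForm_node 2 4 2 rfl ((eval_cmb212_M₀ ..).trans (by ring)) ((eval_cmb212_M₂ ..).trans (by
      ring)) (cross_two_ne_zero (grad_cmb212_M₀ ..) (grad_cmb212_M₂ ..) (ne_zero_of_mul (-1 / 15)
      (by ring))) (forall_fin_five (fun _ _ => (eval_cmb212_C₁ ..).trans_ne (ne_zero_of_mul 100 (by
      ring))) (fun _ _ => (eval_cmb212_C₂ ..).trans_ne (ne_zero_of_mul (25 / 169) (by ring))) (fun h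
      => absurd rfl h) (fun _ _ => (eval_cmb212_M₁ ..).trans_ne (ne_zero_of_mul (-1 / 78) (by
      ring))) (fun _ h => absurd rfl h))
  -- The lines `M₁` and `M₂` are parallel in the chart `z = 1`, so the chart `y = 1` is used.
  have h10 : HasLocalForm cmb212First (node 3 4) ![-8 / 15, 1, 0] :=
    hasLocalForm_node 3 4 1 rfl ((eval_cmb212_M₁ ..).trans (by ring)) ((eval_cmb212_M₂ ..).trans (by
      ring)) (cross_one_ne_zero (grad_cmb212_M₁ ..) (grad_cmb212_M₂ ..) (ne_zero_of_mul (-1 / 1170)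
      (by ring))) (forall_fin_five (fun _ _ => (eval_cmb212_C₁ ..).trans_ne (ne_zero_of_mul (225 /
      169) (by ring))) (fun _ _ => (eval_cmb212_C₂ ..).trans_ne (ne_zero_of_mul (225 / 103684) (by
      ring))) (fun _ _ => (eval_cmb212_M₀ ..).trans_ne (ne_zero_of_mul 1 (by ring))) (fun h =>
      absurd rfl h) (fun _ h => absurd rfl h))
  fin_cases a
  exacts [h0, h1, h2, h3, h4, h5, h6, h7, h8, h9, h10]

lemma isArrangement_cmb212First {r : ℂ} (hr : r ^ 2 - 27 / 4 = 0) :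
    IsArrangement cmb212First cmb212Degrees cmb212Types (cmb212FirstPoints r) where
  smooth := forall_fin_five isSmoothForm_cmb212_C₁ isSmoothForm_cmb212_C₂ isSmoothForm_cmb212_M₀
    isSmoothForm_cmb212_M₁ isSmoothForm_cmb212_M₂
  localForm := hasLocalForm_cmb212First hr
  cover := forall_lt_five (covered_of fun _ _ _ h h' => by
      rcases inter_cmb212_C₁_cmb212_C₂ hr h h' with e | e | e | e
      exacts [⟨0, e⟩, ⟨1, e⟩, ⟨2, e⟩, ⟨3, e⟩])
    (covered_of fun _ _ _ h h' => by
      rcases inter_cmb212_C₁_cmb212_M₀ hr h h' with e | e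
      exacts [⟨2, e⟩, ⟨3, e⟩])
    (covered_of fun _ _ _ h h' => ⟨4, inter_cmb212_C₁_cmb212_M₁ h h'⟩)
    (covered_of fun _ _ _ h h' => ⟨6, inter_cmb212_C₁_cmb212_M₂ h h'⟩)
    (covered_of fun _ _ _ h h' => by
      rcases inter_cmb212_C₂_cmb212_M₀ hr h h' with e | e
      exacts [⟨2, e⟩, ⟨3, e⟩])
    (covered_of fun _ _ _ h h' => ⟨5, inter_cmb212_C₂_cmb212_M₁ h h'⟩)
    (covered_of fun _ _ _ h h' => ⟨7, inter_cmb212_C₂_cmb212_M₂ h h'⟩)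
    (covered_of fun _ _ _ h h' => ⟨8, inter_cmb212_M₀_cmb212_M₁ h h'⟩)
    (covered_of fun _ _ _ h h' => ⟨9, inter_cmb212_M₀_cmb212_M₂ h h'⟩)
    (covered_of fun _ _ _ h h' => ⟨10, inter_cmb212_M₁_cmb212_M₂ h h'⟩)
  injective := by
    intro u v huv h
    rcases cmb212Types_eq u v huv h with ⟨rfl, rfl⟩ | ⟨rfl, rfl⟩
    · exact ne_smul_of_coordinates fun c h0 h1 h2 => one_ne_zero (α := ℂ) (by linear_combination 2 /
      27 * r * h1 + 1 / 2 * h2 + (-2 / 27 * c - 2 / 27) * hr)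
    · exact ne_smul_of_coordinates fun c h0 h1 h2 => one_ne_zero (α := ℂ) (by linear_combination 2 /
      27 * r * h0 + 1 / 2 * h2 + (-2 / 27 * c - 2 / 27) * hr)

/-- The line `M₃` is the image of `M₁` under exchanging `x` and `y`, a symmetry of both conics that
does not preserve `M₀`. By contrast `M₂` is the image of `M₁` under `z ↦ -z`, which preserves `M₀`.
-/
lemma inter_cmb212_C₁_cmb212_M₃ {X Y Z : ℂ}
    (h : eval ![X, Y, Z] Cmb212.C₁ = 0) (h' : eval ![X, Y, Z] Cmb212.M₃ = 0) :
    Proportional ![X, Y, Z] ![3 / 26, 33 / 13, 1] := by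
  rw [eval_cmb212_C₁] at h
  rw [eval_cmb212_M₃] at h'
  have e : X - 3 / 26 * Z = 0 := pow_eq_zero_iff two_ne_zero |>.1 (by linear_combination 225 / 169 *
    h + (-7 / 169 * X - 15 / 169 * Y - 3 / 13 * Z) * h')
  exact proportional_of_coordinates Z (by linear_combination e) (by linear_combination -8 / 15 * e +
    1 / 15 * h') (by ring)

lemma inter_cmb212_C₂_cmb212_M₃ {X Y Z : ℂ}
    (h : eval ![X, Y, Z] Cmb212.C₂ = 0) (h' : eval ![X, Y, Z] Cmb212.M₃ = 0) :
    Proportional ![X, Y, Z] ![-39 / 322, 429 / 161, 1] := by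
  rw [eval_cmb212_C₂] at h
  rw [eval_cmb212_M₃] at h'
  have e : X + 39 / 322 * Z = 0 := pow_eq_zero_iff two_ne_zero |>.1 (by linear_combination 225 /
    103684 * h + (-1513 / 25921 * X - 2535 / 25921 * Y - 6591 / 25921 * Z) * h')
  exact proportional_of_coordinates Z (by linear_combination e) (by linear_combination -8 / 15 * e +
    1 / 15 * h') (by ring)

lemma inter_cmb212_M₀_cmb212_M₃ {X Y Z : ℂ}
    (h : eval ![X, Y, Z] Cmb212.M₀ = 0) (h' : eval ![X, Y, Z] Cmb212.M₃ = 0) :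
    Proportional ![X, Y, Z] ![39 / 8, 0, 1] := by
  rw [eval_cmb212_M₀] at h
  rw [eval_cmb212_M₃] at h'
  exact proportional_of_coordinates Z (by linear_combination -15 / 8 * h + 1 / 8 * h') (by
    linear_combination h) (by ring)

lemma inter_cmb212_M₁_cmb212_M₃ {X Y Z : ℂ}
    (h : eval ![X, Y, Z] Cmb212.M₁ = 0) (h' : eval ![X, Y, Z] Cmb212.M₃ = 0) :
    Proportional ![X, Y, Z] ![39 / 23, 39 / 23, 1] := by
  rw [eval_cmb212_M₁] at h
  rw [eval_cmb212_M₃] at h'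
  exact proportional_of_coordinates Z (by linear_combination 15 / 161 * h - 8 / 161 * h') (by
    linear_combination -8 / 161 * h + 15 / 161 * h') (by ring)

/-- The components of the second curve. -/
def cmb212Second : Fin 5 → S :=
  ![Cmb212.C₁, Cmb212.C₂, Cmb212.M₀, Cmb212.M₁, Cmb212.M₃]

/-- The singular points of the second curve. -/
def cmb212SecondPoints (r : ℂ) : Fin 11 → Fin 3 → ℂ :=
  ![![0, r, 1], ![0, -r, 1], ![r, 0, 1], ![-r, 0, 1], ![33 / 13, 3 / 26, 1], ![429 / 161, -39 / 322,
    1], ![3 / 26, 33 / 13, 1], ![-39 / 322, 429 / 161, 1], ![13 / 5, 0, 1], ![39 / 8, 0, 1], ![39 /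
    23, 39 / 23, 1]]

lemma hasLocalForm_cmb212Second {r : ℂ} (hr : r ^ 2 - 27 / 4 = 0) (a : Fin 11) :
    HasLocalForm cmb212Second (cmb212Types a) (cmb212SecondPoints r a) := by
  have h0 : HasLocalForm cmb212Second (node 0 1) ![0, r, 1] :=
    hasLocalForm_node 0 1 2 rfl ((eval_cmb212_C₁ ..).trans (by linear_combination hr))
      ((eval_cmb212_C₂ ..).trans (by linear_combination 676 * hr)) (cross_two_ne_zero
      (grad_cmb212_C₁ ..) (grad_cmb212_C₂ ..) (ne_zero_of_mul (-1 / 1188) (by linear_combination 4 /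
      27 * hr))) (forall_fin_five (fun h => absurd rfl h) (fun _ h => absurd rfl h) (fun _ _ =>
      (eval_cmb212_M₀ ..).trans_ne (ne_zero_of_mul (4 / 27 * r) (by linear_combination 4 / 27 *
      hr))) (fun _ _ => (eval_cmb212_M₁ ..).trans_ne (ne_zero_of_mul (-8 / 1089 * r - 13 / 363) (by
      linear_combination -64 / 1089 * hr))) (fun _ _ => (eval_cmb212_M₃ ..).trans_ne (ne_zero_of_mul
      (-20 / 3 * r - 52 / 3) (by linear_combination -100 * hr))))
  have h1 : HasLocalForm cmb212Second (node 0 1) ![0, -r, 1] :=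
    hasLocalForm_node 0 1 2 rfl ((eval_cmb212_C₁ ..).trans (by linear_combination hr))
      ((eval_cmb212_C₂ ..).trans (by linear_combination 676 * hr)) (cross_two_ne_zero
      (grad_cmb212_C₁ ..) (grad_cmb212_C₂ ..) (ne_zero_of_mul (-1 / 1188) (by linear_combination 4 /
      27 * hr))) (forall_fin_five (fun h => absurd rfl h) (fun _ h => absurd rfl h) (fun _ _ =>
      (eval_cmb212_M₀ ..).trans_ne (ne_zero_of_mul (-4 / 27 * r) (by linear_combination 4 / 27 *
      hr))) (fun _ _ => (eval_cmb212_M₁ ..).trans_ne (ne_zero_of_mul (8 / 1089 * r - 13 / 363) (by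
      linear_combination -64 / 1089 * hr))) (fun _ _ => (eval_cmb212_M₃ ..).trans_ne (ne_zero_of_mul
      (20 / 3 * r - 52 / 3) (by linear_combination -100 * hr))))
  have h2 : HasLocalForm cmb212Second (triplePoint 0 2 1) ![r, 0, 1] :=
    hasLocalForm_triplePoint 0 2 1 2 (C 676 : S) (linearForm 88 0 0) (C 1) rfl ((eval_cmb212_C₁
      ..).trans (by linear_combination hr)) ((eval_cmb212_M₀ ..).trans (by ring)) (cross_two_ne_zero
      (grad_cmb212_C₁ ..) (grad_cmb212_M₀ ..) (ne_zero_of_mul (2 / 27 * r) (by linear_combination 4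
      / 27 * hr))) ((eval_C _).trans_ne (ne_zero_of_mul (1 / 676) (by ring))) ((eval_linearForm_vec
      ..).trans_ne (ne_zero_of_mul (1 / 594 * r) (by linear_combination 4 / 27 * hr))) ((eval_C
      _).trans_ne (ne_zero_of_mul 1 (by ring))) (eq_of_eval fun X Y Z => by
        simp only [cmb212Second, cons_val, map_add, map_mul, eval_C, eval_linearForm_vec,
          eval_cmb212_C₂, eval_cmb212_C₁, eval_cmb212_M₀]
        ring) (forall_fin_five (fun h => absurd rfl h) (fun _ _ h => absurd rfl h) (fun _ h =>
          absurd rfl h) (fun _ _ _ => (eval_cmb212_M₁ ..).trans_ne (ne_zero_of_mul (-20 / 3 * r - 52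
          / 3) (by linear_combination -100 * hr))) (fun _ _ _ => (eval_cmb212_M₃ ..).trans_ne
          (ne_zero_of_mul (-8 / 1089 * r - 13 / 363) (by linear_combination -64 / 1089 * hr))))
  have h3 : HasLocalForm cmb212Second (triplePoint 0 2 1) ![-r, 0, 1] :=
    hasLocalForm_triplePoint 0 2 1 2 (C 676 : S) (linearForm 88 0 0) (C 1) rfl ((eval_cmb212_C₁
      ..).trans (by linear_combination hr)) ((eval_cmb212_M₀ ..).trans (by ring)) (cross_two_ne_zero
      (grad_cmb212_C₁ ..) (grad_cmb212_M₀ ..) (ne_zero_of_mul (-2 / 27 * r) (by linear_combination 4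
      / 27 * hr))) ((eval_C _).trans_ne (ne_zero_of_mul (1 / 676) (by ring))) ((eval_linearForm_vec
      ..).trans_ne (ne_zero_of_mul (-1 / 594 * r) (by linear_combination 4 / 27 * hr))) ((eval_C
      _).trans_ne (ne_zero_of_mul 1 (by ring))) (eq_of_eval fun X Y Z => by
        simp only [cmb212Second, cons_val, map_add, map_mul, eval_C, eval_linearForm_vec,
          eval_cmb212_C₂, eval_cmb212_C₁, eval_cmb212_M₀]
        ring) (forall_fin_five (fun h => absurd rfl h) (fun _ _ h => absurd rfl h) (fun _ h =>
          absurd rfl h) (fun _ _ _ => (eval_cmb212_M₁ ..).trans_ne (ne_zero_of_mul (20 / 3 * r - 52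
          / 3) (by linear_combination -100 * hr))) (fun _ _ _ => (eval_cmb212_M₃ ..).trans_ne
          (ne_zero_of_mul (8 / 1089 * r - 13 / 363) (by linear_combination -64 / 1089 * hr))))
  have h4 : HasLocalForm cmb212Second (tacnode 3 0) ![33 / 13, 3 / 26, 1] :=
    hasLocalForm_tacnode 3 0 2 (linearForm (-7 / 169) (8 / 169) (3 / 13)) (C (64 / 169) : S)
      (linearForm 1 0 (-33 / 13)) rfl ((eval_cmb212_M₁ ..).trans (by ring)) ((eval_linearForm_vec
      ..).trans (by ring)) (cross_two_ne_zero (grad_linearForm_vec ..) (grad_cmb212_M₁ ..)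
      (ne_zero_of_mul (1 / 8) (by ring))) ((eval_linearForm_vec ..).trans_ne (ne_zero_of_mul (2197 /
      288) (by ring))) ((eval_C _).trans_ne (ne_zero_of_mul (169 / 64) (by ring))) (eq_of_eval fun X
      Y Z => by
        simp only [cmb212Second, cons_val, map_add, map_mul, map_pow, eval_C, eval_linearForm_vec,
          eval_cmb212_C₁, eval_cmb212_M₁]
        ring) (by decide) (forall_fin_five (fun _ h => absurd rfl h) (fun _ _ => (eval_cmb212_C₂
          ..).trans_ne (ne_zero_of_mul (169 / 4356) (by ring))) (fun _ _ => (eval_cmb212_M₀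
          ..).trans_ne (ne_zero_of_mul (26 / 3) (by ring))) (fun h => absurd rfl h) (fun _ _ =>
          (eval_cmb212_M₃ ..).trans_ne (ne_zero_of_mul (-26 / 441) (by ring))))
  have h5 : HasLocalForm cmb212Second (tacnode 3 1) ![429 / 161, -39 / 322, 1] :=
    hasLocalForm_tacnode 3 1 2 (linearForm (-1007 / 25921) (1352 / 25921) (6591 / 25921)) (C (16 /
      25921) : S) (linearForm 1 0 (-429 / 161)) rfl ((eval_cmb212_M₁ ..).trans (by ring))
      ((eval_linearForm_vec ..).trans (by ring)) (cross_two_ne_zero (grad_linearForm_vec ..)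
      (grad_cmb212_M₁ ..) (ne_zero_of_mul (1 / 8) (by ring))) ((eval_linearForm_vec ..).trans_ne
      (ne_zero_of_mul (25921 / 3744) (by ring))) ((eval_C _).trans_ne (ne_zero_of_mul (25921 / 16)
      (by ring))) (eq_of_eval fun X Y Z => by
        simp only [cmb212Second, cons_val, map_add, map_mul, map_pow, eval_C, eval_linearForm_vec,
          eval_cmb212_C₂, eval_cmb212_M₁]
        ring) (by decide) (forall_fin_five (fun _ _ => (eval_cmb212_C₁ ..).trans_ne (ne_zero_of_mul
          (25921 / 1089) (by ring))) (fun _ h => absurd rfl h) (fun _ _ => (eval_cmb212_M₀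
          ..).trans_ne (ne_zero_of_mul (-322 / 39) (by ring))) (fun h => absurd rfl h) (fun _ _ =>
          (eval_cmb212_M₃ ..).trans_ne (ne_zero_of_mul (-2 / 39) (by ring))))
  have h6 : HasLocalForm cmb212Second (tacnode 4 0) ![3 / 26, 33 / 13, 1] :=
    hasLocalForm_tacnode 4 0 2 (linearForm (7 / 169) (15 / 169) (3 / 13)) (C (225 / 169) : S)
      (linearForm 1 0 (-3 / 26)) rfl ((eval_cmb212_M₃ ..).trans (by ring)) ((eval_linearForm_vec
      ..).trans (by ring)) (cross_two_ne_zero (grad_linearForm_vec ..) (grad_cmb212_M₃ ..)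
      (ne_zero_of_mul (1 / 15) (by ring))) ((eval_linearForm_vec ..).trans_ne (ne_zero_of_mul (4394
      / 2025) (by ring))) ((eval_C _).trans_ne (ne_zero_of_mul (169 / 225) (by ring))) (eq_of_eval
      fun X Y Z => by
        simp only [cmb212Second, cons_val, map_add, map_mul, map_pow, eval_C, eval_linearForm_vec,
          eval_cmb212_C₁, eval_cmb212_M₃]
        ring) (by decide) (forall_fin_five (fun _ h => absurd rfl h) (fun _ _ => (eval_cmb212_C₂
          ..).trans_ne (ne_zero_of_mul (169 / 4356) (by ring))) (fun _ _ => (eval_cmb212_M₀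
          ..).trans_ne (ne_zero_of_mul (13 / 33) (by ring))) (fun _ _ => (eval_cmb212_M₁
          ..).trans_ne (ne_zero_of_mul (-26 / 441) (by ring))) (fun h => absurd rfl h))
  have h7 : HasLocalForm cmb212Second (tacnode 4 1) ![-39 / 322, 429 / 161, 1] :=
    hasLocalForm_tacnode 4 1 2 (linearForm (1513 / 25921) (2535 / 25921) (6591 / 25921)) (C (225 /
      103684) : S) (linearForm 1 0 (39 / 322)) rfl ((eval_cmb212_M₃ ..).trans (by ring))
      ((eval_linearForm_vec ..).trans (by ring)) (cross_two_ne_zero (grad_linearForm_vec ..)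
      (grad_cmb212_M₃ ..) (ne_zero_of_mul (1 / 15) (by ring))) ((eval_linearForm_vec ..).trans_ne
      (ne_zero_of_mul (51842 / 26325) (by ring))) ((eval_C _).trans_ne (ne_zero_of_mul (103684 /
      225) (by ring))) (eq_of_eval fun X Y Z => by
        simp only [cmb212Second, cons_val, map_add, map_mul, map_pow, eval_C, eval_linearForm_vec,
          eval_cmb212_C₂, eval_cmb212_M₃]
        ring) (by decide) (forall_fin_five (fun _ _ => (eval_cmb212_C₁ ..).trans_ne (ne_zero_of_mul
          (25921 / 1089) (by ring))) (fun _ h => absurd rfl h) (fun _ _ => (eval_cmb212_M₀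
          ..).trans_ne (ne_zero_of_mul (161 / 429) (by ring))) (fun _ _ => (eval_cmb212_M₁
          ..).trans_ne (ne_zero_of_mul (-2 / 39) (by ring))) (fun h => absurd rfl h))
  have h8 : HasLocalForm cmb212Second (node 2 3) ![13 / 5, 0, 1] :=
    hasLocalForm_node 2 3 2 rfl ((eval_cmb212_M₀ ..).trans (by ring)) ((eval_cmb212_M₁ ..).trans (by
      ring)) (cross_two_ne_zero (grad_cmb212_M₀ ..) (grad_cmb212_M₁ ..) (ne_zero_of_mul (-1 / 15)
      (by ring))) (forall_fin_five (fun _ _ => (eval_cmb212_C₁ ..).trans_ne (ne_zero_of_mul 100 (by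
      ring))) (fun _ _ => (eval_cmb212_C₂ ..).trans_ne (ne_zero_of_mul (25 / 169) (by ring))) (fun h
      => absurd rfl h) (fun _ h => absurd rfl h) (fun _ _ => (eval_cmb212_M₃ ..).trans_ne
      (ne_zero_of_mul (-5 / 91) (by ring))))
  have h9 : HasLocalForm cmb212Second (node 2 4) ![39 / 8, 0, 1] :=
    hasLocalForm_node 2 4 2 rfl ((eval_cmb212_M₀ ..).trans (by ring)) ((eval_cmb212_M₃ ..).trans (by
      ring)) (cross_two_ne_zero (grad_cmb212_M₀ ..) (grad_cmb212_M₃ ..) (ne_zero_of_mul (-1 / 8) (by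
      ring))) (forall_fin_five (fun _ _ => (eval_cmb212_C₁ ..).trans_ne (ne_zero_of_mul (64 / 1089)
      (by ring))) (fun _ _ => (eval_cmb212_C₂ ..).trans_ne (ne_zero_of_mul (16 / 184041) (by ring)))
      (fun h => absurd rfl h) (fun _ _ => (eval_cmb212_M₁ ..).trans_ne (ne_zero_of_mul (8 / 273) (by
      ring))) (fun _ h => absurd rfl h))
  have h10 : HasLocalForm cmb212Second (node 3 4) ![39 / 23, 39 / 23, 1] :=
    hasLocalForm_node 3 4 2 rfl ((eval_cmb212_M₁ ..).trans (by ring)) ((eval_cmb212_M₃ ..).trans (by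
      ring)) (cross_two_ne_zero (grad_cmb212_M₁ ..) (grad_cmb212_M₃ ..) (ne_zero_of_mul (1 / 161)
      (by ring))) (forall_fin_five (fun _ _ => (eval_cmb212_C₁ ..).trans_ne (ne_zero_of_mul (2116 /
      3969) (by ring))) (fun _ _ => (eval_cmb212_C₂ ..).trans_ne (ne_zero_of_mul (1 / 1521) (by
      ring))) (fun _ _ => (eval_cmb212_M₀ ..).trans_ne (ne_zero_of_mul (23 / 39) (by ring))) (fun h
      => absurd rfl h) (fun _ h => absurd rfl h))
  fin_cases a
  exacts [h0, h1, h2, h3, h4, h5, h6, h7, h8, h9, h10]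

lemma isArrangement_cmb212Second {r : ℂ} (hr : r ^ 2 - 27 / 4 = 0) :
    IsArrangement cmb212Second cmb212Degrees cmb212Types (cmb212SecondPoints r) where
  smooth := forall_fin_five isSmoothForm_cmb212_C₁ isSmoothForm_cmb212_C₂ isSmoothForm_cmb212_M₀
    isSmoothForm_cmb212_M₁ isSmoothForm_cmb212_M₃
  localForm := hasLocalForm_cmb212Second hr
  cover := forall_lt_five (covered_of fun _ _ _ h h' => by
      rcases inter_cmb212_C₁_cmb212_C₂ hr h h' with e | e | e | e
      exacts [⟨0, e⟩, ⟨1, e⟩, ⟨2, e⟩, ⟨3, e⟩])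
    (covered_of fun _ _ _ h h' => by
      rcases inter_cmb212_C₁_cmb212_M₀ hr h h' with e | e
      exacts [⟨2, e⟩, ⟨3, e⟩])
    (covered_of fun _ _ _ h h' => ⟨4, inter_cmb212_C₁_cmb212_M₁ h h'⟩)
    (covered_of fun _ _ _ h h' => ⟨6, inter_cmb212_C₁_cmb212_M₃ h h'⟩)
    (covered_of fun _ _ _ h h' => by
      rcases inter_cmb212_C₂_cmb212_M₀ hr h h' with e | e
      exacts [⟨2, e⟩, ⟨3, e⟩])
    (covered_of fun _ _ _ h h' => ⟨5, inter_cmb212_C₂_cmb212_M₁ h h'⟩)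
    (covered_of fun _ _ _ h h' => ⟨7, inter_cmb212_C₂_cmb212_M₃ h h'⟩)
    (covered_of fun _ _ _ h h' => ⟨8, inter_cmb212_M₀_cmb212_M₁ h h'⟩)
    (covered_of fun _ _ _ h h' => ⟨9, inter_cmb212_M₀_cmb212_M₃ h h'⟩)
    (covered_of fun _ _ _ h h' => ⟨10, inter_cmb212_M₁_cmb212_M₃ h h'⟩)
  injective := by
    intro u v huv h
    rcases cmb212Types_eq u v huv h with ⟨rfl, rfl⟩ | ⟨rfl, rfl⟩
    · exact ne_smul_of_coordinates fun c h0 h1 h2 => one_ne_zero (α := ℂ) (by linear_combination 2 /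
      27 * r * h1 + 1 / 2 * h2 + (-2 / 27 * c - 2 / 27) * hr)
    · exact ne_smul_of_coordinates fun c h0 h1 h2 => one_ne_zero (α := ℂ) (by linear_combination 2 /
      27 * r * h0 + 1 / 2 * h2 + (-2 / 27 * c - 2 / 27) * hr)

/-! ### The `cmb224` pair: singular points and combinatorics. -/

/-- The degrees of the components. -/
def cmb224Degrees : Fin 4 → ℕ := ![2, 2, 2, 1]

/-- The local types at the singular points. -/
def cmb224Types : Fin 10 → Fin 4 → Branch :=
  ![triplePoint 0 3 1, triplePoint 0 3 1, node 0 1, node 0 1, tacnode 0 2, tacnode 0 2, tacnode 1 2,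
    tacnode 1 2, node 2 3, node 2 3]

lemma isSeparating_cmb224Types : IsSeparating cmb224Types := by
  unfold IsSeparating
  decide +kernel

lemma cmb224Types_eq : ∀ u v, u < v →
    (∀ i, cmb224Types u i = .away ↔ cmb224Types v i = .away) →
    (u = 0 ∧ v = 1) ∨ (u = 2 ∧ v = 3) ∨ (u = 4 ∧ v = 5) ∨ (u = 6 ∧ v = 7) ∨ (u = 8 ∧ v = 9) := by
  decide +kernel

/-- The pencil contains the pair of lines `2 C₁ + C₂ = y ^ 2 - x ^ 2`, each of which carries two of
the four base points. -/
lemma inter_cmb224_C₁_cmb224_C₂ {X Y Z : ℂ}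
    (h : eval ![X, Y, Z] Cmb224.C₁ = 0) (h' : eval ![X, Y, Z] Cmb224.C₂ = 0) :
    Proportional ![X, Y, Z] ![2, 2, 1] ∨ Proportional ![X, Y, Z] ![-1, -1, 1] ∨ Proportional ![X, Y,
      Z] ![1, -1, 1] ∨ Proportional ![X, Y, Z] ![-2, 2, 1] := by
  rw [eval_cmb224_C₁] at h
  rw [eval_cmb224_C₂] at h'
  have hh : (-X + Y) * (X + Y) = 0 := by linear_combination 2 * h + h'
  rcases mul_eq_zero.1 hh with h₁ | h₁
  · have key : (X - 2 * Z) * (X + Z) = 0 := by linear_combination -h + Z * h₁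
    rcases mul_eq_zero.1 key with e | e
    · exact .inl (proportional_of_coordinates Z (by linear_combination e) (by linear_combination e +
      h₁) (by ring))
    · exact .inr (.inl (proportional_of_coordinates Z (by linear_combination e) (by
      linear_combination e + h₁) (by ring)))
  · have key : (X - Z) * (X + 2 * Z) = 0 := by linear_combination -h + Z * h₁
    rcases mul_eq_zero.1 key with e | e
    · exact .inr (.inr (.inl (proportional_of_coordinates Z (by linear_combination e) (by
      linear_combination -e + h₁) (by ring))))
    · exact .inr (.inr (.inr (proportional_of_coordinates Z (by linear_combination e) (by
      linear_combination -e + h₁) (by ring))))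

/-- These conics are tangent at two points of `x = 0`, because `2 D - 2 C₁ = x ^ 2`. -/
lemma inter_cmb224_C₁_cmb224_D {X Y Z : ℂ}
    (h : eval ![X, Y, Z] Cmb224.C₁ = 0) (h' : eval ![X, Y, Z] Cmb224.D = 0) :
    Proportional ![X, Y, Z] ![0, 1, 0] ∨ Proportional ![X, Y, Z] ![0, -2, 1] := by
  rw [eval_cmb224_C₁] at h
  rw [eval_cmb224_D] at h'
  have h₁ : X = 0 := pow_eq_zero_iff two_ne_zero |>.1 (by linear_combination -2 * h + 2 * h')
  have key : (-Z) * (Y + 2 * Z) = 0 := by linear_combination -h - X * h₁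
  rcases mul_eq_zero.1 key with e | e
  · exact .inl (proportional_of_coordinates Y (by linear_combination h₁) (by ring) (by
    linear_combination -e))
  · exact .inr (proportional_of_coordinates Z (by linear_combination h₁) (by linear_combination e)
    (by ring))

lemma inter_cmb224_C₁_cmb224_M₁ {X Y Z : ℂ}
    (h : eval ![X, Y, Z] Cmb224.C₁ = 0) (h' : eval ![X, Y, Z] Cmb224.M₁ = 0) :
    Proportional ![X, Y, Z] ![2, 2, 1] ∨ Proportional ![X, Y, Z] ![-1, -1, 1] := by
  rw [eval_cmb224_C₁] at h
  rw [eval_cmb224_M₁] at h'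
  have key : (X - 2 * Z) * (X + Z) = 0 := by linear_combination -h + Z * h'
  rcases mul_eq_zero.1 key with e | e
  · exact .inl (proportional_of_coordinates Z (by linear_combination e) (by linear_combination e +
    h') (by ring))
  · exact .inr (proportional_of_coordinates Z (by linear_combination e) (by linear_combination e +
    h') (by ring))

/-- These conics are tangent at two points of `y = 0`, because `2 D + C₂ = y ^ 2`. -/
lemma inter_cmb224_C₂_cmb224_D {X Y Z : ℂ}
    (h : eval ![X, Y, Z] Cmb224.C₂ = 0) (h' : eval ![X, Y, Z] Cmb224.D = 0) :
    Proportional ![X, Y, Z] ![2, 0, 1] ∨ Proportional ![X, Y, Z] ![-2, 0, 1] := by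
  rw [eval_cmb224_C₂] at h
  rw [eval_cmb224_D] at h'
  have h₁ : Y = 0 := pow_eq_zero_iff two_ne_zero |>.1 (by linear_combination h + 2 * h')
  have key : (X - 2 * Z) * (X + 2 * Z) = 0 := by linear_combination h + (-Y + 2 * Z) * h₁
  rcases mul_eq_zero.1 key with e | e
  · exact .inl (proportional_of_coordinates Z (by linear_combination e) (by linear_combination h₁)
    (by ring))
  · exact .inr (proportional_of_coordinates Z (by linear_combination e) (by linear_combination h₁)
    (by ring))

lemma inter_cmb224_C₂_cmb224_M₁ {X Y Z : ℂ}
    (h : eval ![X, Y, Z] Cmb224.C₂ = 0) (h' : eval ![X, Y, Z] Cmb224.M₁ = 0) :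
    Proportional ![X, Y, Z] ![2, 2, 1] ∨ Proportional ![X, Y, Z] ![-1, -1, 1] := by
  rw [eval_cmb224_C₂] at h
  rw [eval_cmb224_M₁] at h'
  have key : (X - 2 * Z) * (X + Z) = 0 := by linear_combination 1 / 2 * h + (-1 / 2 * X - 1 / 2 * Y
    + Z) * h'
  rcases mul_eq_zero.1 key with e | e
  · exact .inl (proportional_of_coordinates Z (by linear_combination e) (by linear_combination e +
    h') (by ring))
  · exact .inr (proportional_of_coordinates Z (by linear_combination e) (by linear_combination e +
    h') (by ring))

lemma inter_cmb224_D_cmb224_M₁ {X Y Z : ℂ} {r : ℂ} (hr : r ^ 2 - 2 * r - 4 = 0)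
    (h : eval ![X, Y, Z] Cmb224.D = 0) (h' : eval ![X, Y, Z] Cmb224.M₁ = 0) :
    Proportional ![X, Y, Z] ![r, r, 1] ∨ Proportional ![X, Y, Z] ![-r + 2, -r + 2, 1] := by
  rw [eval_cmb224_D] at h
  rw [eval_cmb224_M₁] at h'
  have key : (-r * Z + X) * (r * Z + X - 2 * Z) = 0 := by linear_combination -2 * h + 2 * Z * h' - Z
    ^ 2 * hr
  rcases mul_eq_zero.1 key with e | e
  · exact .inl (proportional_of_coordinates Z (by linear_combination e) (by linear_combination e +
    h') (by ring))
  · exact .inr (proportional_of_coordinates Z (by linear_combination e) (by linear_combination e +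
    h') (by ring))

/-- The components of the first curve. -/
def cmb224First : Fin 4 → S :=
  ![Cmb224.C₁, Cmb224.C₂, Cmb224.D, Cmb224.M₁]

/-- The singular points of the first curve. -/
def cmb224FirstPoints (r : ℂ) : Fin 10 → Fin 3 → ℂ :=
  ![![2, 2, 1], ![-1, -1, 1], ![1, -1, 1], ![-2, 2, 1], ![0, 1, 0], ![0, -2, 1], ![2, 0, 1], ![-2,
    0, 1], ![r, r, 1], ![-r + 2, -r + 2, 1]]

lemma hasLocalForm_cmb224First {r : ℂ} (hr : r ^ 2 - 2 * r - 4 = 0) (a : Fin 10) :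
    HasLocalForm cmb224First (cmb224Types a) (cmb224FirstPoints r a) := by
  -- The line `M₁` is a component of a degenerate member of the pencil, `C₂ = -2 C₁ + (x + y) M₁`.
  have h0 : HasLocalForm cmb224First (triplePoint 0 3 1) ![2, 2, 1] :=
    hasLocalForm_triplePoint 0 3 1 2 (C (-2) : S) (linearForm 1 1 0) (C 1) rfl ((eval_cmb224_C₁
      ..).trans (by ring)) ((eval_cmb224_M₁ ..).trans (by ring)) (cross_two_ne_zero (grad_cmb224_C₁
      ..) (grad_cmb224_M₁ ..) (ne_zero_of_mul (-1 / 3) (by ring))) ((eval_C _).trans_ne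
      (ne_zero_of_mul (-1 / 2) (by ring))) ((eval_linearForm_vec ..).trans_ne (ne_zero_of_mul (1 /
      4) (by ring))) ((eval_C _).trans_ne (ne_zero_of_mul 1 (by ring))) (eq_of_eval fun X Y Z => by
        simp only [cmb224First, cons_val, map_add, map_mul, eval_C, eval_linearForm_vec,
          eval_cmb224_C₂, eval_cmb224_C₁, eval_cmb224_M₁]
        ring) (forall_fin_four (fun h => absurd rfl h) (fun _ _ h => absurd rfl h) (fun _ _ _ =>
          (eval_cmb224_D ..).trans_ne (ne_zero_of_mul (1 / 2) (by ring))) (fun _ h => absurd rfl h))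
  have h1 : HasLocalForm cmb224First (triplePoint 0 3 1) ![-1, -1, 1] :=
    hasLocalForm_triplePoint 0 3 1 2 (C (-2) : S) (linearForm 1 1 0) (C 1) rfl ((eval_cmb224_C₁
      ..).trans (by ring)) ((eval_cmb224_M₁ ..).trans (by ring)) (cross_two_ne_zero (grad_cmb224_C₁
      ..) (grad_cmb224_M₁ ..) (ne_zero_of_mul (1 / 3) (by ring))) ((eval_C _).trans_ne
      (ne_zero_of_mul (-1 / 2) (by ring))) ((eval_linearForm_vec ..).trans_ne (ne_zero_of_mul (-1 /
      2) (by ring))) ((eval_C _).trans_ne (ne_zero_of_mul 1 (by ring))) (eq_of_eval fun X Y Z => by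
        simp only [cmb224First, cons_val, map_add, map_mul, eval_C, eval_linearForm_vec,
          eval_cmb224_C₂, eval_cmb224_C₁, eval_cmb224_M₁]
        ring) (forall_fin_four (fun h => absurd rfl h) (fun _ _ h => absurd rfl h) (fun _ _ _ =>
          (eval_cmb224_D ..).trans_ne (ne_zero_of_mul 2 (by ring))) (fun _ h => absurd rfl h))
  have h2 : HasLocalForm cmb224First (node 0 1) ![1, -1, 1] :=
    hasLocalForm_node 0 1 2 rfl ((eval_cmb224_C₁ ..).trans (by ring)) ((eval_cmb224_C₂ ..).trans (by
      ring)) (cross_two_ne_zero (grad_cmb224_C₁ ..) (grad_cmb224_C₂ ..) (ne_zero_of_mul (1 / 6) (by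
      ring))) (forall_fin_four (fun h => absurd rfl h) (fun _ h => absurd rfl h) (fun _ _ =>
      (eval_cmb224_D ..).trans_ne (ne_zero_of_mul 2 (by ring))) (fun _ _ => (eval_cmb224_M₁
      ..).trans_ne (ne_zero_of_mul (-1 / 2) (by ring))))
  have h3 : HasLocalForm cmb224First (node 0 1) ![-2, 2, 1] :=
    hasLocalForm_node 0 1 2 rfl ((eval_cmb224_C₁ ..).trans (by ring)) ((eval_cmb224_C₂ ..).trans (by
      ring)) (cross_two_ne_zero (grad_cmb224_C₁ ..) (grad_cmb224_C₂ ..) (ne_zero_of_mul (1 / 12) (by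
      ring))) (forall_fin_four (fun h => absurd rfl h) (fun _ h => absurd rfl h) (fun _ _ =>
      (eval_cmb224_D ..).trans_ne (ne_zero_of_mul (1 / 2) (by ring))) (fun _ _ => (eval_cmb224_M₁
      ..).trans_ne (ne_zero_of_mul (1 / 4) (by ring))))
  have h4 : HasLocalForm cmb224First (tacnode 0 2) ![0, 1, 0] :=
    hasLocalForm_tacnode 0 2 1 (C 2 : S) (C 2 : S) (linearForm 1 0 0) rfl ((eval_cmb224_C₁ ..).trans
      (by ring)) ((eval_linearForm_vec ..).trans (by ring)) (cross_one_ne_zero (grad_linearForm_vec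
      ..) (grad_cmb224_C₁ ..) (ne_zero_of_mul (-1) (by ring))) ((eval_C _).trans_ne (ne_zero_of_mul
      (1 / 2) (by ring))) ((eval_C _).trans_ne (ne_zero_of_mul (1 / 2) (by ring))) (eq_of_eval fun X
      Y Z => by
        simp only [cmb224First, cons_val, map_add, map_mul, map_pow, eval_C, eval_linearForm_vec,
          eval_cmb224_D, eval_cmb224_C₁]
        ring) (by decide) (forall_fin_four (fun h => absurd rfl h) (fun _ _ => (eval_cmb224_C₂
          ..).trans_ne (ne_zero_of_mul 1 (by ring))) (fun _ h => absurd rfl h) (fun _ _ =>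
          (eval_cmb224_M₁ ..).trans_ne (ne_zero_of_mul 1 (by ring))))
  have h5 : HasLocalForm cmb224First (tacnode 0 2) ![0, -2, 1] :=
    hasLocalForm_tacnode 0 2 2 (C 2 : S) (C 2 : S) (linearForm 1 0 0) rfl ((eval_cmb224_C₁ ..).trans
      (by ring)) ((eval_linearForm_vec ..).trans (by ring)) (cross_two_ne_zero (grad_linearForm_vec
      ..) (grad_cmb224_C₁ ..) (ne_zero_of_mul 1 (by ring))) ((eval_C _).trans_ne (ne_zero_of_mul (1
      / 2) (by ring))) ((eval_C _).trans_ne (ne_zero_of_mul (1 / 2) (by ring))) (eq_of_eval fun X Y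
      Z => by
        simp only [cmb224First, cons_val, map_add, map_mul, map_pow, eval_C, eval_linearForm_vec,
          eval_cmb224_D, eval_cmb224_C₁]
        ring) (by decide) (forall_fin_four (fun h => absurd rfl h) (fun _ _ => (eval_cmb224_C₂
          ..).trans_ne (ne_zero_of_mul (1 / 4) (by ring))) (fun _ h => absurd rfl h) (fun _ _ =>
          (eval_cmb224_M₁ ..).trans_ne (ne_zero_of_mul (-1 / 2) (by ring))))
  have h6 : HasLocalForm cmb224First (tacnode 1 2) ![2, 0, 1] :=
    hasLocalForm_tacnode 1 2 2 (C (-1) : S) (C 2 : S) (linearForm 0 1 0) rfl ((eval_cmb224_C₂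
      ..).trans (by ring)) ((eval_linearForm_vec ..).trans (by ring)) (cross_two_ne_zero
      (grad_linearForm_vec ..) (grad_cmb224_C₂ ..) (ne_zero_of_mul (-1 / 4) (by ring))) ((eval_C
      _).trans_ne (ne_zero_of_mul (-1) (by ring))) ((eval_C _).trans_ne (ne_zero_of_mul (1 / 2) (by
      ring))) (eq_of_eval fun X Y Z => by
        simp only [cmb224First, cons_val, map_add, map_mul, map_pow, eval_C, eval_linearForm_vec,
          eval_cmb224_D, eval_cmb224_C₂]
        ring) (by decide) (forall_fin_four (fun _ _ => (eval_cmb224_C₁ ..).trans_ne (ne_zero_of_mul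
          (-1 / 2) (by ring))) (fun h => absurd rfl h) (fun _ h => absurd rfl h) (fun _ _ =>
          (eval_cmb224_M₁ ..).trans_ne (ne_zero_of_mul (-1 / 2) (by ring))))
  have h7 : HasLocalForm cmb224First (tacnode 1 2) ![-2, 0, 1] :=
    hasLocalForm_tacnode 1 2 2 (C (-1) : S) (C 2 : S) (linearForm 0 1 0) rfl ((eval_cmb224_C₂
      ..).trans (by ring)) ((eval_linearForm_vec ..).trans (by ring)) (cross_two_ne_zero
      (grad_linearForm_vec ..) (grad_cmb224_C₂ ..) (ne_zero_of_mul (1 / 4) (by ring))) ((eval_C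
      _).trans_ne (ne_zero_of_mul (-1) (by ring))) ((eval_C _).trans_ne (ne_zero_of_mul (1 / 2) (by
      ring))) (eq_of_eval fun X Y Z => by
        simp only [cmb224First, cons_val, map_add, map_mul, map_pow, eval_C, eval_linearForm_vec,
          eval_cmb224_D, eval_cmb224_C₂]
        ring) (by decide) (forall_fin_four (fun _ _ => (eval_cmb224_C₁ ..).trans_ne (ne_zero_of_mul
          (-1 / 2) (by ring))) (fun h => absurd rfl h) (fun _ h => absurd rfl h) (fun _ _ =>
          (eval_cmb224_M₁ ..).trans_ne (ne_zero_of_mul (1 / 2) (by ring))))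
  have h8 : HasLocalForm cmb224First (node 2 3) ![r, r, 1] :=
    hasLocalForm_node 2 3 2 rfl ((eval_cmb224_D ..).trans (by linear_combination -1 / 2 * hr))
      ((eval_cmb224_M₁ ..).trans (by ring)) (cross_two_ne_zero (grad_cmb224_D ..) (grad_cmb224_M₁
      ..) (ne_zero_of_mul (-1 / 5 * r + 1 / 5) (by linear_combination 1 / 5 * hr))) (forall_fin_four
      (fun _ _ => (eval_cmb224_C₁ ..).trans_ne (ne_zero_of_mul (1 / 4 * r - 1) (by
      linear_combination (-1 / 4 * r + 3 / 4) * hr))) (fun _ _ => (eval_cmb224_C₂ ..).trans_ne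
      (ne_zero_of_mul (-1 / 8 * r + 1 / 2) (by linear_combination (-1 / 4 * r + 3 / 4) * hr))) (fun
      h => absurd rfl h) (fun _ h => absurd rfl h))
  have h9 : HasLocalForm cmb224First (node 2 3) ![-r + 2, -r + 2, 1] :=
    hasLocalForm_node 2 3 2 rfl ((eval_cmb224_D ..).trans (by linear_combination -1 / 2 * hr))
      ((eval_cmb224_M₁ ..).trans (by ring)) (cross_two_ne_zero (grad_cmb224_D ..) (grad_cmb224_M₁
      ..) (ne_zero_of_mul (1 / 5 * r - 1 / 5) (by linear_combination 1 / 5 * hr))) (forall_fin_four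
      (fun _ _ => (eval_cmb224_C₁ ..).trans_ne (ne_zero_of_mul (-1 / 4 * r - 1 / 2) (by
      linear_combination (1 / 4 * r + 1 / 4) * hr))) (fun _ _ => (eval_cmb224_C₂ ..).trans_ne
      (ne_zero_of_mul (1 / 8 * r + 1 / 4) (by linear_combination (1 / 4 * r + 1 / 4) * hr))) (fun h
      => absurd rfl h) (fun _ h => absurd rfl h))
  fin_cases a
  exacts [h0, h1, h2, h3, h4, h5, h6, h7, h8, h9]

lemma isArrangement_cmb224First {r : ℂ} (hr : r ^ 2 - 2 * r - 4 = 0) :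
    IsArrangement cmb224First cmb224Degrees cmb224Types (cmb224FirstPoints r) where
  smooth := forall_fin_four isSmoothForm_cmb224_C₁ isSmoothForm_cmb224_C₂ isSmoothForm_cmb224_D
    isSmoothForm_cmb224_M₁
  localForm := hasLocalForm_cmb224First hr
  cover := forall_lt_four (covered_of fun _ _ _ h h' => by
      rcases inter_cmb224_C₁_cmb224_C₂ h h' with e | e | e | e
      exacts [⟨0, e⟩, ⟨1, e⟩, ⟨2, e⟩, ⟨3, e⟩])
    (covered_of fun _ _ _ h h' => by
      rcases inter_cmb224_C₁_cmb224_D h h' with e | e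
      exacts [⟨4, e⟩, ⟨5, e⟩])
    (covered_of fun _ _ _ h h' => by
      rcases inter_cmb224_C₁_cmb224_M₁ h h' with e | e
      exacts [⟨0, e⟩, ⟨1, e⟩])
    (covered_of fun _ _ _ h h' => by
      rcases inter_cmb224_C₂_cmb224_D h h' with e | e
      exacts [⟨6, e⟩, ⟨7, e⟩])
    (covered_of fun _ _ _ h h' => by
      rcases inter_cmb224_C₂_cmb224_M₁ h h' with e | e
      exacts [⟨0, e⟩, ⟨1, e⟩])
    (covered_of fun _ _ _ h h' => by
      rcases inter_cmb224_D_cmb224_M₁ hr h h' with e | e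
      exacts [⟨8, e⟩, ⟨9, e⟩])
  injective := by
    intro u v huv h
    rcases cmb224Types_eq u v huv h with ⟨rfl, rfl⟩ | ⟨rfl, rfl⟩ | ⟨rfl, rfl⟩ | ⟨rfl, rfl⟩ | ⟨rfl,
      rfl⟩
    · exact ne_smul_of_coordinates fun c h0 h1 h2 => one_ne_zero (α := ℂ) (by linear_combination 1 /
      3 * h0 + 1 / 3 * h2)
    · exact ne_smul_of_coordinates fun c h0 h1 h2 => one_ne_zero (α := ℂ) (by linear_combination 1 /
      3 * h0 + 2 / 3 * h2)
    · exact ne_smul_of_coordinates fun c h0 h1 h2 => one_ne_zero (α := ℂ) (by linear_combination h1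
      + 2 * h2)
    · exact ne_smul_of_coordinates fun c h0 h1 h2 => one_ne_zero (α := ℂ) (by linear_combination 1 /
      4 * h0 + 1 / 2 * h2)
    · exact ne_smul_of_coordinates fun c h0 h1 h2 => one_ne_zero (α := ℂ) (by linear_combination (1
      / 10 * r - 1 / 10) * h0 + (-1 / 10 * r + 3 / 5) * h2 + (-1 / 10 * c - 1 / 10) * hr)

/-- The line `M₂` also joins two base points of the pencil of `C₁` and `C₂`, but it shares only `(2,
2, 1)` with `M₁`, and it is not one of the lines `y = ± x`. -/
lemma inter_cmb224_C₁_cmb224_M₂ {X Y Z : ℂ}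
    (h : eval ![X, Y, Z] Cmb224.C₁ = 0) (h' : eval ![X, Y, Z] Cmb224.M₂ = 0) :
    Proportional ![X, Y, Z] ![2, 2, 1] ∨ Proportional ![X, Y, Z] ![1, -1, 1] := by
  rw [eval_cmb224_C₁] at h
  rw [eval_cmb224_M₂] at h'
  have key : (X - 2 * Z) * (X - Z) = 0 := by linear_combination -h + Z * h'
  rcases mul_eq_zero.1 key with e | e
  · exact .inl (proportional_of_coordinates Z (by linear_combination e) (by linear_combination 3 * e
    + h') (by ring))
  · exact .inr (proportional_of_coordinates Z (by linear_combination e) (by linear_combination 3 * e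
    + h') (by ring))

lemma inter_cmb224_C₂_cmb224_M₂ {X Y Z : ℂ}
    (h : eval ![X, Y, Z] Cmb224.C₂ = 0) (h' : eval ![X, Y, Z] Cmb224.M₂ = 0) :
    Proportional ![X, Y, Z] ![2, 2, 1] ∨ Proportional ![X, Y, Z] ![1, -1, 1] := by
  rw [eval_cmb224_C₂] at h
  rw [eval_cmb224_M₂] at h'
  have key : (X - 2 * Z) * (X - Z) = 0 := by linear_combination 1 / 10 * h + (-3 / 10 * X - 1 / 10 *
    Y + 3 / 5 * Z) * h'
  rcases mul_eq_zero.1 key with e | e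
  · exact .inl (proportional_of_coordinates Z (by linear_combination e) (by linear_combination 3 * e
    + h') (by ring))
  · exact .inr (proportional_of_coordinates Z (by linear_combination e) (by linear_combination 3 * e
    + h') (by ring))

lemma inter_cmb224_D_cmb224_M₂ {X Y Z : ℂ} {r : ℂ} (hr : r ^ 2 - 6 * r + 4 = 0)
    (h : eval ![X, Y, Z] Cmb224.D = 0) (h' : eval ![X, Y, Z] Cmb224.M₂ = 0) :
    Proportional ![X, Y, Z] ![r, 3 * r - 4, 1] ∨ Proportional ![X, Y, Z] ![-r + 6, -3 * r + 14, 1]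
      := by
  rw [eval_cmb224_D] at h
  rw [eval_cmb224_M₂] at h'
  have key : (-r * Z + X) * (r * Z + X - 6 * Z) = 0 := by linear_combination -2 * h + 2 * Z * h' - Z
    ^ 2 * hr
  rcases mul_eq_zero.1 key with e | e
  · exact .inl (proportional_of_coordinates Z (by linear_combination e) (by linear_combination 3 * e
    + h') (by ring))
  · exact .inr (proportional_of_coordinates Z (by linear_combination e) (by linear_combination 3 * e
    + h') (by ring))

/-- The components of the second curve. -/
def cmb224Second : Fin 4 → S :=
  ![Cmb224.C₁, Cmb224.C₂, Cmb224.D, Cmb224.M₂]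

/-- The singular points of the second curve. -/
def cmb224SecondPoints (r : ℂ) : Fin 10 → Fin 3 → ℂ :=
  ![![2, 2, 1], ![1, -1, 1], ![-1, -1, 1], ![-2, 2, 1], ![0, 1, 0], ![0, -2, 1], ![2, 0, 1], ![-2,
    0, 1], ![r, 3 * r - 4, 1], ![-r + 6, -3 * r + 14, 1]]

lemma hasLocalForm_cmb224Second {r : ℂ} (hr : r ^ 2 - 6 * r + 4 = 0) (a : Fin 10) :
    HasLocalForm cmb224Second (cmb224Types a) (cmb224SecondPoints r a) := by
  -- Here the degenerate member is `C₂ + 10 C₁ = (3 x + y + 4 z) M₂`.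
  have h0 : HasLocalForm cmb224Second (triplePoint 0 3 1) ![2, 2, 1] :=
    hasLocalForm_triplePoint 0 3 1 2 (C (-10) : S) (linearForm 3 1 4) (C 1) rfl ((eval_cmb224_C₁
      ..).trans (by ring)) ((eval_cmb224_M₂ ..).trans (by ring)) (cross_two_ne_zero (grad_cmb224_C₁
      ..) (grad_cmb224_M₂ ..) (ne_zero_of_mul (-1) (by ring))) ((eval_C _).trans_ne (ne_zero_of_mul
      (-1 / 10) (by ring))) ((eval_linearForm_vec ..).trans_ne (ne_zero_of_mul (1 / 12) (by ring)))
      ((eval_C _).trans_ne (ne_zero_of_mul 1 (by ring))) (eq_of_eval fun X Y Z => by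
        simp only [cmb224Second, cons_val, map_add, map_mul, eval_C, eval_linearForm_vec,
          eval_cmb224_C₂, eval_cmb224_C₁, eval_cmb224_M₂]
        ring) (forall_fin_four (fun h => absurd rfl h) (fun _ _ h => absurd rfl h) (fun _ _ _ =>
          (eval_cmb224_D ..).trans_ne (ne_zero_of_mul (1 / 2) (by ring))) (fun _ h => absurd rfl h))
  have h1 : HasLocalForm cmb224Second (triplePoint 0 3 1) ![1, -1, 1] :=
    hasLocalForm_triplePoint 0 3 1 2 (C (-10) : S) (linearForm 3 1 4) (C 1) rfl ((eval_cmb224_C₁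
      ..).trans (by ring)) ((eval_cmb224_M₂ ..).trans (by ring)) (cross_two_ne_zero (grad_cmb224_C₁
      ..) (grad_cmb224_M₂ ..) (ne_zero_of_mul 1 (by ring))) ((eval_C _).trans_ne (ne_zero_of_mul (-1
      / 10) (by ring))) ((eval_linearForm_vec ..).trans_ne (ne_zero_of_mul (1 / 6) (by ring)))
      ((eval_C _).trans_ne (ne_zero_of_mul 1 (by ring))) (eq_of_eval fun X Y Z => by
        simp only [cmb224Second, cons_val, map_add, map_mul, eval_C, eval_linearForm_vec,
          eval_cmb224_C₂, eval_cmb224_C₁, eval_cmb224_M₂]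
        ring) (forall_fin_four (fun h => absurd rfl h) (fun _ _ h => absurd rfl h) (fun _ _ _ =>
          (eval_cmb224_D ..).trans_ne (ne_zero_of_mul 2 (by ring))) (fun _ h => absurd rfl h))
  have h2 : HasLocalForm cmb224Second (node 0 1) ![-1, -1, 1] :=
    hasLocalForm_node 0 1 2 rfl ((eval_cmb224_C₁ ..).trans (by ring)) ((eval_cmb224_C₂ ..).trans (by
      ring)) (cross_two_ne_zero (grad_cmb224_C₁ ..) (grad_cmb224_C₂ ..) (ne_zero_of_mul (-1 / 6) (by
      ring))) (forall_fin_four (fun h => absurd rfl h) (fun _ h => absurd rfl h) (fun _ _ =>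
      (eval_cmb224_D ..).trans_ne (ne_zero_of_mul 2 (by ring))) (fun _ _ => (eval_cmb224_M₂
      ..).trans_ne (ne_zero_of_mul (1 / 6) (by ring))))
  have h3 : HasLocalForm cmb224Second (node 0 1) ![-2, 2, 1] :=
    hasLocalForm_node 0 1 2 rfl ((eval_cmb224_C₁ ..).trans (by ring)) ((eval_cmb224_C₂ ..).trans (by
      ring)) (cross_two_ne_zero (grad_cmb224_C₁ ..) (grad_cmb224_C₂ ..) (ne_zero_of_mul (1 / 12) (by
      ring))) (forall_fin_four (fun h => absurd rfl h) (fun _ h => absurd rfl h) (fun _ _ =>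
      (eval_cmb224_D ..).trans_ne (ne_zero_of_mul (1 / 2) (by ring))) (fun _ _ => (eval_cmb224_M₂
      ..).trans_ne (ne_zero_of_mul (1 / 12) (by ring))))
  have h4 : HasLocalForm cmb224Second (tacnode 0 2) ![0, 1, 0] :=
    hasLocalForm_tacnode 0 2 1 (C 2 : S) (C 2 : S) (linearForm 1 0 0) rfl ((eval_cmb224_C₁ ..).trans
      (by ring)) ((eval_linearForm_vec ..).trans (by ring)) (cross_one_ne_zero (grad_linearForm_vec
      ..) (grad_cmb224_C₁ ..) (ne_zero_of_mul (-1) (by ring))) ((eval_C _).trans_ne (ne_zero_of_mul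
      (1 / 2) (by ring))) ((eval_C _).trans_ne (ne_zero_of_mul (1 / 2) (by ring))) (eq_of_eval fun X
      Y Z => by
        simp only [cmb224Second, cons_val, map_add, map_mul, map_pow, eval_C, eval_linearForm_vec,
          eval_cmb224_D, eval_cmb224_C₁]
        ring) (by decide) (forall_fin_four (fun h => absurd rfl h) (fun _ _ => (eval_cmb224_C₂
          ..).trans_ne (ne_zero_of_mul 1 (by ring))) (fun _ h => absurd rfl h) (fun _ _ =>
          (eval_cmb224_M₂ ..).trans_ne (ne_zero_of_mul 1 (by ring))))
  have h5 : HasLocalForm cmb224Second (tacnode 0 2) ![0, -2, 1] :=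
    hasLocalForm_tacnode 0 2 2 (C 2 : S) (C 2 : S) (linearForm 1 0 0) rfl ((eval_cmb224_C₁ ..).trans
      (by ring)) ((eval_linearForm_vec ..).trans (by ring)) (cross_two_ne_zero (grad_linearForm_vec
      ..) (grad_cmb224_C₁ ..) (ne_zero_of_mul 1 (by ring))) ((eval_C _).trans_ne (ne_zero_of_mul (1
      / 2) (by ring))) ((eval_C _).trans_ne (ne_zero_of_mul (1 / 2) (by ring))) (eq_of_eval fun X Y
      Z => by
        simp only [cmb224Second, cons_val, map_add, map_mul, map_pow, eval_C, eval_linearForm_vec,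
          eval_cmb224_D, eval_cmb224_C₁]
        ring) (by decide) (forall_fin_four (fun h => absurd rfl h) (fun _ _ => (eval_cmb224_C₂
          ..).trans_ne (ne_zero_of_mul (1 / 4) (by ring))) (fun _ h => absurd rfl h) (fun _ _ =>
          (eval_cmb224_M₂ ..).trans_ne (ne_zero_of_mul (1 / 2) (by ring))))
  have h6 : HasLocalForm cmb224Second (tacnode 1 2) ![2, 0, 1] :=
    hasLocalForm_tacnode 1 2 2 (C (-1) : S) (C 2 : S) (linearForm 0 1 0) rfl ((eval_cmb224_C₂
      ..).trans (by ring)) ((eval_linearForm_vec ..).trans (by ring)) (cross_two_ne_zero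
      (grad_linearForm_vec ..) (grad_cmb224_C₂ ..) (ne_zero_of_mul (-1 / 4) (by ring))) ((eval_C
      _).trans_ne (ne_zero_of_mul (-1) (by ring))) ((eval_C _).trans_ne (ne_zero_of_mul (1 / 2) (by
      ring))) (eq_of_eval fun X Y Z => by
        simp only [cmb224Second, cons_val, map_add, map_mul, map_pow, eval_C, eval_linearForm_vec,
          eval_cmb224_D, eval_cmb224_C₂]
        ring) (by decide) (forall_fin_four (fun _ _ => (eval_cmb224_C₁ ..).trans_ne (ne_zero_of_mul
          (-1 / 2) (by ring))) (fun h => absurd rfl h) (fun _ h => absurd rfl h) (fun _ _ =>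
          (eval_cmb224_M₂ ..).trans_ne (ne_zero_of_mul (-1 / 2) (by ring))))
  have h7 : HasLocalForm cmb224Second (tacnode 1 2) ![-2, 0, 1] :=
    hasLocalForm_tacnode 1 2 2 (C (-1) : S) (C 2 : S) (linearForm 0 1 0) rfl ((eval_cmb224_C₂
      ..).trans (by ring)) ((eval_linearForm_vec ..).trans (by ring)) (cross_two_ne_zero
      (grad_linearForm_vec ..) (grad_cmb224_C₂ ..) (ne_zero_of_mul (1 / 4) (by ring))) ((eval_C
      _).trans_ne (ne_zero_of_mul (-1) (by ring))) ((eval_C _).trans_ne (ne_zero_of_mul (1 / 2) (by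
      ring))) (eq_of_eval fun X Y Z => by
        simp only [cmb224Second, cons_val, map_add, map_mul, map_pow, eval_C, eval_linearForm_vec,
          eval_cmb224_D, eval_cmb224_C₂]
        ring) (by decide) (forall_fin_four (fun _ _ => (eval_cmb224_C₁ ..).trans_ne (ne_zero_of_mul
          (-1 / 2) (by ring))) (fun h => absurd rfl h) (fun _ h => absurd rfl h) (fun _ _ =>
          (eval_cmb224_M₂ ..).trans_ne (ne_zero_of_mul (1 / 10) (by ring))))
  have h8 : HasLocalForm cmb224Second (node 2 3) ![r, 3 * r - 4, 1] :=
    hasLocalForm_node 2 3 2 rfl ((eval_cmb224_D ..).trans (by linear_combination -1 / 2 * hr))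
      ((eval_cmb224_M₂ ..).trans (by ring)) (cross_two_ne_zero (grad_cmb224_D ..) (grad_cmb224_M₂
      ..) (ne_zero_of_mul (-1 / 5 * r + 3 / 5) (by linear_combination 1 / 5 * hr))) (forall_fin_four
      (fun _ _ => (eval_cmb224_C₁ ..).trans_ne (ne_zero_of_mul (3 / 4 * r - 4) (by
      linear_combination (-3 / 4 * r + 7 / 4) * hr))) (fun _ _ => (eval_cmb224_C₂ ..).trans_ne
      (ne_zero_of_mul (-3 / 40 * r + 2 / 5) (by linear_combination (-3 / 4 * r + 7 / 4) * hr))) (fun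
      h => absurd rfl h) (fun _ h => absurd rfl h))
  have h9 : HasLocalForm cmb224Second (node 2 3) ![-r + 6, -3 * r + 14, 1] :=
    hasLocalForm_node 2 3 2 rfl ((eval_cmb224_D ..).trans (by linear_combination -1 / 2 * hr))
      ((eval_cmb224_M₂ ..).trans (by ring)) (cross_two_ne_zero (grad_cmb224_D ..) (grad_cmb224_M₂
      ..) (ne_zero_of_mul (1 / 5 * r - 3 / 5) (by linear_combination 1 / 5 * hr))) (forall_fin_four
      (fun _ _ => (eval_cmb224_C₁ ..).trans_ne (ne_zero_of_mul (-3 / 4 * r + 1 / 2) (by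
      linear_combination (3 / 4 * r - 11 / 4) * hr))) (fun _ _ => (eval_cmb224_C₂ ..).trans_ne
      (ne_zero_of_mul (3 / 40 * r - 1 / 20) (by linear_combination (3 / 4 * r - 11 / 4) * hr))) (fun
      h => absurd rfl h) (fun _ h => absurd rfl h))
  fin_cases a
  exacts [h0, h1, h2, h3, h4, h5, h6, h7, h8, h9]

lemma isArrangement_cmb224Second {r : ℂ} (hr : r ^ 2 - 6 * r + 4 = 0) :
    IsArrangement cmb224Second cmb224Degrees cmb224Types (cmb224SecondPoints r) where
  smooth := forall_fin_four isSmoothForm_cmb224_C₁ isSmoothForm_cmb224_C₂ isSmoothForm_cmb224_D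
    isSmoothForm_cmb224_M₂
  localForm := hasLocalForm_cmb224Second hr
  cover := forall_lt_four (covered_of fun _ _ _ h h' => by
      rcases inter_cmb224_C₁_cmb224_C₂ h h' with e | e | e | e
      -- Compared with the first curve, `(1, -1, 1)` becomes a triple point and `(-1, -1, 1)` a
      -- node, so the indices of these points are exchanged.
      exacts [⟨0, e⟩, ⟨2, e⟩, ⟨1, e⟩, ⟨3, e⟩])
    (covered_of fun _ _ _ h h' => by
      rcases inter_cmb224_C₁_cmb224_D h h' with e | e
      exacts [⟨4, e⟩, ⟨5, e⟩])
    (covered_of fun _ _ _ h h' => by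
      rcases inter_cmb224_C₁_cmb224_M₂ h h' with e | e
      exacts [⟨0, e⟩, ⟨1, e⟩])
    (covered_of fun _ _ _ h h' => by
      rcases inter_cmb224_C₂_cmb224_D h h' with e | e
      exacts [⟨6, e⟩, ⟨7, e⟩])
    (covered_of fun _ _ _ h h' => by
      rcases inter_cmb224_C₂_cmb224_M₂ h h' with e | e
      exacts [⟨0, e⟩, ⟨1, e⟩])
    (covered_of fun _ _ _ h h' => by
      rcases inter_cmb224_D_cmb224_M₂ hr h h' with e | e
      exacts [⟨8, e⟩, ⟨9, e⟩])
  injective := by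
    intro u v huv h
    rcases cmb224Types_eq u v huv h with ⟨rfl, rfl⟩ | ⟨rfl, rfl⟩ | ⟨rfl, rfl⟩ | ⟨rfl, rfl⟩ | ⟨rfl,
      rfl⟩
    · exact ne_smul_of_coordinates fun c h0 h1 h2 => one_ne_zero (α := ℂ) (by linear_combination h0
      - h2)
    · exact ne_smul_of_coordinates fun c h0 h1 h2 => one_ne_zero (α := ℂ) (by linear_combination h0
      + 2 * h2)
    · exact ne_smul_of_coordinates fun c h0 h1 h2 => one_ne_zero (α := ℂ) (by linear_combination h1
      + 2 * h2)
    · exact ne_smul_of_coordinates fun c h0 h1 h2 => one_ne_zero (α := ℂ) (by linear_combination 1 /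
      4 * h0 + 1 / 2 * h2)
    · exact ne_smul_of_coordinates fun c h0 h1 h2 => one_ne_zero (α := ℂ) (by linear_combination (1
      / 10 * r - 3 / 10) * h0 + (-3 / 10 * r + 7 / 5) * h2 + (-1 / 10 * c - 1 / 10) * hr)

/-! ### The `cmb123` pair: syzygies and conclusion. -/

/-- Reductions modulo `17` showing that the first curve has no syzygies of degree two. -/
def cmb123FirstCertificate : Certificate where
  cs := [cmb123_CCoeffs, cmb123_L₁Coeffs, cmb123_L₂Coeffs, cmb123_DCoeffs, cmb123_M₁Coeffs]
  d := 2
  vs := [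
    (0, 0, 1), (1, 0, 0), (0, 1, 1), (1, 0, 1), (1, 1, 0), (0, 1, 2), (0, 2, 1), (1, 0, 2), (1,
    2, 0), (2, 0, 1), (2, 1, 0), (1, 1, 2), (1, 2, 1), (2, 1, 1), (1, 2, 2), (2, 1, 2), (2, 2,
    1), (0, 1, 3)]
  gs := ![
    [0, 7, 2, 12, 11, 1, 9, 11, 8, 10, 4, 14, 5, 5, 10, 14, 14, 5],
    [13, 10, 3, 4, 14, 7, 11, 7, 0, 5, 11, 4, 2, 13, 7, 13, 13, 15],
    [0, 16, 15, 8, 0, 5, 13, 9, 2, 7, 6, 8, 10, 1, 16, 10, 8, 6]]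
  L := [
    [15, 1, 3, 0, 6, 7, 2, 4, 3, 10, 5, 12, 4, 5, 15, 1, 5, 9],
    [2, 10, 15, 2, 1, 2, 8, 2, 16, 13, 13, 5, 13, 11, 9, 4, 13, 15],
    [7, 0, 4, 8, 15, 6, 14, 4, 16, 12, 16, 9, 15, 7, 7, 3, 4, 6],
    [8, 7, 1, 4, 4, 1, 1, 5, 11, 3, 4, 6, 10, 3, 12, 7, 10, 10],
    [13, 5, 13, 13, 12, 13, 12, 0, 16, 0, 13, 2, 11, 12, 8, 14, 15, 5],
    [8, 10, 16, 11, 15, 9, 14, 11, 7, 4, 5, 13, 15, 12, 10, 12, 11, 8],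
    [13, 6, 9, 10, 1, 16, 12, 8, 0, 7, 5, 16, 13, 4, 0, 3, 3, 6],
    [14, 13, 5, 2, 4, 0, 1, 5, 16, 7, 7, 7, 8, 1, 13, 8, 12, 6],
    [10, 10, 10, 2, 13, 5, 7, 1, 16, 1, 5, 10, 0, 0, 10, 7, 9, 13],
    [2, 10, 10, 8, 4, 11, 13, 16, 16, 7, 10, 0, 4, 8, 11, 8, 5, 2],
    [13, 11, 12, 8, 3, 1, 0, 1, 16, 0, 4, 4, 9, 1, 2, 14, 12, 2],
    [4, 0, 0, 0, 0, 0, 0, 0, 0, 0, 0, 0, 0, 0, 0, 0, 0, 0],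
    [14, 15, 9, 15, 1, 5, 15, 6, 4, 4, 0, 6, 5, 7, 3, 3, 14, 4],
    [4, 3, 11, 9, 12, 5, 15, 2, 6, 6, 9, 11, 8, 16, 9, 9, 6, 10],
    [7, 12, 7, 11, 15, 8, 4, 16, 14, 14, 11, 3, 11, 16, 6, 12, 6, 16],
    [9, 6, 11, 10, 5, 4, 3, 8, 8, 3, 5, 14, 16, 1, 4, 11, 12, 0],
    [13, 14, 16, 1, 12, 9, 9, 7, 14, 9, 2, 6, 6, 1, 3, 13, 14, 6],
    [6, 12, 0, 1, 5, 3, 12, 12, 8, 3, 9, 2, 12, 7, 0, 10, 16, 11]]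

/-- A degree two syzygy has 3 · 6 = 18 unknown coefficients, and 18 points give a square system. The
check is arithmetic with natural numbers modulo 17. -/
lemma cmb123FirstCertificate_valid :
    cmb123FirstCertificate.GradientValid ∧ cmb123FirstCertificate.InverseValid := by
  decide +kernel

lemma two_notMem_syzygyDegrees_cmb123First : 2 ∉ syzygyDegrees (∏ i, cmb123First i) := by
  refine cmb123FirstCertificate.notMem_syzygyDegrees (by decide) cmb123FirstCertificate_valid (c :=
    1)
    (eq_of_eval fun X Y Z => ?_)
  rw [map_prodForm, eval_prodForm, Fin.prod_univ_five]
  simp only [cmb123FirstCertificate, cmb123First, List.map_cons, List.map_nil, prodVal, cons_val,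
    map_mul, eval_C, formVal_cmb123_CCoeffs, formVal_cmb123_L₁Coeffs, formVal_cmb123_L₂Coeffs,
    formVal_cmb123_DCoeffs, formVal_cmb123_M₁Coeffs]
  ring

/-- Reductions modulo `17` showing that the second curve has no syzygies of degree three. -/
def cmb123SecondCertificate : Certificate where
  cs := [cmb123_CCoeffs, cmb123_L₁Coeffs, cmb123_L₂Coeffs, cmb123_DCoeffs, cmb123_M₂Coeffs]
  d := 3
  vs := [
    (0, 0, 1), (1, 0, 0), (0, 1, 1), (1, 0, 1), (1, 1, 0), (0, 1, 2), (0, 2, 1), (1, 0, 2), (1,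
    2, 0), (2, 0, 1), (2, 1, 0), (1, 1, 2), (1, 2, 1), (2, 1, 1), (1, 2, 2), (2, 1, 2), (2, 2,
    1), (0, 1, 3), (0, 3, 1), (1, 0, 3), (1, 3, 0), (3, 0, 1), (3, 1, 0), (0, 2, 3), (1, 1, 3),
    (1, 3, 1), (2, 0, 3), (2, 3, 0), (3, 0, 2), (3, 1, 1)]
  gs := ![
    [0, 10, 13, 11, 0, 1, 13, 6, 6, 7, 6, 7, 15, 0, 12, 7, 2, 10, 16, 16, 7, 3, 1, 0, 1, 15, 6,
    12, 9, 5],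
    [13, 10, 3, 8, 5, 7, 11, 0, 16, 13, 12, 4, 1, 15, 14, 6, 9, 15, 9, 15, 9, 4, 2, 5, 14, 16,
    15, 0, 4, 15],
    [0, 7, 15, 16, 1, 5, 13, 11, 16, 5, 2, 7, 16, 6, 16, 9, 9, 6, 16, 9, 1, 8, 11, 16, 14, 14,
    13, 6, 4, 4]]
  L := [
    [5, 7, 1, 7, 11, 12, 15, 1, 2, 6, 16, 5, 9, 5, 0, 8, 5, 1, 9, 5, 14, 2, 10, 0, 6, 10, 5, 2,
    15, 9],
    [12, 0, 6, 10, 4, 2, 10, 2, 9, 9, 0, 5, 6, 11, 4, 2, 5, 15, 4, 8, 8, 8, 4, 13, 2, 0, 13, 7,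
    3, 0],
    [13, 15, 10, 0, 0, 14, 11, 7, 0, 14, 16, 2, 12, 2, 2, 6, 9, 0, 7, 8, 7, 13, 5, 9, 8, 15, 5,
    4, 0, 6],
    [15, 13, 3, 2, 6, 11, 7, 10, 6, 13, 13, 16, 16, 10, 3, 9, 10, 14, 7, 1, 12, 13, 6, 2, 11, 8,
    3, 4, 9, 13],
    [12, 1, 6, 16, 3, 7, 6, 6, 9, 8, 1, 6, 14, 10, 4, 14, 3, 16, 5, 15, 1, 4, 0, 5, 13, 12, 10,
    11, 10, 4],
    [6, 14, 6, 14, 15, 16, 7, 8, 0, 1, 4, 15, 5, 3, 14, 8, 7, 8, 9, 9, 2, 8, 14, 6, 7, 12, 15,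
    13, 12, 1],
    [14, 8, 14, 8, 4, 2, 10, 9, 5, 3, 12, 1, 10, 13, 8, 11, 14, 3, 10, 14, 7, 16, 5, 12, 3, 14,
    14, 3, 7, 3],
    [16, 9, 14, 0, 11, 1, 8, 7, 10, 3, 9, 8, 9, 4, 1, 3, 13, 5, 3, 9, 12, 9, 14, 14, 12, 10, 12,
    4, 1, 8],
    [15, 14, 3, 8, 4, 16, 7, 11, 7, 4, 15, 11, 15, 0, 16, 11, 0, 1, 7, 8, 2, 9, 15, 13, 6, 3, 13,
    2, 6, 7],
    [10, 7, 4, 5, 3, 13, 11, 4, 8, 1, 14, 13, 0, 10, 3, 10, 10, 13, 10, 5, 1, 12, 8, 8, 8, 12, 7,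
    0, 16, 13],
    [5, 16, 1, 9, 9, 4, 1, 12, 10, 3, 3, 1, 8, 13, 12, 8, 9, 14, 15, 10, 3, 0, 0, 15, 5, 2, 1,
    16, 16, 12],
    [9, 12, 13, 8, 0, 3, 0, 3, 6, 13, 6, 15, 11, 11, 2, 14, 2, 6, 5, 0, 6, 13, 9, 4, 14, 11, 13,
    6, 16, 0],
    [10, 1, 9, 7, 3, 10, 1, 15, 14, 13, 9, 16, 10, 2, 8, 14, 3, 9, 11, 10, 5, 12, 12, 8, 0, 9,
    12, 8, 7, 6],
    [12, 12, 3, 11, 13, 4, 10, 3, 6, 12, 1, 12, 7, 14, 10, 13, 2, 4, 10, 4, 9, 11, 14, 10, 0, 2,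
    12, 11, 2, 1],
    [15, 12, 6, 14, 0, 14, 2, 11, 12, 8, 1, 15, 6, 11, 4, 13, 11, 1, 8, 6, 5, 4, 6, 5, 9, 0, 4,
    7, 4, 12],
    [6, 9, 14, 9, 11, 13, 2, 7, 12, 0, 4, 7, 16, 5, 5, 13, 9, 7, 10, 16, 13, 4, 4, 13, 0, 13, 16,
    8, 0, 10],
    [0, 7, 10, 13, 3, 12, 11, 14, 13, 2, 9, 16, 2, 4, 4, 10, 10, 9, 10, 4, 2, 7, 14, 0, 7, 3, 3,
    7, 8, 3],
    [13, 11, 9, 0, 3, 10, 7, 8, 16, 10, 5, 9, 13, 12, 8, 14, 13, 9, 4, 15, 5, 12, 12, 10, 14, 12,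
    5, 5, 13, 3],
    [13, 16, 11, 10, 12, 6, 1, 5, 1, 15, 0, 14, 8, 6, 15, 1, 2, 11, 5, 11, 4, 16, 8, 10, 13, 14,
    15, 16, 16, 8],
    [4, 0, 0, 0, 0, 0, 0, 0, 0, 0, 0, 0, 0, 0, 0, 0, 0, 0, 0, 0, 0, 0, 0, 0, 0, 0, 0, 0, 0, 0],
    [10, 11, 2, 16, 3, 16, 16, 13, 12, 9, 2, 6, 0, 1, 12, 16, 14, 15, 7, 15, 0, 2, 10, 15, 11,
    12, 6, 1, 14, 4],
    [5, 6, 9, 1, 0, 3, 13, 0, 0, 14, 7, 1, 13, 11, 14, 8, 16, 14, 9, 12, 16, 12, 10, 6, 15, 7, 7,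
    6, 16, 10],
    [12, 16, 16, 12, 9, 14, 4, 9, 12, 10, 15, 11, 11, 9, 1, 3, 9, 14, 11, 6, 5, 10, 9, 13, 15,
    14, 1, 9, 3, 10],
    [14, 0, 13, 0, 0, 15, 9, 0, 0, 0, 0, 0, 0, 0, 0, 0, 0, 13, 6, 0, 0, 0, 0, 2, 0, 0, 0, 0, 0,
    0],
    [16, 12, 10, 4, 8, 2, 14, 10, 7, 15, 4, 15, 6, 2, 8, 3, 0, 14, 2, 16, 10, 13, 0, 10, 12, 15,
    14, 16, 8, 11],
    [4, 1, 4, 14, 8, 4, 13, 10, 6, 16, 11, 7, 2, 11, 0, 4, 8, 10, 14, 8, 13, 13, 13, 7, 2, 4, 6,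
    6, 10, 5],
    [11, 7, 12, 5, 14, 0, 1, 2, 6, 7, 9, 9, 13, 0, 11, 16, 13, 11, 15, 2, 11, 1, 3, 8, 13, 6, 6,
    12, 1, 9],
    [4, 10, 10, 6, 13, 13, 15, 8, 2, 16, 4, 0, 8, 6, 8, 16, 15, 5, 14, 10, 9, 1, 7, 10, 13, 1, 7,
    0, 1, 9],
    [13, 5, 15, 11, 5, 7, 5, 7, 16, 0, 8, 2, 14, 1, 1, 5, 10, 2, 11, 10, 8, 0, 14, 9, 7, 1, 14,
    1, 7, 0],
    [8, 16, 7, 6, 6, 12, 16, 7, 7, 3, 9, 4, 10, 3, 14, 1, 15, 16, 14, 3, 2, 1, 3, 9, 5, 7, 2, 3,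
    6, 5]]

/-- In degree three there are 3 · 10 = 30 unknown coefficients and 30 points. -/
lemma cmb123SecondCertificate_valid :
    cmb123SecondCertificate.GradientValid ∧ cmb123SecondCertificate.InverseValid := by
  decide +kernel

lemma three_notMem_syzygyDegrees_cmb123Second : 3 ∉ syzygyDegrees (∏ i, cmb123Second i) := by
  refine cmb123SecondCertificate.notMem_syzygyDegrees (by decide) cmb123SecondCertificate_valid (c
    := 1)
    (eq_of_eval fun X Y Z => ?_)
  rw [map_prodForm, eval_prodForm, Fin.prod_univ_five]
  simp only [cmb123SecondCertificate, cmb123Second, List.map_cons, List.map_nil, prodVal, cons_val,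
    map_mul, eval_C, formVal_cmb123_CCoeffs, formVal_cmb123_L₁Coeffs, formVal_cmb123_L₂Coeffs,
    formVal_cmb123_DCoeffs, formVal_cmb123_M₂Coeffs]
  ring

/-- A syzygy of degree three of the first curve. -/
def cmb123FirstSyzygyThree : Fin 3 → S :=
  ![formOfCoeffs 3 [6 * b, -6 * b - 9, -3, 0, -48 * b + 18, -15 * b, 7 * b, 18 * b + 12, 28 * b, 28
    * b],
    formOfCoeffs 3 [-126 * b + 84, 6 * b - 63, 8 * b - 9, 4, 84 * b, 71 * b - 66, -15 * b + 28, 56 *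
      b, -66 * b + 40, 0],
    formOfCoeffs 3 [-42, 0, 0, 0, -36 * b + 63, -6 * b + 33, -10, 15 * b + 18, 27 * b - 28, 18 * b -
      16]]

/-- The listed quadratic forms are the cofactors of the vector field on the five components, in
their order; they sum to zero. -/
lemma cmb123FirstSyzygyThree_mem : cmb123FirstSyzygyThree ∈ AR (∏ i, cmb123First i) := by
  refine mem_AR_prod ![formOfCoeffs 2 [12 * b, -12 * b + 24, -6, 30 * b - 48, 12 * b, -48 * b + 24],
    formOfCoeffs 2 [-36 * b, 8 * b - 30, 4, -20 * b + 60, 6 * b, 60 * b - 16],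
    formOfCoeffs 2 [48 * b, 8 * b + 12, 4, -20 * b - 24, -36 * b, -24 * b - 16],
    formOfCoeffs 2 [-30 * b + 63, 2 * b + 3, -6, -5 * b - 6, 33 * b - 28, -6 * b - 32],
    formOfCoeffs 2 [6 * b - 63, -6 * b - 9, 4, 15 * b + 18, -15 * b + 28, 18 * b + 40]]
    (forall_fin_five ?_ ?_ ?_ ?_ ?_) ?_
  · refine eq_of_eval fun X Y Z => ?_
    simp only [cmb123FirstSyzygyThree, cmb123First, cons_val, map_add, map_mul, ←
      grad_eq_eval_gradient, grad_cmb123_C, eval_cmb123_C, eval_formOfCoeffs_three,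
      eval_formOfCoeffs_two]
    ring
  · refine eq_of_eval fun X Y Z => ?_
    simp only [cmb123FirstSyzygyThree, cmb123First, cons_val, map_add, map_mul, ←
      grad_eq_eval_gradient, grad_cmb123_L₁, eval_cmb123_L₁, eval_formOfCoeffs_three,
      eval_formOfCoeffs_two]
    ring
  · refine eq_of_eval fun X Y Z => ?_
    simp only [cmb123FirstSyzygyThree, cmb123First, cons_val, map_add, map_mul, ←
      grad_eq_eval_gradient, grad_cmb123_L₂, eval_cmb123_L₂, eval_formOfCoeffs_three,
      eval_formOfCoeffs_two]
    ring
  · refine eq_of_eval fun X Y Z => ?_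
    simp only [cmb123FirstSyzygyThree, cmb123First, cons_val, map_add, map_mul, ←
      grad_eq_eval_gradient, grad_cmb123_D, eval_cmb123_D, eval_formOfCoeffs_three,
      eval_formOfCoeffs_two]
    linear_combination (504 * X ^ 4 - 168 * X ^ 3 * Y - 1092 * X ^ 3 * Z - 252 * X ^ 2 * Y * Z + 504
      * X ^ 2 * Z ^ 2 + 168 * X * Y ^ 2 * Z + 1092 * X * Y * Z ^ 2 - 252 * Y ^ 2 * Z ^ 2 - 504 * Y *
      Z ^ 3) * b_mul_b
  · refine eq_of_eval fun X Y Z => ?_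
    simp only [cmb123FirstSyzygyThree, cmb123First, cons_val, map_add, map_mul, ←
      grad_eq_eval_gradient, grad_cmb123_M₁, eval_cmb123_M₁, eval_formOfCoeffs_three,
      eval_formOfCoeffs_two]
    linear_combination (-126 * X ^ 2 * Z + 14 * Y ^ 2 * Z + 56 * Y * Z ^ 2 + 56 * Z ^ 3) * b_mul_b
  · refine eq_of_eval fun X Y Z => ?_
    simp only [Fin.sum_univ_five, cons_val, map_add, map_zero, eval_formOfCoeffs_two]
    ring

lemma isHomogeneous_cmb123FirstSyzygyThree : ∀ i, (cmb123FirstSyzygyThree i).IsHomogeneous 3 := by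
  intro i
  fin_cases i <;> exact isHomogeneous_formOfCoeffs _ _

/-- A syzygy of degree four of the first curve. -/
def cmb123FirstSyzygyFour : Fin 3 → S :=
  ![formOfCoeffs 4 [-2676 * b + 4038, -2042 * b + 3004, -597 * b - 2850, -393 * b - 60, 0, -12484 *
    b + 17936, 5610 * b - 18720, 2248 * b - 6170, 140 * b + 1834, 7560 * b - 9156, 4900 * b + 196,
    -1008 * b + 9492, 14560 * b - 19376, -5712 * b + 15960, -6272 * b + 8624],
    formOfCoeffs 4 [-39900 * b + 60312, 20550 * b - 50352, -5171 * b - 4808, -1955 * b + 3380, 524 *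
      b + 80, 3696 * b - 1092, 13696 * b - 5528, -12702 * b + 25338, 4432 * b - 3902, 47152 * b -
      64232, 14700, 4088 * b - 11872, -12544 * b + 17248, -18032 * b + 25480, 0],
    formOfCoeffs 4 [-3108 * b - 672, -5502 * b - 840, 0, 0, 0, -5154 * b + 8238, 10047 * b - 4794,
      6543 * b - 4572, -1310 * b - 200, 6948 * b - 6648, 1158 * b + 6396, -5788 * b + 7844, 0, 0,
      0]]

lemma cmb123FirstSyzygyFour_mem : cmb123FirstSyzygyFour ∈ AR (∏ i, cmb123First i) := by
  refine mem_AR_prod ![formOfCoeffs 3 [-5352 * b + 8076, -976 * b + 6680, 4308 * b - 4860, -786 * b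
    - 120, 14932 * b - 24440, -9528 * b + 12750, -1356 * b + 3942, 11424 * b - 17220, 4088 * b -
    11872, -18032 * b + 25480],
    formOfCoeffs 3 [-18048 * b + 23694, 7156 * b - 22238, -4706 * b + 2960, 524 * b + 80, -2656 * b
      + 7268, 12988 * b - 11356, 1184 * b + 1040, 29680 * b - 39844, -12880 * b + 30212, -9408 * b +
      12936],
    formOfCoeffs 3 [12696 * b - 15618, -992 * b + 15142, 796 * b + 3800, 524 * b + 80, -1816 * b +
      2396, -6920 * b - 2788, 344 * b - 9964, -14000 * b + 18284, -5152 * b - 4732, 9408 * b -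
      12936],
    formOfCoeffs 3 [-1362 * b + 2868, 5107 * b - 1328, 1837 * b - 1612, -786 * b - 120, -11332 * b +
      12212, 3142 * b - 6640, -4604 * b + 8884, -14000 * b + 18284, 11312 * b - 21196, 9408 * b -
      12936],
    formOfCoeffs 3 [12066 * b - 19020, -10295 * b + 1744, -2235 * b - 288, 524 * b + 80, 872 * b +
      2564, 318 * b + 8034, 4432 * b - 3902, -13104 * b + 20496, 2632 * b + 7588, 8624 * b - 12544]]
    (forall_fin_five ?_ ?_ ?_ ?_ ?_) ?_
  · refine eq_of_eval fun X Y Z => ?_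
    simp only [cmb123FirstSyzygyFour, cmb123First, cons_val, map_add, map_mul, ←
      grad_eq_eval_gradient, grad_cmb123_C, eval_cmb123_C, eval_formOfCoeffs_four,
      eval_formOfCoeffs_three]
    ring
  · refine eq_of_eval fun X Y Z => ?_
    simp only [cmb123FirstSyzygyFour, cmb123First, cons_val, map_add, map_mul, ←
      grad_eq_eval_gradient, grad_cmb123_L₁, eval_cmb123_L₁, eval_formOfCoeffs_four,
      eval_formOfCoeffs_three]
    ring
  · refine eq_of_eval fun X Y Z => ?_
    simp only [cmb123FirstSyzygyFour, cmb123First, cons_val, map_add, map_mul, ←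
      grad_eq_eval_gradient, grad_cmb123_L₂, eval_cmb123_L₂, eval_formOfCoeffs_four,
      eval_formOfCoeffs_three]
    ring
  · refine eq_of_eval fun X Y Z => ?_
    simp only [cmb123FirstSyzygyFour, cmb123First, cons_val, map_add, map_mul, ←
      grad_eq_eval_gradient, grad_cmb123_D, eval_cmb123_D, eval_formOfCoeffs_four,
      eval_formOfCoeffs_three]
    linear_combination (64008 * X ^ 5 + 87780 * X ^ 4 * Y - 79968 * X ^ 4 * Z - 36372 * X ^ 3 * Y ^
      2 - 271488 * X ^ 3 * Y * Z - 73920 * X ^ 3 * Z ^ 2 - 38724 * X ^ 2 * Y ^ 2 * Z + 211008 * X ^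
      2 * Y * Z ^ 2 + 65856 * X ^ 2 * Z ^ 3 + 36372 * X * Y ^ 3 * Z + 207480 * X * Y ^ 2 * Z ^ 2 +
      73920 * X * Y * Z ^ 3 - 49056 * Y ^ 3 * Z ^ 2 - 131040 * Y ^ 2 * Z ^ 3 - 65856 * Y * Z ^ 4) *
      b_mul_b
  · refine eq_of_eval fun X Y Z => ?_
    simp only [cmb123FirstSyzygyFour, cmb123First, cons_val, map_add, map_mul, ←
      grad_eq_eval_gradient, grad_cmb123_M₁, eval_cmb123_M₁, eval_formOfCoeffs_four,
      eval_formOfCoeffs_three]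
    linear_combination (-29484 * X ^ 4 + 16506 * X ^ 3 * Y - 26712 * X ^ 3 * Z + 3276 * X ^ 2 * Y ^
      2 + 10584 * X ^ 2 * Y * Z + 41328 * X ^ 2 * Z ^ 2 - 1834 * X * Y ^ 3 - 4368 * X * Y ^ 2 * Z +
      4536 * X * Y * Z ^ 2 + 11872 * X * Z ^ 3 + 280 * Y ^ 3 * Z - 2016 * Y ^ 2 * Z ^ 2 - 11424 * Y
      * Z ^ 3 - 12544 * Z ^ 4) * b_mul_b
  · refine eq_of_eval fun X Y Z => ?_
    simp only [Fin.sum_univ_five, cons_val, map_add, map_zero, eval_formOfCoeffs_three]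
    ring

lemma isHomogeneous_cmb123FirstSyzygyFour : ∀ i, (cmb123FirstSyzygyFour i).IsHomogeneous 4 := by
  intro i
  fin_cases i <;> exact isHomogeneous_formOfCoeffs _ _

/-- A syzygy of degree four that is a multiple of the one of degree three would be useless for
`isEmpty_AR_equiv`; one value of the last coordinate of the cross product rules this out. -/
lemma crossProduct_cmb123First_ne_zero : cmb123FirstSyzygyThree ⨯₃ cmb123FirstSyzygyFour ≠ 0 := by
  refine crossProduct_ne_zero_of_eval 1 0 0 ?_
  simp only [cmb123FirstSyzygyThree, cmb123FirstSyzygyFour, cons_val, eval_formOfCoeffs_three,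
    eval_formOfCoeffs_four]
  exact ne_zero_of_mul (23 / 3630312 * b + 47 / 5445468) (by linear_combination (-26312 / 7203 * b +
    84871 / 43218) * b_mul_b)

/-- A syzygy of degree four of the second curve. -/
def cmb123SecondSyzygyFour : Fin 3 → S :=
  ![formOfCoeffs 4 [-128928 * b - 190944, -16977 * b - 559455, 164769 * b + 50035, 0, 0, 159366 * b
    - 1899186, 560397 * b + 755086, 55785 * b + 488022, -101934 * b - 138572, -485862 * b + 1817992,
    1622208, -331548 * b - 653464, -386148 * b + 494760, -102984 * b - 950992, 304752 * b - 396704],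
    formOfCoeffs 4 [400302 * b - 5042184, 1000137 * b - 450441, -32083 * b + 248037, -37104 * b +
      57588, 0, -1375584 * b + 4483584, 323957 * b + 4830180, -324333 * b - 468682, -25646 * b -
      195780, -832720 * b + 975072, 6042 * b - 2536204, -82208 * b - 683424, 609504 * b - 793408,
      60424 * b + 14448, 0],
    formOfCoeffs 4 [-132174 * b - 1112622, 343896 * b + 95760, 0, 0, 0, -108873 * b + 1022121,
      236955 * b + 767955, -181122 * b - 330422, 0, -323319 * b + 341472, -367089 * b - 281642,
      30564 * b + 149544, 191850 * b - 213380, 0, 0]]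

lemma cmb123SecondSyzygyFour_mem : cmb123SecondSyzygyFour ∈ AR (∏ i, cmb123Second i) := by
  refine mem_AR_prod ![formOfCoeffs 3 [-257856 * b - 381888, 98220 * b - 6288, -14358 * b + 4310, 0,
    -81570 * b + 1243812, -28326 * b + 556604, 4918 * b - 46236, 403860 * b - 847600, -82208 * b -
    683424, 60424 * b + 14448],
    formOfCoeffs 3 [-83610 * b - 2613420, 573536 * b + 225378, -37104 * b + 57588, 0, -316004 * b +
      2019036, 549330 * b + 2053852, -331448 * b - 611496, -768312 * b + 1024640, -352828 * b -
      1121736, 457128 * b - 595056],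
    formOfCoeffs 3 [-174246 * b + 2231532, -637702 * b + 270696, -37104 * b + 57588, 0, 574312 * b -
      2587440, 60744 * b - 2048960, 280156 * b + 219936, 390132 * b - 459640, 413252 * b + 1136184,
      -457128 * b + 595056],
    formOfCoeffs 3 [-1172217 * b + 1022697, -17077 * b + 69669, 125670 * b - 177074, 0, 1425313 * b
      - 1260816, 582753 * b - 99646, -205124 * b + 225840, 581982 * b - 673020, -761068 * b +
      151032, -457128 * b + 595056],
    formOfCoeffs 3 [1687929 * b - 258921, -16977 * b - 559455, -37104 * b + 57588, 0, -1602051 * b +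
      585408, -1164501 * b - 461850, 251498 * b + 211956, -607662 * b + 955620, 782852 * b + 517944,
      396704 * b - 609504]]
    (forall_fin_five ?_ ?_ ?_ ?_ ?_) ?_
  · refine eq_of_eval fun X Y Z => ?_
    simp only [cmb123SecondSyzygyFour, cmb123Second, cons_val, map_add, map_mul, ←
      grad_eq_eval_gradient, grad_cmb123_C, eval_cmb123_C, eval_formOfCoeffs_four,
      eval_formOfCoeffs_three]
    ring
  · refine eq_of_eval fun X Y Z => ?_
    simp only [cmb123SecondSyzygyFour, cmb123Second, cons_val, map_add, map_mul, ←
      grad_eq_eval_gradient, grad_cmb123_L₁, eval_cmb123_L₁, eval_formOfCoeffs_four,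
      eval_formOfCoeffs_three]
    ring
  · refine eq_of_eval fun X Y Z => ?_
    simp only [cmb123SecondSyzygyFour, cmb123Second, cons_val, map_add, map_mul, ←
      grad_eq_eval_gradient, grad_cmb123_L₂, eval_cmb123_L₂, eval_formOfCoeffs_four,
      eval_formOfCoeffs_three]
    ring
  · refine eq_of_eval fun X Y Z => ?_
    simp only [cmb123SecondSyzygyFour, cmb123Second, cons_val, map_add, map_mul, ←
      grad_eq_eval_gradient, grad_cmb123_D, eval_cmb123_D, eval_formOfCoeffs_four,
      eval_formOfCoeffs_three]
    linear_combination (15730596 * X ^ 5 - 12582780 * X ^ 4 * Y - 53262300 * X ^ 4 * Z + 2446416 * X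
      ^ 3 * Y ^ 2 + 14429520 * X ^ 3 * Y * Z + 61476408 * X ^ 3 * Z ^ 2 + 8913156 * X ^ 2 * Y ^ 2 *
      Z + 34936524 * X ^ 2 * Y * Z ^ 2 - 21973056 * X ^ 2 * Z ^ 3 - 2446416 * X * Y ^ 3 * Z -
      30160116 * X * Y ^ 2 * Z ^ 2 - 61476408 * X * Y * Z ^ 3 + 3669624 * Y ^ 3 * Z ^ 2 + 18325776 *
      Y ^ 2 * Z ^ 3 + 21973056 * Y * Z ^ 4) * b_mul_b
  · refine eq_of_eval fun X Y Z => ?_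
    simp only [cmb123SecondSyzygyFour, cmb123Second, cons_val, map_add, map_mul, ←
      grad_eq_eval_gradient, grad_cmb123_M₂, eval_cmb123_M₂, eval_formOfCoeffs_four,
      eval_formOfCoeffs_three]
    linear_combination (3633714 * X ^ 4 - 3522834 * X ^ 3 * Z - 403746 * X ^ 2 * Y ^ 2 - 3449796 * X
      ^ 2 * Y * Z - 243600 * X ^ 2 * Z ^ 2 + 391426 * X * Y ^ 2 * Z + 1565704 * X * Y * Z ^ 2 +
      1565704 * X * Z ^ 3 + 203868 * Y ^ 3 * Z + 663096 * Y ^ 2 * Z ^ 2 + 205968 * Y * Z ^ 3 -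
      609504 * Z ^ 4) * b_mul_b
  · refine eq_of_eval fun X Y Z => ?_
    simp only [Fin.sum_univ_five, cons_val, map_add, map_zero, eval_formOfCoeffs_three]
    ring

lemma isHomogeneous_cmb123SecondSyzygyFour : ∀ i, (cmb123SecondSyzygyFour i).IsHomogeneous 4 := by
  intro i
  fin_cases i <;> exact isHomogeneous_formOfCoeffs _ _

lemma cmb123SecondSyzygyFour_ne_zero : cmb123SecondSyzygyFour ≠ 0 := by
  refine ne_zero_of_eval 0 0 1 ?_
  simp only [cmb123SecondSyzygyFour, cons_val, eval_formOfCoeffs_four]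
  exact ne_zero_of_mul (2721 / 253334816 * b + 253 / 18095344) (by linear_combination 7403841 /
    2261918 * b_mul_b)

theorem isStrongZieglerPair_cmb123 :
    IsStrongZieglerPair (firstCurve .cmb123) (secondCurve .cmb123) ∧
    IsLeast (syzygyDegrees (firstCurve .cmb123)) 3 ∧
    IsLeast (syzygyDegrees (secondCurve .cmb123)) 4 ∧
    Nonempty (MinimalGradedFreeResolution (jacobianIdeal (firstCurve .cmb123))) ∧
    Nonempty (MinimalGradedFreeResolution (jacobianIdeal (secondCurve .cmb123))) ∧
    ∀ (F : MinimalGradedFreeResolution (jacobianIdeal (firstCurve .cmb123)))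
      (G : MinimalGradedFreeResolution (jacobianIdeal (secondCurve .cmb123))),
      F.twists ≠ G.twists := by
  have hf : firstCurve .cmb123 = ∏ i, cmb123First i := by
    rw [Fin.prod_univ_five]
    rfl
  have hg : secondCurve .cmb123 = ∏ i, cmb123Second i := by
    rw [Fin.prod_univ_five]
    rfl
  -- This root parametrises the two points of `D` on `M₁`; the second curve needs none.
  obtain ⟨r₁, hr₁⟩ := exists_quadratic_root (2 * b - 1 / 6) 2
  exact conclusion_of_arrangements isSeparating_cmb123Types (isArrangement_cmb123First (r := r₁) (by
    linear_combination hr₁))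
    isArrangement_cmb123Second (by decide) hf hg cmb123FirstSyzygyThree_mem
      cmb123FirstSyzygyFour_mem cmb123SecondSyzygyFour_mem isHomogeneous_cmb123FirstSyzygyThree
      isHomogeneous_cmb123FirstSyzygyFour isHomogeneous_cmb123SecondSyzygyFour
      crossProduct_cmb123First_ne_zero cmb123SecondSyzygyFour_ne_zero
    (hf ▸ two_notMem_syzygyDegrees_cmb123First) (hg ▸ three_notMem_syzygyDegrees_cmb123Second)

/-! ### The `cmb124` pair: syzygies and conclusion. -/

/-- Reductions modulo `17` showing that the first curve has no syzygies of degree two. -/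
def cmb124FirstCertificate : Certificate where
  cs := [cmb123_CCoeffs, cmb123_L₁Coeffs, cmb123_L₂Coeffs, cmb124_DCoeffs, cmb124_M₁Coeffs]
  d := 2
  vs := [
    (1, 0, 0), (0, 1, 1), (1, 0, 1), (1, 1, 0), (0, 1, 2), (0, 2, 1), (1, 0, 2), (1, 2, 0), (2,
    0, 1), (2, 1, 0), (1, 1, 2), (1, 2, 1), (2, 1, 1), (1, 2, 2), (2, 1, 2), (2, 2, 1), (0, 1,
    3), (0, 3, 1)]
  gs := ![
    [6, 13, 0, 4, 16, 15, 14, 9, 5, 6, 9, 12, 5, 1, 3, 2, 8, 2],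
    [4, 16, 0, 13, 4, 2, 9, 8, 7, 10, 3, 7, 15, 10, 9, 10, 13, 14],
    [9, 7, 10, 8, 13, 13, 4, 9, 1, 1, 7, 5, 3, 12, 0, 7, 4, 12]]
  L := [
    [5, 13, 7, 10, 6, 7, 13, 15, 6, 5, 10, 14, 7, 6, 3, 7, 13, 10],
    [0, 15, 16, 14, 4, 8, 11, 14, 16, 10, 3, 13, 9, 14, 6, 4, 12, 4],
    [13, 13, 0, 5, 16, 3, 1, 10, 11, 3, 3, 8, 4, 4, 1, 15, 0, 9],
    [8, 1, 16, 0, 12, 8, 15, 16, 3, 2, 0, 2, 7, 5, 14, 11, 16, 1],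
    [4, 6, 16, 8, 5, 0, 10, 13, 1, 6, 2, 15, 4, 7, 7, 9, 6, 11],
    [13, 6, 8, 2, 10, 1, 14, 2, 0, 12, 1, 15, 0, 4, 15, 1, 1, 2],
    [7, 8, 16, 1, 9, 16, 10, 8, 10, 11, 4, 15, 13, 10, 10, 4, 7, 5],
    [8, 13, 9, 4, 3, 5, 7, 10, 13, 10, 1, 10, 14, 3, 1, 6, 8, 10],
    [5, 4, 8, 0, 16, 1, 6, 11, 8, 6, 6, 15, 13, 1, 7, 16, 8, 14],
    [14, 11, 16, 2, 13, 2, 6, 0, 8, 4, 14, 1, 3, 9, 1, 10, 10, 10],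
    [13, 12, 7, 4, 6, 0, 6, 15, 0, 3, 8, 15, 9, 15, 7, 13, 16, 13],
    [5, 3, 16, 9, 14, 12, 8, 10, 5, 6, 1, 13, 6, 4, 2, 1, 7, 12],
    [5, 1, 9, 8, 9, 9, 2, 11, 1, 5, 1, 1, 16, 1, 3, 3, 9, 10],
    [10, 5, 0, 10, 5, 10, 16, 12, 12, 1, 1, 9, 4, 12, 10, 10, 1, 3],
    [3, 3, 13, 2, 4, 0, 15, 6, 3, 7, 4, 1, 7, 16, 8, 4, 6, 7],
    [10, 12, 10, 4, 1, 4, 12, 2, 16, 11, 4, 15, 8, 2, 3, 4, 13, 15],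
    [13, 15, 0, 1, 7, 5, 4, 7, 13, 11, 9, 4, 11, 13, 11, 7, 5, 7],
    [2, 4, 10, 5, 7, 4, 3, 4, 0, 1, 12, 1, 10, 14, 11, 10, 12, 9]]

lemma cmb124FirstCertificate_valid :
    cmb124FirstCertificate.GradientValid ∧ cmb124FirstCertificate.InverseValid := by
  decide +kernel

lemma two_notMem_syzygyDegrees_cmb124First : 2 ∉ syzygyDegrees (∏ i, cmb124First i) := by
  -- The scalar 8 is the factor by which the coefficients of `D` were multiplied; the other
  -- components are unscaled.
  refine cmb124FirstCertificate.notMem_syzygyDegrees (by decide) cmb124FirstCertificate_valid (c :=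
    8)
    (eq_of_eval fun X Y Z => ?_)
  rw [map_prodForm, eval_prodForm, Fin.prod_univ_five]
  simp only [cmb124FirstCertificate, cmb124First, List.map_cons, List.map_nil, prodVal, cons_val,
    map_mul, eval_C, formVal_cmb123_CCoeffs, formVal_cmb123_L₁Coeffs, formVal_cmb123_L₂Coeffs,
    formVal_cmb124_DCoeffs, formVal_cmb124_M₁Coeffs]
  ring

/-- Reductions modulo `17` showing that the second curve has no syzygies of degree three. -/
def cmb124SecondCertificate : Certificate where
  cs := [cmb123_CCoeffs, cmb123_L₁Coeffs, cmb123_L₂Coeffs, cmb124_DCoeffs, cmb124_M₂Coeffs]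
  d := 3
  vs := [
    (1, 0, 0), (0, 1, 1), (1, 0, 1), (1, 1, 0), (0, 1, 2), (0, 2, 1), (1, 0, 2), (1, 2, 0), (2,
    0, 1), (2, 1, 0), (1, 1, 2), (1, 2, 1), (2, 1, 1), (1, 2, 2), (2, 1, 2), (2, 2, 1), (0, 1,
    3), (0, 3, 1), (1, 0, 3), (1, 3, 0), (3, 0, 1), (3, 1, 0), (0, 2, 3), (0, 3, 2), (1, 1, 3),
    (1, 3, 1), (2, 0, 3), (1, 2, 3), (1, 3, 2), (2, 1, 3)]
  gs := ![
    [0, 0, 2, 9, 0, 0, 7, 13, 1, 2, 9, 7, 0, 0, 1, 8, 0, 0, 1, 7, 4, 4, 0, 0, 2, 4, 14, 0, 4, 6],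
    [4, 4, 4, 14, 2, 5, 4, 10, 1, 8, 4, 6, 10, 10, 0, 2, 14, 13, 4, 9, 9, 3, 16, 12, 9, 15, 1,
    10, 3, 3],
    [13, 13, 7, 6, 4, 4, 6, 2, 5, 6, 1, 1, 7, 7, 9, 7, 10, 1, 10, 1, 15, 2, 14, 6, 12, 7, 2, 15,
    0, 15]]
  L := [
    [4, 9, 16, 13, 12, 7, 15, 3, 16, 0, 8, 7, 2, 3, 5, 15, 13, 5, 10, 16, 0, 14, 16, 7, 9, 13,
    11, 16, 16, 12],
    [7, 4, 1, 8, 13, 16, 1, 1, 6, 3, 10, 12, 7, 1, 8, 5, 10, 1, 5, 14, 2, 1, 6, 9, 16, 7, 15, 4,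
    0, 14],
    [8, 13, 14, 11, 14, 9, 8, 6, 13, 1, 12, 5, 0, 7, 1, 4, 9, 1, 3, 13, 3, 6, 3, 5, 10, 5, 8, 9,
    4, 6],
    [4, 8, 15, 5, 0, 0, 1, 11, 2, 7, 0, 0, 9, 4, 0, 0, 0, 0, 8, 9, 11, 1, 0, 0, 0, 0, 15, 0, 0,
    0],
    [2, 11, 12, 1, 11, 15, 14, 7, 5, 3, 16, 11, 15, 11, 3, 2, 12, 9, 7, 2, 5, 7, 10, 10, 12, 11,
    9, 15, 1, 1],
    [5, 12, 0, 11, 3, 12, 0, 11, 5, 16, 2, 16, 7, 10, 6, 11, 12, 11, 1, 2, 3, 6, 8, 0, 3, 15, 0,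
    11, 10, 16],
    [5, 9, 15, 6, 0, 7, 7, 10, 15, 10, 2, 13, 16, 0, 12, 1, 14, 11, 12, 15, 12, 4, 13, 0, 15, 4,
    0, 16, 10, 2],
    [2, 8, 5, 1, 8, 13, 3, 5, 10, 0, 7, 10, 4, 12, 2, 8, 9, 8, 9, 10, 6, 8, 15, 6, 3, 10, 2, 1,
    8, 12],
    [12, 9, 15, 8, 0, 14, 2, 5, 9, 14, 12, 10, 8, 4, 15, 1, 1, 8, 8, 1, 15, 6, 11, 16, 4, 13, 5,
    8, 7, 10],
    [7, 0, 11, 0, 0, 0, 6, 0, 3, 0, 0, 0, 0, 0, 0, 0, 0, 0, 4, 0, 11, 0, 0, 0, 0, 0, 8, 0, 0, 0],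
    [0, 1, 10, 3, 13, 8, 2, 3, 8, 4, 3, 5, 12, 0, 3, 12, 10, 2, 16, 14, 8, 16, 10, 7, 14, 16, 8,
    10, 8, 16],
    [15, 12, 16, 12, 16, 16, 7, 11, 16, 13, 15, 15, 7, 11, 0, 7, 1, 1, 4, 7, 2, 4, 1, 6, 3, 10,
    15, 10, 9, 15],
    [12, 14, 11, 16, 2, 12, 14, 3, 9, 7, 4, 3, 1, 2, 0, 14, 12, 14, 4, 5, 1, 8, 4, 9, 14, 8, 10,
    0, 14, 5],
    [7, 5, 9, 5, 14, 13, 1, 8, 6, 0, 1, 16, 3, 9, 10, 6, 4, 16, 10, 16, 11, 6, 7, 13, 15, 16, 0,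
    5, 6, 9],
    [13, 1, 14, 16, 0, 3, 2, 6, 13, 0, 8, 11, 12, 5, 2, 13, 9, 1, 11, 2, 3, 14, 8, 2, 10, 5, 4,
    13, 12, 13],
    [11, 13, 1, 5, 6, 12, 15, 10, 13, 10, 12, 16, 4, 7, 11, 13, 13, 13, 2, 0, 9, 8, 10, 10, 16,
    6, 4, 4, 8, 16],
    [9, 2, 14, 4, 14, 2, 11, 3, 15, 0, 11, 6, 16, 14, 8, 15, 13, 4, 8, 6, 2, 15, 7, 6, 12, 6, 0,
    4, 15, 14],
    [15, 16, 14, 12, 0, 14, 12, 6, 3, 3, 14, 5, 3, 6, 10, 16, 3, 11, 9, 2, 16, 0, 5, 9, 9, 13, 2,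
    0, 11, 6],
    [16, 11, 6, 9, 7, 16, 12, 11, 4, 0, 12, 5, 2, 6, 1, 4, 0, 10, 1, 5, 13, 4, 5, 8, 10, 5, 0, 9,
    4, 6],
    [0, 7, 0, 0, 10, 2, 0, 0, 0, 0, 0, 0, 0, 0, 0, 0, 7, 1, 0, 0, 0, 0, 4, 16, 0, 0, 0, 0, 0, 0],
    [4, 1, 10, 3, 13, 8, 2, 3, 8, 4, 3, 5, 12, 0, 3, 12, 10, 2, 16, 14, 8, 16, 10, 7, 14, 16, 8,
    10, 8, 16],
    [8, 2, 9, 5, 3, 7, 4, 12, 11, 13, 12, 6, 15, 14, 13, 12, 11, 14, 0, 1, 16, 3, 12, 14, 6, 3,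
    12, 4, 3, 2],
    [13, 10, 3, 0, 9, 12, 11, 0, 13, 4, 11, 15, 0, 0, 12, 2, 3, 13, 13, 13, 14, 16, 5, 13, 10,
    11, 8, 6, 3, 16],
    [0, 3, 0, 0, 7, 9, 0, 0, 0, 0, 0, 0, 0, 0, 0, 0, 1, 11, 0, 0, 0, 0, 6, 3, 0, 0, 0, 0, 0, 0],
    [10, 15, 4, 6, 13, 12, 5, 5, 1, 0, 11, 3, 0, 4, 6, 8, 16, 5, 15, 8, 6, 15, 14, 11, 7, 12, 7,
    2, 1, 9],
    [2, 15, 9, 6, 8, 12, 8, 0, 3, 3, 12, 1, 13, 3, 13, 4, 7, 3, 2, 8, 9, 15, 16, 0, 11, 8, 8, 1,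
    3, 1],
    [8, 7, 3, 13, 7, 1, 6, 14, 2, 0, 6, 11, 1, 3, 9, 2, 10, 11, 9, 11, 15, 2, 11, 14, 5, 11, 0,
    13, 2, 3],
    [10, 8, 14, 10, 8, 14, 5, 2, 9, 13, 7, 8, 14, 8, 13, 3, 1, 5, 0, 3, 3, 2, 15, 15, 1, 8, 0,
    14, 10, 10],
    [10, 7, 8, 12, 2, 12, 16, 9, 11, 0, 16, 1, 14, 8, 7, 11, 8, 14, 7, 1, 6, 11, 9, 0, 2, 1, 0,
    12, 11, 8],
    [14, 12, 1, 10, 12, 11, 2, 16, 12, 0, 2, 15, 6, 1, 3, 12, 5, 12, 3, 15, 5, 12, 14, 9, 13, 15,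
    0, 10, 12, 1]]

lemma cmb124SecondCertificate_valid :
    cmb124SecondCertificate.GradientValid ∧ cmb124SecondCertificate.InverseValid := by
  decide +kernel

lemma three_notMem_syzygyDegrees_cmb124Second : 3 ∉ syzygyDegrees (∏ i, cmb124Second i) := by
  refine cmb124SecondCertificate.notMem_syzygyDegrees (by decide) cmb124SecondCertificate_valid (c
    := 8)
    (eq_of_eval fun X Y Z => ?_)
  rw [map_prodForm, eval_prodForm, Fin.prod_univ_five]
  simp only [cmb124SecondCertificate, cmb124Second, List.map_cons, List.map_nil, prodVal, cons_val,
    map_mul, eval_C, formVal_cmb123_CCoeffs, formVal_cmb123_L₁Coeffs, formVal_cmb123_L₂Coeffs,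
    formVal_cmb124_DCoeffs, formVal_cmb124_M₂Coeffs]
  ring

/-- A syzygy of degree three of the first curve. -/
def cmb124FirstSyzygyThree : Fin 3 → S :=
  ![formOfCoeffs 3 [0, 59, 3, 0, 118, 0, -56, -12, -112, 0],
    formOfCoeffs 3 [252, 63, 3, -4, 0, -246, -28, 0, -40, 0],
    formOfCoeffs 3 [126, 0, 0, 0, -63, -123, 10, 6, 28, 16]]

lemma cmb124FirstSyzygyThree_mem : cmb124FirstSyzygyThree ∈ AR (∏ i, cmb124First i) := by
  refine mem_AR_prod ![formOfCoeffs 2 [0, -8, 6, -16, 0, -24],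
    formOfCoeffs 2 [168, 24, -4, -36, -168, 16],
    formOfCoeffs 2 [-168, -18, -4, 48, 168, 16],
    formOfCoeffs 2 [0, 6, 6, 12, 0, -24],
    formOfCoeffs 2 [0, -4, -4, -8, 0, 16]]
    (forall_fin_five ?_ ?_ ?_ ?_ ?_) ?_
  · refine eq_of_eval fun X Y Z => ?_
    simp only [cmb124FirstSyzygyThree, cmb124First, cons_val, map_add, map_mul, ←
      grad_eq_eval_gradient, grad_cmb123_C, eval_cmb123_C, eval_formOfCoeffs_three,
      eval_formOfCoeffs_two]
    ring
  · refine eq_of_eval fun X Y Z => ?_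
    simp only [cmb124FirstSyzygyThree, cmb124First, cons_val, map_add, map_mul, ←
      grad_eq_eval_gradient, grad_cmb123_L₁, eval_cmb123_L₁, eval_formOfCoeffs_three,
      eval_formOfCoeffs_two]
    ring
  · refine eq_of_eval fun X Y Z => ?_
    simp only [cmb124FirstSyzygyThree, cmb124First, cons_val, map_add, map_mul, ←
      grad_eq_eval_gradient, grad_cmb123_L₂, eval_cmb123_L₂, eval_formOfCoeffs_three,
      eval_formOfCoeffs_two]
    ring
  · refine eq_of_eval fun X Y Z => ?_
    simp only [cmb124FirstSyzygyThree, cmb124First, cons_val, map_add, map_mul, ←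
      grad_eq_eval_gradient, grad_cmb124_D, eval_cmb124_D, eval_formOfCoeffs_three,
      eval_formOfCoeffs_two]
    ring
  · refine eq_of_eval fun X Y Z => ?_
    simp only [cmb124FirstSyzygyThree, cmb124First, cons_val, map_add, map_mul, ←
      grad_eq_eval_gradient, grad_cmb124_M₁, eval_cmb124_M₁, eval_formOfCoeffs_three,
      eval_formOfCoeffs_two]
    ring
  · refine eq_of_eval fun X Y Z => ?_
    simp only [Fin.sum_univ_five, cons_val, map_add, map_zero, eval_formOfCoeffs_two]
    ring

lemma isHomogeneous_cmb124FirstSyzygyThree : ∀ i, (cmb124FirstSyzygyThree i).IsHomogeneous 3 := by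
  intro i
  fin_cases i <;> exact isHomogeneous_formOfCoeffs _ _

/-- A syzygy of degree four of the first curve. -/
def cmb124FirstSyzygyFour : Fin 3 → S :=
  ![formOfCoeffs 4 [0, -41, 237, 6, 0, -82, 236, 40, -224, -476, 56, -224, 0, 448, 0],
    formOfCoeffs 4 [-252, 1071, 141, 6, -8, -1008, 282, -1024, -72, 0, 952, -112, 0, 0, 0],
    formOfCoeffs 4 [-126, 504, 0, 0, 0, -567, 15, -484, 20, 30, 544, 40, 0, 0, 0]]

lemma cmb124FirstSyzygyFour_mem : cmb124FirstSyzygyFour ∈ AR (∏ i, cmb124First i) := by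
  refine mem_AR_prod ![formOfCoeffs 3 [0, 44, -30, 12, 88, -32, -32, 56, -112, 0],
    formOfCoeffs 3 [-168, 708, 48, -8, -684, 96, -688, 0, 672, 0],
    formOfCoeffs 3 [168, -678, -36, -8, 744, -72, 656, 0, -672, 0],
    formOfCoeffs 3 [0, 30, 26, 12, 60, 24, -32, -56, -112, 0],
    formOfCoeffs 3 [0, -104, -8, -8, -208, -16, 96, 0, 224, 0]]
    (forall_fin_five ?_ ?_ ?_ ?_ ?_) ?_
  · refine eq_of_eval fun X Y Z => ?_
    simp only [cmb124FirstSyzygyFour, cmb124First, cons_val, map_add, map_mul, ←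
      grad_eq_eval_gradient, grad_cmb123_C, eval_cmb123_C, eval_formOfCoeffs_four,
      eval_formOfCoeffs_three]
    ring
  · refine eq_of_eval fun X Y Z => ?_
    simp only [cmb124FirstSyzygyFour, cmb124First, cons_val, map_add, map_mul, ←
      grad_eq_eval_gradient, grad_cmb123_L₁, eval_cmb123_L₁, eval_formOfCoeffs_four,
      eval_formOfCoeffs_three]
    ring
  · refine eq_of_eval fun X Y Z => ?_
    simp only [cmb124FirstSyzygyFour, cmb124First, cons_val, map_add, map_mul, ←
      grad_eq_eval_gradient, grad_cmb123_L₂, eval_cmb123_L₂, eval_formOfCoeffs_four,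
      eval_formOfCoeffs_three]
    ring
  · refine eq_of_eval fun X Y Z => ?_
    simp only [cmb124FirstSyzygyFour, cmb124First, cons_val, map_add, map_mul, ←
      grad_eq_eval_gradient, grad_cmb124_D, eval_cmb124_D, eval_formOfCoeffs_four,
      eval_formOfCoeffs_three]
    ring
  · refine eq_of_eval fun X Y Z => ?_
    simp only [cmb124FirstSyzygyFour, cmb124First, cons_val, map_add, map_mul, ←
      grad_eq_eval_gradient, grad_cmb124_M₁, eval_cmb124_M₁, eval_formOfCoeffs_four,
      eval_formOfCoeffs_three]
    ring
  · refine eq_of_eval fun X Y Z => ?_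
    simp only [Fin.sum_univ_five, cons_val, map_add, map_zero, eval_formOfCoeffs_three]
    ring

lemma isHomogeneous_cmb124FirstSyzygyFour : ∀ i, (cmb124FirstSyzygyFour i).IsHomogeneous 4 := by
  intro i
  fin_cases i <;> exact isHomogeneous_formOfCoeffs _ _

lemma crossProduct_cmb124First_ne_zero : cmb124FirstSyzygyThree ⨯₃ cmb124FirstSyzygyFour ≠ 0 := by
  refine crossProduct_ne_zero_of_eval 0 1 1 ?_
  simp only [cmb124FirstSyzygyThree, cmb124FirstSyzygyFour, cons_val, eval_formOfCoeffs_three,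
    eval_formOfCoeffs_four]
  exact ne_zero_of_mul (1 / 32256) (by ring)

/-- A syzygy of degree four of the second curve. -/
def cmb124SecondSyzygyFour : Fin 3 → S :=
  ![formOfCoeffs 4 [0, -9, 0, 3, 0, -9, 0, 3, 0, 0, 0, 0, 12, 0, 0],
    formOfCoeffs 4 [0, 0, 54, 0, -4, 0, -72, 0, -18, 0, 0, 0, 0, 40, 0],
    formOfCoeffs 4 [0, 0, 0, 0, 0, 0, -72, 0, 10, 54, 0, 24, 0, 0, -16]]

/-- The second curve is invariant under `x ↦ -x`, and so is this vector field; accordingly the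
cofactors of `L₁` and `L₂` are mirror images of each other. -/
lemma cmb124SecondSyzygyFour_mem : cmb124SecondSyzygyFour ∈ AR (∏ i, cmb124Second i) := by
  refine mem_AR_prod ![formOfCoeffs 3 [0, -18, 0, 6, -18, 0, 6, 0, 0, 24],
    formOfCoeffs 3 [0, -9, 21, -4, -9, -63, 10, 42, 28, -16],
    formOfCoeffs 3 [0, -9, -21, -4, -9, 63, 10, -42, 28, -16],
    formOfCoeffs 3 [0, -18, 0, 6, -18, 0, 6, 0, 0, 24],
    formOfCoeffs 3 [0, 54, 0, -4, 54, 0, -32, 0, -56, -16]]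
    (forall_fin_five ?_ ?_ ?_ ?_ ?_) ?_
  · refine eq_of_eval fun X Y Z => ?_
    simp only [cmb124SecondSyzygyFour, cmb124Second, cons_val, map_add, map_mul, ←
      grad_eq_eval_gradient, grad_cmb123_C, eval_cmb123_C, eval_formOfCoeffs_four,
      eval_formOfCoeffs_three]
    ring
  · refine eq_of_eval fun X Y Z => ?_
    simp only [cmb124SecondSyzygyFour, cmb124Second, cons_val, map_add, map_mul, ←
      grad_eq_eval_gradient, grad_cmb123_L₁, eval_cmb123_L₁, eval_formOfCoeffs_four,
      eval_formOfCoeffs_three]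
    ring
  · refine eq_of_eval fun X Y Z => ?_
    simp only [cmb124SecondSyzygyFour, cmb124Second, cons_val, map_add, map_mul, ←
      grad_eq_eval_gradient, grad_cmb123_L₂, eval_cmb123_L₂, eval_formOfCoeffs_four,
      eval_formOfCoeffs_three]
    ring
  · refine eq_of_eval fun X Y Z => ?_
    simp only [cmb124SecondSyzygyFour, cmb124Second, cons_val, map_add, map_mul, ←
      grad_eq_eval_gradient, grad_cmb124_D, eval_cmb124_D, eval_formOfCoeffs_four,
      eval_formOfCoeffs_three]
    ring
  · refine eq_of_eval fun X Y Z => ?_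
    simp only [cmb124SecondSyzygyFour, cmb124Second, cons_val, map_add, map_mul, ←
      grad_eq_eval_gradient, grad_cmb124_M₂, eval_cmb124_M₂, eval_formOfCoeffs_four,
      eval_formOfCoeffs_three]
    ring
  · refine eq_of_eval fun X Y Z => ?_
    simp only [Fin.sum_univ_five, cons_val, map_add, map_zero, eval_formOfCoeffs_three]
    ring

lemma isHomogeneous_cmb124SecondSyzygyFour : ∀ i, (cmb124SecondSyzygyFour i).IsHomogeneous 4 := by
  intro i
  fin_cases i <;> exact isHomogeneous_formOfCoeffs _ _

lemma cmb124SecondSyzygyFour_ne_zero : cmb124SecondSyzygyFour ≠ 0 := by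
  refine ne_zero_of_eval 1 0 1 ?_
  simp only [cmb124SecondSyzygyFour, cons_val, eval_formOfCoeffs_four]
  exact ne_zero_of_mul (1 / 3) (by ring)

theorem isStrongZieglerPair_cmb124 :
    IsStrongZieglerPair (firstCurve .cmb124) (secondCurve .cmb124) ∧
    IsLeast (syzygyDegrees (firstCurve .cmb124)) 3 ∧
    IsLeast (syzygyDegrees (secondCurve .cmb124)) 4 ∧
    Nonempty (MinimalGradedFreeResolution (jacobianIdeal (firstCurve .cmb124))) ∧
    Nonempty (MinimalGradedFreeResolution (jacobianIdeal (secondCurve .cmb124))) ∧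
    ∀ (F : MinimalGradedFreeResolution (jacobianIdeal (firstCurve .cmb124)))
      (G : MinimalGradedFreeResolution (jacobianIdeal (secondCurve .cmb124))),
      F.twists ≠ G.twists := by
  have hf : firstCurve .cmb124 = ∏ i, cmb124First i := by
    rw [Fin.prod_univ_five]
    rfl
  have hg : secondCurve .cmb124 = ∏ i, cmb124Second i := by
    rw [Fin.prod_univ_five]
    rfl
  obtain ⟨r₁, hr₁⟩ := exists_quadratic_root (-8 / 9) (-16 / 9)
  exact conclusion_of_arrangements isSeparating_cmb124Types (isArrangement_cmb124First (r := r₁) (by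
    linear_combination hr₁))
    isArrangement_cmb124Second (by decide) hf hg cmb124FirstSyzygyThree_mem
      cmb124FirstSyzygyFour_mem cmb124SecondSyzygyFour_mem isHomogeneous_cmb124FirstSyzygyThree
      isHomogeneous_cmb124FirstSyzygyFour isHomogeneous_cmb124SecondSyzygyFour
      crossProduct_cmb124First_ne_zero cmb124SecondSyzygyFour_ne_zero
    (hf ▸ two_notMem_syzygyDegrees_cmb124First) (hg ▸ three_notMem_syzygyDegrees_cmb124Second)

/-! ### The `cmb212` pair: syzygies and conclusion. -/

/-- Reductions modulo `17` showing that the first curve has no syzygies of degree two. -/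
def cmb212FirstCertificate : Certificate where
  cs := [cmb212_C₁Coeffs, cmb212_C₂Coeffs, cmb212_M₀Coeffs, cmb212_M₁Coeffs, cmb212_M₂Coeffs]
  d := 2
  vs := [
    (0, 0, 1), (0, 1, 0), (1, 0, 0), (0, 1, 1), (1, 0, 1), (1, 1, 0), (1, 1, 1), (0, 1, 2), (0,
    2, 1), (1, 2, 0), (2, 1, 0), (1, 1, 2), (1, 2, 1), (2, 1, 1), (1, 2, 2), (2, 1, 2), (2, 2,
    1), (0, 3, 1)]
  gs := ![
    [0, 14, 0, 10, 0, 1, 5, 6, 8, 3, 11, 4, 5, 6, 1, 8, 5, 8],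
    [1, 6, 4, 10, 8, 0, 12, 10, 12, 10, 6, 16, 14, 2, 15, 2, 14, 1],
    [0, 0, 0, 5, 0, 0, 1, 6, 2, 0, 0, 10, 3, 11, 4, 0, 13, 7]]
  L := [
    [12, 4, 1, 10, 10, 8, 3, 5, 1, 14, 1, 6, 1, 12, 10, 6, 12, 5],
    [5, 15, 13, 7, 7, 0, 14, 12, 16, 6, 11, 11, 16, 5, 7, 11, 5, 12],
    [0, 15, 3, 0, 0, 10, 0, 0, 0, 14, 5, 0, 0, 0, 0, 0, 0, 0],
    [1, 12, 1, 4, 11, 1, 1, 12, 10, 1, 13, 14, 12, 13, 3, 2, 4, 8],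
    [3, 9, 10, 2, 8, 0, 7, 7, 12, 15, 10, 1, 1, 7, 8, 8, 14, 1],
    [7, 4, 16, 1, 9, 2, 0, 10, 9, 8, 11, 3, 6, 10, 8, 11, 7, 5],
    [0, 0, 13, 0, 0, 0, 0, 0, 0, 0, 0, 0, 0, 0, 0, 0, 0, 0],
    [12, 4, 11, 10, 10, 10, 3, 5, 1, 12, 3, 6, 1, 12, 10, 6, 12, 5],
    [0, 2, 10, 0, 0, 5, 0, 0, 0, 7, 11, 0, 0, 0, 0, 0, 0, 0],
    [16, 0, 4, 0, 15, 0, 0, 0, 0, 0, 0, 0, 0, 0, 0, 0, 0, 0],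
    [0, 15, 14, 4, 0, 7, 0, 9, 16, 3, 12, 0, 0, 0, 0, 0, 0, 3],
    [1, 0, 0, 0, 0, 0, 0, 0, 0, 0, 0, 0, 0, 0, 0, 0, 0, 0],
    [3, 14, 9, 15, 16, 5, 0, 4, 15, 8, 15, 12, 12, 7, 8, 16, 15, 8],
    [12, 7, 15, 16, 16, 16, 1, 5, 3, 1, 7, 0, 5, 4, 10, 11, 6, 13],
    [5, 0, 15, 5, 1, 9, 3, 9, 6, 3, 10, 15, 15, 3, 1, 1, 6, 11],
    [12, 15, 3, 11, 4, 15, 6, 2, 3, 7, 2, 4, 9, 1, 3, 4, 7, 1],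
    [0, 10, 5, 9, 16, 6, 0, 8, 13, 15, 0, 11, 5, 14, 1, 12, 3, 6],
    [7, 2, 10, 13, 0, 5, 0, 16, 9, 7, 11, 0, 0, 0, 0, 0, 0, 16]]

lemma cmb212FirstCertificate_valid :
    cmb212FirstCertificate.GradientValid ∧ cmb212FirstCertificate.InverseValid := by
  decide +kernel

lemma two_notMem_syzygyDegrees_cmb212First : 2 ∉ syzygyDegrees (∏ i, cmb212First i) := by
  -- The scalar 4 clears the denominator of `C₁`.
  refine cmb212FirstCertificate.notMem_syzygyDegrees (by decide) cmb212FirstCertificate_valid (c :=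
    4)
    (eq_of_eval fun X Y Z => ?_)
  rw [map_prodForm, eval_prodForm, Fin.prod_univ_five]
  simp only [cmb212FirstCertificate, cmb212First, List.map_cons, List.map_nil, prodVal, cons_val,
    map_mul, eval_C, formVal_cmb212_C₁Coeffs, formVal_cmb212_C₂Coeffs, formVal_cmb212_M₀Coeffs,
    formVal_cmb212_M₁Coeffs, formVal_cmb212_M₂Coeffs]
  ring

/-- Reductions modulo `17` showing that the second curve has no syzygies of degree three. -/
def cmb212SecondCertificate : Certificate where
  cs := [cmb212_C₁Coeffs, cmb212_C₂Coeffs, cmb212_M₀Coeffs, cmb212_M₁Coeffs, cmb212_M₃Coeffs]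
  d := 3
  vs := [
    (0, 0, 1), (0, 1, 0), (1, 0, 0), (0, 1, 1), (1, 0, 1), (1, 1, 0), (1, 1, 1), (0, 1, 2), (0,
    2, 1), (1, 0, 2), (1, 2, 0), (2, 1, 0), (1, 1, 2), (1, 2, 1), (2, 1, 1), (1, 2, 2), (2, 1,
    2), (2, 2, 1), (0, 1, 3), (0, 3, 1), (1, 3, 0), (3, 1, 0), (0, 2, 3), (1, 1, 3), (1, 3, 1),
    (2, 3, 0), (3, 1, 1), (3, 2, 0), (1, 2, 3), (1, 3, 2)]
  gs := ![
    [0, 14, 0, 8, 0, 15, 6, 4, 15, 0, 5, 11, 12, 7, 7, 15, 5, 15, 5, 16, 13, 15, 1, 1, 8, 2, 12,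
    13, 6, 3],
    [16, 7, 1, 3, 8, 3, 8, 3, 0, 6, 2, 8, 13, 3, 1, 9, 15, 2, 3, 1, 6, 5, 5, 11, 2, 14, 14, 10,
    0, 13],
    [0, 4, 0, 2, 0, 3, 0, 11, 1, 0, 6, 3, 8, 3, 10, 2, 1, 5, 16, 2, 10, 9, 4, 8, 3, 6, 1, 4, 15,
    6]]
  L := [
    [16, 5, 16, 14, 12, 10, 15, 9, 12, 4, 12, 9, 1, 10, 13, 15, 4, 9, 0, 5, 1, 7, 14, 9, 0, 8, 8,
    15, 12, 0],
    [12, 12, 15, 15, 15, 6, 15, 6, 4, 14, 15, 2, 6, 2, 1, 14, 10, 5, 2, 3, 9, 15, 14, 2, 8, 8, 0,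
    4, 0, 5],
    [0, 4, 2, 11, 16, 1, 4, 14, 13, 8, 1, 7, 4, 5, 9, 1, 3, 5, 16, 10, 13, 9, 16, 10, 16, 1, 1,
    5, 10, 1],
    [2, 6, 11, 5, 15, 13, 2, 0, 2, 16, 6, 5, 8, 15, 2, 1, 7, 13, 7, 6, 0, 1, 8, 0, 4, 14, 13, 10,
    11, 15],
    [1, 4, 0, 16, 6, 0, 15, 4, 11, 12, 9, 7, 2, 15, 11, 16, 13, 9, 14, 14, 8, 5, 4, 8, 7, 4, 9,
    15, 16, 12],
    [16, 4, 9, 1, 8, 13, 14, 4, 3, 10, 1, 7, 4, 14, 9, 10, 2, 5, 6, 5, 7, 9, 9, 12, 12, 15, 12,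
    12, 12, 6],
    [8, 6, 4, 2, 4, 0, 5, 11, 3, 2, 12, 8, 1, 5, 3, 8, 10, 12, 4, 11, 4, 14, 6, 13, 0, 16, 0, 8,
    0, 10],
    [3, 12, 12, 0, 12, 8, 7, 9, 0, 13, 13, 13, 15, 14, 16, 8, 2, 16, 7, 11, 5, 13, 13, 8, 0, 16,
    3, 6, 10, 11],
    [13, 14, 10, 15, 4, 3, 6, 0, 2, 16, 4, 5, 8, 4, 3, 2, 6, 14, 6, 5, 13, 13, 2, 6, 9, 12, 11,
    13, 1, 2],
    [2, 12, 0, 7, 14, 7, 12, 3, 11, 14, 2, 5, 10, 9, 13, 4, 5, 2, 10, 0, 2, 9, 1, 12, 4, 5, 2,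
    16, 6, 13],
    [0, 0, 1, 0, 0, 0, 0, 0, 0, 0, 0, 0, 0, 0, 0, 0, 0, 0, 0, 0, 0, 0, 0, 0, 0, 0, 0, 0, 0, 0],
    [0, 5, 12, 8, 11, 3, 16, 9, 13, 12, 14, 8, 5, 9, 14, 7, 16, 7, 12, 8, 4, 3, 1, 9, 2, 9, 6,
    12, 9, 16],
    [11, 15, 9, 4, 16, 13, 14, 6, 3, 6, 16, 1, 2, 3, 0, 5, 15, 7, 7, 0, 3, 1, 10, 2, 6, 14, 2,
    10, 3, 6],
    [8, 8, 10, 14, 8, 2, 12, 14, 4, 4, 1, 3, 2, 14, 0, 5, 14, 6, 10, 0, 7, 7, 14, 10, 15, 4, 2,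
    9, 3, 10],
    [15, 0, 7, 0, 13, 0, 0, 0, 0, 7, 0, 0, 0, 0, 0, 0, 0, 0, 0, 0, 0, 0, 0, 0, 0, 0, 0, 0, 0, 0],
    [15, 0, 7, 4, 9, 8, 2, 10, 8, 1, 0, 13, 13, 9, 0, 11, 4, 12, 8, 5, 11, 11, 12, 15, 7, 5, 8,
    6, 12, 13],
    [6, 15, 1, 3, 10, 7, 16, 13, 0, 4, 15, 14, 2, 10, 15, 2, 0, 5, 4, 11, 10, 0, 6, 2, 14, 0, 4,
    12, 15, 15],
    [3, 0, 9, 0, 2, 0, 0, 0, 0, 10, 0, 0, 0, 0, 0, 0, 0, 0, 0, 0, 0, 0, 0, 0, 0, 0, 0, 0, 0, 0],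
    [3, 4, 8, 13, 13, 2, 7, 5, 7, 6, 4, 12, 4, 0, 13, 0, 15, 6, 7, 0, 12, 13, 15, 4, 13, 0, 6, 9,
    10, 7],
    [16, 0, 0, 0, 0, 0, 0, 0, 0, 0, 0, 0, 0, 0, 0, 0, 0, 0, 0, 0, 0, 0, 0, 0, 0, 0, 0, 0, 0, 0],
    [6, 13, 14, 1, 13, 6, 12, 14, 13, 10, 15, 12, 11, 8, 7, 12, 10, 14, 0, 4, 16, 4, 1, 14, 0, 2,
    3, 6, 13, 0],
    [15, 13, 1, 14, 8, 1, 8, 1, 5, 4, 15, 14, 2, 6, 12, 10, 9, 8, 16, 2, 12, 1, 15, 8, 2, 5, 15,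
    2, 14, 13],
    [1, 3, 10, 14, 1, 16, 7, 14, 8, 4, 0, 10, 8, 13, 2, 1, 1, 7, 8, 6, 4, 14, 15, 14, 7, 3, 13,
    16, 11, 5],
    [13, 12, 12, 9, 10, 2, 6, 1, 3, 5, 7, 7, 11, 8, 10, 9, 2, 12, 9, 13, 9, 14, 7, 8, 15, 12, 2,
    13, 3, 15],
    [11, 16, 3, 2, 4, 12, 1, 4, 11, 0, 8, 7, 0, 4, 14, 11, 14, 0, 9, 10, 14, 3, 5, 1, 8, 14, 9,
    16, 7, 3],
    [3, 15, 9, 14, 5, 3, 0, 9, 0, 0, 2, 12, 8, 12, 3, 2, 6, 4, 9, 3, 11, 5, 8, 3, 16, 5, 12, 1,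
    12, 3],
    [16, 1, 9, 10, 12, 3, 5, 1, 13, 12, 8, 14, 6, 1, 16, 12, 11, 2, 14, 12, 15, 9, 6, 15, 7, 15,
    4, 8, 3, 1],
    [5, 1, 13, 3, 13, 8, 8, 14, 0, 3, 8, 3, 2, 9, 0, 14, 0, 11, 6, 10, 1, 6, 12, 2, 7, 1, 8, 0,
    7, 12],
    [1, 15, 2, 8, 5, 5, 3, 1, 5, 13, 10, 6, 9, 15, 0, 8, 3, 13, 10, 3, 6, 13, 10, 12, 11, 16, 12,
    1, 4, 12],
    [16, 9, 10, 8, 8, 9, 12, 12, 1, 12, 2, 16, 7, 12, 1, 11, 7, 13, 6, 12, 12, 7, 1, 4, 6, 1, 13,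
    0, 12, 2]]

lemma cmb212SecondCertificate_valid :
    cmb212SecondCertificate.GradientValid ∧ cmb212SecondCertificate.InverseValid := by
  decide +kernel

lemma three_notMem_syzygyDegrees_cmb212Second : 3 ∉ syzygyDegrees (∏ i, cmb212Second i) := by
  refine cmb212SecondCertificate.notMem_syzygyDegrees (by decide) cmb212SecondCertificate_valid (c
    := 4)
    (eq_of_eval fun X Y Z => ?_)
  rw [map_prodForm, eval_prodForm, Fin.prod_univ_five]
  simp only [cmb212SecondCertificate, cmb212Second, List.map_cons, List.map_nil, prodVal, cons_val,
    map_mul, eval_C, formVal_cmb212_C₁Coeffs, formVal_cmb212_C₂Coeffs, formVal_cmb212_M₀Coeffs,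
    formVal_cmb212_M₁Coeffs, formVal_cmb212_M₃Coeffs]
  ring

/-- A syzygy of degree three of the first curve. -/
def cmb212FirstSyzygyThree : Fin 3 → S :=
  ![formOfCoeffs 3 [0, 0, 0, 0, 42534, 45360, 42588, 0, 0, -287469],
    formOfCoeffs 3 [0, 0, 0, 0, 0, 72, 0, 0, 0, 0],
    formOfCoeffs 3 [6300, 10080, 9884, 3360, 0, 0, 0, -42579, -22680, 0]]

/-- The reflection `z ↦ -z` preserves the first curve and exchanges `M₁` and `M₂`. It changes the
sign of this vector field, which explains the pattern of the last two cofactors. -/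
lemma cmb212FirstSyzygyThree_mem : cmb212FirstSyzygyThree ∈ AR (∏ i, cmb212First i) := by
  refine mem_AR_prod ![formOfCoeffs 2 [0, 0, 0, 18, -2772, 0],
    formOfCoeffs 2 [0, 0, 0, 18, 2772, 0],
    formOfCoeffs 2 [0, 0, 0, 72, 0, 0],
    formOfCoeffs 2 [-16380, -17472, -16380, -54, 0, 110565],
    formOfCoeffs 2 [16380, 17472, 16380, -54, 0, -110565]]
    (forall_fin_five ?_ ?_ ?_ ?_ ?_) ?_
  · refine eq_of_eval fun X Y Z => ?_
    simp only [cmb212FirstSyzygyThree, cmb212First, cons_val, map_add, map_mul, ←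
      grad_eq_eval_gradient, grad_cmb212_C₁, eval_cmb212_C₁, eval_formOfCoeffs_three,
      eval_formOfCoeffs_two]
    ring
  · refine eq_of_eval fun X Y Z => ?_
    simp only [cmb212FirstSyzygyThree, cmb212First, cons_val, map_add, map_mul, ←
      grad_eq_eval_gradient, grad_cmb212_C₂, eval_cmb212_C₂, eval_formOfCoeffs_three,
      eval_formOfCoeffs_two]
    ring
  · refine eq_of_eval fun X Y Z => ?_
    simp only [cmb212FirstSyzygyThree, cmb212First, cons_val, map_add, map_mul, ←
      grad_eq_eval_gradient, grad_cmb212_M₀, eval_cmb212_M₀, eval_formOfCoeffs_three,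
      eval_formOfCoeffs_two]
    ring
  · refine eq_of_eval fun X Y Z => ?_
    simp only [cmb212FirstSyzygyThree, cmb212First, cons_val, map_add, map_mul, ←
      grad_eq_eval_gradient, grad_cmb212_M₁, eval_cmb212_M₁, eval_formOfCoeffs_three,
      eval_formOfCoeffs_two]
    ring
  · refine eq_of_eval fun X Y Z => ?_
    simp only [cmb212FirstSyzygyThree, cmb212First, cons_val, map_add, map_mul, ←
      grad_eq_eval_gradient, grad_cmb212_M₂, eval_cmb212_M₂, eval_formOfCoeffs_three,
      eval_formOfCoeffs_two]
    ring
  · refine eq_of_eval fun X Y Z => ?_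
    simp only [Fin.sum_univ_five, cons_val, map_add, map_zero, eval_formOfCoeffs_two]
    ring

lemma isHomogeneous_cmb212FirstSyzygyThree : ∀ i, (cmb212FirstSyzygyThree i).IsHomogeneous 3 := by
  intro i
  fin_cases i <;> exact isHomogeneous_formOfCoeffs _ _

/-- A syzygy of degree four of the first curve. -/
def cmb212FirstSyzygyFour : Fin 3 → S :=
  ![formOfCoeffs 4 [0, 0, 0, 0, 0, 34178494302, 1118154240, 19594652364, -35380406880, 0, 0, 0,
    -231025324257, 238817746440, 0],
    formOfCoeffs 4 [0, 0, 0, 0, 0, 0, 19381223016, 20515481280, 10097136000, 0, 0, 0, 0,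
      -130395938400, 0],
    formOfCoeffs 4 [5539293900, 5407194240, 7932722252, 77394240, -1843027200, 0, 0, 0, 0,
      -40657366287, 0, 0, 0, 0, 21732656400]]

lemma cmb212FirstSyzygyFour_mem : cmb212FirstSyzygyFour ∈ AR (∏ i, cmb212First i) := by
  refine mem_AR_prod ![formOfCoeffs 3 [0, 0, 0, 0, -6423479046, -10777617396, 9694732320, 0, 0,
    43465312800],
    formOfCoeffs 3 [0, 0, 0, 0, -6423479046, -2969153964, 5088998880, 0, 0, 43465312800],
    formOfCoeffs 3 [0, 0, 0, 0, 19381223016, 20515481280, 10097136000, 0, 0, -130395938400],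
    formOfCoeffs 3 [-14402164140, -6377550816, -17223717420, 8984757600, -3267132462, -3384354960,
      -12440433600, 97214607945, -60647113800, 21732656400],
    formOfCoeffs 3 [14402164140, 6377550816, 17223717420, -8984757600, -3267132462, -3384354960,
      -12440433600, -97214607945, 60647113800, 21732656400]]
    (forall_fin_five ?_ ?_ ?_ ?_ ?_) ?_
  · refine eq_of_eval fun X Y Z => ?_
    simp only [cmb212FirstSyzygyFour, cmb212First, cons_val, map_add, map_mul, ←
      grad_eq_eval_gradient, grad_cmb212_C₁, eval_cmb212_C₁, eval_formOfCoeffs_four,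
      eval_formOfCoeffs_three]
    ring
  · refine eq_of_eval fun X Y Z => ?_
    simp only [cmb212FirstSyzygyFour, cmb212First, cons_val, map_add, map_mul, ←
      grad_eq_eval_gradient, grad_cmb212_C₂, eval_cmb212_C₂, eval_formOfCoeffs_four,
      eval_formOfCoeffs_three]
    ring
  · refine eq_of_eval fun X Y Z => ?_
    simp only [cmb212FirstSyzygyFour, cmb212First, cons_val, map_add, map_mul, ←
      grad_eq_eval_gradient, grad_cmb212_M₀, eval_cmb212_M₀, eval_formOfCoeffs_four,
      eval_formOfCoeffs_three]
    ring
  · refine eq_of_eval fun X Y Z => ?_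
    simp only [cmb212FirstSyzygyFour, cmb212First, cons_val, map_add, map_mul, ←
      grad_eq_eval_gradient, grad_cmb212_M₁, eval_cmb212_M₁, eval_formOfCoeffs_four,
      eval_formOfCoeffs_three]
    ring
  · refine eq_of_eval fun X Y Z => ?_
    simp only [cmb212FirstSyzygyFour, cmb212First, cons_val, map_add, map_mul, ←
      grad_eq_eval_gradient, grad_cmb212_M₂, eval_cmb212_M₂, eval_formOfCoeffs_four,
      eval_formOfCoeffs_three]
    ring
  · refine eq_of_eval fun X Y Z => ?_
    simp only [Fin.sum_univ_five, cons_val, map_add, map_zero, eval_formOfCoeffs_three]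
    ring

lemma isHomogeneous_cmb212FirstSyzygyFour : ∀ i, (cmb212FirstSyzygyFour i).IsHomogeneous 4 := by
  intro i
  fin_cases i <;> exact isHomogeneous_formOfCoeffs _ _

lemma crossProduct_cmb212First_ne_zero : cmb212FirstSyzygyThree ⨯₃ cmb212FirstSyzygyFour ≠ 0 := by
  refine crossProduct_ne_zero_of_eval 0 1 1 ?_
  simp only [cmb212FirstSyzygyThree, cmb212FirstSyzygyFour, cons_val, eval_formOfCoeffs_three,
    eval_formOfCoeffs_four]
  exact ne_zero_of_mul (1 / 29458891030514400) (by ring)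

/-- A syzygy of degree four of the second curve. -/
def cmb212SecondSyzygyFour : Fin 3 → S :=
  ![formOfCoeffs 4 [630659172, -1676485824, -3984517056, -2806713000, -2245395516, 4375185444,
    21557575134, 12779133858, 17128084428, -39686956803, -7735790790, 5262247809, 36841739571,
    -115614569889, 66785660487],
    formOfCoeffs 4 [0, 2876054688, 3106605216, 3043969500, 1976378040, 0, -18945985716, -8158844340,
      -5832720144, 0, 14634411480, -13340551770, 0, 39386415159, 0],
    formOfCoeffs 4 [890971200, 1688020852, -264647348, 1256991652, 487477508, -5248745268,
      -2822528904, 1649215230, 0, 3819165336, -6964650045, -3288168855, 9893195091, 0, 0]]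

lemma cmb212SecondSyzygyFour_mem : cmb212SecondSyzygyFour ∈ AR (∏ i, cmb212Second i) := by
  refine mem_AR_prod ![formOfCoeffs 3 [1261318344, -1107576132, -940547556, 1707360564, -3277740312,
    9033808806, -1118302218, -1953666, -9894171924, 0],
    formOfCoeffs 3 [1261318344, -815276124, -940547556, 1415060556, -3277740312, 7563706326,
      1111389246, -1953666, -11182170636, 0],
    formOfCoeffs 3 [2876054688, 3106605216, 3043969500, 1976378040, -18945985716, -8158844340,
      -5832720144, 14634411480, -13340551770, 39386415159],
    formOfCoeffs 3 [-1685865948, -3632315700, 297657204, -4610191404, 13638671676, 2073645522,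
      3807755064, -14156240319, 31118791977, -25686792495],
    formOfCoeffs 3 [-3712825428, 2448562740, -1460531592, -488607756, 11862794664, -10512316314,
      2031878052, -474263829, 3298102353, -13699622664]]
    (forall_fin_five ?_ ?_ ?_ ?_ ?_) ?_
  · refine eq_of_eval fun X Y Z => ?_
    simp only [cmb212SecondSyzygyFour, cmb212Second, cons_val, map_add, map_mul, ←
      grad_eq_eval_gradient, grad_cmb212_C₁, eval_cmb212_C₁, eval_formOfCoeffs_four,
      eval_formOfCoeffs_three]
    ring
  · refine eq_of_eval fun X Y Z => ?_
    simp only [cmb212SecondSyzygyFour, cmb212Second, cons_val, map_add, map_mul, ←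
      grad_eq_eval_gradient, grad_cmb212_C₂, eval_cmb212_C₂, eval_formOfCoeffs_four,
      eval_formOfCoeffs_three]
    ring
  · refine eq_of_eval fun X Y Z => ?_
    simp only [cmb212SecondSyzygyFour, cmb212Second, cons_val, map_add, map_mul, ←
      grad_eq_eval_gradient, grad_cmb212_M₀, eval_cmb212_M₀, eval_formOfCoeffs_four,
      eval_formOfCoeffs_three]
    ring
  · refine eq_of_eval fun X Y Z => ?_
    simp only [cmb212SecondSyzygyFour, cmb212Second, cons_val, map_add, map_mul, ←
      grad_eq_eval_gradient, grad_cmb212_M₁, eval_cmb212_M₁, eval_formOfCoeffs_four,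
      eval_formOfCoeffs_three]
    ring
  · refine eq_of_eval fun X Y Z => ?_
    simp only [cmb212SecondSyzygyFour, cmb212Second, cons_val, map_add, map_mul, ←
      grad_eq_eval_gradient, grad_cmb212_M₃, eval_cmb212_M₃, eval_formOfCoeffs_four,
      eval_formOfCoeffs_three]
    ring
  · refine eq_of_eval fun X Y Z => ?_
    simp only [Fin.sum_univ_five, cons_val, map_add, map_zero, eval_formOfCoeffs_three]
    ring

lemma isHomogeneous_cmb212SecondSyzygyFour : ∀ i, (cmb212SecondSyzygyFour i).IsHomogeneous 4 := by
  intro i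
  fin_cases i <;> exact isHomogeneous_formOfCoeffs _ _

lemma cmb212SecondSyzygyFour_ne_zero : cmb212SecondSyzygyFour ≠ 0 := by
  refine ne_zero_of_eval 0 0 1 ?_
  simp only [cmb212SecondSyzygyFour, cons_val, eval_formOfCoeffs_four]
  exact ne_zero_of_mul (1 / 66785660487) (by ring)

theorem isStrongZieglerPair_cmb212 :
    IsStrongZieglerPair (firstCurve .cmb212) (secondCurve .cmb212) ∧
    IsLeast (syzygyDegrees (firstCurve .cmb212)) 3 ∧
    IsLeast (syzygyDegrees (secondCurve .cmb212)) 4 ∧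
    Nonempty (MinimalGradedFreeResolution (jacobianIdeal (firstCurve .cmb212))) ∧
    Nonempty (MinimalGradedFreeResolution (jacobianIdeal (secondCurve .cmb212))) ∧
    ∀ (F : MinimalGradedFreeResolution (jacobianIdeal (firstCurve .cmb212)))
      (G : MinimalGradedFreeResolution (jacobianIdeal (secondCurve .cmb212))),
      F.twists ≠ G.twists := by
  have hf : firstCurve .cmb212 = ∏ i, cmb212First i := by
    rw [Fin.prod_univ_five]
    rfl
  have hg : secondCurve .cmb212 = ∏ i, cmb212Second i := by
    rw [Fin.prod_univ_five]
    rfl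
  -- Both curves contain the base points of the pencil of `C₁` and `C₂`, so the same quadratic
  -- occurs twice; either root may be taken for each curve.
  obtain ⟨r₁, hr₁⟩ := exists_quadratic_root 0 (-27 / 4)
  obtain ⟨r₂, hr₂⟩ := exists_quadratic_root 0 (-27 / 4)
  exact conclusion_of_arrangements isSeparating_cmb212Types (isArrangement_cmb212First (r := r₁) (by
    linear_combination hr₁))
    (isArrangement_cmb212Second (r := r₂) (by linear_combination hr₂)) (by decide) hf hg
      cmb212FirstSyzygyThree_mem cmb212FirstSyzygyFour_mem cmb212SecondSyzygyFour_mem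
      isHomogeneous_cmb212FirstSyzygyThree isHomogeneous_cmb212FirstSyzygyFour
      isHomogeneous_cmb212SecondSyzygyFour crossProduct_cmb212First_ne_zero
      cmb212SecondSyzygyFour_ne_zero
    (hf ▸ two_notMem_syzygyDegrees_cmb212First) (hg ▸ three_notMem_syzygyDegrees_cmb212Second)

/-! ### The `cmb224` pair: syzygies and conclusion. -/

/-- Reductions modulo `17` showing that the first curve has no syzygies of degree two. -/
def cmb224FirstCertificate : Certificate where
  cs := [cmb224_C₁Coeffs, cmb224_C₂Coeffs, cmb224_DCoeffs, cmb224_M₁Coeffs]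
  d := 2
  vs := [
    (0, 0, 1), (1, 0, 0), (0, 1, 1), (1, 0, 1), (1, 1, 0), (1, 1, 1), (0, 1, 2), (0, 2, 1), (1,
    0, 2), (1, 2, 0), (2, 1, 0), (1, 2, 1), (2, 1, 1), (1, 2, 2), (2, 1, 2), (0, 1, 3), (0, 3,
    1), (1, 0, 3)]
  gs := ![
    [15, 10, 5, 13, 15, 6, 9, 9, 8, 0, 2, 12, 2, 9, 8, 3, 16, 15],
    [2, 1, 3, 12, 2, 11, 9, 8, 4, 9, 14, 8, 2, 11, 0, 9, 14, 3],
    [0, 0, 13, 16, 0, 0, 15, 11, 9, 0, 7, 7, 14, 7, 0, 7, 13, 12]]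
  L := [
    [12, 5, 3, 9, 6, 14, 15, 12, 9, 15, 5, 11, 10, 15, 3, 13, 9, 14],
    [0, 11, 5, 5, 10, 8, 12, 3, 7, 7, 3, 16, 9, 14, 14, 9, 8, 8],
    [12, 15, 8, 16, 5, 1, 13, 3, 9, 6, 4, 10, 7, 6, 14, 9, 7, 7],
    [13, 7, 7, 12, 5, 0, 8, 5, 11, 9, 15, 10, 11, 4, 15, 4, 11, 13],
    [10, 12, 6, 4, 8, 7, 4, 8, 9, 11, 13, 12, 7, 12, 15, 11, 0, 3],
    [1, 11, 8, 13, 0, 8, 4, 15, 8, 8, 5, 5, 16, 9, 6, 9, 4, 4],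
    [16, 2, 4, 12, 8, 13, 3, 16, 12, 3, 1, 9, 2, 3, 4, 6, 12, 13],
    [7, 8, 9, 8, 14, 1, 16, 12, 15, 8, 14, 1, 15, 6, 5, 2, 13, 13],
    [1, 4, 3, 10, 8, 9, 4, 7, 15, 0, 14, 10, 9, 9, 5, 6, 16, 3],
    [7, 11, 2, 8, 15, 13, 0, 14, 2, 9, 16, 15, 3, 14, 5, 0, 5, 6],
    [7, 8, 11, 8, 6, 8, 12, 16, 1, 11, 12, 7, 15, 2, 8, 15, 6, 10],
    [10, 11, 8, 13, 0, 8, 4, 15, 8, 8, 5, 5, 16, 9, 6, 9, 4, 4],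
    [7, 1, 0, 4, 16, 16, 12, 1, 7, 4, 16, 14, 9, 3, 10, 14, 8, 15],
    [11, 13, 8, 8, 12, 15, 10, 13, 5, 5, 14, 14, 16, 2, 14, 14, 14, 12],
    [8, 7, 1, 16, 0, 2, 5, 9, 2, 2, 14, 14, 4, 15, 10, 10, 3, 1],
    [8, 2, 13, 16, 6, 10, 12, 16, 11, 15, 4, 6, 1, 5, 13, 7, 12, 1],
    [8, 5, 15, 5, 8, 2, 12, 14, 8, 10, 16, 12, 12, 16, 4, 15, 9, 8],
    [5, 6, 15, 1, 6, 5, 3, 4, 15, 8, 8, 3, 9, 5, 10, 4, 0, 0]]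

lemma cmb224FirstCertificate_valid :
    cmb224FirstCertificate.GradientValid ∧ cmb224FirstCertificate.InverseValid := by
  decide +kernel

lemma two_notMem_syzygyDegrees_cmb224First : 2 ∉ syzygyDegrees (∏ i, cmb224First i) := by
  -- The scalar 2 clears the denominator of `D`.
  refine cmb224FirstCertificate.notMem_syzygyDegrees (by decide) cmb224FirstCertificate_valid (c :=
    2)
    (eq_of_eval fun X Y Z => ?_)
  rw [map_prodForm, eval_prodForm, Fin.prod_univ_four]
  simp only [cmb224FirstCertificate, cmb224First, List.map_cons, List.map_nil, prodVal, cons_val,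
    map_mul, eval_C, formVal_cmb224_C₁Coeffs, formVal_cmb224_C₂Coeffs, formVal_cmb224_DCoeffs,
    formVal_cmb224_M₁Coeffs]
  ring

/-- Reductions modulo `17` showing that the second curve has no syzygies of degree three. -/
def cmb224SecondCertificate : Certificate where
  cs := [cmb224_C₁Coeffs, cmb224_C₂Coeffs, cmb224_DCoeffs, cmb224_M₂Coeffs]
  d := 3
  vs := [
    (0, 0, 1), (1, 0, 0), (0, 1, 1), (1, 0, 1), (1, 1, 0), (1, 1, 1), (0, 1, 2), (0, 2, 1), (1,
    0, 2), (1, 2, 0), (2, 1, 0), (1, 1, 2), (1, 2, 1), (2, 1, 1), (1, 2, 2), (2, 1, 2), (0, 1,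
    3), (0, 3, 1), (1, 0, 3), (1, 3, 0), (3, 0, 1), (3, 1, 0), (0, 2, 3), (0, 3, 2), (1, 1, 3),
    (1, 3, 1), (2, 0, 3), (2, 3, 0), (3, 0, 2), (3, 1, 1)]
  gs := ![
    [11, 13, 15, 6, 8, 0, 10, 10, 14, 14, 0, 11, 2, 15, 11, 14, 9, 14, 1, 4, 8, 2, 16, 6, 9, 16,
    8, 10, 0, 1],
    [14, 1, 1, 4, 15, 7, 0, 8, 16, 1, 5, 2, 14, 2, 2, 3, 0, 3, 7, 10, 14, 7, 3, 4, 9, 15, 1, 5,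
    6, 6],
    [5, 4, 11, 16, 7, 11, 14, 14, 13, 3, 15, 15, 7, 5, 14, 3, 11, 6, 11, 6, 5, 15, 7, 2, 12, 7,
    4, 8, 7, 15]]
  L := [
    [16, 11, 0, 5, 0, 0, 0, 0, 0, 0, 0, 0, 0, 0, 0, 0, 0, 0, 6, 0, 5, 0, 0, 0, 0, 0, 0, 0, 1, 0],
    [6, 10, 7, 5, 9, 10, 7, 5, 15, 1, 8, 8, 9, 5, 12, 16, 9, 3, 1, 14, 1, 15, 10, 1, 5, 3, 12, 9,
    9, 3],
    [5, 4, 16, 1, 1, 12, 1, 9, 3, 13, 15, 8, 6, 13, 15, 5, 11, 0, 8, 0, 16, 3, 6, 15, 16, 1, 4,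
    0, 15, 10],
    [2, 0, 1, 6, 4, 11, 16, 7, 6, 10, 6, 8, 13, 3, 14, 16, 7, 15, 10, 14, 10, 0, 10, 9, 0, 12, 8,
    14, 2, 14],
    [5, 11, 0, 13, 0, 0, 0, 0, 8, 0, 0, 0, 0, 0, 0, 0, 0, 0, 13, 0, 3, 0, 0, 0, 0, 0, 2, 0, 9, 0],
    [6, 10, 7, 13, 9, 12, 5, 5, 7, 1, 4, 9, 4, 0, 3, 16, 14, 16, 11, 4, 1, 8, 11, 11, 6, 16, 9,
    4, 8, 13],
    [5, 4, 0, 13, 9, 9, 3, 0, 10, 2, 9, 2, 10, 7, 5, 3, 9, 13, 10, 4, 0, 0, 8, 11, 7, 5, 15, 3,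
    11, 15],
    [12, 16, 0, 3, 0, 0, 0, 0, 12, 0, 0, 0, 0, 0, 0, 0, 0, 0, 13, 0, 13, 0, 0, 0, 0, 0, 9, 0, 14,
    0],
    [13, 0, 15, 4, 5, 10, 2, 0, 5, 14, 4, 10, 8, 12, 3, 15, 12, 10, 16, 1, 14, 2, 8, 3, 11, 7,
    10, 7, 12, 9],
    [11, 7, 0, 13, 0, 0, 0, 0, 13, 0, 0, 0, 0, 0, 0, 0, 0, 0, 16, 0, 6, 0, 0, 0, 0, 0, 12, 0, 5,
    0],
    [14, 7, 0, 16, 12, 3, 9, 12, 5, 13, 16, 7, 10, 13, 15, 3, 2, 15, 4, 4, 12, 11, 9, 6, 1, 1, 8,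
    8, 15, 3],
    [1, 12, 7, 3, 0, 16, 7, 0, 3, 7, 7, 6, 7, 0, 4, 8, 8, 10, 14, 5, 15, 12, 2, 15, 11, 0, 9, 2,
    14, 8],
    [16, 13, 9, 5, 6, 16, 10, 16, 2, 12, 0, 1, 6, 1, 0, 1, 4, 5, 9, 9, 3, 14, 1, 16, 2, 4, 2, 12,
    9, 10],
    [6, 2, 2, 16, 6, 3, 11, 4, 4, 2, 10, 0, 9, 5, 15, 14, 4, 14, 2, 4, 13, 6, 12, 13, 0, 3, 5, 0,
    5, 15],
    [1, 5, 1, 13, 13, 0, 3, 2, 0, 3, 7, 14, 8, 7, 10, 8, 11, 10, 7, 1, 13, 15, 11, 15, 0, 10, 12,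
    11, 2, 1],
    [12, 3, 3, 0, 1, 4, 16, 12, 3, 10, 3, 3, 4, 5, 8, 5, 7, 15, 13, 11, 1, 8, 9, 13, 13, 4, 11,
    10, 5, 7],
    [0, 15, 7, 4, 5, 9, 10, 8, 8, 6, 11, 6, 2, 9, 10, 5, 3, 0, 7, 13, 9, 1, 6, 15, 3, 14, 12, 3,
    4, 7],
    [12, 0, 1, 10, 5, 6, 7, 13, 16, 16, 1, 0, 5, 0, 5, 2, 10, 16, 15, 6, 13, 10, 16, 0, 0, 11,
    11, 8, 1, 7],
    [8, 14, 9, 9, 12, 2, 0, 6, 6, 14, 14, 4, 13, 7, 15, 3, 2, 16, 6, 8, 1, 10, 15, 16, 0, 11, 12,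
    7, 4, 15],
    [8, 12, 13, 15, 16, 14, 9, 0, 11, 13, 13, 11, 6, 15, 3, 4, 6, 16, 13, 5, 11, 2, 2, 4, 0, 9,
    7, 15, 3, 3],
    [4, 1, 0, 1, 14, 12, 2, 14, 3, 1, 13, 11, 6, 1, 9, 12, 8, 9, 5, 16, 2, 10, 2, 7, 4, 4, 15,
    15, 10, 12],
    [11, 6, 13, 0, 16, 8, 1, 15, 2, 7, 8, 14, 4, 8, 4, 16, 1, 12, 14, 1, 13, 5, 14, 9, 10, 15, 8,
    10, 6, 3],
    [9, 13, 11, 8, 12, 9, 8, 10, 8, 1, 16, 5, 6, 4, 13, 10, 5, 12, 2, 1, 2, 1, 10, 16, 0, 16, 5,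
    6, 14, 13],
    [2, 0, 12, 0, 0, 0, 11, 2, 0, 0, 0, 0, 0, 0, 0, 0, 4, 10, 0, 0, 0, 0, 7, 12, 0, 0, 0, 0, 0,
    0],
    [15, 7, 4, 6, 1, 0, 12, 8, 2, 12, 11, 5, 15, 11, 6, 15, 10, 6, 4, 4, 11, 9, 10, 9, 0, 6, 6,
    10, 8, 4],
    [16, 5, 12, 15, 11, 9, 7, 11, 8, 10, 8, 9, 2, 10, 2, 5, 15, 13, 2, 4, 8, 8, 11, 14, 1, 12,
    16, 11, 1, 12],
    [7, 12, 12, 3, 8, 9, 13, 15, 16, 10, 1, 12, 14, 9, 9, 6, 3, 2, 10, 11, 8, 2, 8, 11, 0, 2, 8,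
    4, 16, 9],
    [3, 16, 4, 10, 3, 7, 11, 1, 3, 13, 4, 0, 3, 0, 3, 8, 6, 13, 0, 7, 15, 6, 13, 0, 0, 10, 9, 15,
    1, 11],
    [16, 15, 3, 4, 5, 9, 6, 12, 8, 6, 11, 6, 2, 9, 10, 5, 16, 4, 7, 13, 9, 1, 11, 1, 3, 14, 12,
    3, 4, 7],
    [8, 2, 1, 11, 13, 5, 2, 0, 12, 1, 1, 10, 7, 9, 12, 16, 7, 13, 10, 3, 7, 8, 8, 16, 0, 2, 5, 9,
    1, 12]]

lemma cmb224SecondCertificate_valid :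
    cmb224SecondCertificate.GradientValid ∧ cmb224SecondCertificate.InverseValid := by
  decide +kernel

lemma three_notMem_syzygyDegrees_cmb224Second : 3 ∉ syzygyDegrees (∏ i, cmb224Second i) := by
  refine cmb224SecondCertificate.notMem_syzygyDegrees (by decide) cmb224SecondCertificate_valid (c
    := 2)
    (eq_of_eval fun X Y Z => ?_)
  rw [map_prodForm, eval_prodForm, Fin.prod_univ_four]
  simp only [cmb224SecondCertificate, cmb224Second, List.map_cons, List.map_nil, prodVal, cons_val,
    map_mul, eval_C, formVal_cmb224_C₁Coeffs, formVal_cmb224_C₂Coeffs, formVal_cmb224_DCoeffs,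
    formVal_cmb224_M₂Coeffs]
  ring

/-- A syzygy of degree three of the first curve. -/
def cmb224FirstSyzygyThree : Fin 3 → S :=
  ![formOfCoeffs 3 [0, -11, 3, 0, -44, 12, 14, 0, 84, 112],
    formOfCoeffs 3 [0, -7, 3, -4, -28, 12, -2, 0, 84, 112],
    formOfCoeffs 3 [-14, 0, 0, 0, 7, 17, 10, 40, -2, -28]]

/-- All four cofactors are multiples of `y + 4 z`; the complementary factors `-8 x + 6 y`, `6 x - 8
y`, `6 x + 6 y` and `-4 x - 4 y` sum to zero. -/
lemma cmb224FirstSyzygyThree_mem : cmb224FirstSyzygyThree ∈ AR (∏ i, cmb224First i) := by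
  refine mem_AR_prod ![formOfCoeffs 2 [0, -8, 6, -32, 24, 0],
    formOfCoeffs 2 [0, 6, -8, 24, -32, 0],
    formOfCoeffs 2 [0, 6, 6, 24, 24, 0],
    formOfCoeffs 2 [0, -4, -4, -16, -16, 0]]
    (forall_fin_four ?_ ?_ ?_ ?_) ?_
  · refine eq_of_eval fun X Y Z => ?_
    simp only [cmb224FirstSyzygyThree, cmb224First, cons_val, map_add, map_mul, ←
      grad_eq_eval_gradient, grad_cmb224_C₁, eval_cmb224_C₁, eval_formOfCoeffs_three,
      eval_formOfCoeffs_two]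
    ring
  · refine eq_of_eval fun X Y Z => ?_
    simp only [cmb224FirstSyzygyThree, cmb224First, cons_val, map_add, map_mul, ←
      grad_eq_eval_gradient, grad_cmb224_C₂, eval_cmb224_C₂, eval_formOfCoeffs_three,
      eval_formOfCoeffs_two]
    ring
  · refine eq_of_eval fun X Y Z => ?_
    simp only [cmb224FirstSyzygyThree, cmb224First, cons_val, map_add, map_mul, ←
      grad_eq_eval_gradient, grad_cmb224_D, eval_cmb224_D, eval_formOfCoeffs_three,
      eval_formOfCoeffs_two]
    ring
  · refine eq_of_eval fun X Y Z => ?_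
    simp only [cmb224FirstSyzygyThree, cmb224First, cons_val, map_add, map_mul, ←
      grad_eq_eval_gradient, grad_cmb224_M₁, eval_cmb224_M₁, eval_formOfCoeffs_three,
      eval_formOfCoeffs_two]
    ring
  · refine eq_of_eval fun X Y Z => ?_
    simp only [Fin.sum_univ_four, cons_val, map_add, map_zero, eval_formOfCoeffs_two]
    ring

lemma isHomogeneous_cmb224FirstSyzygyThree : ∀ i, (cmb224FirstSyzygyThree i).IsHomogeneous 3 := by
  intro i
  fin_cases i <;> exact isHomogeneous_formOfCoeffs _ _

/-- A syzygy of degree four of the first curve. -/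
def cmb224FirstSyzygyFour : Fin 3 → S :=
  ![formOfCoeffs 4 [0, 50, -677, 57, 0, 200, -3016, 284, 952, -1232, 168, 6104, -224, 9968, 3136],
    formOfCoeffs 4 [0, -280, -209, -5, -76, -1120, -1032, 624, -52, -784, 3696, 2128, 4480, 5264,
      3136],
    formOfCoeffs 4 [126, -952, 0, 0, 0, -112, -69, 1507, 190, -360, 2920, 340, 0, 0, 0]]

lemma cmb224FirstSyzygyFour_mem : cmb224FirstSyzygyFour ∈ AR (∏ i, cmb224First i) := by
  refine mem_AR_prod ![formOfCoeffs 3 [0, -26, -402, 114, -104, -1832, 820, -896, 1848, 1568],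
    formOfCoeffs 3 [0, -152, -10, -152, -608, 128, -636, 672, 280, 1568],
    formOfCoeffs 3 [0, -152, 550, 114, -608, 2368, 820, 672, 1848, 1568],
    formOfCoeffs 3 [0, 330, -138, -76, 1320, -664, -1004, -448, -3976, -4704]]
    (forall_fin_four ?_ ?_ ?_ ?_) ?_
  · refine eq_of_eval fun X Y Z => ?_
    simp only [cmb224FirstSyzygyFour, cmb224First, cons_val, map_add, map_mul, ←
      grad_eq_eval_gradient, grad_cmb224_C₁, eval_cmb224_C₁, eval_formOfCoeffs_four,
      eval_formOfCoeffs_three]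
    ring
  · refine eq_of_eval fun X Y Z => ?_
    simp only [cmb224FirstSyzygyFour, cmb224First, cons_val, map_add, map_mul, ←
      grad_eq_eval_gradient, grad_cmb224_C₂, eval_cmb224_C₂, eval_formOfCoeffs_four,
      eval_formOfCoeffs_three]
    ring
  · refine eq_of_eval fun X Y Z => ?_
    simp only [cmb224FirstSyzygyFour, cmb224First, cons_val, map_add, map_mul, ←
      grad_eq_eval_gradient, grad_cmb224_D, eval_cmb224_D, eval_formOfCoeffs_four,
      eval_formOfCoeffs_three]
    ring
  · refine eq_of_eval fun X Y Z => ?_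
    simp only [cmb224FirstSyzygyFour, cmb224First, cons_val, map_add, map_mul, ←
      grad_eq_eval_gradient, grad_cmb224_M₁, eval_cmb224_M₁, eval_formOfCoeffs_four,
      eval_formOfCoeffs_three]
    ring
  · refine eq_of_eval fun X Y Z => ?_
    simp only [Fin.sum_univ_four, cons_val, map_add, map_zero, eval_formOfCoeffs_three]
    ring

lemma isHomogeneous_cmb224FirstSyzygyFour : ∀ i, (cmb224FirstSyzygyFour i).IsHomogeneous 4 := by
  intro i
  fin_cases i <;> exact isHomogeneous_formOfCoeffs _ _

lemma crossProduct_cmb224First_ne_zero : cmb224FirstSyzygyThree ⨯₃ cmb224FirstSyzygyFour ≠ 0 := by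
  refine crossProduct_ne_zero_of_eval 0 1 1 ?_
  simp only [cmb224FirstSyzygyThree, cmb224FirstSyzygyFour, cons_val, eval_formOfCoeffs_three,
    eval_formOfCoeffs_four]
  exact ne_zero_of_mul (-1 / 1646400) (by ring)

/-- A syzygy of degree four of the second curve. -/
def cmb224SecondSyzygyFour : Fin 3 → S :=
  ![formOfCoeffs 4 [56, 234, -39, 9, 0, 840, -548, -252, 0, -1456, -1512, 392, -2016, 2352, 3136],
    formOfCoeffs 4 [0, 168, -81, 73, -12, 448, -504, 68, -84, -336, -1232, 336, -1792, 1680, 1344],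
    formOfCoeffs 4 [294, 0, 0, 0, 0, -448, -333, -151, 30, -840, 460, 84, 1344, 0, 0]]

lemma cmb224SecondSyzygyFour_mem : cmb224SecondSyzygyFour ∈ AR (∏ i, cmb224Second i) := by
  refine mem_AR_prod ![formOfCoeffs 3 [112, 174, -78, 18, 504, -704, 84, -1344, 504, 672],
    formOfCoeffs 3 [112, -120, 146, -24, -672, 584, -252, 224, -168, 672],
    formOfCoeffs 3 [112, -120, -78, 18, -672, -312, 84, 224, 504, 672],
    formOfCoeffs 3 [-336, 66, 10, -12, 840, 432, 84, 896, -840, -2016]]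
    (forall_fin_four ?_ ?_ ?_ ?_) ?_
  · refine eq_of_eval fun X Y Z => ?_
    simp only [cmb224SecondSyzygyFour, cmb224Second, cons_val, map_add, map_mul, ←
      grad_eq_eval_gradient, grad_cmb224_C₁, eval_cmb224_C₁, eval_formOfCoeffs_four,
      eval_formOfCoeffs_three]
    ring
  · refine eq_of_eval fun X Y Z => ?_
    simp only [cmb224SecondSyzygyFour, cmb224Second, cons_val, map_add, map_mul, ←
      grad_eq_eval_gradient, grad_cmb224_C₂, eval_cmb224_C₂, eval_formOfCoeffs_four,
      eval_formOfCoeffs_three]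
    ring
  · refine eq_of_eval fun X Y Z => ?_
    simp only [cmb224SecondSyzygyFour, cmb224Second, cons_val, map_add, map_mul, ←
      grad_eq_eval_gradient, grad_cmb224_D, eval_cmb224_D, eval_formOfCoeffs_four,
      eval_formOfCoeffs_three]
    ring
  · refine eq_of_eval fun X Y Z => ?_
    simp only [cmb224SecondSyzygyFour, cmb224Second, cons_val, map_add, map_mul, ←
      grad_eq_eval_gradient, grad_cmb224_M₂, eval_cmb224_M₂, eval_formOfCoeffs_four,
      eval_formOfCoeffs_three]
    ring
  · refine eq_of_eval fun X Y Z => ?_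
    simp only [Fin.sum_univ_four, cons_val, map_add, map_zero, eval_formOfCoeffs_three]
    ring

lemma isHomogeneous_cmb224SecondSyzygyFour : ∀ i, (cmb224SecondSyzygyFour i).IsHomogeneous 4 := by
  intro i
  fin_cases i <;> exact isHomogeneous_formOfCoeffs _ _

lemma cmb224SecondSyzygyFour_ne_zero : cmb224SecondSyzygyFour ≠ 0 := by
  refine ne_zero_of_eval 0 0 1 ?_
  simp only [cmb224SecondSyzygyFour, cons_val, eval_formOfCoeffs_four]
  exact ne_zero_of_mul (1 / 3136) (by ring)

theorem isStrongZieglerPair_cmb224 :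
    IsStrongZieglerPair (firstCurve .cmb224) (secondCurve .cmb224) ∧
    IsLeast (syzygyDegrees (firstCurve .cmb224)) 3 ∧
    IsLeast (syzygyDegrees (secondCurve .cmb224)) 4 ∧
    Nonempty (MinimalGradedFreeResolution (jacobianIdeal (firstCurve .cmb224))) ∧
    Nonempty (MinimalGradedFreeResolution (jacobianIdeal (secondCurve .cmb224))) ∧
    ∀ (F : MinimalGradedFreeResolution (jacobianIdeal (firstCurve .cmb224)))
      (G : MinimalGradedFreeResolution (jacobianIdeal (secondCurve .cmb224))),
      F.twists ≠ G.twists := by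
  have hf : firstCurve .cmb224 = ∏ i, cmb224First i := by
    rw [Fin.prod_univ_four]
    rfl
  have hg : secondCurve .cmb224 = ∏ i, cmb224Second i := by
    rw [Fin.prod_univ_four]
    rfl
  -- The roots belong to the nodes of `D` with `M₁` and with `M₂` respectively; both quadratics
  -- split over `ℚ(√5)`.
  obtain ⟨r₁, hr₁⟩ := exists_quadratic_root (-2) (-4)
  obtain ⟨r₂, hr₂⟩ := exists_quadratic_root (-6) 4
  exact conclusion_of_arrangements isSeparating_cmb224Types (isArrangement_cmb224First (r := r₁) (by
    linear_combination hr₁))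
    (isArrangement_cmb224Second (r := r₂) (by linear_combination hr₂)) (by decide) hf hg
      cmb224FirstSyzygyThree_mem cmb224FirstSyzygyFour_mem cmb224SecondSyzygyFour_mem
      isHomogeneous_cmb224FirstSyzygyThree isHomogeneous_cmb224FirstSyzygyFour
      isHomogeneous_cmb224SecondSyzygyFour crossProduct_cmb224First_ne_zero
      cmb224SecondSyzygyFour_ne_zero
    (hf ▸ two_notMem_syzygyDegrees_cmb224First) (hg ▸ three_notMem_syzygyDegrees_cmb224Second)

end ConicLine

end

theorem mainTheorem2 (i : ConicLine.Example) :
    ConicLine.IsStrongZieglerPair (ConicLine.firstCurve i) (ConicLine.secondCurve i) ∧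
    IsLeast (ConicLine.syzygyDegrees (ConicLine.firstCurve i)) 3 ∧
    IsLeast (ConicLine.syzygyDegrees (ConicLine.secondCurve i)) 4 ∧
    Nonempty (ConicLine.MinimalGradedFreeResolution
      (ConicLine.jacobianIdeal (ConicLine.firstCurve i))) ∧
    Nonempty (ConicLine.MinimalGradedFreeResolution
      (ConicLine.jacobianIdeal (ConicLine.secondCurve i))) ∧
    ∀ (F : ConicLine.MinimalGradedFreeResolution
          (ConicLine.jacobianIdeal (ConicLine.firstCurve i)))
      (G : ConicLine.MinimalGradedFreeResolution
          (ConicLine.jacobianIdeal (ConicLine.secondCurve i))),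
      F.twists ≠ G.twists := by
  cases i
  · exact ConicLine.isStrongZieglerPair_cmb123
  · exact ConicLine.isStrongZieglerPair_cmb124
  · exact ConicLine.isStrongZieglerPair_cmb212
  · exact ConicLine.isStrongZieglerPair_cmb224
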